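/- **Setting.** Let $\widetilde G=(W,U)$ be a finite simple graph in which every node $v$ is given a clockwise (cyclic) order of its incident edges, as induced by an embedding of the graph (edges may cross one another). Let $P$ be a finite family of simple paths in $\widetilde G$, each with at least one edge; coincident paths are allowed. The two ends of a path are its *terminal* nodes, its other nodes are *intermediate*. Assume the *path terminal property*: no node is both a terminal node of some path of $P$ and an intermediate node of some path of $P$. Let $L$ be the total number of edges of the paths, counted with multiplicity. **Orderings and crossings.** An *ordering of paths* assigns to each edge $vw$ a linear order of the set $P_{vw}$ of paths using it, read clockwise as seen from $v$; as seen from $w$ the order is reversed. Going clockwise around a node $v$, visiting its edges in clockwise order and on each of them its paths in clockwise order, one meets every path with intermediate node $v$ twice. Two distinct paths with intermediate node $v$ *cross at $v$* if the two places where one is met separate, in the cyclic order, the two places where the other is met. For two distinct paths and a maximal common subpath $S$ of them (possibly traversed in opposite directions, possibly a single node), the paths have an *unavoidable crossing along $S$* if, for every ordering of paths, they cross at some node of $S$. An ordering is *consistent* if, for all pairs of distinct paths and each of their maximal common subpaths $S$, the two paths cross at exactly one node of $S$ if they have an unavoidable crossing along $S$, and at no node of $S$ otherwise. **Algorithm.**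 Let $H$ be the subgraph of $\widetilde G$ formed by the paths of $P$, with the induced clockwise orders. *Phase 1.* In any order, delete the nonterminal nodes one after the other. To delete $v$, let $e_1,\dots,e_t$ be its current edges in clockwise order, with other ends $v_1,\dots,v_t$. For each pair $\{a,b\}$ such that some path traverses $e_a$ and $e_b$ consecutively at $v$, add a new edge $v_av_b$ (parallel edges are kept apart) and reroute all these paths along it. At $v_a$, the new edges take the place of $e_a$ in the clockwise order, arranged by the index $b$ in the cyclic order $a+1,\dots,t,1,\dots,a-1$. *Phase 2.* When only terminal nodes remain, order the (coincident) paths on each remaining edge arbitrarily. Re-insert the deleted nodes in reverse order: on re-insertion of $v$, the order of paths on $e_a$, as seen from $v_a$, is the concatenation of the orders on the new edges $v_av_b$ in the above arrangement; all other orders are kept. **Theorem.** 1. For every choice of the deletion order and of the orders on the edges remaining after Phase 1, the algorithm computes a consistent ordering of paths. 2. The algorithm runs in $O(|W|+|U|+L)$ time: there are a fixed program for a random access machine (unit-cost addition, truncated subtraction, comparison and indirect addressing) and a constant $C$ such that, given the clockwise adjacency lists and the node lists of the paths, the program halts after at most $C(|W|+|U|+L+1)$ steps, all words occurring being at most $C(|W|+|U|+L+1)$,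 and outputs the ordering computed by the algorithm for some choice of the deletion order and of the orders on the remaining edges. 3. In particular, a consistent ordering always exists; and every consistent ordering has the minimum total number of crossings among all orderings of paths. -/

import Mathlib

/-! ## Embedded graphs with routed paths -/

/-- An instance of the path ordering problem: a graph on the nodes `0, …, n - 1`, for each node the
clockwise list of its edges (an edge at `v` is given by its other end), and a finite family of `m`
simple paths with at least one edge each (coincident paths are allowed). Only the clockwise orders
of the embedding matter: the edges of the drawing may cross one another. -/
structure RoutedGraph (n m : ℕ) where
  graph : SimpleGraph (Fin n)
  rot : Fin n → List (Fin n)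
  rot_nodup : ∀ v, (rot v).Nodup
  mem_rot : ∀ v w, w ∈ rot v ↔ graph.Adj v w
  src : Fin m → Fin n
  tgt : Fin m → Fin n
  path : ∀ i, graph.Walk (src i) (tgt i)
  isPath : ∀ i, (path i).IsPath
  src_ne_tgt : ∀ i, src i ≠ tgt i

namespace RoutedGraph

variable {n m : ℕ} (I : RoutedGraph n m)

/-- `v` is an end of path `i`. -/
def TerminalOf (i : Fin m) (v : Fin n) : Prop := v = I.src i ∨ v = I.tgt i

/-- `v` is an inner node of path `i`. -/
def IntermediateOf (i : Fin m) (v : Fin n) : Prop :=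
  v ∈ (I.path i).support ∧ ¬ I.TerminalOf i v

/-- No node is a terminal of some path and an intermediate node of some path. -/
def PathTerminalProperty : Prop :=
  ∀ v, ¬ ((∃ i, I.TerminalOf i v) ∧ ∃ j, I.IntermediateOf j v)

/-- The number of edges of the graph. -/
noncomputable def numEdges : ℕ := I.graph.edgeSet.ncard

/-- The total length (number of edges) of the paths. -/
def totalLength : ℕ := ∑ i, (I.path i).length

/-! ### Orderings and crossings -/

/-- `o` is an ordering of paths on all edges: `o v w` lists the paths that use the edge `vw`, each
once, clockwise as seen from `v` (left to right when looking from `v` to `w`), so that the list seen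
from the other end is the reverse one. -/
def IsOrdering (o : Fin n → Fin n → List (Fin m)) : Prop :=
  ∀ v w, (o v w).Nodup ∧ (∀ i, i ∈ o v w ↔ s(v, w) ∈ (I.path i).edges) ∧
    o w v = (o v w).reverse

/-- Going clockwise around `v`, the list of the paths that are met: the edges at `v` are visited in
clockwise order, and on each of them its paths are visited in clockwise order. A path with inner
node `v` is met twice. -/
def around (o : Fin n → Fin n → List (Fin m)) (v : Fin n) : List (Fin m) :=
  (I.rot v).flatMap (o v)

/-- Paths `i` and `j` cross at `v`: the two places at `v` where `i` is met separate, in the cyclic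
order around `v`, the two places where `j` is met. -/
def CrossAt (o : Fin n → Fin n → List (Fin m)) (i j : Fin m) (v : Fin n) : Prop :=
  (I.around o v).filter (fun k => k = i ∨ k = j) = [i, j, i, j] ∨
    (I.around o v).filter (fun k => k = i ∨ k = j) = [j, i, j, i]

/-- The total number of crossings among all pairs of paths. -/
noncomputable def crossings (o : Fin n → Fin n → List (Fin m)) : ℕ :=
  {x : Fin m × Fin m × Fin n | x.1 < x.2.1 ∧ I.CrossAt o x.1 x.2.1 x.2.2}.ncard

/-- The node list `S` is a common subpath of the paths `i` and `j`, which may traverse it in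
opposite directions. (A single common node is a subpath without edges.) -/
def IsCommonSubpath (i j : Fin m) (S : List (Fin n)) : Prop :=
  S ≠ [] ∧ S <:+: (I.path i).support ∧
    (S <:+: (I.path j).support ∨ S.reverse <:+: (I.path j).support)

/-- A common subpath that is not part of a longer one. -/
def IsMaximalCommonSubpath (i j : Fin m) (S : List (Fin n)) : Prop :=
  I.IsCommonSubpath i j S ∧ ∀ T, I.IsCommonSubpath i j T → S <:+: T → T = S

/-- Paths `i` and `j` have an unavoidable crossing along `S`: they cross there for every ordering
of paths. -/
def Unavoidable (i j : Fin m) (S : List (Fin n)) : Prop :=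
  ∀ o, I.IsOrdering o → ∃ v ∈ S, I.CrossAt o i j v

/-- A consistent ordering: along each maximal common subpath, two paths cross only if their crossing
there is unavoidable, and in that case they cross exactly once. -/
def IsConsistent (o : Fin n → Fin n → List (Fin m)) : Prop :=
  I.IsOrdering o ∧
    ∀ i j, i ≠ j → ∀ S, I.IsMaximalCommonSubpath i j S →
      (I.Unavoidable i j S → ∃! v, v ∈ S ∧ I.CrossAt o i j v) ∧
        (¬ I.Unavoidable i j S → ∀ v ∈ S, ¬ I.CrossAt o i j v)

end RoutedGraph

/-! ## The algorithm: deletion and re-insertion of nodes -/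

/-- A directed edge of the multigraph `H` that the algorithm maintains. It is named by the node
list, from its first to its last node, of the subpath of the input graph that it stands for; the
same edge in the other direction is the reversed list. Parallel edges have different names. -/
abbrev HDart (n : ℕ) := List (Fin n)

/-- The state of the algorithm: for each node the clockwise list of the edges that leave it, and
each path as the sequence of the edges that it traverses. -/
structure HState (n m : ℕ) where
  rot : Fin n → List (HDart n)
  path : Fin m → List (HDart n)

namespace HState

variable {n m : ℕ} (H : HState n m)

/-- The path `i` contains the edge `d`, in one of the two directions. -/
def Contains (i : Fin m) (d : HDart n) : Prop := d ∈ H.path i ∨ d.reverse ∈ H.path i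

/-- The edge `r`, which ends at a node, and the edge `d`, which leaves this node, are traversed one
after the other by some path, in one of the two directions. -/
def PairUsed (r d : HDart n) : Prop :=
  ∃ i, [r, d] <:+: H.path i ∨ [d.reverse, r.reverse] <:+: H.path i

instance (r d : HDart n) : Decidable (H.PairUsed r d) := by
  unfold PairUsed; infer_instance

/-- The edges at `v` other than `d` in clockwise order, starting right after `d`. -/
def clockwiseFrom (v : Fin n) (d : HDart n) : List (HDart n) :=
  (H.rot v).drop ((H.rot v).idxOf d + 1) ++ (H.rot v).take ((H.rot v).idxOf d)

/-- The new edges that replace the edge `r`, which ends at `v`, when `v` is deleted: one for each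
edge at `v` that some path uses together with `r`, in the clockwise order at `v` that starts
after `r`. -/
def children (v : Fin n) (r : HDart n) : List (HDart n) :=
  ((H.clockwiseFrom v r.reverse).filter (fun d => H.PairUsed r d)).map (fun d => r ++ d.tail)

/-- In a path, join the edges that enter and leave `v` to one new edge. -/
def mergeAt (v : Fin n) : List (HDart n) → List (HDart n)
  | d :: e :: l =>
    if d.getLast? = some v then (d ++ e.tail) :: mergeAt v l else d :: mergeAt v (e :: l)
  | l => l

/-- Deletion of the node `v`: at each other node the edge to `v` gives its place to the new edges
that replace it, and each path through `v` is rerouted along its new edge. -/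
def deleteNode (v : Fin n) : HState n m where
  rot x := if x = v then [] else
    (H.rot x).flatMap (fun r => if r.getLast? = some v then H.children v r else [r])
  path i := mergeAt v (H.path i)

/-- `ord` is an ordering of paths on the edges of `H`, in the convention of
`RoutedGraph.IsOrdering`. -/
def IsOrderingOn (ord : HDart n → List (Fin m)) : Prop :=
  ∀ d, (ord d).Nodup ∧ (∀ i, i ∈ ord d ↔ H.Contains i d) ∧ ord d.reverse = (ord d).reverse

/-- Re-insertion of `v`: from the orders `ord` after the deletion of `v` from `H`, the orders on the
edges of `H`. On an edge that ends at `v` the orders on the new edges are concatenated; seen from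
`v`, the result is reversed. All other orders are kept. -/
def reinsertNode (v : Fin n) (ord : HDart n → List (Fin m)) : HDart n → List (Fin m) := fun d =>
  if d.getLast? = some v then (H.children v d).flatMap ord
  else if d.head? = some v then ((H.children v d.reverse).flatMap ord).reverse
  else ord d

/-- Delete the nodes in the order `σ`, start with the orders `base` on the edges that remain, and
re-insert the nodes in the reverse order. -/
def orders (base : HDart n → List (Fin m)) : List (Fin n) → HState n m → HDart n → List (Fin m)
  | [], _ => base
  | v :: σ, H => H.reinsertNode v (orders base σ (H.deleteNode v))

end HState

namespace RoutedGraph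

variable {n m : ℕ} (I : RoutedGraph n m)

/-- The initial graph `H`: the subgraph that is formed by the paths. -/
def initial : HState n m where
  rot v := ((I.rot v).filter (fun w => ∃ i, s(v, w) ∈ (I.path i).edges)).map (fun w => [v, w])
  path i := (I.path i).darts.map (fun d => [d.fst, d.snd])

/-- `σ` lists the nonterminal nodes, each once. -/
def IsDeletionOrder (σ : List (Fin n)) : Prop :=
  σ.Nodup ∧ ∀ v, v ∈ σ ↔ ¬ ∃ i, I.TerminalOf i v

/-- The first phase: delete the nodes in the order `σ`. -/
def phaseOne (σ : List (Fin n)) : HState n m := σ.foldl HState.deleteNode I.initial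

/-- `σ` and `base` are admissible choices for the algorithm: the nonterminal nodes are deleted in
the order `σ`, and `base` is any ordering of paths on the edges that remain in the end (each of
which carries a class of coincident paths). -/
def IsRun (σ : List (Fin n)) (base : HDart n → List (Fin m)) : Prop :=
  I.IsDeletionOrder σ ∧ (I.phaseOne σ).IsOrderingOn base

/-- The result of the algorithm for the choices `σ` and `base`. -/
def algorithm (σ : List (Fin n)) (base : HDart n → List (Fin m)) :
    Fin n → Fin n → List (Fin m) :=
  fun v w => HState.orders base σ I.initial [v, w]

end RoutedGraph

/-! ## The machine model

A random access machine, programmed in structured form, with registers, a fixed number of arrays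
with indirect addressing, comparison, addition and truncated subtraction. All words that occur
(values, addresses and intermediate results) have to be at most a bound `w`, which the theorem takes
linear in the size of the input. -/

namespace RAM

/-- The memory: the registers, and the arrays. -/
structure State where
  reg : ℕ → ℕ
  arr : ℕ → ℕ → ℕ

/-- Expressions; `arr A e` is the entry of the array `A` with index `e`. -/
inductive Expr where
  | const (c : ℕ)
  | reg (r : ℕ)
  | arr (A : ℕ) (e : Expr)
  | add (e f : Expr)
  | sub (e f : Expr)

namespace Expr

/-- The value of an expression. -/
def eval (s : State) : Expr → ℕ
  | const c => c
  | reg r => s.reg r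
  | arr A e => s.arr A (e.eval s)
  | add e f => e.eval s + f.eval s
  | sub e f => e.eval s - f.eval s

/-- The number of steps that the evaluation takes: one for each operation. -/
def cost : Expr → ℕ
  | const _ => 1
  | reg _ => 1
  | arr _ e => e.cost + 1
  | add e f => e.cost + f.cost + 1
  | sub e f => e.cost + f.cost + 1

/-- No word above `w` occurs in the evaluation. -/
def Fits (w : ℕ) (s : State) : Expr → Prop
  | const c => c ≤ w
  | reg r => s.reg r ≤ w
  | arr A e => e.Fits w s ∧ s.arr A (e.eval s) ≤ w
  | add e f => e.Fits w s ∧ f.Fits w s ∧ e.eval s + f.eval s ≤ w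
  | sub e f => e.Fits w s ∧ f.Fits w s

end Expr

/-- Programs. `ite e f p q` runs `p` if `e < f` and `q` otherwise; `loop e f p` runs `p` as long as
`e < f`. -/
inductive Prog where
  | skip
  | assign (r : ℕ) (e : Expr)
  | store (A : ℕ) (e f : Expr)
  | seq (p q : Prog)
  | ite (e f : Expr) (p q : Prog)
  | loop (e f : Expr) (p : Prog)

/-- `Exec w p s t s'`: started in `s`, the program `p` halts after exactly `t` steps in `s'`, and no
word above `w` occurs. -/
inductive Exec (w : ℕ) : Prog → State → ℕ → State → Prop
  | skip (s : State) : Exec w .skip s 1 s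
  | assign (r : ℕ) (e : Expr) (s : State) (he : e.Fits w s) :
      Exec w (.assign r e) s (e.cost + 1)
        { s with reg := Function.update s.reg r (e.eval s) }
  | store (A : ℕ) (e f : Expr) (s : State) (he : e.Fits w s) (hf : f.Fits w s) :
      Exec w (.store A e f) s (e.cost + f.cost + 1)
        { s with
          arr := Function.update s.arr A (Function.update (s.arr A) (e.eval s) (f.eval s)) }
  | seq {p q : Prog} {s s₁ s₂ : State} {t₁ t₂ : ℕ} (hp : Exec w p s t₁ s₁)
      (hq : Exec w q s₁ t₂ s₂) : Exec w (.seq p q) s (t₁ + t₂) s₂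
  | ite_lt {e f : Expr} {p q : Prog} {s s₁ : State} {t : ℕ} (he : e.Fits w s) (hf : f.Fits w s)
      (h : e.eval s < f.eval s) (hp : Exec w p s t s₁) :
      Exec w (.ite e f p q) s (e.cost + f.cost + 1 + t) s₁
  | ite_ge {e f : Expr} {p q : Prog} {s s₁ : State} {t : ℕ} (he : e.Fits w s) (hf : f.Fits w s)
      (h : ¬ e.eval s < f.eval s) (hq : Exec w q s t s₁) :
      Exec w (.ite e f p q) s (e.cost + f.cost + 1 + t) s₁
  | loop_lt {e f : Expr} {p : Prog} {s s₁ s₂ : State} {t₁ t₂ : ℕ} (he : e.Fits w s)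
      (hf : f.Fits w s) (h : e.eval s < f.eval s) (hp : Exec w p s t₁ s₁)
      (hl : Exec w (.loop e f p) s₁ t₂ s₂) :
      Exec w (.loop e f p) s (e.cost + f.cost + 1 + t₁ + t₂) s₂
  | loop_ge {e f : Expr} {p : Prog} {s : State} (he : e.Fits w s) (hf : f.Fits w s)
      (h : ¬ e.eval s < f.eval s) : Exec w (.loop e f p) s (e.cost + f.cost + 1) s

/-- The positions in the concatenation of `ls` at which its members start, and the end position. -/
def offsets {α : Type*} (ls : List (List α)) : List ℕ :=
  (List.range (ls.length + 1)).map (fun k => (ls.take k).flatten.length)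

/-- The concatenation of `ls`, as a list of words. -/
def contents {k : ℕ} (ls : List (List (Fin k))) : List ℕ := ls.flatten.map Fin.val

end RAM

namespace RoutedGraph

variable {n m : ℕ} (I : RoutedGraph n m)

/-- The input: the numbers of nodes and of paths in registers `0` and `1`; the clockwise lists of
the neighbours of the nodes `0, 1, …` in arrays `0` (offsets) and `1` (contents); the node lists of
the paths in arrays `2` (offsets) and `3` (contents). Everything else is `0`. -/
def input : RAM.State where
  reg r := [n, m].getD r 0
  arr A k := ([RAM.offsets ((List.finRange n).map I.rot),
    RAM.contents ((List.finRange n).map I.rot),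
    RAM.offsets ((List.finRange m).map (fun i => (I.path i).support)),
    RAM.contents ((List.finRange m).map (fun i => (I.path i).support))].getD A []).getD k 0

/-- The lists of an ordering, for all pairs of a node and an edge at it, in the order in which these
pairs occur in the input. -/
def outputLists (o : Fin n → Fin n → List (Fin m)) : List (List (Fin m)) :=
  (List.finRange n).flatMap (fun v => (I.rot v).map (o v))

/-- In the memory `s`, arrays `4` (offsets) and `5` (contents) hold the ordering `o`. -/
def IsOutput (s : RAM.State) (o : Fin n → Fin n → List (Fin m)) : Prop :=
  (∀ k < (RAM.offsets (I.outputLists o)).length,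
    s.arr 4 k = (RAM.offsets (I.outputLists o)).getD k 0) ∧
  ∀ k < (RAM.contents (I.outputLists o)).length,
    s.arr 5 k = (RAM.contents (I.outputLists o)).getD k 0

/-- The size `|W| + |U| + L` of an instance, plus one (so that it is positive for the empty
graph). -/
noncomputable def size : ℕ := n + I.numEdges + I.totalLength + 1

end RoutedGraph

/-! ## Infixes of lists without repetitions -/

namespace List

variable {α : Type*}

/-! The proof rests on one property of an ordering, `CrossesLast`: if two paths cross at a node `v`
of a common subpath, then all other nodes of this subpath precede `v` in the deletion order. The
algorithm produces orderings with this property, the property implies consistency, and conversely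
every ordering with this property is an output of the algorithm.

After the deletion of the nodes in `τ`, the edges of the multigraph are exactly the links: subpaths
traversed by some path, with inner nodes in `τ` and ends outside `τ` (`phaseOne_path`,
`phaseOne_rot`). Re-inserting a node only regroups the paths met around any other present node
(`flatMap_deleteNode`), so the crossings at `v` are settled at the moment when `v` is re-inserted.
If two paths share a link `d` at `v` at that moment, then the order on `d` is copied from the
remaining links at `v`, read clockwise from `d`; the two paths occur in opposite orders on `d` and
on the rest of the way around, hence do not cross (`not_alternate_reinsertNode`). Two paths with a
common subpath through `v` that contains another node not yet deleted do share such a link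
(`exists_common_link`). This gives `IsRun.crossesLast`.

Consistency follows from `CrossesLast` alone (`isConsistent_of_crossesLast`). Two crossings along
the same maximal common subpath would each have to come later than the other. To see that an
avoidable crossing does not occur, compare the ordering with one that has no crossing along `S`.
Along `S` the two orderings start or stop differing in the order of the two paths exactly at the
nodes where they disagree about a crossing; this is a parity count of inversions around a node
(`crossAt_iff_differ`). A crossing at `v` makes all nodes of `S` nonterminal, so the paths continue
beyond both ends of `S`, where they are separate and no difference is possible. Carrying agreement
from both ends to `v` shows that the two orderings agree about the crossing at `v` as well.

For minimality, each crossing of a consistent ordering lies on a maximal common subpath with an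
unavoidable crossing, and is charged to a crossing of the other ordering on that subpath. The charge
is injective because maximal common subpaths of two paths are disjoint or equal
(`IsMaximalCommonSubpath.eq_of_mem`).

By the converse `exists_run`, the machine need not simulate the lists of the algorithm literally: it
suffices that its output is an ordering with `CrossesLast` for the increasing order of the
nonterminal nodes. The program keeps the two half-edges of every path edge sorted into blocks, one
block for each direction of a link. Every node owns a fixed interval of positions; deleting `v`
subdivides the blocks at the other ends of the links at `v`, within their own intervals, at a cost
proportional to the number of half-edges at `v` (`Layout.Deleted.valid`). In the second phase,
blocks are copied in reverse from their other ends, so that in the end all blocks of all layouts are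
mirrored (`Layout.Resolved`). This implies that two paths do not alternate around `v` if they share
a link at `v` when `v` is deleted (`Layout.Resolved.not_alternating`). Since the program adds
nothing but the constant 1, its words are bounded by the input words plus the running time
(`RAM.Run.exec`). -/

theorem append_cons_inj_of_nodup {A A' B B' : List α} {v : α}
    (h : A ++ v :: B = A' ++ v :: B') (hn : (A ++ v :: B).Nodup) : A = A' ∧ B = B' := by
  induction A generalizing A' with
  | nil =>
    cases A' with
    | nil => simpa using h
    | cons a A' =>
      simp only [nil_append, cons_append, cons.injEq] at h
      simp [h.2] at hn
  | cons a A ih =>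
    cases A' with
    | nil =>
      simp only [nil_append, cons_append, cons.injEq] at h
      simp [h.1] at hn
    | cons a' A' =>
      simp only [cons_append, cons.injEq] at h
      have := ih h.2 (by simp at hn ⊢; tauto)
      exact ⟨by rw [h.1, this.1], this.2⟩

/-- The node `v` occurs only once in `p`, so the two occurrences of infixes are aligned at `v`. This
is how pieces of a simple path are assembled throughout. -/
theorem glue_infix {p A B : List α} {v : α} (hp : p.Nodup) (h1 : A ++ [v] <:+: p)
    (h2 : v :: B <:+: p) : A ++ v :: B <:+: p := by
  obtain ⟨s, t, h1⟩ := h1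
  obtain ⟨s', t', h2⟩ := h2
  have h : (s ++ A) ++ v :: t = s' ++ v :: (B ++ t') := by
    rw [← cons_append, ← append_assoc, h2, ← h1]; simp
  have := append_cons_inj_of_nodup h (by rw [h, ← cons_append, ← append_assoc, h2]; exact hp)
  refine ⟨s, t', ?_⟩
  rw [← h2, ← this.1]; simp

theorem infix_pair_left {p : List α} {x x' y : α} (hp : p.Nodup) (h1 : [x, y] <:+: p)
    (h2 : [x', y] <:+: p) : x = x' := by
  obtain ⟨s, t, h1⟩ := h1
  obtain ⟨s', t', h2⟩ := h2
  have h : (s ++ [x]) ++ y :: t = (s' ++ [x']) ++ y :: t' := by simpa using h1.trans h2.symm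
  have := append_cons_inj_of_nodup h (by simpa [← h1] using hp)
  simpa using (append_inj' this.1 rfl).2

theorem infix_pair_right {p : List α} {x y y' : α} (hp : p.Nodup) (h1 : [x, y] <:+: p)
    (h2 : [x, y'] <:+: p) : y = y' := by
  have h1' := reverse_infix.2 h1
  have h2' := reverse_infix.2 h2
  exact infix_pair_left (nodup_reverse.2 hp) (by simpa using h1') (by simpa using h2')

theorem infix_reverse_left {l m : List α} : l.reverse <:+: m ↔ l <:+: m.reverse := by
  rw [← reverse_infix, reverse_reverse]

/-- Two lists without repetitions and with the same members are equal if they order each pair of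
members in the same way. -/
theorem eq_of_filter_pair [DecidableEq α] {l l' : List α} (hl : l.Nodup) (hl' : l'.Nodup)
    (hm : ∀ a, a ∈ l ↔ a ∈ l')
    (h : ∀ a ∈ l, ∀ b ∈ l, a ≠ b →
      l.filter (fun k => k = a ∨ k = b) = l'.filter (fun k => k = a ∨ k = b)) : l = l' := by
  have key : ∀ m : List α, m.Nodup → m.Pairwise (fun a b => [a, b] <+ m) := by
    intro m _
    rw [pairwise_iff_forall_sublist]
    exact fun h => h
  have h2 : l.Pairwise (fun a b => [a, b] <+ l') := by
    refine ((key l hl).imp_of_mem fun {a b} ha hb hab => ?_)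
    have hne : a ≠ b := by
      have := hl.sublist hab
      simpa using this
    have h3 : [a, b] <+ l.filter (fun k => k = a ∨ k = b) := by
      have := hab.filter (fun k => decide (k = a ∨ k = b))
      simpa using this
    rw [h a ha b hb hne] at h3
    exact h3.trans filter_sublist
  have hperm : l.Perm l' := (perm_ext_iff_of_nodup hl hl').2 hm
  refine hperm.eq_of_pairwise ?_ h2 (key l' hl')
  intro a b ha hb hab hba
  by_contra hne
  have : ∀ {a b : α}, [a, b] <+ l' → a ≠ b → ∃ A B, l' = A ++ a :: B ∧ b ∈ B := by
    intro a b h _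
    rw [cons_sublist_iff] at h
    obtain ⟨r₁, r₂, h1, h2, h3⟩ := h
    obtain ⟨s, t, rfl⟩ := append_of_mem h2
    exact ⟨s, t ++ r₂, by simp [h1], mem_append_right _ (by simpa using h3)⟩
  obtain ⟨A, B, h1, h2⟩ := this hab hne
  obtain ⟨A', B', h1', h2'⟩ := this hba (Ne.symm hne)
  obtain ⟨C, D, rfl⟩ := append_of_mem h2
  have h4 : (A ++ a :: C) ++ b :: D = A' ++ b :: B' := by rw [← h1']; simp [h1]
  have := append_cons_inj_of_nodup h4 (by simpa [h1] using hl')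
  rw [← this.2] at h2'
  simp [h1, nodup_append] at hl'
  tauto

theorem flatMap_eq_of_forall_ne {β : Type*} {l : List α} (hl : l.Nodup) {d : α} (hd : d ∈ l)
    {g : α → List β} (h : ∀ e ∈ l, e ≠ d → g e = []) : l.flatMap g = g d := by
  obtain ⟨A, B, rfl⟩ := append_of_mem hd
  have hA : A.flatMap g = [] := by
    rw [flatMap_eq_nil_iff]; intro e he
    refine h e (by simp [he]) ?_
    rintro rfl
    simp [nodup_append] at hl
    exact hl.2.2 _ he |>.1 rfl
  have hB : B.flatMap g = [] := by
    rw [flatMap_eq_nil_iff]; intro e he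
    refine h e (by simp [he]) ?_
    rintro rfl
    simp [nodup_append] at hl
    tauto
  simp [hA, hB]

/-- A list without repetitions that contains two elements, restricted to these. -/
theorem filter_pair_of_nodup [DecidableEq α] {l : List α} (hl : l.Nodup) {a b : α} (hab : a ≠ b)
    (ha : a ∈ l) (hb : b ∈ l) :
    l.filter (fun k => k = a ∨ k = b) = [a, b] ∨ l.filter (fun k => k = a ∨ k = b) = [b, a] := by
  have hp : (l.filter (fun k => k = a ∨ k = b)).Perm [a, b] := by
    rw [perm_ext_iff_of_nodup (hl.filter _) (by simpa using hab)]
    intro c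
    simp only [mem_filter, decide_eq_true_eq, mem_cons, not_mem_nil, or_false]
    constructor
    · exact fun h => h.2
    · rintro (rfl | rfl) <;> simp [*]
  have := hp.symm
  rcases hf : l.filter (fun k => k = a ∨ k = b) with _ | ⟨x, _ | ⟨y, _ | ⟨z, t⟩⟩⟩
  · rw [hf] at hp; simpa using hp.length_eq
  · rw [hf] at hp; simpa using hp.length_eq
  · have h1 : x ∈ [a, b] := by rw [← hp.mem_iff, hf]; simp
    have h2 : y ∈ [a, b] := by rw [← hp.mem_iff, hf]; simp
    have h3 : [x, y].Nodup := by rw [← hf]; exact hl.filter _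
    simp at h1 h2 h3
    rcases h1 with rfl | rfl <;> rcases h2 with rfl | rfl <;> simp_all
  · rw [hf] at hp; simpa using hp.length_eq

theorem filter_pair_left [DecidableEq α] {l : List α} (hl : l.Nodup) {a b : α}
    (ha : a ∈ l) (hb : b ∉ l) : l.filter (fun k => k = a ∨ k = b) = [a] := by
  have : l.filter (fun k => k = a ∨ k = b) = l.filter (fun k => k = a) := by
    refine filter_congr fun x hx => ?_
    have : x ≠ b := by rintro rfl; exact hb hx
    simp [this]
  rw [this]
  rw [filter_eq, count_eq_one_of_mem hl ha]
  rfl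

/-- The occurrences of `a` and `b` alternate. -/
def Alternate [DecidableEq α] (a b : α) (l : List α) : Prop :=
  l.filter (fun k => k = a ∨ k = b) = [a, b, a, b] ∨
    l.filter (fun k => k = a ∨ k = b) = [b, a, b, a]

/-- Alternation is a property of the cyclic word: a rotation of `abab` is `abab` or `baba`. Hence
the reading around a node may start at any of its edges. -/
theorem Alternate.rotate [DecidableEq α] {a b : α} {l m : List α} (h : Alternate a b (l ++ m)) :
    Alternate a b (m ++ l) := by
  unfold Alternate at *
  simp only [filter_append] at *
  generalize l.filter (fun k => k = a ∨ k = b) = l at *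
  generalize m.filter (fun k => k = a ∨ k = b) = m at *
  have key : ∀ x y : α, l ++ m = [x, y, x, y] → m ++ l = [x, y, x, y] ∨ m ++ l = [y, x, y, x] := by
    intro x y h
    rcases l with _ | ⟨l1, _ | ⟨l2, _ | ⟨l3, _ | ⟨l4, l5⟩⟩⟩⟩ <;>
      simp only [cons_append, nil_append, cons.injEq, append_eq_nil_iff] at h
    · simp [h]
    · obtain ⟨rfl, rfl⟩ := h; simp
    · obtain ⟨rfl, rfl, rfl⟩ := h; simp
    · obtain ⟨rfl, rfl, rfl, rfl⟩ := h; simp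
    · obtain ⟨rfl, rfl, rfl, rfl, rfl, rfl⟩ := h; simp
  rcases h with h | h
  · exact key _ _ h
  · exact (key _ _ h).symm

theorem alternate_append_comm [DecidableEq α] {a b : α} {l m : List α} :
    Alternate a b (l ++ m) ↔ Alternate a b (m ++ l) := ⟨.rotate, .rotate⟩

/-- Two blocks that both contain `a` and `b` once alternate unless their orders are opposite. -/
theorem alternate_append_iff [DecidableEq α] {a b : α} (hab : a ≠ b) {l m : List α}
    (hl : l.filter (fun k => k = a ∨ k = b) = [a, b] ∨ l.filter (fun k => k = a ∨ k = b) = [b, a])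
    (hm : m.filter (fun k => k = a ∨ k = b) = [a, b] ∨
      m.filter (fun k => k = a ∨ k = b) = [b, a]) :
    ¬ Alternate a b (l ++ m) ↔ l.filter (fun k => k = a ∨ k = b) =
      (m.filter (fun k => k = a ∨ k = b)).reverse := by
  unfold Alternate
  rw [filter_append]
  rcases hl with hl | hl <;> rcases hm with hm | hm <;> rw [hl, hm] <;> simp [hab, hab.symm]

theorem filter_pair_comm [DecidableEq α] (l : List α) (a b : α) :
    l.filter (fun k => k = a ∨ k = b) = l.filter (fun k => k = b ∨ k = a) :=
  filter_congr fun x _ => by simp [or_comm]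

end List

namespace RoutedGraph

variable {n m : ℕ} (I : RoutedGraph n m)

/-! ## Traversed subpaths and links -/

/-- The path `i` traverses the node list `d`, in one of the two directions. -/
def Traverses (i : Fin m) (d : List (Fin n)) : Prop :=
  d <:+: (I.path i).support ∨ d.reverse <:+: (I.path i).support

variable {I}

theorem support_nodup (i : Fin m) : (I.path i).support.Nodup := (I.isPath i).support_nodup

theorem traverses_iff {i : Fin m} {d : List (Fin n)} :
    I.Traverses i d ↔
      ∃ p, (p = (I.path i).support ∨ p = (I.path i).support.reverse) ∧ d <:+: p := by
  unfold Traverses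
  rw [List.infix_reverse_left]
  constructor
  · rintro (h | h)
    exacts [⟨_, .inl rfl, h⟩, ⟨_, .inr rfl, h⟩]
  · rintro ⟨p, rfl | rfl, h⟩
    exacts [.inl h, .inr h]

theorem nodup_of_dir {i : Fin m} {p : List (Fin n)}
    (hp : p = (I.path i).support ∨ p = (I.path i).support.reverse) : p.Nodup := by
  rcases hp with rfl | rfl
  · exact support_nodup i
  · exact List.nodup_reverse.2 (support_nodup i)

theorem traverses_reverse {i : Fin m} {d : List (Fin n)} :
    I.Traverses i d.reverse ↔ I.Traverses i d := by
  unfold Traverses; rw [List.reverse_reverse, or_comm]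

theorem Traverses.of_infix {i : Fin m} {d e : List (Fin n)} (h : I.Traverses i d)
    (he : e <:+: d) : I.Traverses i e :=
  h.imp he.trans (List.reverse_infix.2 he).trans

theorem Traverses.nodup {i : Fin m} {d : List (Fin n)} (h : I.Traverses i d) : d.Nodup := by
  rcases h with h | h
  · exact (support_nodup i).sublist h.sublist
  · exact List.nodup_reverse.1 ((support_nodup i).sublist h.sublist)

theorem Traverses.mem {i : Fin m} {d : List (Fin n)} (h : I.Traverses i d) {v : Fin n}
    (hv : v ∈ d) : v ∈ (I.path i).support := by
  rcases h with h | h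
  · exact h.subset hv
  · exact h.subset (List.mem_reverse.2 hv)

theorem traverses_pair_iff {i : Fin m} {v w : Fin n} :
    I.Traverses i [v, w] ↔ s(v, w) ∈ (I.path i).edges := by
  rw [← SimpleGraph.Walk.infix_support_iff_mem_edges]; rfl

theorem Traverses.adj {i : Fin m} {v w : Fin n} (h : I.Traverses i [v, w]) : I.graph.Adj v w :=
  (I.path i).adj_of_mem_edges (traverses_pair_iff.1 h)

/-- A list of at least two nodes, the inner ones in `τ` and the ends not in `τ`. -/
def IsLink (τ : List (Fin n)) (d : List (Fin n)) : Prop :=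
  ∃ x l y, d = x :: (l ++ [y]) ∧ x ∉ τ ∧ y ∉ τ ∧ ∀ u ∈ l, u ∈ τ

theorem IsLink.reverse {τ d : List (Fin n)} (h : IsLink τ d) : IsLink τ d.reverse := by
  obtain ⟨x, l, y, rfl, hx, hy, hl⟩ := h
  exact ⟨y, l.reverse, x, by simp, hy, hx, by simpa using hl⟩

theorem isLink_reverse {τ d : List (Fin n)} : IsLink τ d.reverse ↔ IsLink τ d :=
  ⟨fun h => by simpa using h.reverse, .reverse⟩

theorem isLink_pair {v w : Fin n} : IsLink [] [v, w] := ⟨v, [], w, rfl, by simp, by simp, by simp⟩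

/-- A link ends at the first node outside `τ` after its start, so it can be recovered from any list
that it begins. -/
theorem link_unique {τ l l' B B' : List (Fin n)} {y y' : Fin n} (hy : y ∉ τ) (hy' : y' ∉ τ)
    (hl : ∀ u ∈ l, u ∈ τ) (hl' : ∀ u ∈ l', u ∈ τ) (h : l ++ y :: B = l' ++ y' :: B') :
    l = l' ∧ y = y' := by
  induction l generalizing l' with
  | nil =>
    cases l' with
    | nil => exact ⟨rfl, (List.cons.inj h).1⟩
    | cons a l' => exact absurd (hl' a (by simp)) ((List.cons.inj h).1 ▸ hy)
  | cons a l ih =>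
    cases l' with
    | nil => exact absurd (hl a (by simp)) ((List.cons.inj h).1 ▸ hy')
    | cons a' l' =>
      simp only [List.cons_append, List.cons.injEq] at h
      have := ih (fun u hu => hl u (by simp [hu])) (fun u hu => hl' u (by simp [hu])) h.2
      exact ⟨by rw [h.1, this.1], this.2⟩

/-- In a fixed direction of the path, `v` has one position, and a link that starts there has to run
to the next node outside `τ`. -/
theorem dir_unique {τ p d e : List (Fin n)} {v : Fin n} (hp : p.Nodup) (hd : IsLink τ d)
    (he : IsLink τ e) (hdv : d.head? = some v) (hev : e.head? = some v) (h1 : d <:+: p)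
    (h2 : e <:+: p) : d = e := by
  obtain ⟨x, l, y, rfl, hx, hy, hl⟩ := hd
  obtain ⟨x', l', y', rfl, hx', hy', hl'⟩ := he
  obtain rfl : x = v := by simpa using hdv
  obtain rfl : x' = x := by simpa using hev
  obtain ⟨s, t, h1⟩ := h1
  obtain ⟨s', t', h2⟩ := h2
  have h : s ++ x' :: (l ++ y :: t) = s' ++ x' :: (l' ++ y' :: t') := by
    simpa using h1.trans h2.symm
  have := List.append_cons_inj_of_nodup h (by simpa [← h1] using hp)
  have := link_unique hy hy' hl hl' this.2
  rw [this.1, this.2]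

/-- A path has at most two links at a node. -/
theorem link_third {τ d e f : List (Fin n)} {i : Fin m} {v : Fin n} (hd : IsLink τ d)
    (he : IsLink τ e) (hf : IsLink τ f) (hdv : d.head? = some v) (hev : e.head? = some v)
    (hfv : f.head? = some v) (h1 : I.Traverses i d) (h2 : I.Traverses i e)
    (h3 : I.Traverses i f) (hde : e ≠ d) (hdf : f ≠ d) : e = f := by
  have hn := support_nodup (I := I) i
  have hn' := List.nodup_reverse.2 hn
  unfold Traverses at h1 h2 h3
  rw [List.infix_reverse_left] at h1 h2 h3
  rcases h1 with h1 | h1 <;> rcases h2 with h2 | h2 <;> rcases h3 with h3 | h3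
  all_goals first
    | exact dir_unique hn he hf hev hfv h2 h3
    | exact dir_unique hn' he hf hev hfv h2 h3
    | exact absurd (dir_unique hn he hd hev hdv h2 h1) hde
    | exact absurd (dir_unique hn' he hd hev hdv h2 h1) hde
    | exact absurd (dir_unique hn hf hd hfv hdv h3 h1) hdf
    | exact absurd (dir_unique hn' hf hd hfv hdv h3 h1) hdf

/-- A path uses two links at `v` one after the other if and only if it contains both. -/
theorem traverses_glue {τ d e : List (Fin n)} {i : Fin m} {v : Fin n} (hd : IsLink τ d)
    (he : IsLink τ e) (hdv : d.head? = some v) (hev : e.head? = some v) :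
    I.Traverses i (d.reverse ++ e.tail) ↔ I.Traverses i d ∧ I.Traverses i e ∧ e ≠ d := by
  obtain ⟨x, l, y, rfl, hx, hy, hl⟩ := id hd
  obtain ⟨x', l', y', rfl, hx', hy', hl'⟩ := id he
  obtain rfl : x = v := by simpa using hdv
  obtain rfl : x' = x := by simpa using hev
  constructor
  · intro h
    refine ⟨?_, ?_, ?_⟩
    · rw [← traverses_reverse]
      exact h.of_infix (List.prefix_append _ _).isInfix
    · refine h.of_infix ⟨y :: l.reverse, [], by simp⟩
    · rintro h2
      have h3 := h.nodup
      simp only [List.cons.injEq, true_and] at h2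
      simp [h2, List.nodup_append] at h3
  · rintro ⟨h1, h2, hne⟩
    have hn := support_nodup (I := I) i
    have hn' := List.nodup_reverse.2 hn
    have h1' := h1
    have h2' := h2
    unfold Traverses at h1 h2
    rw [List.infix_reverse_left] at h1 h2
    have key : ∀ p : List (Fin n), p.Nodup → (x' :: (l ++ [y])).reverse <:+: p →
        x' :: (l' ++ [y']) <:+: p → (x' :: (l ++ [y])).reverse ++ (x' :: (l' ++ [y'])).tail <:+: p := by
      intro p hp h3 h4
      have : (y :: l.reverse) ++ [x'] <:+: p := by simpa using h3
      have := List.glue_infix hp this h4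
      simpa using this
    rcases h1 with h1 | h1 <;> rcases h2 with h2 | h2
    · exact absurd (dir_unique hn he hd hev hdv h2 h1) hne
    · rw [traverses_iff]
      refine ⟨_, .inr rfl, key _ hn' ?_ h2⟩
      exact List.reverse_infix.2 h1
    · rw [traverses_iff]
      refine ⟨_, .inl rfl, key _ hn ?_ h2⟩
      exact List.infix_reverse_left.2 h1
    · exact absurd (dir_unique hn' he hd hev hdv h2 h1) hne

theorem exists_link_prefix {τ B : List (Fin n)} {x z : Fin n} (hx : x ∉ τ) (hz : z ∉ τ)
    (hzB : z ∈ B) : ∃ l y C, B = l ++ y :: C ∧ IsLink τ (x :: (l ++ [y])) := by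
  induction B with
  | nil => simp at hzB
  | cons b B ih =>
    by_cases hb : b ∈ τ
    · obtain ⟨l, y, C, rfl, x', l', y', h, hx', hy', hl⟩ := ih (by
        rcases List.mem_cons.1 hzB with rfl | h
        · exact absurd hb hz
        · exact h)
      refine ⟨b :: l, y, C, rfl, x, b :: l, y, rfl, hx, ?_, ?_⟩
      · simp at h
        rw [h.2.2]; exact hy'
      · simp at h
        rw [h.2.1]
        simpa [hb] using hl
    · exact ⟨[], b, B, rfl, x, [], b, rfl, hx, hb, by simp⟩

theorem head_support (i : Fin m) : ∃ l, (I.path i).support = I.src i :: l :=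
  ⟨_, (I.path i).cons_tail_support.symm⟩

theorem last_support (i : Fin m) : ∃ l, (I.path i).support = l ++ [I.tgt i] :=
  ⟨_, (I.path i).dropLast_support_concat.symm⟩

end RoutedGraph

namespace RoutedGraph

variable {n m : ℕ} {I : RoutedGraph n m}

@[simp]
theorem getLast?_link {α : Type*} (x : α) (l : List α) (y : α) :
    (x :: (l ++ [y])).getLast? = some y := by
  rw [← List.cons_append]; exact List.getLast?_concat

/-- Walk from `v` along the path, away from `d`. The end of the path that is reached is not `v`,
since `v` is not terminal, and it lies outside `τ`; hence a first node outside `τ` exists and closes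
the second link. -/
theorem link_other {τ d : List (Fin n)} {i : Fin m} {v : Fin n}
    (hτ : ∀ u ∈ τ, ¬ I.TerminalOf i u) (hd : IsLink τ d) (hdv : d.head? = some v)
    (hv : ¬ I.TerminalOf i v) (h : I.Traverses i d) :
    ∃ e, IsLink τ e ∧ e.head? = some v ∧ e ≠ d ∧ I.Traverses i e := by
  obtain ⟨p, hp, hdp⟩ := traverses_iff.1 h
  have hn := nodup_of_dir hp
  obtain ⟨z, hz, hzp⟩ : ∃ z, I.TerminalOf i z ∧ ∃ q, p = z :: q := by
    rcases hp with rfl | rfl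
    · exact ⟨_, .inl rfl, head_support i⟩
    · obtain ⟨l, hl⟩ := last_support (I := I) i
      exact ⟨_, .inr rfl, l.reverse, by simp [hl]⟩
  obtain ⟨q, rfl⟩ := hzp
  obtain ⟨x, l, y, rfl, hx, hy, hl⟩ := id hd
  obtain rfl : x = v := by simpa using hdv
  obtain ⟨s, t, hst⟩ := hdp
  have hzs : z ∈ s := by
    cases s with
    | nil =>
      simp at hst
      exact absurd (hst.1 ▸ hz) hv
    | cons a s => simp at hst; simp [hst.1]
  obtain ⟨l', y', C, hs, he⟩ := exists_link_prefix (τ := τ) (B := s.reverse) hx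
    (fun hz' => hτ z hz' hz) (List.mem_reverse.2 hzs)
  refine ⟨_, he, rfl, ?_, ?_⟩
  · intro hh
    simp only [List.cons.injEq, true_and] at hh
    rw [← hst] at hn
    have h1 : y' ∈ l ++ [y] := by rw [← hh]; simp
    have h2 : y' ∈ s := by rw [← List.mem_reverse, hs]; simp
    have h3 := List.nodup_append.1 (List.nodup_append.1 hn).1
    exact h3.2.2 y' h2 y' (List.mem_cons_of_mem _ h1) rfl
  · rw [traverses_iff]
    refine ⟨(z :: q).reverse, ?_, t.reverse ++ y :: l.reverse, C, ?_⟩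
    · rcases hp with hp | hp
      · exact .inr (by rw [hp])
      · exact .inl (by rw [hp, List.reverse_reverse])
    · rw [← hst]; simp [hs]

/-- As long as another node `u` of a common subpath is present, both paths run together from `v` at
least to the first present node in the direction of `u`. This link is what prevents a crossing at
`v`. -/
theorem exists_common_link {τ S : List (Fin n)} {i j : Fin m} {u v : Fin n}
    (hi : I.Traverses i S) (hj : I.Traverses j S) (hu : u ∈ S) (hv : v ∈ S) (huv : u ≠ v)
    (huτ : u ∉ τ) (hvτ : v ∉ τ) :
    ∃ d, IsLink τ d ∧ d.head? = some v ∧ I.Traverses i d ∧ I.Traverses j d := by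
  obtain ⟨A, B, rfl⟩ := List.append_of_mem hv
  have key : ∀ A B : List (Fin n), I.Traverses i (A ++ v :: B) → I.Traverses j (A ++ v :: B) →
      u ∈ B → ∃ d, IsLink τ d ∧ d.head? = some v ∧ I.Traverses i d ∧ I.Traverses j d := by
    intro A B hi hj hu
    obtain ⟨l, y, C, rfl, h⟩ := exists_link_prefix hvτ huτ hu
    have hin : v :: (l ++ [y]) <:+: A ++ v :: (l ++ y :: C) := ⟨A, C, by simp⟩
    exact ⟨_, h, rfl, hi.of_infix hin, hj.of_infix hin⟩
  rcases List.mem_append.1 hu with hu | hu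
  · refine key B.reverse A.reverse ?_ ?_ (List.mem_reverse.2 hu)
    · rw [← traverses_reverse] at hi; simpa using hi
    · rw [← traverses_reverse] at hj; simpa using hj
  · refine key A B hi hj ?_
    rcases List.mem_cons.1 hu with rfl | h
    · exact absurd rfl huv
    · exact h

/-! ## The state of the algorithm after some deletions -/

/-- The node list `p`, cut at its members that are not in `τ`. -/
def cuts (τ : List (Fin n)) : List (Fin n) → List (List (Fin n))
  | x :: y :: l => if y ∈ τ then (cuts τ (y :: l)).modifyHead (x :: ·)
      else [x, y] :: cuts τ (y :: l)
  | _ => []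

theorem cuts_cons {τ l r : List (Fin n)} {x y : Fin n} (hl : ∀ u ∈ l, u ∈ τ) (hy : y ∉ τ) :
    cuts τ (x :: (l ++ y :: r)) = (x :: (l ++ [y])) :: cuts τ (y :: r) := by
  induction l generalizing x with
  | nil => simp [cuts, hy]
  | cons a l ih =>
    rw [List.cons_append, cuts, if_pos (hl a (by simp)), ih (fun u hu => hl u (by simp [hu]))]
    rfl

theorem cuts_append {τ p r : List (Fin n)} {z : Fin n} (hz : z ∉ τ) :
    cuts τ (p ++ z :: r) = cuts τ (p ++ [z]) ++ cuts τ (z :: r) := by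
  induction p with
  | nil => simp [cuts]
  | cons x p ih =>
    cases p with
    | nil => simp [cuts, hz]
    | cons y p =>
      simp only [List.cons_append] at ih ⊢
      rw [cuts, cuts, ih]
      split_ifs with hy
      · have : cuts τ (y :: (p ++ [z])) ≠ [] := by
          clear ih
          induction p generalizing y with
          | nil => simp [cuts, hz]
          | cons a p ih' =>
            rw [List.cons_append, cuts]
            split_ifs with h
            · have := ih' a h
              simpa [List.modifyHead_eq_nil_iff] using this
            · simp
        obtain ⟨s, ss, hs⟩ := List.exists_cons_of_ne_nil this
        rw [hs]; rfl
      · rfl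

/-- Induction over the cuts of a node list whose ends are not in `τ`. -/
theorem cuts_induction {τ : List (Fin n)} {P : List (Fin n) → Prop}
    (single : ∀ y, y ∉ τ → P [y])
    (cons : ∀ x l y r, x ∉ τ → (∀ u ∈ l, u ∈ τ) → y ∉ τ → P (y :: r) →
      P (x :: (l ++ y :: r)))
    (x z : Fin n) (q : List (Fin n)) (hx : x ∉ τ) (hz : z ∉ τ) (hq : (x :: q).getLast? = some z) :
    P (x :: q) := by
  induction h : q.length using Nat.strong_induction_on generalizing x q with
  | _ k ih =>
    cases q with
    | nil => exact single x hx
    | cons a q =>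
      have hmem : z ∈ a :: q := by
        rw [List.getLast?_cons_cons] at hq
        exact List.mem_of_getLast? hq
      obtain ⟨l, y, C, hC, x', l', y', h1, hx', hy', hl'⟩ := exists_link_prefix hx hz hmem
      simp only [List.cons.injEq] at h1
      obtain ⟨rfl, h1⟩ := h1
      obtain ⟨rfl, h1⟩ := List.append_inj' h1 rfl
      obtain rfl : y = y' := by simpa using h1
      rw [hC] at h hq ⊢
      refine cons _ _ _ _ hx hl' hy' (ih C.length ?_ y C hy' ?_ rfl)
      · rw [← h]; simp; omega
      · rw [← hq, ← List.cons_append, List.getLast?_append]; simp [List.getLast?_cons]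

theorem exists_support_eq (i : Fin m) :
    ∃ q, (I.path i).support = I.src i :: q ∧ (I.src i :: q).getLast? = some (I.tgt i) := by
  obtain ⟨q, hq⟩ := head_support (I := I) i
  obtain ⟨l, hl⟩ := last_support (I := I) i
  exact ⟨q, hq, by rw [← hq, hl]; simp⟩

theorem mem_cuts {τ : List (Fin n)} {i : Fin m} (hτ : ∀ u ∈ τ, ¬ I.TerminalOf i u)
    {d : List (Fin n)} :
    d ∈ cuts τ (I.path i).support ↔ d <:+: (I.path i).support ∧ IsLink τ d := by
  constructor
  · obtain ⟨q, hq, hl⟩ := exists_support_eq (I := I) i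
    rw [hq]
    refine cuts_induction (P := fun p => d ∈ cuts τ p → d <:+: p ∧ IsLink τ d) ?_ ?_ _ _ _
      (fun h => hτ _ h (.inl rfl)) (fun h => hτ _ h (.inr rfl)) hl
    · intro y _ h; simp [cuts] at h
    · intro x l y r hx hl hy ih h
      rw [cuts_cons hl hy] at h
      rcases List.mem_cons.1 h with rfl | h
      · exact ⟨⟨[], r, by simp⟩, x, l, y, rfl, hx, hy, hl⟩
      · refine ⟨(ih h).1.trans ⟨x :: l, [], by simp⟩, (ih h).2⟩
  · rintro ⟨⟨s, t, h⟩, x, l, y, rfl, hx, hy, hl⟩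
    rw [← h]
    rw [show s ++ x :: (l ++ [y]) ++ t = s ++ x :: (l ++ y :: t) by simp, cuts_append hx,
      cuts_cons hl hy]
    simp

theorem pair_infix_cuts {τ p r d : List (Fin n)} {v : Fin n} (hr : IsLink τ r) (hd : IsLink τ d)
    (hrv : r.getLast? = some v) (hdv : d.head? = some v) (h : r ++ d.tail <:+: p) :
    [r, d] <:+: cuts τ p := by
  obtain ⟨x, l, y, rfl, hx, hy, hl⟩ := hr
  obtain ⟨x', l', y', rfl, hx', hy', hl'⟩ := hd
  obtain rfl : x' = v := by simpa using hdv
  obtain rfl : y = x' := by simpa using hrv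
  obtain ⟨s, t, rfl⟩ := h
  rw [show s ++ (x :: (l ++ [y]) ++ (y :: (l' ++ [y'])).tail) ++ t =
    s ++ x :: (l ++ y :: (l' ++ y' :: t)) by simp, cuts_append hx, cuts_cons hl hy, cuts_cons hl' hy']
  exact ⟨cuts τ (s ++ [x]), cuts τ (y' :: t), by simp⟩

/-- Joining edges at `v` removes exactly the cut at `v`. The ends of the list differ from `v`, so
every edge that ends at `v` has a successor to be joined with. -/
theorem mergeAt_cuts {τ : List (Fin n)} {v x z : Fin n} {q : List (Fin n)} (hx : x ∉ τ)
    (hz : z ∉ τ) (hxv : x ≠ v) (hzv : z ≠ v) (hq : (x :: q).getLast? = some z)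
    (hn : (x :: q).Nodup) (hvτ : v ∉ τ) :
    HState.mergeAt v (cuts τ (x :: q)) = cuts (τ ++ [v]) (x :: q) := by
  induction h : q.length using Nat.strong_induction_on generalizing x q with
  | _ k ih =>
    rcases q with _ | ⟨a, q⟩
    · simp [cuts, HState.mergeAt]
    have hmem : z ∈ a :: q := by
      rw [List.getLast?_cons_cons] at hq
      exact List.mem_of_getLast? hq
    obtain ⟨l, y, C, hC, x', l', y', h1, hx', hy', hl'⟩ := exists_link_prefix hx hz hmem
    simp only [List.cons.injEq] at h1
    obtain ⟨rfl, h1⟩ := h1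
    obtain ⟨rfl, h1⟩ := List.append_inj' h1 rfl
    obtain rfl : y = y' := by simpa using h1
    rw [hC] at h hq hn ⊢
    rw [cuts_cons hl' hy']
    have hlast : (y :: C).getLast? = some z := by
      rw [← hq, ← List.cons_append, List.getLast?_append]; simp [List.getLast?_cons]
    have hlen : C.length < k := by rw [← h]; simp; omega
    by_cases hyv : y = v
    · subst hyv
      rcases C with _ | ⟨b, C⟩
      · simp at hlast; exact absurd hlast.symm hzv
      have hmem2 : z ∈ b :: C := by
        rw [List.getLast?_cons_cons] at hlast
        exact List.mem_of_getLast? hlast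
      obtain ⟨l2, y2, C2, hC2, x2, l2', y2', h2, hx2, hy2, hl2⟩ := exists_link_prefix hy' hz hmem2
      simp only [List.cons.injEq] at h2
      obtain ⟨rfl, h2⟩ := h2
      obtain ⟨rfl, h2⟩ := List.append_inj' h2 rfl
      obtain rfl : y2 = y2' := by simpa using h2
      rw [hC2] at hlast hn hlen ⊢
      rw [cuts_cons hl2 hy2, HState.mergeAt, if_pos (by simp)]
      rw [show l ++ y :: (l2 ++ y2 :: C2) = (l ++ y :: l2) ++ y2 :: C2 by simp]
      -- Since `v` occurs only once, the joined link does not end at `v` again; `mergeAt` may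
      -- therefore go on behind it.
      have hy2v : y2 ≠ y := by
        rintro rfl
        simp [List.nodup_append] at hn
      rw [cuts_cons (τ := τ ++ [y]) ?_ ?_, ih C2.length ?_ hy2 hy2v ?_ ?_ rfl]
      · simp
      · simp at hlen; omega
      · rw [← hlast, ← List.cons_append, List.getLast?_append]; simp [List.getLast?_cons]
      · refine hn.sublist (List.IsInfix.sublist ⟨x :: (l ++ y :: l2), [], by simp⟩)
      · intro u hu
        simp only [List.mem_append, List.mem_cons, List.not_mem_nil, or_false] at hu ⊢
        rcases hu with hu | rfl | hu
        exacts [.inl (hl' u hu), .inr rfl, .inl (hl2 u hu)]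
      · simp [hy2, hy2v]
    · rw [cuts_cons (τ := τ ++ [v]) (fun u hu => by simp [hl' u hu]) (by simp [hy', hyv]),
        ← ih C.length hlen hy' hyv hlast ?_ rfl]
      · rcases cuts τ (y :: C) with _ | ⟨e, c⟩
        · simp [HState.mergeAt]
        · rw [HState.mergeAt, if_neg]
          simpa using hyv
      · refine hn.sublist (List.IsInfix.sublist ⟨x :: l, [], by simp⟩)

theorem cuts_nil_support {u w : Fin n} (p : I.graph.Walk u w) :
    cuts [] p.support = p.darts.map (fun d => [d.fst, d.snd]) := by
  induction p with
  | nil => simp [cuts]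
  | cons h p ih =>
    rw [SimpleGraph.Walk.support_cons, SimpleGraph.Walk.darts_cons, List.map_cons, ← ih,
      ← p.cons_tail_support, cuts]
    simp

/-- `τ` contains nonterminal nodes, each once. -/
def IsPartialDeletion (I : RoutedGraph n m) (τ : List (Fin n)) : Prop :=
  τ.Nodup ∧ ∀ u ∈ τ, ∀ i, ¬ I.TerminalOf i u

theorem IsPartialDeletion.of_append {τ ρ : List (Fin n)} (h : I.IsPartialDeletion (τ ++ ρ)) :
    I.IsPartialDeletion τ :=
  ⟨(List.nodup_append.1 h.1).1, fun u hu => h.2 u (List.mem_append_left _ hu)⟩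

theorem IsPartialDeletion.notMem {τ : List (Fin n)} {v : Fin n}
    (h : I.IsPartialDeletion (τ ++ [v])) : v ∉ τ := by
  have := h.1
  simp [List.nodup_append] at this
  exact fun hv => this.2 _ hv rfl

theorem IsPartialDeletion.nonterminal {τ : List (Fin n)} {v : Fin n}
    (h : I.IsPartialDeletion (τ ++ [v])) (i : Fin m) : ¬ I.TerminalOf i v := h.2 v (by simp) i

theorem phaseOne_append (τ : List (Fin n)) (v : Fin n) :
    I.phaseOne (τ ++ [v]) = (I.phaseOne τ).deleteNode v := by simp [phaseOne]

theorem phaseOne_path {τ : List (Fin n)} (hτ : I.IsPartialDeletion τ) (i : Fin m) :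
    (I.phaseOne τ).path i = cuts τ (I.path i).support := by
  induction τ using List.reverseRecOn with
  | nil => rw [cuts_nil_support]; rfl
  | append_singleton τ v ih =>
    rw [phaseOne_append]
    change HState.mergeAt v ((I.phaseOne τ).path i) = _
    rw [ih hτ.of_append]
    obtain ⟨q, hq, hl⟩ := exists_support_eq (I := I) i
    rw [hq]
    refine mergeAt_cuts (z := I.tgt i) (fun h => hτ.2 _ (List.mem_append_left _ h) i (.inl rfl))
      (fun h => hτ.2 _ (List.mem_append_left _ h) i (.inr rfl)) ?_ ?_ hl ?_ hτ.notMem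
    · rintro rfl; exact hτ.nonterminal i (.inl rfl)
    · rintro rfl; exact hτ.nonterminal i (.inr rfl)
    · rw [← hq]; exact support_nodup i

theorem contains_iff {τ d : List (Fin n)} (hτ : I.IsPartialDeletion τ) {i : Fin m} :
    (I.phaseOne τ).Contains i d ↔ I.Traverses i d ∧ IsLink τ d := by
  unfold HState.Contains Traverses
  rw [phaseOne_path hτ, mem_cuts (fun u hu => hτ.2 u hu i), mem_cuts (fun u hu => hτ.2 u hu i),
    isLink_reverse]
  tauto

theorem pairUsed_iff {τ d e : List (Fin n)} {v : Fin n} (hτ : I.IsPartialDeletion τ)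
    (hd : IsLink τ d) (he : IsLink τ e) (hdv : d.head? = some v) (hev : e.head? = some v) :
    (I.phaseOne τ).PairUsed d.reverse e ↔ ∃ i, I.Traverses i (d.reverse ++ e.tail) := by
  have hrev : (d.reverse ++ e.tail).reverse = e.reverse ++ d.tail := by
    obtain ⟨x, l, y, rfl, -⟩ := hd
    obtain ⟨x', l', y', rfl, -⟩ := he
    obtain rfl : x = v := by simpa using hdv
    obtain rfl : x' = x := by simpa using hev
    simp
  have hglue : ∀ {p d e : List (Fin n)}, p.Nodup → d.head? = some v → e.head? = some v →
      d.reverse <:+: p → e <:+: p → d.reverse ++ e.tail <:+: p := by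
    intro p d e hp hdv hev h1 h2
    obtain ⟨d, rfl⟩ : ∃ q, d = v :: q := by
      cases d with
      | nil => simp at hdv
      | cons a d => exact ⟨d, by simpa using hdv⟩
    obtain ⟨e, rfl⟩ : ∃ q, e = v :: q := by
      cases e with
      | nil => simp at hev
      | cons a e => exact ⟨e, by simpa using hev⟩
    have := List.glue_infix hp (A := d.reverse) (B := e) (by simpa using h1) h2
    simpa using this
  constructor
  · rintro ⟨i, h⟩
    have hm := fun d => mem_cuts (I := I) (τ := τ) (i := i) (fun u hu => hτ.2 u hu i) (d := d)
    rw [phaseOne_path hτ] at h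
    refine ⟨i, ?_⟩
    rcases h with h | h
    · exact .inl (hglue (support_nodup i) hdv hev ((hm _).1 (h.subset (by simp))).1
        ((hm _).1 (h.subset (by simp))).1)
    · refine .inr ?_
      rw [hrev]
      rw [List.reverse_reverse] at h
      exact hglue (support_nodup i) hev hdv ((hm _).1 (h.subset (by simp))).1
        ((hm _).1 (h.subset (by simp))).1
  · rintro ⟨i, h⟩
    refine ⟨i, ?_⟩
    rw [phaseOne_path hτ]
    rcases h with h | h
    · exact .inl (pair_infix_cuts hd.reverse he (by simpa using hdv) hev h)
    · rw [hrev] at h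
      refine .inr ?_
      rw [List.reverse_reverse]
      exact pair_infix_cuts he.reverse hd (by simpa using hev) hdv h

end RoutedGraph

/-! ### Joining two links at a deleted node -/

namespace RoutedGraph

variable {n m : ℕ} {I : RoutedGraph n m}

theorem join_reverse {d e : List (Fin n)} {v : Fin n} (hdv : d.head? = some v)
    (hev : e.head? = some v) : (d.reverse ++ e.tail).reverse = e.reverse ++ d.tail := by
  obtain ⟨d, rfl⟩ := List.head?_eq_some_iff.1 hdv
  obtain ⟨e, rfl⟩ := List.head?_eq_some_iff.1 hev
  simp

/-- The traversal matters: a list from `v` back to `v` may satisfy `IsLink τ`, but on a simple path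
the outer ends of the two links differ from `v`, as required for a link after the deletion of `v`.
-/
theorem isLink_join {τ d e : List (Fin n)} {v : Fin n} {i : Fin m} (hd : IsLink τ d)
    (he : IsLink τ e) (hdv : d.head? = some v) (hev : e.head? = some v)
    (h : I.Traverses i (d.reverse ++ e.tail)) : IsLink (τ ++ [v]) (d.reverse ++ e.tail) := by
  have hn := h.nodup
  obtain ⟨x, l, y, rfl, hx, hy, hl⟩ := hd
  obtain ⟨x', l', y', rfl, hx', hy', hl'⟩ := he
  obtain rfl : x = v := by simpa using hdv
  obtain rfl : x' = x := by simpa using hev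
  refine ⟨y, l.reverse ++ x' :: l', y', by simp, ?_, ?_, ?_⟩
  · have : y ≠ x' := by rintro rfl; simp [List.nodup_append] at hn
    simp [hy, this]
  · have : y' ≠ x' := by rintro rfl; simp [List.nodup_append] at hn
    simp [hy', this]
  · intro u hu
    simp only [List.mem_append, List.mem_reverse, List.mem_cons, List.not_mem_nil, or_false] at hu ⊢
    rcases hu with hu | rfl | hu
    exacts [.inl (hl u hu), .inr rfl, .inl (hl' u hu)]

theorem isLink_append_of_ne {τ d : List (Fin n)} {v : Fin n} (hd : IsLink τ d)
    (hdv : d.head? ≠ some v) (hdv' : d.getLast? ≠ some v) : IsLink (τ ++ [v]) d := by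
  obtain ⟨x, l, y, rfl, hx, hy, hl⟩ := hd
  refine ⟨x, l, y, rfl, ?_, ?_, fun u hu => by simp [hl u hu]⟩
  · simpa [hx] using hdv
  · simpa [hy] using hdv'

theorem clockwiseFrom_eq {H : HState n m} {v : Fin n} {d : HDart n} {A B : List (HDart n)}
    (hn : (H.rot v).Nodup) (h : H.rot v = A ++ d :: B) : H.clockwiseFrom v d = B ++ A := by
  have hdA : d ∉ A := by
    rw [h] at hn
    simp [List.nodup_append] at hn
    exact fun hd => (hn.2.2 d hd).1 rfl
  unfold HState.clockwiseFrom
  rw [h, List.idxOf_append_of_notMem hdA]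
  simp

theorem mem_clockwiseFrom {H : HState n m} {v : Fin n} {d e : HDart n}
    (hn : (H.rot v).Nodup) (hd : d ∈ H.rot v) :
    e ∈ H.clockwiseFrom v d ↔ e ∈ H.rot v ∧ e ≠ d := by
  obtain ⟨A, B, h⟩ := List.append_of_mem hd
  rw [clockwiseFrom_eq hn h, h]
  rw [h] at hn
  have h1 : ∀ a ∈ A, a ≠ d := by
    rintro a ha rfl; simp [List.nodup_append] at hn; exact (hn.2.2 a ha).1 rfl
  have h2 : ∀ a ∈ B, a ≠ d := by
    rintro a ha rfl; simp [List.nodup_append] at hn; tauto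
  simp only [List.mem_append, List.mem_cons]
  constructor
  · rintro (h | h)
    exacts [⟨.inr (.inr h), h2 _ h⟩, ⟨.inl h, h1 _ h⟩]
  · rintro ⟨h | h | h, hne⟩
    exacts [.inr h, absurd h hne, .inl h]

theorem nodup_clockwiseFrom {H : HState n m} {v : Fin n} {d : HDart n}
    (hn : (H.rot v).Nodup) (hd : d ∈ H.rot v) : (H.clockwiseFrom v d).Nodup := by
  obtain ⟨A, B, h⟩ := List.append_of_mem hd
  rw [clockwiseFrom_eq hn h]
  rw [h] at hn
  exact (List.nodup_middle.1 hn).of_cons.perm List.perm_append_comm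

/-- The clockwise lists of the edges after the deletion of the nodes in `τ`. -/
theorem phaseOne_rot {τ : List (Fin n)} (hτ : I.IsPartialDeletion τ) {x : Fin n} (hx : x ∉ τ) :
    ((I.phaseOne τ).rot x).Nodup ∧ ∀ d, d ∈ (I.phaseOne τ).rot x ↔
      d.head? = some x ∧ IsLink τ d ∧ ∃ i, I.Traverses i d := by
  induction τ using List.reverseRecOn generalizing x with
  | nil =>
    change (List.map _ _).Nodup ∧ ∀ d, d ∈ List.map _ _ ↔ _
    refine ⟨((I.rot_nodup x).filter _).map fun a b h => by simpa using h, fun d => ?_⟩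
    simp only [List.mem_map, List.mem_filter, decide_eq_true_eq, ← traverses_pair_iff]
    constructor
    · rintro ⟨w, ⟨-, i, hi⟩, rfl⟩
      exact ⟨rfl, isLink_pair, i, hi⟩
    · rintro ⟨h, ⟨a, l, b, rfl, -, -, hl⟩, i, hi⟩
      obtain rfl : a = x := by simpa using h
      obtain rfl : l = [] := List.eq_nil_iff_forall_not_mem.2 fun u hu => by simpa using hl u hu
      exact ⟨b, ⟨(I.mem_rot _ _).2 hi.adj, i, hi⟩, rfl⟩
  | append_singleton τ v ih =>
    have hxτ : x ∉ τ := fun h => hx (List.mem_append_left _ h)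
    have hxv : x ≠ v := by rintro rfl; simp at hx
    have hτ' := hτ.of_append
    obtain ⟨hn, hm⟩ := ih hτ' hxτ
    obtain ⟨hnv, hmv⟩ := ih hτ' hτ.notMem
    rw [phaseOne_append]
    set H := I.phaseOne τ with hH
    have hrot : (H.deleteNode v).rot x =
        (H.rot x).flatMap (fun r => if r.getLast? = some v then H.children v r else [r]) := by
      simp [HState.deleteNode, hxv]
    have hch : ∀ r ∈ H.rot x, r.getLast? = some v → ∀ c, c ∈ H.children v r ↔
        ∃ e ∈ H.rot v, (∃ i, I.Traverses i (r ++ e.tail)) ∧ c = r ++ e.tail := by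
      intro r hr hrv c
      have hr' := (hm r).1 hr
      have hd : r.reverse ∈ H.rot v :=
        (hmv _).2 ⟨by simpa using hrv, hr'.2.1.reverse, hr'.2.2.imp fun i => traverses_reverse.2⟩
      unfold HState.children
      simp only [List.mem_map, List.mem_filter, mem_clockwiseFrom hnv hd, decide_eq_true_eq]
      constructor
      · rintro ⟨e, ⟨⟨he, hne⟩, hp⟩, rfl⟩
        have he' := (hmv e).1 he
        have := (pairUsed_iff hτ' hr'.2.1.reverse he'.2.1 (by simpa using hrv) he'.1).1
          (by simpa using hp)
        exact ⟨e, he, by simpa using this, rfl⟩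
      · rintro ⟨e, he, ⟨i, hi⟩, rfl⟩
        have he' := (hmv e).1 he
        have h3 : I.Traverses i (r.reverse.reverse ++ e.tail) := by simpa using hi
        refine ⟨e, ⟨⟨he, ?_⟩, ?_⟩, rfl⟩
        · exact ((traverses_glue hr'.2.1.reverse he'.2.1 (by simpa using hrv) he'.1).1 h3).2.2
        · have := (pairUsed_iff hτ' hr'.2.1.reverse he'.2.1 (by simpa using hrv) he'.1).2 ⟨i, h3⟩
          simpa using this
    have hmem : ∀ r ∈ H.rot x, ∀ c ∈ (if r.getLast? = some v then H.children v r else [r]),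
        ∃ B, c = r ++ B := by
      intro r hr c hc
      split_ifs at hc with h
      · obtain ⟨e, -, -, rfl⟩ := (hch r hr h c).1 hc
        exact ⟨_, rfl⟩
      · exact ⟨[], by simpa using hc⟩
    rw [hrot]
    constructor
    · rw [List.nodup_flatMap]
      constructor
      · intro r hr
        split_ifs with h
        · unfold HState.children
          have hr' := (hm r).1 hr
          have hd : r.reverse ∈ H.rot v :=
            (hmv _).2 ⟨by simpa using h, hr'.2.1.reverse, hr'.2.2.imp fun i => traverses_reverse.2⟩
          refine List.Nodup.map_on ?_ ((nodup_clockwiseFrom hnv hd).filter _)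
          intro e he e' he' hee
          have h1 := ((hmv e).1 ((mem_clockwiseFrom hnv hd).1 (List.mem_of_mem_filter he)).1).1
          have h2 := ((hmv e').1 ((mem_clockwiseFrom hnv hd).1 (List.mem_of_mem_filter he')).1).1
          obtain ⟨e, rfl⟩ := List.head?_eq_some_iff.1 h1
          obtain ⟨e', rfl⟩ := List.head?_eq_some_iff.1 h2
          simpa using hee
        · simp
      -- The new edges that replace different old edges stay different: the old edge is the part of
      -- the new one up to the first node after the start that is outside `τ`.
      · refine hn.imp_of_mem fun {r r'} hr hr' hne => ?_
        intro c hc hc'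
        obtain ⟨B, rfl⟩ := hmem r hr c hc
        obtain ⟨B', hB'⟩ := hmem r' hr' _ hc'
        obtain ⟨h1, ⟨a, l, y, rfl, ha, hy, hl⟩, -⟩ := (hm r).1 hr
        obtain ⟨h2, ⟨a', l', y', rfl, ha', hy', hl'⟩, -⟩ := (hm r').1 hr'
        obtain rfl : a = x := by simpa using h1
        obtain rfl : a' = a := by simpa using h2
        have := link_unique (B := B) (B' := B') hy hy' hl hl' (by simpa using hB')
        exact hne (by rw [this.1, this.2])
    · intro c
      rw [List.mem_flatMap]
      constructor
      · rintro ⟨r, hr, hc⟩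
        have hr' := (hm r).1 hr
        split_ifs at hc with h
        · obtain ⟨e, he, ⟨i, hi⟩, rfl⟩ := (hch r hr h c).1 hc
          have he' := (hmv e).1 he
          refine ⟨by simp [List.head?_append, hr'.1], ?_, i, hi⟩
          have := isLink_join hr'.2.1.reverse he'.2.1 (by simpa using h) he'.1
            (by simpa using hi)
          simpa using this
        · obtain rfl : c = r := by simpa using hc
          refine ⟨hr'.1, isLink_append_of_ne hr'.2.1 ?_ h, hr'.2.2⟩
          rw [hr'.1]; simpa using hxv
      · rintro ⟨h1, ⟨a, l, y, rfl, ha, hy, hl⟩, i, hi⟩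
        obtain rfl : a = x := by simpa using h1
        simp only [List.mem_append, List.mem_cons, List.not_mem_nil, or_false, not_or] at hy hl
        -- A link after the deletion either has `v` as an inner node, and then it is a child of its
        -- part up to `v`, or it avoids `v` and was a link before.
        by_cases hvl : v ∈ l
        · obtain ⟨l1, l2, rfl⟩ := List.append_of_mem hvl
          have hnd := hi.nodup
          have hl12 : ∀ u ∈ l1 ++ l2, u ∈ τ := by
            intro u hu
            rcases hl u (by simp at hu ⊢; tauto) with h | rfl
            · exact h
            · exfalso
              have h3 : (l1 ++ u :: (l2 ++ [y])).Nodup := by simpa using hnd.of_cons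
              have h4 := (List.nodup_cons.1 (List.nodup_middle.1 h3)).1
              exact h4 (by rw [← List.append_assoc]; exact List.mem_append_left _ hu)
          have hr : a :: (l1 ++ [v]) ∈ H.rot a := (hm _).2 ⟨rfl,
            ⟨a, l1, v, rfl, hxτ, hτ.notMem, fun u hu => hl12 u (by simp [hu])⟩, i,
            hi.of_infix ⟨[], l2 ++ [y], by simp⟩⟩
          refine ⟨_, hr, ?_⟩
          rw [if_pos (by simp), hch _ hr (by simp)]
          refine ⟨v :: (l2 ++ [y]), (hmv _).2 ⟨rfl, ⟨v, l2, y, rfl, hτ.notMem, hy.1,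
            fun u hu => hl12 u (by simp [hu])⟩, i, hi.of_infix ⟨a :: l1, [], by simp⟩⟩,
            ⟨i, by simpa using hi⟩, by simp⟩
        · refine ⟨_, (hm _).2 ⟨h1, ⟨a, l, y, rfl, hxτ, hy.1, fun u hu => ?_⟩, i, hi⟩, ?_⟩
          · rcases hl u hu with h | rfl
            · exact h
            · exact absurd hu hvl
          · rw [if_neg (by simpa using hy.2)]; simp

/-! ## Orders on the links -/

/-- `G` orders on each link the paths that contain it, reversely as seen from the other end. -/
def IsLinkOrder (I : RoutedGraph n m) (τ : List (Fin n)) (G : HDart n → List (Fin m)) : Prop :=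
  ∀ d, IsLink τ d → (G d).Nodup ∧ (∀ i, i ∈ G d ↔ I.Traverses i d) ∧ G d.reverse = (G d).reverse

open Classical in
/-- The order that re-insertion of `v` yields on a link to `v`, link by link after it. -/
noncomputable def joined (I : RoutedGraph n m) (G : HDart n → List (Fin m))
    (d e : HDart n) : List (Fin m) :=
  if ∃ i, I.Traverses i (d.reverse ++ e.tail) then G (d.reverse ++ e.tail) else []

theorem mem_joined {τ : List (Fin n)} {G : HDart n → List (Fin m)} {v : Fin n}
    (hG : I.IsLinkOrder (τ ++ [v]) G) {d e : HDart n} (hd : IsLink τ d) (he : IsLink τ e)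
    (hdv : d.head? = some v) (hev : e.head? = some v) {i : Fin m} :
    i ∈ joined I G d e ↔ I.Traverses i d ∧ I.Traverses i e ∧ e ≠ d := by
  rw [← traverses_glue hd he hdv hev]
  unfold joined
  split_ifs with h
  · obtain ⟨j, hj⟩ := h
    exact (hG _ (isLink_join hd he hdv hev hj)).2.1 i
  · simp only [List.not_mem_nil, false_iff]
    exact fun hi => h ⟨i, hi⟩

theorem nodup_joined {τ : List (Fin n)} {G : HDart n → List (Fin m)} {v : Fin n}
    (hG : I.IsLinkOrder (τ ++ [v]) G) {d e : HDart n} (hd : IsLink τ d) (he : IsLink τ e)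
    (hdv : d.head? = some v) (hev : e.head? = some v) : (joined I G d e).Nodup := by
  unfold joined
  split_ifs with h
  · obtain ⟨j, hj⟩ := h
    exact (hG _ (isLink_join hd he hdv hev hj)).1
  · simp

theorem joined_swap {τ : List (Fin n)} {G : HDart n → List (Fin m)} {v : Fin n}
    (hG : I.IsLinkOrder (τ ++ [v]) G) {d e : HDart n} (hd : IsLink τ d) (he : IsLink τ e)
    (hdv : d.head? = some v) (hev : e.head? = some v) :
    joined I G e d = (joined I G d e).reverse := by
  have hr := join_reverse hdv hev
  have hiff : (∃ i, I.Traverses i (e.reverse ++ d.tail)) ↔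
      ∃ i, I.Traverses i (d.reverse ++ e.tail) := by
    rw [← hr]; exact exists_congr fun i => traverses_reverse
  unfold joined
  by_cases h : ∃ i, I.Traverses i (d.reverse ++ e.tail)
  · rw [if_pos h, if_pos (hiff.2 h), ← hr]
    obtain ⟨j, hj⟩ := h
    exact (hG _ (isLink_join hd he hdv hev hj)).2.2
  · rw [if_neg h, if_neg (fun h' => h (hiff.1 h'))]; rfl

section Reinsert

variable {τ : List (Fin n)} {v : Fin n} (hτ : I.IsPartialDeletion (τ ++ [v]))
  {G : HDart n → List (Fin m)}

include hτ in
theorem mem_rot_links {e : HDart n} (he : e ∈ (I.phaseOne τ).rot v) :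
    e.head? = some v ∧ IsLink τ e :=
  ⟨(((phaseOne_rot hτ.of_append hτ.notMem).2 e).1 he).1,
    (((phaseOne_rot hτ.of_append hτ.notMem).2 e).1 he).2.1⟩

theorem mem_rot_of_mem_clockwiseFrom {H : HState n m} {d e : HDart n}
    (h : e ∈ H.clockwiseFrom v d) : e ∈ H.rot v := by
  unfold HState.clockwiseFrom at h
  rcases List.mem_append.1 h with h | h
  · exact List.mem_of_mem_drop h
  · exact List.mem_of_mem_take h

include hτ in
-- Written from the viewpoint of `v`: `d` leaves `v`, and seen from the other end of `d` the lists
-- of the joins are concatenated clockwise around `v`, beginning after `d`.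
theorem reinsertNode_reverse {d : HDart n} (hd : IsLink τ d) (hdv : d.head? = some v) :
    (I.phaseOne τ).reinsertNode v G d.reverse =
      ((I.phaseOne τ).clockwiseFrom v d).flatMap (joined I G d) := by
  unfold HState.reinsertNode HState.children
  rw [if_pos (by simpa using hdv), List.reverse_reverse, List.flatMap_map]
  generalize hR : (I.phaseOne τ).clockwiseFrom v d = R
  have hR' : ∀ e ∈ R, e ∈ (I.phaseOne τ).rot v := by
    intro e he; rw [← hR] at he; exact mem_rot_of_mem_clockwiseFrom he
  clear hR
  induction R with
  | nil => rfl
  | cons e R ih =>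
    have he := mem_rot_links hτ (hR' e (by simp))
    have hp := pairUsed_iff hτ.of_append hd he.2 hdv he.1
    rw [List.filter_cons, List.flatMap_cons, ← ih fun e he => hR' e (by simp [he])]
    unfold joined
    by_cases h : (I.phaseOne τ).PairUsed d.reverse e
    · rw [if_pos (by simpa using h), if_pos (hp.1 h)]; rfl
    · rw [if_neg (by simpa using h), if_neg (fun h' => h (hp.2 h'))]; rfl

include hτ in
-- Since `v` is not terminal, a path on `d` leaves `v` on another link (`link_other`), and only on
-- one (`link_third`). So it occurs in exactly one of the concatenated lists.
theorem reinsertNode_links (hG : I.IsLinkOrder (τ ++ [v]) G) {d : HDart n} (hd : IsLink τ d)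
    (hdv : d.head? = some v) :
    (((I.phaseOne τ).clockwiseFrom v d).flatMap (joined I G d)).Nodup ∧
      ∀ i, i ∈ ((I.phaseOne τ).clockwiseFrom v d).flatMap (joined I G d) ↔
        I.Traverses i d := by
  obtain ⟨hn, hm⟩ := phaseOne_rot hτ.of_append hτ.notMem
  have hmem : ∀ e ∈ (I.phaseOne τ).clockwiseFrom v d, ∀ i, i ∈ joined I G d e ↔
      I.Traverses i d ∧ I.Traverses i e ∧ e ≠ d := by
    intro e he i
    have he' := mem_rot_links hτ (mem_rot_of_mem_clockwiseFrom he)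
    exact mem_joined hG hd he'.2 hdv he'.1
  by_cases hdr : d ∈ (I.phaseOne τ).rot v
  · constructor
    · rw [List.nodup_flatMap]
      constructor
      · intro e he
        have he' := mem_rot_links hτ (mem_rot_of_mem_clockwiseFrom he)
        exact nodup_joined hG hd he'.2 hdv he'.1
      · refine (nodup_clockwiseFrom hn hdr).imp_of_mem fun {e f} he hf hne => ?_
        intro i hi hi'
        have h1 := (hmem e he i).1 hi
        have h2 := (hmem f hf i).1 hi'
        have he' := mem_rot_links hτ (mem_rot_of_mem_clockwiseFrom he)
        have hf' := mem_rot_links hτ (mem_rot_of_mem_clockwiseFrom hf)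
        exact hne (link_third hd he'.2 hf'.2 hdv he'.1 hf'.1 h1.1 h1.2.1 h2.2.1 h1.2.2 h2.2.2)
    · intro i
      rw [List.mem_flatMap]
      constructor
      · rintro ⟨e, he, hi⟩
        exact ((hmem e he i).1 hi).1
      · intro hi
        obtain ⟨e, he, hev, hne, hie⟩ := link_other (fun u hu => hτ.of_append.2 u hu i) hd hdv
          (hτ.nonterminal i) hi
        have he' := (mem_clockwiseFrom hn hdr).2 ⟨(hm e).2 ⟨hev, he, i, hie⟩, hne⟩
        exact ⟨e, he', (hmem e he' i).2 ⟨hi, hie, hne⟩⟩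
  · have hno : ∀ i, ¬ I.Traverses i d := fun i hi => hdr ((hm d).2 ⟨hdv, hd, i, hi⟩)
    have : ((I.phaseOne τ).clockwiseFrom v d).flatMap (joined I G d) = [] := by
      rw [List.flatMap_eq_nil_iff]
      intro e he
      rw [List.eq_nil_iff_forall_not_mem]
      intro i hi
      exact hno i ((hmem e he i).1 hi).1
    rw [this]
    simpa using hno

include hτ in
theorem isLinkOrder_reinsertNode (hG : I.IsLinkOrder (τ ++ [v]) G) :
    I.IsLinkOrder τ ((I.phaseOne τ).reinsertNode v G) := by
  intro d hd
  by_cases h1 : d.head? = some v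
  · have h2 := reinsertNode_links hτ hG hd h1
    rw [← reinsertNode_reverse hτ hd h1] at h2
    have h3 : (I.phaseOne τ).reinsertNode v G d =
        ((I.phaseOne τ).reinsertNode v G d.reverse).reverse := by
      by_cases h4 : d.getLast? = some v
      -- A list that starts and ends at `v` can be a link formally, but no simple path traverses it;
      -- both orders are empty.
      · have h5 := reinsertNode_links hτ hG hd.reverse (by simpa using h4)
        rw [← reinsertNode_reverse hτ hd.reverse (by simpa using h4), List.reverse_reverse] at h5
        have hno : ∀ i, ¬ I.Traverses i d := by
          intro i hi
          have hnd := hi.nodup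
          obtain ⟨x, l, y, rfl, -⟩ := hd
          obtain rfl : x = v := by simpa using h1
          obtain rfl : y = x := by simpa using h4
          simp at hnd
        rw [List.eq_nil_iff_forall_not_mem.2 fun i hi => hno i ((h2.2 i).1 hi),
          List.eq_nil_iff_forall_not_mem.2 fun i hi => hno i (traverses_reverse.1 ((h5.2 i).1 hi))]
        rfl
      · unfold HState.reinsertNode
        rw [if_neg h4, if_pos h1, if_pos (by simpa using h1)]
    rw [h3]
    refine ⟨List.nodup_reverse.2 h2.1, fun i => by rw [List.mem_reverse]; exact h2.2 i, by simp⟩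
  · by_cases h4 : d.getLast? = some v
    · have h2 := reinsertNode_links hτ hG hd.reverse (by simpa using h4)
      rw [← reinsertNode_reverse hτ hd.reverse (by simpa using h4), List.reverse_reverse] at h2
      refine ⟨h2.1, fun i => by rw [h2.2 i, traverses_reverse], ?_⟩
      conv_lhs => unfold HState.reinsertNode
      rw [if_neg (by simpa using h1), if_pos (by simpa using h4), List.reverse_reverse]
      unfold HState.reinsertNode
      rw [if_pos h4]
    · have h5 := hG d (isLink_append_of_ne hd h1 h4)
      have h6 : (I.phaseOne τ).reinsertNode v G d = G d := by
        unfold HState.reinsertNode; rw [if_neg h4, if_neg h1]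
      have h7 : (I.phaseOne τ).reinsertNode v G d.reverse = G d.reverse := by
        unfold HState.reinsertNode; rw [if_neg (by simpa using h1), if_neg (by simpa using h4)]
      rw [h6, h7]
      exact h5

include hτ in
-- At `x`, the new edges stand in the place of the old edge, in the order in which their lists are
-- concatenated. So re-insertion of another node only regroups what is met around `x`, and crossings
-- at `x` are decided when `x` itself is re-inserted.
theorem flatMap_deleteNode {x : Fin n} (hx : x ∉ τ ++ [v]) :
    ((I.phaseOne (τ ++ [v])).rot x).flatMap G =
      ((I.phaseOne τ).rot x).flatMap ((I.phaseOne τ).reinsertNode v G) := by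
  have hxv : x ≠ v := by rintro rfl; simp at hx
  rw [phaseOne_append]
  have hm := (phaseOne_rot hτ.of_append (fun h => hx (List.mem_append_left _ h))).2
  simp only [HState.deleteNode, hxv, if_false, List.flatMap_assoc]
  refine List.flatMap_congr fun r hr => ?_
  unfold HState.reinsertNode
  split_ifs with h1 h2
  · rfl
  · rw [((hm r).1 hr).1] at h2; simp [hxv] at h2
  · simp

include hτ in
theorem reinsertNode_congr {G' : HDart n → List (Fin m)}
    (h : ∀ d, IsLink (τ ++ [v]) d → G d = G' d) {d : HDart n} (hd : IsLink τ d) :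
    (I.phaseOne τ).reinsertNode v G d = (I.phaseOne τ).reinsertNode v G' d := by
  have key : ∀ e, IsLink τ e → e.head? = some v →
      (I.phaseOne τ).reinsertNode v G e.reverse = (I.phaseOne τ).reinsertNode v G' e.reverse := by
    intro e he hev
    rw [reinsertNode_reverse hτ he hev, reinsertNode_reverse hτ he hev]
    refine List.flatMap_congr fun f hf => ?_
    have hf' := mem_rot_links hτ (mem_rot_of_mem_clockwiseFrom hf)
    unfold joined
    split_ifs with h1
    · obtain ⟨i, hi⟩ := h1
      exact h _ (isLink_join he hf'.2 hev hf'.1 hi)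
    · rfl
  by_cases h1 : d.getLast? = some v
  · have := key d.reverse hd.reverse (by simpa using h1)
    simpa using this
  · by_cases h2 : d.head? = some v
    · have := key d hd h2
      unfold HState.reinsertNode at this ⊢
      rw [if_pos (by simpa using h2), if_pos (by simpa using h2)] at this
      rw [if_neg h1, if_neg h1, if_pos h2, if_pos h2, this]
    · unfold HState.reinsertNode
      rw [if_neg h1, if_neg h1, if_neg h2, if_neg h2]
      exact h d (isLink_append_of_ne hd h2 h1)

include hτ in
theorem alternate_rot_iff {d : HDart n} (hd : d ∈ (I.phaseOne τ).rot v) {i j : Fin m} :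
    List.Alternate i j (((I.phaseOne τ).rot v).flatMap G) ↔
      List.Alternate i j (G d ++ ((I.phaseOne τ).clockwiseFrom v d).flatMap G) := by
  obtain ⟨A, B, h⟩ := List.append_of_mem hd
  rw [clockwiseFrom_eq (phaseOne_rot hτ.of_append hτ.notMem).1 h, h, List.flatMap_append,
    List.alternate_append_comm]
  simp

end Reinsert

end RoutedGraph

/-! ### Paths that share a link at a re-inserted node -/

namespace RoutedGraph

variable {n m : ℕ} {I : RoutedGraph n m}

/-- Whenever two paths cross at a node of a common subpath, the other nodes of the common subpath
come before this node in `σ`. -/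
def CrossesLast (I : RoutedGraph n m) (o : Fin n → Fin n → List (Fin m)) (σ : List (Fin n)) :
    Prop :=
  ∀ i j, i ≠ j → ∀ τ v ρ, σ = τ ++ v :: ρ → I.CrossAt o i j v → ∀ d, I.Traverses i d →
    I.Traverses j d → v ∈ d → ∀ u ∈ d, u ≠ v → u ∈ τ

theorem filter_flatMap_congr {α β : Type*} {p : β → Bool} {l : List α} {f g : α → List β}
    (h : ∀ a ∈ l, (f a).filter p = (g a).filter p) :
    (l.flatMap f).filter p = (l.flatMap g).filter p := by
  rw [List.filter_flatMap, List.filter_flatMap]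
  exact List.flatMap_congr h

section Core

variable {τ : List (Fin n)} {v : Fin n} (hτ : I.IsPartialDeletion (τ ++ [v]))
  {G : HDart n → List (Fin m)} {i j : Fin m} {d : HDart n}

include hτ in
-- The order on `e` is concatenated over all turns at `v` that use `e`. The paths `i` and `j` also
-- run on `d` and have only two links at `v` each, so of these turns only the one between `e` and
-- `d` can contain them.
theorem filter_reinsertNode (hG : I.IsLinkOrder (τ ++ [v]) G) (hd : IsLink τ d)
    (hdv : d.head? = some v) (hi : I.Traverses i d) (hj : I.Traverses j d) {e : HDart n}
    (he : e ∈ (I.phaseOne τ).clockwiseFrom v d) :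
    ((I.phaseOne τ).reinsertNode v G e).filter (fun k => k = i ∨ k = j) =
      (joined I G d e).filter (fun k => k = i ∨ k = j) := by
  obtain ⟨hn, hm⟩ := phaseOne_rot hτ.of_append hτ.notMem
  have hdr : d ∈ (I.phaseOne τ).rot v := (hm d).2 ⟨hdv, hd, i, hi⟩
  have her := mem_rot_of_mem_clockwiseFrom he
  have hne : e ≠ d := ((mem_clockwiseFrom hn hdr).1 he).2
  have he' := mem_rot_links hτ her
  have h1 := (isLinkOrder_reinsertNode hτ hG e he'.2).2.2
  rw [← List.reverse_reverse ((I.phaseOne τ).reinsertNode v G e), ← h1,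
    reinsertNode_reverse hτ he'.2 he'.1, List.filter_reverse, List.filter_flatMap,
    List.flatMap_eq_of_forall_ne (d := d) (nodup_clockwiseFrom hn her)
      ((mem_clockwiseFrom hn her).2 ⟨hdr, hne.symm⟩), ← List.filter_reverse,
    ← joined_swap hG he'.2 hd he'.1 hdv]
  intro f hf hfd
  have hf' := mem_rot_links hτ (mem_rot_of_mem_clockwiseFrom hf)
  rw [List.filter_eq_nil_iff]
  intro k hk hkij
  have h2 := (mem_joined hG he'.2 hf'.2 he'.1 hf'.1).1 hk
  have hkd : I.Traverses k d := by
    rcases of_decide_eq_true hkij with rfl | rfl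
    exacts [hi, hj]
  exact h2.2.2 (link_third hd hf'.2 he'.2 hdv hf'.1 he'.1 hkd h2.2.1 h2.1 hfd hne)

/-- The paths `i` and `j` share the link `d` at `v`, and `K` orders them at the other links of `v`
as re-insertion does. Then they do not alternate around `v` if and only if `K` orders them on `d` as
re-insertion does. -/
theorem not_alternate_iff (hτ : I.IsPartialDeletion (τ ++ [v])) (hG : I.IsLinkOrder (τ ++ [v]) G)
    {K : HDart n → List (Fin m)} (hK : I.IsLinkOrder τ K) (hij : i ≠ j)
    (hd : IsLink τ d) (hdv : d.head? = some v) (hi : I.Traverses i d) (hj : I.Traverses j d)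
    (h : ∀ e ∈ (I.phaseOne τ).clockwiseFrom v d, (K e).filter (fun k => k = i ∨ k = j) =
      (joined I G d e).filter (fun k => k = i ∨ k = j)) :
    ¬ List.Alternate i j (((I.phaseOne τ).rot v).flatMap K) ↔
      (K d.reverse).filter (fun k => k = i ∨ k = j) =
        ((I.phaseOne τ).reinsertNode v G d.reverse).filter (fun k => k = i ∨ k = j) := by
  obtain ⟨hn, hm⟩ := phaseOne_rot hτ.of_append hτ.notMem
  have hdr : d ∈ (I.phaseOne τ).rot v := (hm d).2 ⟨hdv, hd, i, hi⟩
  have h1 := filter_flatMap_congr h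
  rw [← reinsertNode_reverse hτ hd hdv] at h1
  have h2 := isLinkOrder_reinsertNode hτ hG d.reverse hd.reverse
  have h3 := hK d hd
  rw [alternate_rot_iff hτ hdr, List.alternate_append_iff hij
    (List.filter_pair_of_nodup h3.1 hij ((h3.2.1 i).2 hi) ((h3.2.1 j).2 hj)) ?_, h1, h3.2.2,
    List.filter_reverse, ← List.reverse_inj, List.reverse_reverse]
  rw [h1]
  exact List.filter_pair_of_nodup h2.1 hij ((h2.2.1 i).2 (traverses_reverse.2 hi))
    ((h2.2.1 j).2 (traverses_reverse.2 hj))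

include hτ in
-- The heart of the matter: seen from its far end, `d` repeats the order in which the rest of the
-- way around `v` meets the two paths. Seen from `v` the order is the opposite one, so their
-- occurrences do not alternate.
theorem not_alternate_reinsertNode (hG : I.IsLinkOrder (τ ++ [v]) G) (hij : i ≠ j)
    (hd : IsLink τ d) (hdv : d.head? = some v) (hi : I.Traverses i d) (hj : I.Traverses j d) :
    ¬ List.Alternate i j
      (((I.phaseOne τ).rot v).flatMap ((I.phaseOne τ).reinsertNode v G)) :=
  (not_alternate_iff hτ hG (isLinkOrder_reinsertNode hτ hG) hij hd hdv hi hj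
    fun _ he => filter_reinsertNode hτ hG hd hdv hi hj he).2 rfl

end Core

/-! ## The algorithm yields orderings with late crossings -/

theorem isLinkOrder_of_isOrderingOn {σ : List (Fin n)} (hσ : I.IsPartialDeletion σ)
    {base : HDart n → List (Fin m)} (h : (I.phaseOne σ).IsOrderingOn base) :
    I.IsLinkOrder σ base := by
  intro d hd
  obtain ⟨h1, h2, h3⟩ := h d
  refine ⟨h1, fun i => ?_, h3⟩
  rw [h2 i, contains_iff hσ]
  simp [hd]

theorem isLinkOrder_orders {base : HDart n → List (Fin m)} {τ ρ : List (Fin n)}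
    (hσ : I.IsPartialDeletion (τ ++ ρ)) (h : I.IsLinkOrder (τ ++ ρ) base) :
    I.IsLinkOrder τ (HState.orders base ρ (I.phaseOne τ)) := by
  induction ρ generalizing τ with
  | nil => simpa [HState.orders] using h
  | cons v ρ ih =>
    have e : τ ++ v :: ρ = (τ ++ [v]) ++ ρ := by simp
    rw [e] at hσ h
    have := ih hσ h
    rw [phaseOne_append] at this
    exact isLinkOrder_reinsertNode hσ.of_append this

/-- The nodes of `ρ` are deleted before `v` and thus re-inserted after it; by `flatMap_deleteNode`
none of them changes what is met around `v`. -/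
theorem flatMap_orders {base : HDart n → List (Fin m)} {τ ρ ρ' : List (Fin n)} {v : Fin n}
    (hσ : I.IsPartialDeletion (τ ++ (ρ ++ v :: ρ'))) :
    ((I.phaseOne τ).rot v).flatMap (HState.orders base (ρ ++ v :: ρ') (I.phaseOne τ)) =
      ((I.phaseOne (τ ++ ρ)).rot v).flatMap
        (HState.orders base (v :: ρ') (I.phaseOne (τ ++ ρ))) := by
  induction ρ generalizing τ with
  | nil => simp
  | cons u ρ ih =>
    have e : τ ++ (u :: ρ ++ v :: ρ') = (τ ++ [u]) ++ (ρ ++ v :: ρ') := by simp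
    rw [e] at hσ
    have h1 := ih hσ
    have hv : v ∉ τ ++ [u] := by
      intro hv
      exact (List.nodup_append.1 hσ.1).2.2 v hv v (by simp) rfl
    rw [flatMap_deleteNode hσ.of_append hv, phaseOne_append] at h1
    simpa [HState.orders] using h1

theorem flatMap_initial {F : HDart n → List (Fin m)} (hF : I.IsLinkOrder [] F) (v : Fin n) :
    ((I.phaseOne []).rot v).flatMap F = I.around (fun v w => F [v, w]) v := by
  change (List.map _ _).flatMap F = _
  rw [List.flatMap_map]
  unfold around
  induction I.rot v with
  | nil => rfl
  | cons w l ih =>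
    rw [List.filter_cons, List.flatMap_cons, ← ih]
    split_ifs with h
    · simp
    · have : F [v, w] = [] := by
        rw [List.eq_nil_iff_forall_not_mem]
        intro i hi
        refine h (decide_eq_true ⟨i, ?_⟩)
        exact traverses_pair_iff.1 (((hF _ isLink_pair).2.1 i).1 hi)
      change _ = F [v, w] ++ _
      rw [this, List.nil_append]

theorem isOrdering_of_isLinkOrder {F : HDart n → List (Fin m)} (hF : I.IsLinkOrder [] F) :
    I.IsOrdering (fun v w => F [v, w]) := by
  intro v w
  have h := hF [v, w] isLink_pair
  refine ⟨h.1, fun i => ?_, h.2.2⟩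
  rw [h.2.1 i, traverses_pair_iff]

theorem IsDeletionOrder.isPartialDeletion {σ : List (Fin n)} (h : I.IsDeletionOrder σ) :
    I.IsPartialDeletion σ := ⟨h.1, fun u hu i hi => (h.2 u).1 hu ⟨i, hi⟩⟩

theorem IsRun.isLinkOrder {σ : List (Fin n)} {base : HDart n → List (Fin m)}
    (h : I.IsRun σ base) : I.IsLinkOrder [] (HState.orders base σ (I.phaseOne [])) :=
  isLinkOrder_orders (τ := []) h.1.isPartialDeletion
    (isLinkOrder_of_isOrderingOn h.1.isPartialDeletion h.2)

theorem IsRun.isOrdering {σ : List (Fin n)} {base : HDart n → List (Fin m)} (h : I.IsRun σ base) :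
    I.IsOrdering (I.algorithm σ base) := isOrdering_of_isLinkOrder h.isLinkOrder

/-- If another node of the common subpath were still present when `v` is deleted, the two paths
would share a link at `v` and could not cross there. -/
theorem IsRun.crossesLast {σ : List (Fin n)} {base : HDart n → List (Fin m)}
    (h : I.IsRun σ base) : I.CrossesLast (I.algorithm σ base) σ := by
  intro i j hij τ v ρ hσ hcross d hdi hdj hvd u hud huv
  have hp := h.1.isPartialDeletion
  have hb := isLinkOrder_of_isOrderingOn hp h.2
  have hF := h.isLinkOrder
  have h0 : I.around (I.algorithm σ base) v =
      ((I.phaseOne []).rot v).flatMap (HState.orders base σ (I.phaseOne [])) :=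
    (flatMap_initial hF v).symm
  have hcross : List.Alternate i j (I.around (I.algorithm σ base) v) := hcross
  rw [h0] at hcross
  subst hσ
  rw [flatMap_orders (by simpa using hp), List.nil_append] at hcross
  have hp' : I.IsPartialDeletion ((τ ++ [v]) ++ ρ) := by simpa using hp
  by_contra huτ
  obtain ⟨e, he, hev, hei, hej⟩ := exists_common_link hdi hdj hud hvd huv huτ hp'.of_append.notMem
  refine not_alternate_reinsertNode hp'.of_append
    (isLinkOrder_orders hp' (by simpa using hb)) hij he hev hei hej ?_
  rw [phaseOne_append]
  exact hcross

/-! ## Orderings with late crossings come from the algorithm -/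

section Converse

variable {o : Fin n → Fin n → List (Fin m)} (ho : I.IsOrdering o)

include ho in
theorem mem_order_iff {v w : Fin n} {i : Fin m} : i ∈ o v w ↔ I.Traverses i [v, w] := by
  rw [(ho v w).2.1, traverses_pair_iff]

include ho in
theorem filter_order {i j : Fin m} (hij : i ≠ j) {v w : Fin n} (hi : I.Traverses i [v, w])
    (hj : I.Traverses j [v, w]) :
    (o v w).filter (fun k => k = i ∨ k = j) = [i, j] ∨
      (o v w).filter (fun k => k = i ∨ k = j) = [j, i] :=
  List.filter_pair_of_nodup (ho v w).1 hij ((mem_order_iff ho).2 hi) ((mem_order_iff ho).2 hj)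

include ho in
-- Inside a common subpath, both paths use the same two edges at `w`. For them the way around `w`
-- consists of two blocks, which alternate unless their orders are opposite.
theorem crossAt_inner_iff {i j : Fin m} (hij : i ≠ j) {x w b : Fin n}
    (hi : I.Traverses i [x, w, b]) (hj : I.Traverses j [x, w, b]) :
    ¬ I.CrossAt o i j w ↔ (o w x).filter (fun k => k = i ∨ k = j) =
      ((o w b).filter (fun k => k = i ∨ k = j)).reverse := by
  have key : ∀ {i}, I.Traverses i [x, w, b] → I.Traverses i [w, x] ∧ I.Traverses i [w, b] := by
    intro i hi
    exact ⟨traverses_reverse.1 (hi.of_infix ⟨[], [b], rfl⟩), hi.of_infix ⟨[x], [], rfl⟩⟩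
  have hxb : b ≠ x := by
    have := hi.nodup
    simp at this
    tauto
  obtain ⟨A, B, hAB⟩ := List.append_of_mem ((I.mem_rot w x).2 (key hi).1.adj)
  have hn := I.rot_nodup w
  have hb : b ∈ B ++ A := by
    have := (I.mem_rot w b).2 (key hi).2.adj
    rw [hAB] at this
    simp only [List.mem_append, List.mem_cons] at this ⊢
    tauto
  have hn' : (x :: (B ++ A)).Nodup := by
    rw [hAB] at hn
    exact hn.perm (by simpa using List.perm_append_comm (l₁ := A) (l₂ := x :: B))
  have hF : ((B ++ A).flatMap (o w)).filter (fun k => k = i ∨ k = j) =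
      (o w b).filter (fun k => k = i ∨ k = j) := by
    rw [List.filter_flatMap]
    refine List.flatMap_eq_of_forall_ne hn'.of_cons hb fun c hc hcb => ?_
    have hcx : c ≠ x := by rintro rfl; exact (List.nodup_cons.1 hn').1 hc
    rw [List.filter_eq_nil_iff]
    intro k hk hkij
    have hkc := (mem_order_iff ho).1 hk
    have hk' : I.Traverses k [x, w, b] := by
      rcases of_decide_eq_true hkij with rfl | rfl
      exacts [hi, hj]
    have := link_third (τ := []) isLink_pair isLink_pair isLink_pair rfl rfl rfl (key hk').1
      hkc (key hk').2 (by simpa using hcx) (by simpa using hxb)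
    exact hcb (by simpa using this)
  change ¬ List.Alternate i j (I.around o w) ↔ _
  have hrot : I.around o w = A.flatMap (o w) ++ (o w x ++ B.flatMap (o w)) := by
    unfold around; rw [hAB]; simp
  rw [hrot, List.alternate_append_comm, List.append_assoc, ← List.flatMap_append,
    List.alternate_append_iff hij (filter_order ho hij (key hi).1 (key hj).1) ?_, hF]
  rw [hF]
  exact filter_order ho hij (key hi).2 (key hj).2

include ho in
/-- If two paths do not cross inside a common subpath, then their order at its ends is the same. -/
theorem order_transfer {i j : Fin m} (hij : i ≠ j) {x w y w' : Fin n} {l l' : List (Fin n)}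
    (hrev : (x :: w :: l).reverse = y :: w' :: l')
    (hi : I.Traverses i (x :: w :: l)) (hj : I.Traverses j (x :: w :: l))
    (hc : ∀ u ∈ x :: w :: l, u ≠ x → u ≠ y → ¬ I.CrossAt o i j u) :
    (o x w).filter (fun k => k = i ∨ k = j) =
      ((o y w').filter (fun k => k = i ∨ k = j)).reverse := by
  induction l generalizing x w l' with
  | nil =>
    simp at hrev
    obtain ⟨rfl, rfl, rfl⟩ := hrev
    rw [(ho w x).2.2, List.filter_reverse]
  | cons b l ih =>
    have hin : w :: b :: l <:+: x :: w :: b :: l := ⟨[x], [], by simp⟩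
    have hin' : [x, w, b] <:+: x :: w :: b :: l := ⟨[], l, by simp⟩
    have hnd := hi.nodup
    have hr : (x :: w :: b :: l).reverse = (w :: b :: l).reverse ++ [x] := by simp
    obtain ⟨l'', hl''⟩ : ∃ l'', (w :: b :: l).reverse = y :: w' :: l'' := by
      rcases h : (w :: b :: l).reverse with _ | ⟨p, _ | ⟨q, r⟩⟩
      · simp at h
      · have := congrArg List.length h; simp at this
      · rw [hr, h] at hrev
        simp at hrev
        exact ⟨r, by rw [hrev.1, hrev.2.1]⟩
    have hyw : w ≠ y := by
      rintro rfl
      have : (w :: b :: l).reverse.Nodup := List.nodup_reverse.2 hnd.of_cons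
      rw [hl''] at this
      have h2 : (b :: l).reverse = w' :: l'' ∨ w ∈ w' :: l'' := by
        right
        have h3 : (b :: l).reverse ++ [w] = w :: w' :: l'' := by rw [← hl'']; simp
        rcases h4 : (b :: l).reverse with _ | ⟨p, q⟩
        · simp at h4
        · rw [h4] at h3
          simp at h3
          rw [← h3.2]; simp
      rcases h2 with h2 | h2
      · have := congrArg List.length hl''
        have h5 := congrArg List.length h2
        simp at this h5
        have h3 : (b :: l).reverse ++ [w] = w :: w' :: l'' := by rw [← hl'']; simp
        rw [h2] at h3
        simp at h3
        have h6 : w ∈ (b :: l).reverse := by rw [h2, ← h3.1]; simp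
        rw [List.mem_reverse] at h6
        exact (List.nodup_cons.1 hnd.of_cons).1 h6
      · exact (List.nodup_cons.1 this).1 h2
    have hwx : w ≠ x := by rintro rfl; simp at hnd
    rw [← ih hl'' (hi.of_infix hin) (hj.of_infix hin) ?_]
    · have := (crossAt_inner_iff ho hij (hi.of_infix hin') (hj.of_infix hin')).1
        (hc w (by simp) hwx hyw)
      rw [(ho w x).2.2, List.filter_reverse, this, List.reverse_reverse]
    · intro u hu huw huy
      refine hc u (List.mem_cons_of_mem _ hu) ?_ huy
      rintro rfl
      exact (List.nodup_cons.1 hnd).1 hu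

instance {i : Fin m} {d : List (Fin n)} : Decidable (I.Traverses i d) := by
  unfold Traverses; infer_instance

/-- The order on the link `d` that is induced by the ordering of paths `o`. -/
def induced (I : RoutedGraph n m) (o : Fin n → Fin n → List (Fin m)) :
    HDart n → List (Fin m)
  | x :: w :: l => (o x w).filter (fun i => I.Traverses i (x :: w :: l))
  | _ => []

theorem IsLink.exists_cons_cons {τ d : List (Fin n)} (h : IsLink τ d) :
    ∃ x w l, d = x :: w :: l := by
  obtain ⟨x, l, y, rfl, -⟩ := h
  cases l with
  | nil => exact ⟨x, y, [], rfl⟩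
  | cons a l => exact ⟨x, a, l ++ [y], rfl⟩

theorem filter_induced {i j : Fin m} {x w : Fin n} {l : List (Fin n)}
    (hi : I.Traverses i (x :: w :: l)) (hj : I.Traverses j (x :: w :: l)) :
    (induced I o (x :: w :: l)).filter (fun k => k = i ∨ k = j) =
      (o x w).filter (fun k => k = i ∨ k = j) := by
  unfold induced
  rw [List.filter_filter]
  refine List.filter_congr fun k _ => ?_
  by_cases h : k = i ∨ k = j
  · have : I.Traverses k (x :: w :: l) := by
      rcases h with rfl | rfl
      exacts [hi, hj]
    simp [h, this]
  · simp [h]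

variable {σ : List (Fin n)} (hσ : I.IsPartialDeletion σ) (hQ : I.CrossesLast o σ)

include ho in
theorem mem_induced {τ d : List (Fin n)} (hd : IsLink τ d) {i : Fin m} :
    i ∈ induced I o d ↔ I.Traverses i d := by
  obtain ⟨x, w, l, rfl⟩ := hd.exists_cons_cons
  unfold induced
  rw [List.mem_filter, mem_order_iff ho]
  constructor
  · exact fun h => of_decide_eq_true h.2
  · exact fun h => ⟨h.of_infix ⟨[], l, by simp⟩, decide_eq_true h⟩

include ho in
theorem nodup_induced {τ d : List (Fin n)} (hd : IsLink τ d) : (induced I o d).Nodup := by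
  obtain ⟨x, w, l, rfl⟩ := hd.exists_cons_cons
  exact (ho x w).1.filter _

include ho hQ in
-- The induced order is read off the first edge of the link. That the far end sees the reverse order
-- needs that two paths on the link do not cross inside it: a crossing at an inner node `u` would
-- put an end of the link before `u` in `σ`, hence into `τ`, where it is not.
theorem isLinkOrder_induced {τ ρ : List (Fin n)} (hτρ : σ = τ ++ ρ) :
    I.IsLinkOrder τ (induced I o) := by
  intro d hd
  refine ⟨nodup_induced ho hd, fun i => mem_induced ho hd, ?_⟩
  refine List.eq_of_filter_pair (nodup_induced ho hd.reverse)
    (List.nodup_reverse.2 (nodup_induced ho hd)) (fun i => ?_) fun i hi j hj hij => ?_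
  · rw [List.mem_reverse, mem_induced ho hd, mem_induced ho hd.reverse, traverses_reverse]
  · rw [mem_induced ho hd.reverse] at hi hj
    rw [List.filter_reverse]
    obtain ⟨y, w', l', hyr⟩ := hd.reverse.exists_cons_cons
    obtain ⟨x, w, l, rfl⟩ := hd.exists_cons_cons
    rw [hyr] at hi hj ⊢
    rw [filter_induced hi hj, filter_induced]
    · refine order_transfer ho hij (l := l') (l' := l) (by rw [← hyr, List.reverse_reverse]) hi hj ?_
      obtain ⟨x', m', z', h1, hx', hz', hm'⟩ := hd
      intro u hu huy hux hcross
      have hu' : u ∈ x :: w :: l := by rw [← List.mem_reverse, hyr]; exact hu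
      have huτ : u ∈ τ := by
        rw [h1] at hu' hyr
        simp only [List.reverse_cons, List.reverse_append, List.reverse_nil, List.nil_append,
          List.cons_append, List.cons.injEq] at hyr h1
        simp only [List.mem_cons, List.mem_append, List.not_mem_nil, or_false] at hu'
        rcases hu' with h | h | h
        · exact absurd (h.trans h1.1.symm) hux
        · exact hm' u h
        · exact absurd (h.trans hyr.1) huy
      have hxτ : x ∉ τ := by
        simp only [List.cons.injEq] at h1
        rw [h1.1]; exact hx'
      obtain ⟨s, t, rfl⟩ := List.append_of_mem huτ
      have hx2 : x ∈ y :: w' :: l' := by rw [← hyr]; simp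
      have := hQ i j hij s u (t ++ ρ) (by rw [hτρ]; simp) hcross _ hi hj hu x hx2 (Ne.symm hux)
      exact hxτ (by simp [this])
    · rw [← hyr, traverses_reverse] at hi; exact hi
    · rw [← hyr, traverses_reverse] at hj; exact hj

include ho hσ hQ in
-- This is `not_alternate_iff` in the other direction. Two paths on the link `d` do not cross at `v`
-- in `o`, so their order on `d` is forced by the other links at `v`, and it is the one that
-- re-insertion yields.
theorem reinsertNode_induced {τ ρ : List (Fin n)} {v : Fin n} (hτρ : σ = τ ++ v :: ρ)
    (har : ((I.phaseOne τ).rot v).flatMap (induced I o) = I.around o v) {d : HDart n}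
    (hd : IsLink τ d) :
    (I.phaseOne τ).reinsertNode v (induced I o) d = induced I o d := by
  have hτ : I.IsPartialDeletion (τ ++ [v]) := by
    refine IsPartialDeletion.of_append (ρ := ρ) ?_
    rw [← List.append_cons, ← hτρ]; exact hσ
  have hG : I.IsLinkOrder (τ ++ [v]) (induced I o) :=
    isLinkOrder_induced ho hQ (ρ := ρ) (by simpa using hτρ)
  have hK : I.IsLinkOrder τ (induced I o) := isLinkOrder_induced ho hQ hτρ
  have hR := isLinkOrder_reinsertNode hτ hG
  have key : ∀ d, IsLink τ d → d.head? = some v →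
      (I.phaseOne τ).reinsertNode v (induced I o) d.reverse = induced I o d.reverse := by
    intro d hd hdv
    have h1 := hR _ hd.reverse
    have h2 := hK _ hd.reverse
    refine List.eq_of_filter_pair h1.1 h2.1 (fun i => (h1.2.1 i).trans (h2.2.1 i).symm) ?_
    intro i hi j hj hij
    rw [h1.2.1, traverses_reverse] at hi hj
    symm
    refine (not_alternate_iff hτ hG hK hij hd hdv hi hj ?_).1 ?_
    · intro e he
      obtain ⟨hn, hm⟩ := phaseOne_rot hτ.of_append hτ.notMem
      have her := mem_rot_of_mem_clockwiseFrom he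
      have hdr : d ∈ (I.phaseOne τ).rot v := (hm d).2 ⟨hdv, hd, i, hi⟩
      have hne : e ≠ d := ((mem_clockwiseFrom hn hdr).1 he).2
      have he' := mem_rot_links hτ her
      have h3 : (joined I (induced I o) d e).filter (fun k => k = i ∨ k = j) =
          ((induced I o e.reverse).filter (fun k => k = i ∨ k = j)).reverse := by
        rw [← List.reverse_reverse (joined I (induced I o) d e), ← joined_swap hG hd he'.2 hdv he'.1,
          List.filter_reverse]
        congr 1
        have hglue := fun k => traverses_glue (I := I) (i := k) he'.2 hd he'.1 hdv
        unfold joined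
        split_ifs with hex
        · obtain ⟨x, w, l, hxr⟩ := he'.2.reverse.exists_cons_cons
          rw [hxr]
          unfold induced
          simp only [List.cons_append]
          rw [List.filter_filter, List.filter_filter]
          refine List.filter_congr fun k _ => ?_
          have := hglue k
          rw [hxr] at this
          have h5 : I.Traverses k e ↔ I.Traverses k (x :: w :: l) := by
            rw [← hxr, traverses_reverse]
          rw [h5] at this
          by_cases hk : k = i ∨ k = j
          · have hkd : I.Traverses k d := by
              rcases hk with rfl | rfl
              exacts [hi, hj]
            simp only [hkd, hne.symm, ne_eq, not_false_eq_true, and_true] at this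
            simp only [List.cons_append] at this
            rw [decide_eq_decide.2 this]
          · simp [hk]
        · rw [eq_comm, List.filter_nil, List.filter_eq_nil_iff]
          intro k hk hkij
          have hkd : I.Traverses k d := by
            rcases of_decide_eq_true hkij with rfl | rfl
            exacts [hi, hj]
          exact hex ⟨k, (hglue k).2 ⟨traverses_reverse.1 ((hK _ he'.2.reverse).2.1 k |>.1 hk),
            hkd, hne.symm⟩⟩
      rw [h3, (hK _ he'.2).2.2, List.filter_reverse, List.reverse_reverse]
    · rw [har]
      intro hcross
      obtain ⟨x, l, y, rfl, hx, hy, hl⟩ := hd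
      obtain rfl : x = v := by simpa using hdv
      -- The far end `y` of the link belongs to a common subpath through `x`; a crossing at `x`
      -- would place `y` in `τ`.
      refine hy (hQ i j hij τ x ρ hτρ hcross _ hi hj (by simp) y (by simp) ?_)
      rintro rfl
      have := hi.nodup
      simp at this
  by_cases h1 : d.head? = some v
  · have h2 := key d hd h1
    rw [(hR d hd).2.2, (hK d hd).2.2] at h2
    exact List.reverse_injective h2
  · by_cases h2 : d.getLast? = some v
    · have := key d.reverse hd.reverse (by simpa using h2)
      simpa using this
    · unfold HState.reinsertNode
      rw [if_neg h2, if_neg h1]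

include ho in
theorem induced_pair (v w : Fin n) : induced I o [v, w] = o v w := by
  unfold induced
  rw [List.filter_eq_self]
  intro i hi
  exact decide_eq_true ((mem_order_iff ho).1 hi)

include ho hσ hQ in
theorem flatMap_induced {τ ρ : List (Fin n)} (hτρ : σ = τ ++ ρ) {x : Fin n} (hx : x ∉ τ) :
    ((I.phaseOne τ).rot x).flatMap (induced I o) = I.around o x := by
  induction τ using List.reverseRecOn generalizing ρ x with
  | nil =>
    rw [flatMap_initial (isLinkOrder_induced ho hQ hτρ)]
    simp only [induced_pair ho]
  | append_singleton τ v ih =>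
    have hτ : I.IsPartialDeletion (τ ++ [v]) := by
      rw [hτρ] at hσ; exact hσ.of_append
    have hτρ' : σ = τ ++ v :: ρ := by simpa using hτρ
    rw [flatMap_deleteNode hτ hx, ← ih hτρ' (fun h => hx (List.mem_append_left _ h))]
    refine List.flatMap_congr fun r hr => ?_
    have hx' : x ∉ τ := fun h => hx (List.mem_append_left _ h)
    exact reinsertNode_induced ho hσ hQ hτρ' (ih hτρ' hτ.notMem)
      (((phaseOne_rot hτ.of_append hx').2 r).1 hr).2.1

include ho hσ hQ in
theorem orders_induced {base : HDart n → List (Fin m)}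
    (hb : ∀ d, IsLink σ d → base d = induced I o d) {τ ρ : List (Fin n)} (hτρ : σ = τ ++ ρ)
    {d : HDart n} (hd : IsLink τ d) :
    HState.orders base ρ (I.phaseOne τ) d = induced I o d := by
  induction ρ generalizing τ d with
  | nil => exact hb d (by simpa [hτρ] using hd)
  | cons v ρ ih =>
    have hτ : I.IsPartialDeletion (τ ++ [v]) := by
      refine IsPartialDeletion.of_append (ρ := ρ) ?_
      rw [← List.append_cons, ← hτρ]; exact hσ
    rw [← reinsertNode_induced ho hσ hQ hτρ (flatMap_induced ho hσ hQ hτρ hτ.notMem) hd]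
    refine reinsertNode_congr hτ (fun e he => ?_) hd
    rw [← phaseOne_append]
    exact ih (by simpa using hτρ) he

include ho in
-- This reduces the machine part to a property of its output: any ordering with late crossings is
-- computed by the algorithm for a suitable `base`, no matter how the program represents links and
-- orders.
theorem exists_run (hσ : I.IsDeletionOrder σ) (hQ : I.CrossesLast o σ) :
    ∃ base, I.IsRun σ base ∧ I.algorithm σ base = o := by
  classical
  have hp := hσ.isPartialDeletion
  -- `IsOrderingOn` constrains all node lists, so `base` has to be empty on those that are not
  -- links.
  refine ⟨fun d => if IsLink σ d then induced I o d else [], ⟨hσ, fun d => ?_⟩, ?_⟩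
  · by_cases hd : IsLink σ d
    · have := isLinkOrder_induced ho hQ (ρ := []) (by simp) d hd
      simp only [if_pos hd, isLink_reverse]
      refine ⟨this.1, fun i => ?_, this.2.2⟩
      rw [contains_iff hp, this.2.1 i]
      simp [hd]
    · simp only [if_neg hd, isLink_reverse]
      refine ⟨List.nodup_nil, fun i => ?_, rfl⟩
      rw [contains_iff hp]
      simp [hd]
  · funext v w
    change HState.orders _ σ (I.phaseOne []) [v, w] = o v w
    rw [orders_induced ho hp hQ (fun d hd => if_pos hd) (by simp) isLink_pair, induced_pair ho]

end Converse

end RoutedGraph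

/-! ### Inversions and the parity of alternation -/

namespace List

variable {α : Type*} [DecidableEq α]

/-- The number of pairs of an occurrence of `b` and a later occurrence of `a`. -/
def inversions (a b : α) : List α → ℕ
  | [] => 0
  | x :: l => inversions a b l + if x = b then l.count a else 0

theorem inversions_append (a b : α) (l l' : List α) :
    inversions a b (l ++ l') = inversions a b l + inversions a b l' + l.count b * l'.count a := by
  induction l with
  | nil => simp [inversions]
  | cons x l ih =>
    simp only [cons_append, inversions, ih, count_append, count_cons]
    by_cases h : x = b
    · simp [h]; ring
    · simp [h]

theorem inversions_filter (a b : α) (l : List α) :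
    inversions a b (l.filter (fun k => k = a ∨ k = b)) = inversions a b l := by
  induction l with
  | nil => rfl
  | cons x l ih =>
    have hc : (l.filter (fun k => k = a ∨ k = b)).count a = l.count a :=
      count_filter (by simp)
    by_cases h : x = a ∨ x = b
    · rw [filter_cons_of_pos (by simpa using h), inversions, inversions, ih, hc]
    · rw [filter_cons_of_neg (by simpa using h), inversions, ih, if_neg (fun h' => h (.inr h'))]
      rfl

theorem inversions_eq_zero {a b : α} {l : List α} (h : l.count a = 0 ∨ l.count b = 0) :
    inversions a b l = 0 := by
  induction l with
  | nil => rfl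
  | cons x l ih =>
    simp only [count_cons] at h
    rw [inversions, ih (by omega)]
    split_ifs with hx
    · rcases h with h | h
      · omega
      · simp [hx] at h
    · rfl

/-- The six words `aabb`, `abab`, `abba`, `baab`, `baba`, `bbaa` have 0, 1, 2, 2, 3, 4 inversions.
Parity turns crossing into a quantity that can be summed over the edges at a node. -/
theorem alternate_iff_odd_inversions {a b : α} (hab : a ≠ b) {l : List α} (ha : l.count a = 2)
    (hb : l.count b = 2) : Alternate a b l ↔ inversions a b l % 2 = 1 := by
  have key : ∀ f : List α, (∀ x ∈ f, x = a ∨ x = b) → f.count a = 2 → f.count b = 2 →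
      (f = [a, b, a, b] ∨ f = [b, a, b, a] ↔ inversions a b f % 2 = 1) := by
    intro f hf ha hb
    have hlen : f.length = 4 := by
      have h1 : ∀ g : List α, (∀ x ∈ g, x = a ∨ x = b) → g.length = g.count a + g.count b := by
        intro g hg
        induction g with
        | nil => rfl
        | cons x g ih =>
          have := ih fun y hy => hg y (mem_cons_of_mem _ hy)
          rcases hg x (by simp) with rfl | rfl
          · simp [hab, this]; omega
          · simp [hab.symm, this]; omega
      rw [h1 f hf]; omega
    obtain ⟨x, y, z, w, rfl⟩ : ∃ x y z w, f = [x, y, z, w] := by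
      rcases f with _ | ⟨x, _ | ⟨y, _ | ⟨z, _ | ⟨w, _ | ⟨u, t⟩⟩⟩⟩⟩ <;> simp at hlen
      exact ⟨x, y, z, w, rfl⟩
    have hx := hf x (by simp)
    have hy := hf y (by simp)
    have hz := hf z (by simp)
    have hw := hf w (by simp)
    clear hf
    rcases hx with rfl | rfl <;> rcases hy with hy | hy <;> rcases hz with hz | hz <;>
      rcases hw with hw | hw <;> subst hy hz hw <;>
      simp [inversions, hab, hab.symm] at ha hb ⊢
  unfold Alternate
  rw [← inversions_filter a b, key]
  · intro x hx; simpa using (mem_filter.1 hx).2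
  · rw [count_filter (by simp), ha]
  · rw [count_filter (by simp), hb]

/-- Inversions between different blocks depend only on how often `a` and `b` occur in the blocks.
They are the same for `f` and `f'` and cancel modulo 2. -/
theorem inversions_flatMap_parity {β : Type*} {a b : α} {f f' : β → List α}
    (l : List β) (ha : ∀ w ∈ l, (f w).count a = (f' w).count a)
    (hb : ∀ w ∈ l, (f w).count b = (f' w).count b) :
    (inversions a b (l.flatMap f) + inversions a b (l.flatMap f')) % 2 =
      (l.map (fun w => inversions a b (f w) + inversions a b (f' w))).sum % 2 := by
  induction l with
  | nil => rfl
  | cons w l ih =>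
    have h1 := ih (fun w hw => ha w (mem_cons_of_mem _ hw)) fun w hw => hb w (mem_cons_of_mem _ hw)
    have h2 : (l.flatMap f).count a = (l.flatMap f').count a := by
      rw [count_flatMap, count_flatMap]
      congr 1
      exact map_congr_left fun w hw => ha w (mem_cons_of_mem _ hw)
    simp only [flatMap_cons, inversions_append, map_cons, sum_cons, h2, hb w (by simp)]
    generalize (f' w).count b * _ = c
    omega

theorem sum_map_eq_pair {β : Type*} {l : List β} (hl : l.Nodup) {a b : β} (hab : a ≠ b)
    (ha : a ∈ l) (hb : b ∈ l) {g : β → ℕ} (h : ∀ w ∈ l, w ≠ a → w ≠ b → g w = 0) :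
    (l.map g).sum = g a + g b := by
  classical
  rw [← List.sum_toFinset g hl, Finset.sum_eq_add_of_mem a b (by simpa) (by simpa) hab]
  intro c hc hcab
  exact h c (by simpa using hc) hcab.1 hcab.2

end List

namespace RoutedGraph

variable {n m : ℕ} {I : RoutedGraph n m}

/-! ## Inner nodes of paths -/

theorem traverses_triple_iff {i : Fin m} {a v b : Fin n} :
    I.Traverses i [a, v, b] ↔ I.Traverses i [v, a] ∧ I.Traverses i [v, b] ∧ b ≠ a := by
  have := traverses_glue (I := I) (i := i) (τ := []) (v := v) (d := [v, a]) (e := [v, b])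
    isLink_pair isLink_pair rfl rfl
  simpa using this

theorem not_terminal_of_triple {i : Fin m} {a v b : Fin n} (h : I.Traverses i [a, v, b]) :
    ¬ I.TerminalOf i v := by
  have key : ∀ (p : List (Fin n)) (a b : Fin n), p.Nodup → [a, v, b] <:+: p →
      p.head? ≠ some v := by
    rintro p a b hp ⟨s, t, rfl⟩ hh
    rcases s with _ | ⟨c, s⟩
    · simp at hh; simp [hh] at hp
    · simp at hh; simp [hh] at hp
  have hn := support_nodup (I := I) i
  have h2 : ∀ a b : Fin n, [a, v, b] <:+: (I.path i).support → ¬ I.TerminalOf i v := by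
    rintro a b h (rfl | rfl)
    · obtain ⟨l, hl⟩ := head_support (I := I) i
      exact key _ _ _ hn h (by rw [hl]; rfl)
    · obtain ⟨l, hl⟩ := last_support (I := I) i
      refine key (I.path i).support.reverse b a (List.nodup_reverse.2 hn) ?_ (by rw [hl]; simp)
      simpa using List.reverse_infix.2 h
  rcases h with h | h
  · exact h2 a b h
  · exact h2 b a (by simpa using h)

theorem exists_triple {i : Fin m} {v : Fin n} (hv : v ∈ (I.path i).support)
    (ht : ¬ I.TerminalOf i v) : ∃ a b, [a, v, b] <:+: (I.path i).support := by
  obtain ⟨s, t, hst⟩ := List.append_of_mem hv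
  obtain ⟨l, hl⟩ := head_support (I := I) i
  obtain ⟨l', hl'⟩ := last_support (I := I) i
  rcases List.eq_nil_or_concat s with rfl | ⟨s, a, rfl⟩
  · rw [hl] at hst; simp at hst; exact absurd (.inl hst.1.symm) ht
  rcases t with _ | ⟨b, t⟩
  · rw [hl'] at hst
    have := (List.append_inj' hst rfl).2
    exact absurd (.inr (by simpa using this.symm)) ht
  · exact ⟨a, b, s, t, by simp [hst]⟩

theorem CrossAt.symm {o : Fin n → Fin n → List (Fin m)} {i j : Fin m} {v : Fin n}
    (h : I.CrossAt o i j v) : I.CrossAt o j i v := by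
  unfold CrossAt at *
  rw [List.filter_pair_comm]
  exact h.symm

/-- A crossing path is met twice around `v`, but at most once on each edge; so it uses two edges at
`v`. -/
theorem CrossAt.exists_triple {o : Fin n → Fin n → List (Fin m)} (ho : I.IsOrdering o)
    {i j : Fin m} (hij : i ≠ j) {v : Fin n} (h : I.CrossAt o i j v) :
    ∃ a b, I.Traverses i [a, v, b] := by
  have hcount : (I.around o v).count i = 2 := by
    have h1 : ((I.around o v).filter (fun k => k = i ∨ k = j)).count i = (I.around o v).count i :=
      List.count_filter (by simp)
    rw [← h1]
    rcases h with h | h <;> rw [h] <;> simp [hij.symm]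
  by_contra hcon
  push Not at hcon
  have hle : ∀ w, (o v w).count i ≤ 1 := fun w => List.nodup_iff_count_le_one.1 (ho v w).1 i
  unfold around at hcount
  by_cases hex : ∃ w ∈ I.rot v, i ∈ o v w
  · obtain ⟨w, hw, hiw⟩ := hex
    have : ∀ u ∈ I.rot v, u ≠ w → ((o v u).filter (fun k => k = i)) = [] := by
      intro u _ hne
      rw [List.filter_eq_nil_iff]
      intro k hk hki
      obtain rfl : k = i := of_decide_eq_true hki
      exact hcon w u (traverses_triple_iff.2
        ⟨(mem_order_iff ho).1 hiw, (mem_order_iff ho).1 hk, hne⟩)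
    have h2 : ((I.rot v).flatMap (o v)).filter (fun k => k = i) =
        (o v w).filter (fun k => k = i) := by
      rw [List.filter_flatMap]
      exact List.flatMap_eq_of_forall_ne (I.rot_nodup v) hw this
    rw [List.filter_eq, List.filter_eq, hcount] at h2
    have := congrArg List.length h2
    simp at this
    have := hle w
    omega
  · push Not at hex
    have : i ∉ (I.rot v).flatMap (o v) := by
      rw [List.mem_flatMap]; rintro ⟨w, hw, hi⟩; exact hex w hw hi
    rw [List.count_eq_zero_of_not_mem this] at hcount
    omega

/-! ## The parity of the crossings along a common subpath -/

section Parity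

variable {o o' : Fin n → Fin n → List (Fin m)} (ho : I.IsOrdering o) (ho' : I.IsOrdering o')
  {i j : Fin m} (hij : i ≠ j)

/-- The orderings differ in the order of the paths `i` and `j` on the edge `vw`. -/
def Differ (o o' : Fin n → Fin n → List (Fin m)) (i j : Fin m) (v w : Fin n) : Prop :=
  (o v w).filter (fun k => k = i ∨ k = j) ≠ (o' v w).filter (fun k => k = i ∨ k = j)

include ho ho' in
theorem differ_comm {v w : Fin n} : Differ o o' i j v w ↔ Differ o o' i j w v := by
  unfold Differ
  rw [(ho v w).2.2, (ho' v w).2.2, List.filter_reverse, List.filter_reverse,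
    ne_eq, ne_eq, List.reverse_inj]

include ho ho' in
theorem count_order_eq (k : Fin m) (v w : Fin n) : (o v w).count k = (o' v w).count k := by
  by_cases h : I.Traverses k [v, w]
  · rw [List.count_eq_one_of_mem (ho v w).1 ((mem_order_iff ho).2 h),
      List.count_eq_one_of_mem (ho' v w).1 ((mem_order_iff ho').2 h)]
  · rw [List.count_eq_zero_of_not_mem fun h' => h ((mem_order_iff ho).1 h'),
      List.count_eq_zero_of_not_mem fun h' => h ((mem_order_iff ho').1 h')]

include ho ho' hij in
-- Where at most one of the two paths runs, all orderings restrict to the same list. This starts the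
-- comparison of two orderings just outside a common subpath.
theorem differ_traverses {v w : Fin n} (h : Differ o o' i j v w) :
    I.Traverses i [v, w] ∧ I.Traverses j [v, w] := by
  by_contra hcon
  rw [not_and_or] at hcon
  have key : ∀ {o : Fin n → Fin n → List (Fin m)} (_ : I.IsOrdering o) {i j : Fin m} (_ : i ≠ j)
      (_ : ¬ I.Traverses j [v, w]), (o v w).filter (fun k => k = i ∨ k = j) =
        if I.Traverses i [v, w] then [i] else [] := by
    intro o ho i j hij hj
    split_ifs with hi
    · exact List.filter_pair_left (ho v w).1 ((mem_order_iff ho).2 hi)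
        fun h => hj ((mem_order_iff ho).1 h)
    · rw [List.filter_eq_nil_iff]
      intro k hk hkij
      rcases of_decide_eq_true hkij with rfl | rfl
      exacts [hi ((mem_order_iff ho).1 hk), hj ((mem_order_iff ho).1 hk)]
  rcases hcon with hi | hj
  · refine h ?_
    rw [List.filter_pair_comm, List.filter_pair_comm (o' v w), key ho hij.symm hi,
      key ho' hij.symm hi]
  · exact h ((key ho hij hj).trans (key ho' hij hj).symm)

include ho ho' hij in
theorem inversions_add_parity (v w : Fin n) :
    (List.inversions i j (o v w) + List.inversions i j (o' v w)) % 2 = 1 ↔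
      Differ o o' i j v w := by
  by_cases h : I.Traverses i [v, w] ∧ I.Traverses j [v, w]
  · unfold Differ
    rw [← List.inversions_filter i j (o v w), ← List.inversions_filter i j (o' v w)]
    rcases filter_order ho hij h.1 h.2 with h1 | h1 <;>
      rcases filter_order ho' hij h.1 h.2 with h2 | h2 <;> rw [h1, h2] <;>
      simp [List.inversions, hij, hij.symm]
  · have h1 : ¬ Differ o o' i j v w := fun h' => h (differ_traverses ho ho' hij h')
    have h0 : ∀ {o : Fin n → Fin n → List (Fin m)}, I.IsOrdering o →
        (o v w).count i = 0 ∨ (o v w).count j = 0 := by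
      intro o ho
      rw [List.count_eq_zero, List.count_eq_zero, mem_order_iff ho, mem_order_iff ho]
      exact not_and_or.1 h
    rw [List.inversions_eq_zero (h0 ho), List.inversions_eq_zero (h0 ho')]
    simp [h1]

theorem eq_of_traverses_pair {k : Fin m} {a v b w : Fin n} (h : I.Traverses k [a, v, b])
    (hw : I.Traverses k [v, w]) : w = a ∨ w = b := by
  obtain ⟨h1, h2, h3⟩ := traverses_triple_iff.1 h
  by_contra hcon
  push Not at hcon
  have := link_third (τ := []) (d := [v, a]) (e := [v, w]) (f := [v, b]) isLink_pair isLink_pair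
    isLink_pair rfl rfl rfl h1 hw h2 (by simpa using hcon.1) (by simpa using h3)
  exact hcon.2 (by simpa using this)

include ho in
theorem count_around {k : Fin m} {a v b : Fin n} (h : I.Traverses k [a, v, b]) :
    (I.around o v).count k = 2 := by
  obtain ⟨h1, h2, h3⟩ := traverses_triple_iff.1 h
  unfold around
  rw [List.count_flatMap, List.sum_map_eq_pair (I.rot_nodup v) h3.symm
    ((I.mem_rot _ _).2 h1.adj) ((I.mem_rot _ _).2 h2.adj)]
  · simp only [Function.comp]
    rw [List.count_eq_one_of_mem (ho _ _).1 ((mem_order_iff ho).2 h1),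
      List.count_eq_one_of_mem (ho _ _).1 ((mem_order_iff ho).2 h2)]
  · intro w _ hwa hwb
    refine List.count_eq_zero_of_not_mem fun hk => ?_
    rcases eq_of_traverses_pair h ((mem_order_iff ho).1 hk) with h | h
    exacts [hwa h, hwb h]

include ho ho' hij in
-- Crossing at `v` is the parity of the inversions around `v`. Between two orderings this parity
-- changes by one for each edge at `v` on which they order `i` and `j` differently, and only the two
-- edges of `i` can be such edges.
theorem crossAt_iff_differ {a v b c d : Fin n} (hi : I.Traverses i [a, v, b])
    (hj : I.Traverses j [c, v, d]) :
    (I.CrossAt o i j v ↔ I.CrossAt o' i j v) ↔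
      (Differ o o' i j v a ↔ Differ o o' i j v b) := by
  obtain ⟨h1, h2, h3⟩ := traverses_triple_iff.1 hi
  have e1 := List.alternate_iff_odd_inversions hij (count_around ho hi) (count_around ho hj)
  have e2 := List.alternate_iff_odd_inversions hij (count_around ho' hi) (count_around ho' hj)
  have e3 := List.inversions_flatMap_parity (a := i) (b := j) (f := o v) (f' := o' v) (I.rot v)
    (fun w _ => count_order_eq ho ho' i v w) (fun w _ => count_order_eq ho ho' j v w)
  rw [List.sum_map_eq_pair (I.rot_nodup v) h3.symm
    ((I.mem_rot _ _).2 h1.adj) ((I.mem_rot _ _).2 h2.adj)] at e3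
  · have e4 := inversions_add_parity ho ho' hij v a
    have e5 := inversions_add_parity ho ho' hij v b
    change I.CrossAt o i j v ↔ _ at e1
    change I.CrossAt o' i j v ↔ _ at e2
    rw [e1, e2, ← e4, ← e5]
    change (List.inversions i j (I.around o v) + List.inversions i j (I.around o' v)) % 2 = _ at e3
    omega
  · intro w _ hwa hwb
    have h0 : ∀ {o : Fin n → Fin n → List (Fin m)}, I.IsOrdering o →
        (o v w).count i = 0 := by
      intro o ho
      rw [List.count_eq_zero, mem_order_iff ho]
      intro hw
      rcases eq_of_traverses_pair hi hw with h | h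
      exacts [hwa h, hwb h]
    rw [List.inversions_eq_zero (.inl (h0 ho)), List.inversions_eq_zero (.inl (h0 ho'))]

include ho ho' hij in
-- At a node where the orderings agree about the crossing, `crossAt_iff_differ` passes agreement
-- from the incoming to the outgoing edge. Only `i` is assumed to run along the list; `j` just has
-- to pass through its inner nodes.
theorem not_differ_chain {x y : Fin n} {l : List (Fin n)} (hi : I.Traverses i (x :: (l ++ [y])))
    (hj : ∀ u ∈ l, ∃ c d, I.Traverses j [c, u, d])
    (hagree : ∀ u ∈ l, (I.CrossAt o i j u ↔ I.CrossAt o' i j u))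
    (hx : ∀ q, [x, q] <+: x :: (l ++ [y]) → ¬ Differ o o' i j x q) {p q : Fin n}
    (hpq : [p, q] <:+: x :: (l ++ [y])) : ¬ Differ o o' i j p q := by
  induction l generalizing x with
  | nil =>
    have h1 : [p, q] = [x, y] := hpq.eq_of_length rfl
    simp only [List.cons.injEq, and_true] at h1
    rw [h1.1, h1.2]
    exact hx y (List.prefix_refl _)
  | cons w l ih =>
    have hw : ¬ Differ o o' i j x w := hx w ⟨l ++ [y], by simp⟩
    rw [List.cons_append] at hpq hi
    rcases List.infix_cons_iff.1 hpq with h | h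
    · obtain ⟨t, ht⟩ := h
      simp at ht
      rw [ht.1, ht.2.1]
      exact hw
    · refine ih (hi.of_infix (List.suffix_cons _ _).isInfix) (fun u hu => hj u (by simp [hu]))
        (fun u hu => hagree u (by simp [hu])) ?_ h
      rintro b ⟨t, hb⟩
      obtain ⟨c, d, hcd⟩ := hj w (by simp)
      have h3 : I.Traverses i [x, w, b] := hi.of_infix ⟨[], t, by simp at hb; simp [← hb]⟩
      rw [← (crossAt_iff_differ ho ho' hij h3 hcd).1 (hagree w (by simp)), differ_comm ho ho']
      exact hw

end Parity

/-! ## Maximal common subpaths -/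

theorem isCommonSubpath_iff {i j : Fin m} {S : List (Fin n)} :
    I.IsCommonSubpath i j S ↔ S ≠ [] ∧ S <:+: (I.path i).support ∧ I.Traverses j S := Iff.rfl

theorem Traverses.cons {j : Fin m} {a s : Fin n} {S : List (Fin n)} (hn : (a :: s :: S).Nodup)
    (h1 : I.Traverses j [a, s]) (h2 : I.Traverses j (s :: S)) : I.Traverses j (a :: s :: S) := by
  rcases S with _ | ⟨t, S⟩
  · exact h1
  obtain ⟨p, hp, h2⟩ := traverses_iff.1 h2
  have hpn := nodup_of_dir hp
  have h3 : [a, s] <:+: p ∨ [s, a] <:+: p := by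
    rcases hp with rfl | rfl <;> rcases h1 with h1 | h1
    · exact .inl h1
    · exact .inr h1
    · exact .inr (by simpa using List.reverse_infix.2 h1)
    · exact .inl (List.infix_reverse_left.1 h1)
  rcases h3 with h3 | h3
  · exact traverses_iff.2 ⟨p, hp, List.glue_infix (A := [a]) hpn h3 h2⟩
  -- If the edge were behind `s` in this direction of the path, it would be the edge from `s` to
  -- `t`.
  · have : a = t := List.infix_pair_right hpn h3 (List.IsInfix.trans ⟨[], S, by simp⟩ h2)
    subst this
    simp at hn

/-- Edgewise traversal forces one direction along the whole list, because the list does not turn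
back. So common subpaths can be assembled without keeping track of directions. -/
theorem Traverses.of_pairs {j : Fin m} {S : List (Fin n)} (hn : S.Nodup)
    (h1 : ∀ v ∈ S, v ∈ (I.path j).support)
    (h2 : ∀ a b, [a, b] <:+: S → I.Traverses j [a, b]) : I.Traverses j S := by
  induction S with
  | nil => exact .inl ⟨[], (I.path j).support, by simp⟩
  | cons a S ih =>
    rcases S with _ | ⟨s, S⟩
    · obtain ⟨s, t, h⟩ := List.append_of_mem (h1 a (by simp))
      exact .inl ⟨s, t, by simp [h]⟩
    · exact Traverses.cons hn (h2 a s ⟨[], S, by simp⟩) (ih hn.of_cons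
        (fun v hv => h1 v (List.mem_cons_of_mem _ hv))
        fun a b h => h2 a b (h.trans (List.suffix_cons _ _).isInfix))

theorem IsMaximalCommonSubpath.not_traverses_left {i j : Fin m} {a s : Fin n} {S : List (Fin n)}
    (hS : I.IsMaximalCommonSubpath i j (s :: S)) (ha : a :: s :: S <:+: (I.path i).support) :
    ¬ I.Traverses j [a, s] := by
  intro h
  have hn : (a :: s :: S).Nodup := (support_nodup i).sublist ha.sublist
  have := hS.2 (a :: s :: S) ⟨by simp, ha, Traverses.cons hn h hS.1.2.2⟩ (List.suffix_cons _ _).isInfix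
  simpa using congrArg List.length this

theorem IsMaximalCommonSubpath.not_traverses_right {i j : Fin m} {b s : Fin n} {S : List (Fin n)}
    (hS : I.IsMaximalCommonSubpath i j (S ++ [s]))
    (hb : S ++ [s] ++ [b] <:+: (I.path i).support) : ¬ I.Traverses j [b, s] := by
  intro h
  have hn : (S ++ [s] ++ [b]).Nodup := (support_nodup i).sublist hb.sublist
  have h2 : I.Traverses j (b :: s :: S.reverse) := by
    refine .cons ?_ h ?_
    · simpa using List.nodup_reverse.2 hn
    · simpa using traverses_reverse.2 hS.1.2.2
  have h3 : I.Traverses j (S ++ [s] ++ [b]) := by simpa using traverses_reverse.2 h2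
  have := hS.2 (S ++ [s] ++ [b]) ⟨by simp, hb, h3⟩ (List.prefix_append _ _).isInfix
  simpa using congrArg List.length this

/-- The path `i` continues from the end of `S` to `x`, on an edge that `j` does not use, so the
orderings cannot differ there. Agreement is then carried inwards over the nodes behind `v`. The
disjunction in `hp` allows the use for the reversed list, that is, for the other end of `S`. -/
theorem IsMaximalCommonSubpath.not_differ_end {o o' : Fin n → Fin n → List (Fin m)}
    (ho : I.IsOrdering o) (ho' : I.IsOrdering o') {i j : Fin m} (hij : i ≠ j)
    {S A B : List (Fin n)} {v x : Fin n} (hsplit : S = A ++ v :: B)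
    (hp : S ++ [x] <:+: (I.path i).support ∨ (S ++ [x]).reverse <:+: (I.path i).support)
    (hx : ∀ s S', S = S' ++ [s] → ¬ I.Traverses j [x, s])
    (hj : ∀ u ∈ B, ∃ c d, I.Traverses j [c, u, d])
    (hagree : ∀ u ∈ B, (I.CrossAt o i j u ↔ I.CrossAt o' i j u)) {q : Fin n}
    (hq : [v, q] <:+: v :: (B ++ [x])) : ¬ Differ o o' i j v q := by
  have ht : I.Traverses i (S ++ [x]) := hp
  rw [differ_comm ho ho']
  refine not_differ_chain ho ho' hij (x := x) (y := v) (l := B.reverse) ?_ ?_ ?_ ?_ ?_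
  · rw [← traverses_reverse]
    refine ht.of_infix ⟨A, [], ?_⟩
    simp [hsplit]
  · simpa using hj
  · simpa using hagree
  · intro r hr hd
    refine hx r (A ++ v :: B).dropLast ?_ (differ_traverses ho ho' hij hd).2
    have : S.getLast? = some r := by
      obtain ⟨t, ht⟩ := hr
      have h2 : r :: t = B.reverse ++ [v] := by simpa using ht
      rw [hsplit, List.getLast?_append, ← List.head?_reverse (l := v :: B)]
      simp [← h2]
    rw [← hsplit]
    exact (List.dropLast_append_getLast? r (by simpa using this)).symm
  · have := List.reverse_infix.2 hq
    simpa using this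

theorem isConsistent_of_crossesLast (hP : I.PathTerminalProperty) {σ : List (Fin n)}
    (hσ : I.IsDeletionOrder σ) {o : Fin n → Fin n → List (Fin m)} (ho : I.IsOrdering o)
    (hQ : I.CrossesLast o σ) : I.IsConsistent o := by
  refine ⟨ho, fun i j hij S hS => ?_⟩
  have hSi : I.Traverses i S := .inl hS.1.2.1
  have hSj : I.Traverses j S := hS.1.2.2
  -- A crossing node is an inner node of `i`; by the path terminal property it is no terminal of any
  -- path, so it is among the deleted nodes.
  have hcσ : ∀ v, I.CrossAt o i j v → v ∈ σ := by
    intro v hv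
    obtain ⟨a, b, hab⟩ := hv.exists_triple ho hij
    refine (hσ.2 v).2 fun ht => hP v ⟨ht, i, hab.mem (by simp), not_terminal_of_triple hab⟩
  have hlast : ∀ v ∈ S, I.CrossAt o i j v → ∃ τ ρ, σ = τ ++ v :: ρ ∧ ∀ u ∈ S, u ≠ v → u ∈ τ := by
    intro v hv hc
    obtain ⟨τ, ρ, h⟩ := List.append_of_mem (hcσ v hc)
    exact ⟨τ, ρ, h, hQ i j hij τ v ρ h hc S hSi hSj hv⟩
  -- Of two crossing nodes on `S`, each would precede the other in `σ`.
  have huniq : ∀ v ∈ S, ∀ u ∈ S, I.CrossAt o i j v → I.CrossAt o i j u → u = v := by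
    intro v hv u hu hcv hcu
    by_contra hne
    obtain ⟨τ, ρ, h1, h2⟩ := hlast v hv hcv
    obtain ⟨τ', ρ', h1', h2'⟩ := hlast u hu hcu
    obtain ⟨A, B, hAB⟩ := List.append_of_mem (h2 u hu hne)
    have h3 : A ++ u :: (B ++ v :: ρ) = τ' ++ u :: ρ' := by rw [← h1', h1, hAB]; simp
    have h4 := List.append_cons_inj_of_nodup h3 (by rw [h3, ← h1']; exact hσ.1)
    have h5 : v ∈ A := by rw [h4.1]; exact h2' v hv (Ne.symm hne)
    have := hσ.1
    rw [h1, hAB] at this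
    simp [List.nodup_append] at this
    grind
  constructor
  · intro hun
    obtain ⟨v, hv, hc⟩ := hun o ho
    exact ⟨v, ⟨hv, hc⟩, fun u hu => huniq v hv u hu.1 hc hu.2⟩
  · intro hun v hv hcross
    unfold Unavoidable at hun
    push Not at hun
    obtain ⟨o', ho', hno⟩ := hun
    obtain ⟨τ, ρ, hτ, hall⟩ := hlast v hv hcross
    -- A crossing at `v` makes all nodes of `S` members of `σ`; hence no path ends on `S`.
    have hnt : ∀ u ∈ S, ∀ k, ¬ I.TerminalOf k u := by
      intro u hu k hk
      have : u ∈ σ := by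
        by_cases huv : u = v
        · rw [huv]; exact hcσ v hcross
        · rw [hτ]; exact List.mem_append_left _ (hall u hu huv)
      exact (hσ.2 u).1 this ⟨k, hk⟩
    have htri : ∀ u ∈ S, ∃ c d, I.Traverses j [c, u, d] := by
      intro u hu
      obtain ⟨c, d, h⟩ := exists_triple (hSj.mem hu) (hnt u hu j)
      exact ⟨c, d, .inl h⟩
    have hagree : ∀ u ∈ S, u ≠ v → (I.CrossAt o i j u ↔ I.CrossAt o' i j u) := by
      intro u hu huv
      exact ⟨fun h => absurd (huniq v hv u hu hcross h) huv, fun h => absurd h (hno u hu)⟩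
    obtain ⟨A, B, hAB⟩ := List.append_of_mem hv
    have hSn : S.Nodup := hSi.nodup
    obtain ⟨s, t, hst⟩ := hS.1.2.1
    obtain ⟨l, hl⟩ := head_support (I := I) i
    obtain ⟨l', hl'⟩ := last_support (I := I) i
    -- Since the ends of `i` do not lie on `S`, the path has a node `a` before `S` and a node `b`
    -- behind it.
    rcases List.eq_nil_or_concat s with rfl | ⟨s, a, rfl⟩
    · refine absurd (.inl rfl) (hnt (I.src i) ?_ i)
      rw [hl] at hst
      rcases S with _ | ⟨c, S⟩
      · simp at hv
      · simp at hst; simp [hst.1]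
    rcases t with _ | ⟨b, t⟩
    · refine absurd (.inr rfl) (hnt (I.tgt i) ?_ i)
      rw [hl'] at hst
      rcases List.eq_nil_or_concat S with rfl | ⟨S', c, rfl⟩
      · simp at hv
      · have : s ++ [a] ++ S' ++ [c] = l' ++ [I.tgt i] := by simpa using hst
        have := (List.append_inj' this rfl).2
        simp at this
        simp [this]
    have hvA : v ∉ A := by rw [hAB] at hSn; simp [List.nodup_append] at hSn; grind
    have hvB : v ∉ B := by rw [hAB] at hSn; simp [List.nodup_append] at hSn; grind
    have hSb : S ++ [b] <:+: (I.path i).support := ⟨s ++ [a], t, by simp [← hst]⟩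
    have hSa : a :: S <:+: (I.path i).support := ⟨s, b :: t, by simp [← hst]⟩
    obtain ⟨q, t', hq⟩ : ∃ q t', B ++ [b] = q :: t' := by
      cases B with
      | nil => exact ⟨b, [], rfl⟩
      | cons c B => exact ⟨c, B ++ [b], rfl⟩
    obtain ⟨p, t'', hp⟩ : ∃ p t', A.reverse ++ [a] = p :: t' := by
      cases A.reverse with
      | nil => exact ⟨a, [], rfl⟩
      | cons c B => exact ⟨c, B ++ [a], rfl⟩
    have hright : ¬ Differ o o' i j v q := by
      refine IsMaximalCommonSubpath.not_differ_end ho ho' hij hAB (.inl hSb) ?_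
        (fun u hu => htri u (by simp [hAB, hu])) (fun u hu => hagree u (by simp [hAB, hu]) ?_)
        ⟨[], t', by simp [hq]⟩
      · rintro r S' rfl
        exact hS.not_traverses_right hSb
      · rintro rfl; exact hvB hu
    have hleft : ¬ Differ o o' i j v p := by
      refine IsMaximalCommonSubpath.not_differ_end ho ho' hij (S := S.reverse) (A := B.reverse)
        (B := A.reverse) (by simp [hAB]) (.inr (by simpa using hSa)) ?_
        (fun u hu => htri u ?_) (fun u hu => hagree u ?_ ?_) ⟨[], t'', by simp [hp]⟩
      · intro r S' hr
        obtain rfl : S = r :: S'.reverse := by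
          rw [← List.reverse_reverse S, hr]; simp
        exact hS.not_traverses_left hSa
      · rw [hAB]; simp at hu; simp [hu]
      · rw [hAB]; simp at hu; simp [hu]
      · rintro rfl; exact hvA (by simpa using hu)
    have hpvq : I.Traverses i [p, v, q] := by
      refine .inl ⟨s ++ t''.reverse, t' ++ t, ?_⟩
      have hp' : a :: A = t''.reverse ++ [p] := by
        have := congrArg List.reverse hp
        simpa using this
      rw [← hst, hAB]
      calc _ = s ++ (t''.reverse ++ [p]) ++ v :: ((q :: t') ++ t) := by simp
        _ = _ := by rw [← hp', ← hq]; simp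
    obtain ⟨c, d, hcd⟩ := htri v hv
    -- The orderings agree on both edges of `i` at `v`, so they agree about the crossing at `v`, but
    -- `o'` has none on `S`.
    exact hno v hv (((crossAt_iff_differ ho ho' hij hpvq hcd).2
      (iff_of_false hleft hright)).1 hcross)

/-! ## Consistent orderings minimize the number of crossings -/

theorem isCommonSubpath_singleton {i j : Fin m} {v : Fin n} (hi : v ∈ (I.path i).support)
    (hj : v ∈ (I.path j).support) : I.IsCommonSubpath i j [v] := by
  obtain ⟨s, t, h⟩ := List.append_of_mem hi
  obtain ⟨s', t', h'⟩ := List.append_of_mem hj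
  exact ⟨by simp, ⟨s, t, by simp [h]⟩, .inl ⟨s', t', by simp [h']⟩⟩

theorem exists_maximal {i j : Fin m} {v : Fin n} (hi : v ∈ (I.path i).support)
    (hj : v ∈ (I.path j).support) : ∃ S, I.IsMaximalCommonSubpath i j S ∧ v ∈ S := by
  have hb : ∀ k, (∃ S, I.IsCommonSubpath i j S ∧ v ∈ S ∧ S.length = k) →
      k ≤ (I.path i).support.length := by
    rintro k ⟨S, hS, -, rfl⟩
    exact hS.2.1.length_le
  classical
  obtain ⟨S, hS, hvS, hlen⟩ := Nat.findGreatest_spec (P := fun k =>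
    ∃ S, I.IsCommonSubpath i j S ∧ v ∈ S ∧ S.length = k)
    (hb 1 ⟨[v], isCommonSubpath_singleton hi hj, by simp, rfl⟩)
    ⟨[v], isCommonSubpath_singleton hi hj, by simp, rfl⟩
  refine ⟨S, ⟨hS, fun T hT hST => ?_⟩, hvS⟩
  have hex : ∃ S, I.IsCommonSubpath i j S ∧ v ∈ S ∧ S.length = T.length :=
    ⟨T, hT, hST.subset hvS, rfl⟩
  have h1 := Nat.le_findGreatest (P := fun k =>
    ∃ S, I.IsCommonSubpath i j S ∧ v ∈ S ∧ S.length = k) (hb _ hex) hex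
  rw [← hlen] at h1
  exact (hST.eq_of_length_le h1).symm

/-- Around `v`, take the longer of the two left parts and the longer of the two right parts. The
result is again a common subpath, checked edge by edge since `j` might run through `S` and `T` in
different directions. It contains both `S` and `T`, so both are equal to it. -/
theorem IsMaximalCommonSubpath.eq_of_mem {i j : Fin m} {S T : List (Fin n)} {v : Fin n}
    (hS : I.IsMaximalCommonSubpath i j S) (hT : I.IsMaximalCommonSubpath i j T) (hvS : v ∈ S)
    (hvT : v ∈ T) : S = T := by
  obtain ⟨A, B, rfl⟩ := List.append_of_mem hvS
  obtain ⟨A', B', rfl⟩ := List.append_of_mem hvT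
  have hn := support_nodup (I := I) i
  obtain ⟨s, t, h1⟩ := hS.1.2.1
  obtain ⟨s', t', h2⟩ := hT.1.2.1
  have h3 : (s ++ A) ++ v :: (B ++ t) = (s' ++ A') ++ v :: (B' ++ t') := by
    simpa using h1.trans h2.symm
  have h4 := List.append_cons_inj_of_nodup h3 (by
    have : (s ++ A) ++ v :: (B ++ t) = (I.path i).support := by simpa using h1
    rw [this]; exact hn)
  obtain ⟨C, hC, hAC, hAC'⟩ : ∃ C, (C = A ∨ C = A') ∧ A <:+ C ∧ A' <:+ C := by
    rcases List.suffix_or_suffix_of_suffix (l₃ := s ++ A) ⟨s, rfl⟩ ⟨s', h4.1.symm⟩ with h | h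
    · exact ⟨A', .inr rfl, h, List.suffix_refl _⟩
    · exact ⟨A, .inl rfl, List.suffix_refl _, h⟩
  obtain ⟨D, hD, hBD, hBD'⟩ : ∃ D, (D = B ∨ D = B') ∧ B <+: D ∧ B' <+: D := by
    rcases List.prefix_or_prefix_of_prefix (l₃ := B ++ t) ⟨t, rfl⟩ ⟨t', h4.2.symm⟩ with h | h
    · exact ⟨B', .inr rfl, h, List.prefix_refl _⟩
    · exact ⟨B, .inl rfl, List.prefix_refl _, h⟩
  have hl : I.Traverses j (C ++ [v]) ∧ C ++ [v] <:+: (I.path i).support := by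
    rcases hC with rfl | rfl
    · have : C ++ [v] <:+: C ++ v :: B := ⟨[], B, by simp⟩
      exact ⟨Traverses.of_infix hS.1.2.2 this, this.trans hS.1.2.1⟩
    · have : C ++ [v] <:+: C ++ v :: B' := ⟨[], B', by simp⟩
      exact ⟨Traverses.of_infix hT.1.2.2 this, this.trans hT.1.2.1⟩
  have hr : I.Traverses j (v :: D) ∧ v :: D <:+: (I.path i).support := by
    rcases hD with rfl | rfl
    · have : v :: D <:+: A ++ v :: D := ⟨A, [], by simp⟩
      exact ⟨Traverses.of_infix hS.1.2.2 this, this.trans hS.1.2.1⟩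
    · have : v :: D <:+: A' ++ v :: D := ⟨A', [], by simp⟩
      exact ⟨Traverses.of_infix hT.1.2.2 this, this.trans hT.1.2.1⟩
  have hU : C ++ v :: D <:+: (I.path i).support := List.glue_infix hn hl.2 hr.2
  have hcommon : I.IsCommonSubpath i j (C ++ v :: D) := by
    refine isCommonSubpath_iff.2 ⟨by simp, hU, .of_pairs (hn.sublist hU.sublist) ?_ ?_⟩
    · intro u hu
      rw [show C ++ v :: D = (C ++ [v]) ++ D by simp, List.mem_append] at hu
      rcases hu with hu | hu
      · exact hl.1.mem hu
      · exact hr.1.mem (List.mem_cons_of_mem _ hu)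
    · intro a b hab
      have : [a, b] <:+: C ++ [v] ∨ [a, b] <:+: v :: D := by
        obtain ⟨p, q, hpq⟩ := hab
        rcases List.append_eq_append_iff.1 (show p ++ ([a, b] ++ q) = C ++ (v :: D) by
          rw [← hpq]; simp) with ⟨r, hr1, hr2⟩ | ⟨r, hr1, hr2⟩
        · rcases r with _ | ⟨x, _ | ⟨y, r⟩⟩
          · exact .inr ⟨[], q, by simpa using hr2⟩
          · simp at hr2
            refine .inl ⟨p, [], by simp [hr1, hr2]⟩
          · simp at hr2
            refine .inl ⟨p, r ++ [v], by simp [hr1, hr2]⟩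
        · exact .inr ⟨r, q, by simp [hr2]⟩
      rcases this with h | h
      · exact hl.1.of_infix h
      · exact hr.1.of_infix h
  have hmid : ∀ {A B : List (Fin n)}, A <:+ C → B <+: D → A ++ v :: B <:+: C ++ v :: D := by
    rintro A B ⟨p, rfl⟩ ⟨q, rfl⟩
    exact ⟨p, q, by simp⟩
  exact (hS.2 _ hcommon (hmid hAC hBD)).symm.trans (hT.2 _ hcommon (hmid hAC' hBD'))

/-- Each crossing of `o` is charged to a crossing of `o'` on the same maximal common subpath, which
exists because the crossing there is unavoidable. The charged node determines the subpath, and the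
subpath contains only one crossing of `o`. -/
theorem crossings_le_of_isConsistent {o o' : Fin n → Fin n → List (Fin m)}
    (ho : I.IsConsistent o) (ho' : I.IsOrdering o') : I.crossings o ≤ I.crossings o' := by
  have hex : ∀ x : Fin m × Fin m × Fin n, ∃ S w, x.1 < x.2.1 → I.CrossAt o x.1 x.2.1 x.2.2 →
      I.IsMaximalCommonSubpath x.1 x.2.1 S ∧ x.2.2 ∈ S ∧ (w ∈ S ∧ I.CrossAt o' x.1 x.2.1 w) ∧
        ∀ w ∈ S, I.CrossAt o x.1 x.2.1 w → w = x.2.2 := by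
    rintro ⟨i, j, v⟩
    by_cases hboth : i < j ∧ I.CrossAt o i j v
    swap
    -- Arbitrary values for triples that are not crossings, so that the choice is total.
    · exact ⟨[], v, fun h1 h2 => absurd ⟨h1, h2⟩ hboth⟩
    obtain ⟨hij, hc⟩ := hboth
    obtain ⟨a, b, hab⟩ := hc.exists_triple ho.1 hij.ne
    obtain ⟨c, d, hcd⟩ := hc.symm.exists_triple ho.1 hij.ne'
    obtain ⟨S, hS, hvS⟩ := exists_maximal (hab.mem (v := v) (by simp))
      (hcd.mem (v := v) (by simp))
    have h1 := ho.2 i j hij.ne S hS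
    have hun : I.Unavoidable i j S := by
      by_contra hun
      exact h1.2 hun v hvS hc
    obtain ⟨w, hw⟩ := hun o' ho'
    exact ⟨S, w, fun _ _ => ⟨hS, hvS, hw, fun w hw hcw => (h1.1 hun).unique ⟨hw, hcw⟩ ⟨hvS, hc⟩⟩⟩
  choose S w hex using hex
  unfold crossings
  refine Set.ncard_le_ncard_of_injOn (fun x => (x.1, x.2.1, w x)) ?_ ?_ (Set.toFinite _)
  · rintro x ⟨h1, h2⟩
    exact ⟨h1, (hex x h1 h2).2.2.1.2⟩
  · rintro ⟨i, j, v⟩ ⟨h1, h2⟩ ⟨i', j', v'⟩ ⟨h1', h2'⟩ heq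
    simp only [Prod.mk.injEq] at heq
    obtain ⟨rfl, rfl, h3⟩ := heq
    obtain ⟨hS, hvS, hw, -⟩ := hex _ h1 h2
    obtain ⟨hS', hvS', hw', huniq'⟩ := hex _ h1' h2'
    rw [hS.eq_of_mem hS' (h3 ▸ hw.1) hw'.1] at hvS
    simp only [Prod.mk.injEq, true_and]
    exact huniq' v hvS h2

end RoutedGraph

namespace RAM

/-! ## Reasoning about programs -/

/-- As `Exec`, without the bound on the words. -/
inductive Run : Prog → State → ℕ → State → Prop
  | skip (s : State) : Run .skip s 1 s
  | assign (r : ℕ) (e : Expr) (s : State) :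
      Run (.assign r e) s (e.cost + 1) { s with reg := Function.update s.reg r (e.eval s) }
  | store (A : ℕ) (e f : Expr) (s : State) :
      Run (.store A e f) s (e.cost + f.cost + 1)
        { s with
          arr := Function.update s.arr A (Function.update (s.arr A) (e.eval s) (f.eval s)) }
  | seq {p q : Prog} {s s₁ s₂ : State} {t₁ t₂ : ℕ} (hp : Run p s t₁ s₁) (hq : Run q s₁ t₂ s₂) :
      Run (.seq p q) s (t₁ + t₂) s₂
  | ite_lt {e f : Expr} {p q : Prog} {s s₁ : State} {t : ℕ} (h : e.eval s < f.eval s)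
      (hp : Run p s t s₁) : Run (.ite e f p q) s (e.cost + f.cost + 1 + t) s₁
  | ite_ge {e f : Expr} {p q : Prog} {s s₁ : State} {t : ℕ} (h : ¬ e.eval s < f.eval s)
      (hq : Run q s t s₁) : Run (.ite e f p q) s (e.cost + f.cost + 1 + t) s₁
  | loop_lt {e f : Expr} {p : Prog} {s s₁ s₂ : State} {t₁ t₂ : ℕ} (h : e.eval s < f.eval s)
      (hp : Run p s t₁ s₁) (hl : Run (.loop e f p) s₁ t₂ s₂) :
      Run (.loop e f p) s (e.cost + f.cost + 1 + t₁ + t₂) s₂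
  | loop_ge {e f : Expr} {p : Prog} {s : State} (h : ¬ e.eval s < f.eval s) :
      Run (.loop e f p) s (e.cost + f.cost + 1) s

/-- An expression that adds only the constant `1`. -/
def Expr.Incremental : Expr → Prop
  | .const c => c ≤ 1
  | .reg _ => True
  | .arr _ e => e.Incremental
  | .add e f => e.Incremental ∧ f = .const 1
  | .sub e f => e.Incremental ∧ f.Incremental

/-- A program all of whose expressions are incremental. -/
def Prog.Incremental : Prog → Prop
  | .skip => True
  | .assign _ e => e.Incremental
  | .store _ e f => e.Incremental ∧ f.Incremental
  | .seq p q => p.Incremental ∧ q.Incremental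
  | .ite e f p q => e.Incremental ∧ f.Incremental ∧ p.Incremental ∧ q.Incremental
  | .loop e f p => e.Incremental ∧ f.Incremental ∧ p.Incremental

/-- All words in the memory are at most `B`. -/
def State.BoundedBy (B : ℕ) (s : State) : Prop := (∀ r, s.reg r ≤ B) ∧ ∀ A k, s.arr A k ≤ B

theorem State.BoundedBy.mono {B B' : ℕ} {s : State} (h : s.BoundedBy B) (hB : B ≤ B') :
    s.BoundedBy B' := ⟨fun r => (h.1 r).trans hB, fun A k => (h.2 A k).trans hB⟩

/-- Only the constant 1 is ever added, so each operation raises the largest word by at most one. A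
time bound is then also a word bound, and the program can be analysed without mentioning word sizes.
-/
theorem Expr.Incremental.eval_le {e : Expr} (he : e.Incremental) {B : ℕ} {s : State}
    (hs : s.BoundedBy B) : e.eval s ≤ B + e.cost := by
  induction e with
  | const c => exact le_add_left he
  | reg r => exact (hs.1 r).trans (Nat.le_add_right _ _)
  | arr A e _ => exact (hs.2 _ _).trans (Nat.le_add_right _ _)
  | add e f ih _ =>
    obtain ⟨h1, rfl⟩ := he
    have := ih h1
    simp only [eval, cost]
    omega
  | sub e f ih _ =>
    have := ih he.1
    simp only [eval, cost]
    omega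

theorem Expr.Incremental.fits {e : Expr} (he : e.Incremental) {B w : ℕ} {s : State}
    (hs : s.BoundedBy B) (hw : B + e.cost ≤ w) : e.Fits w s := by
  induction e with
  | const c => exact he.trans ((Nat.le_add_left _ _).trans hw)
  | reg r => exact (hs.1 r).trans ((Nat.le_add_right _ _).trans hw)
  | arr A e ih =>
    simp only [cost] at hw
    exact ⟨ih he (by omega), (hs.2 _ _).trans (by omega)⟩
  | add e f ih _ =>
    have h2 := he.eval_le hs
    obtain ⟨h1, rfl⟩ := he
    simp only [cost] at hw h2
    exact ⟨ih h1 (by omega), by change 1 ≤ w; omega, h2.trans hw⟩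
  | sub e f ih ih' =>
    simp only [cost] at hw
    exact ⟨ih he.1 (by omega), ih' he.2 (by omega)⟩

/-- The words in a computation of an incremental program are bounded by the running time. -/
theorem Run.exec {p : Prog} {s s' : State} {t : ℕ} (h : Run p s t s') (hp : p.Incremental)
    {B : ℕ} (hs : s.BoundedBy B) :
    s'.BoundedBy (B + t) ∧ ∀ w, B + t ≤ w → Exec w p s t s' := by
  induction h generalizing B with
  | skip s => exact ⟨hs.mono (by omega), fun w _ => .skip s⟩
  | assign r e s =>
    refine ⟨⟨fun r' => ?_, fun A k => (hs.2 A k).trans (by omega)⟩, fun w hw => ?_⟩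
    · dsimp only
      by_cases h : r' = r
      · subst h
        rw [Function.update_self]
        exact (Expr.Incremental.eval_le hp hs).trans (by omega)
      · rw [Function.update_of_ne h]
        exact (hs.1 r').trans (by omega)
    · exact .assign r e s (Expr.Incremental.fits hp hs (by omega))
  | store A e f s =>
    refine ⟨⟨fun r => (hs.1 r).trans (by omega), fun A' k => ?_⟩, fun w hw => ?_⟩
    · dsimp only
      by_cases h : A' = A
      · subst h
        rw [Function.update_self]
        by_cases hk : k = e.eval s
        · rw [hk, Function.update_self]
          exact (Expr.Incremental.eval_le hp.2 hs).trans (by omega)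
        · rw [Function.update_of_ne hk]
          exact (hs.2 _ _).trans (by omega)
      · rw [Function.update_of_ne h]
        exact (hs.2 _ _).trans (by omega)
    · exact .store A e f s (Expr.Incremental.fits hp.1 hs (by omega))
        (Expr.Incremental.fits hp.2 hs (by omega))
  | seq _ _ ih1 ih2 =>
    obtain ⟨h1, h2⟩ := ih1 hp.1 hs
    obtain ⟨h3, h4⟩ := ih2 hp.2 h1
    exact ⟨h3.mono (by omega), fun w hw => .seq (h2 w (by omega)) (h4 w (by omega))⟩
  | ite_lt h _ ih =>
    obtain ⟨h1, h2⟩ := ih hp.2.2.1 hs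
    exact ⟨h1.mono (by omega), fun w hw => .ite_lt (hp.1.fits hs (by omega))
      (hp.2.1.fits hs (by omega)) h (h2 w (by omega))⟩
  | ite_ge h _ ih =>
    obtain ⟨h1, h2⟩ := ih hp.2.2.2 hs
    exact ⟨h1.mono (by omega), fun w hw => .ite_ge (hp.1.fits hs (by omega))
      (hp.2.1.fits hs (by omega)) h (h2 w (by omega))⟩
  | loop_lt h _ _ ih1 ih2 =>
    obtain ⟨h1, h2⟩ := ih1 hp.2.2 hs
    obtain ⟨h3, h4⟩ := ih2 hp h1
    exact ⟨h3.mono (by omega), fun w hw => .loop_lt (hp.1.fits hs (by omega))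
      (hp.2.1.fits hs (by omega)) h (h2 w (by omega)) (h4 w (by omega))⟩
  | loop_ge h =>
    exact ⟨hs.mono (by omega), fun w hw => .loop_ge (hp.1.fits hs (by omega))
      (hp.2.1.fits hs (by omega)) h⟩

/-- The registers that a program writes. -/
def Prog.regs : Prog → List ℕ
  | .skip => []
  | .assign r _ => [r]
  | .store _ _ _ => []
  | .seq p q => p.regs ++ q.regs
  | .ite _ _ p q => p.regs ++ q.regs
  | .loop _ _ p => p.regs

/-- The arrays that a program writes. -/
def Prog.arrs : Prog → List ℕ
  | .skip => []
  | .assign _ _ => []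
  | .store A _ _ => [A]
  | .seq p q => p.arrs ++ q.arrs
  | .ite _ _ p q => p.arrs ++ q.arrs
  | .loop _ _ p => p.arrs

/-- The states differ only in what `p` writes. -/
def Frame (p : Prog) (s s' : State) : Prop :=
  (∀ r, r ∉ p.regs → s'.reg r = s.reg r) ∧ ∀ A, A ∉ p.arrs → s'.arr A = s.arr A

theorem Frame.refl (p : Prog) (s : State) : Frame p s s := ⟨fun _ _ => rfl, fun _ _ => rfl⟩

theorem Frame.trans {p : Prog} {s s' s'' : State} (h : Frame p s s') (h' : Frame p s' s'') :
    Frame p s s'' :=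
  ⟨fun r hr => (h'.1 r hr).trans (h.1 r hr), fun A hA => (h'.2 A hA).trans (h.2 A hA)⟩

theorem Frame.mono {p q : Prog} {s s' : State} (h : Frame p s s') (hr : p.regs ⊆ q.regs)
    (ha : p.arrs ⊆ q.arrs) : Frame q s s' :=
  ⟨fun r hr' => h.1 r fun h => hr' (hr h), fun A hA => h.2 A fun h => hA (ha h)⟩

theorem Run.frame {p : Prog} {s s' : State} {t : ℕ} (h : Run p s t s') : Frame p s s' := by
  induction h with
  | skip s => exact .refl _ _
  | assign r e s =>
    exact ⟨fun r' h => Function.update_of_ne (by simpa [Prog.regs] using h) _ _, fun _ _ => rfl⟩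
  | store A e f s =>
    exact ⟨fun _ _ => rfl, fun A' h => Function.update_of_ne (by simpa [Prog.arrs] using h) _ _⟩
  | seq _ _ ih1 ih2 =>
    exact (ih1.mono (by simp [Prog.regs]) (by simp [Prog.arrs])).trans
      (ih2.mono (by simp [Prog.regs]) (by simp [Prog.arrs]))
  | ite_lt _ _ ih => exact ih.mono (by simp [Prog.regs]) (by simp [Prog.arrs])
  | ite_ge _ _ ih => exact ih.mono (by simp [Prog.regs]) (by simp [Prog.arrs])
  | loop_lt _ _ _ ih1 ih2 => exact (ih1.mono (by simp [Prog.regs]) (by simp [Prog.arrs])).trans ih2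
  | loop_ge _ => exact .refl _ _

/-- Started in `s`, the program `p` halts after at most `T` steps in a state that satisfies `Q`. -/
def Runs (p : Prog) (s : State) (T : ℕ) (Q : State → Prop) : Prop :=
  ∃ t s', Run p s t s' ∧ t ≤ T ∧ Q s'

theorem Runs.frame {p : Prog} {s : State} {T : ℕ} {Q : State → Prop} (h : Runs p s T Q) :
    Runs p s T (fun s' => Q s' ∧ Frame p s s') := by
  obtain ⟨t, s', h1, h2, h3⟩ := h
  exact ⟨t, s', h1, h2, h3, h1.frame⟩

theorem Runs.mono {p : Prog} {s : State} {T T' : ℕ} {Q Q' : State → Prop} (h : Runs p s T Q)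
    (hT : T ≤ T') (hQ : ∀ s', Q s' → Q' s') : Runs p s T' Q' := by
  obtain ⟨t, s', h1, h2, h3⟩ := h
  exact ⟨t, s', h1, h2.trans hT, hQ _ h3⟩

theorem Runs.seq {p q : Prog} {s : State} {T₁ T₂ : ℕ} {Q R : State → Prop} (h : Runs p s T₁ Q)
    (h' : ∀ s', Q s' → Frame p s s' → Runs q s' T₂ R) : Runs (.seq p q) s (T₁ + T₂) R := by
  obtain ⟨t, s', h1, h2, h3⟩ := h
  obtain ⟨t', s'', h1', h2', h3'⟩ := h' s' h3 h1.frame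
  exact ⟨t + t', s'', .seq h1 h1', by omega, h3'⟩

theorem Runs.ite {e f : Expr} {p q : Prog} {s : State} {T : ℕ} {Q : State → Prop}
    (h1 : e.eval s < f.eval s → Runs p s T Q) (h2 : ¬ e.eval s < f.eval s → Runs q s T Q) :
    Runs (.ite e f p q) s (e.cost + f.cost + 1 + T) Q := by
  by_cases h : e.eval s < f.eval s
  · obtain ⟨t, s', h3, h4, h5⟩ := h1 h
    exact ⟨_, s', .ite_lt h h3, by omega, h5⟩
  · obtain ⟨t, s', h3, h4, h5⟩ := h2 h
    exact ⟨_, s', .ite_ge h h3, by omega, h5⟩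

/-- The effect of a program without loops. -/
def Prog.effect : Prog → State → State
  | .skip, s => s
  | .assign r e, s => { s with reg := Function.update s.reg r (e.eval s) }
  | .store A e f, s =>
    { s with arr := Function.update s.arr A (Function.update (s.arr A) (e.eval s) (f.eval s)) }
  | .seq p q, s => q.effect (p.effect s)
  | .ite e f p q, s => if e.eval s < f.eval s then p.effect s else q.effect s
  | .loop _ _ _, s => s

/-- A bound on the running time of a program without loops. -/
def Prog.time : Prog → ℕ
  | .skip => 1
  | .assign _ e => e.cost + 1
  | .store _ e f => e.cost + f.cost + 1
  | .seq p q => p.time + q.time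
  | .ite e f p q => e.cost + f.cost + 1 + (p.time + q.time)
  | .loop _ _ _ => 0

/-- The program has no loops. -/
def Prog.loopFree : Prog → Bool
  | .seq p q => p.loopFree && q.loopFree
  | .ite _ _ p q => p.loopFree && q.loopFree
  | .loop _ _ _ => false
  | _ => true

/-- Loop-free code is verified by computing its effect; invariants are needed only for loops. Its
time bound adds up both branches of a test and so does not depend on the state. -/
theorem runs_of_loopFree {p : Prog} (hp : p.loopFree = true) {s : State} {Q : State → Prop}
    (h : Q (p.effect s)) : Runs p s p.time Q := by
  induction p generalizing s Q with
  | skip => exact ⟨_, _, .skip s, le_rfl, h⟩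
  | assign r e => exact ⟨_, _, .assign r e s, le_rfl, h⟩
  | store A e f => exact ⟨_, _, .store A e f s, le_rfl, h⟩
  | seq p q ih1 ih2 =>
    simp only [Prog.loopFree, Bool.and_eq_true] at hp
    exact (ih1 hp.1 (Q := fun s' => s' = p.effect s) rfl).seq
      fun s' hs' _ => ih2 hp.2 (by rw [hs']; exact h)
  | ite e f p q ih1 ih2 =>
    simp only [Prog.loopFree, Bool.and_eq_true] at hp
    refine Runs.ite (fun hlt => ?_) (fun hlt => ?_)
    · rw [Prog.effect, if_pos hlt] at h
      exact (ih1 hp.1 h).mono (by omega) fun _ => id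
    · rw [Prog.effect, if_neg hlt] at h
      exact (ih2 hp.2 h).mono (by omega) fun _ => id
  | loop e f p _ => simp [Prog.loopFree] at hp

/-- A loop that runs `N` times, with the invariant `Inv`. -/
theorem runs_loop {e f : Expr} {p : Prog} {s : State} (Inv : ℕ → State → Prop) (N : ℕ)
    (T : ℕ → ℕ) (h0 : Inv 0 s)
    (hstep : ∀ k < N, ∀ s', Inv k s' → Frame p s s' →
      e.eval s' < f.eval s' ∧ Runs p s' (T k) (Inv (k + 1)))
    (hend : ∀ s', Inv N s' → Frame p s s' → ¬ e.eval s' < f.eval s') :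
    Runs (.loop e f p) s (∑ k ∈ Finset.range N, (T k + (e.cost + f.cost + 1)) +
      (e.cost + f.cost + 1)) (Inv N) := by
  have key : ∀ d k, k + d = N → ∀ s', Inv k s' → Frame p s s' →
      Runs (.loop e f p) s' (∑ j ∈ Finset.Ico k N, (T j + (e.cost + f.cost + 1)) +
        (e.cost + f.cost + 1)) (Inv N) := by
    intro d
    induction d with
    | zero =>
      intro k hk s' hi hf
      obtain rfl : k = N := by omega
      exact ⟨_, s', .loop_ge (hend s' hi hf), by omega, hi⟩
    | succ d ih =>
      intro k hk s' hi hf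
      obtain ⟨h1, t, s'', h2, h3, h4⟩ := hstep k (by omega) s' hi hf
      obtain ⟨t', s₃, h5, h6, h7⟩ := ih (k + 1) (by omega) s'' h4 (hf.trans h2.frame)
      refine ⟨_, s₃, .loop_lt h1 h2 h5, ?_, h7⟩
      rw [Finset.sum_eq_sum_Ico_succ_bot (show k < N by omega)]
      omega
  rw [Finset.range_eq_Ico]
  exact key N 0 (by omega) s h0 (.refl _ _)

end RAM

namespace RoutedGraph

/-! ## Blocks of positions -/

/-- `blk` maps each position below `M` to the first position of its block, where the blocks
partition the positions into intervals. -/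
structure Blocks (M : ℕ) (blk : ℕ → ℕ) : Prop where
  le : ∀ q < M, blk q ≤ q
  idem : ∀ q < M, blk (blk q) = blk q
  mono : ∀ p q, p ≤ q → q < M → blk p ≤ blk q

namespace Blocks

variable {M : ℕ} {blk : ℕ → ℕ} (hB : Blocks M blk)

include hB

theorem lt_iff {p q : ℕ} (hp : p < M) (hq : q < M) (h : blk p ≠ blk q) :
    p < q ↔ blk p < blk q := by
  constructor
  · intro hpq
    exact lt_of_le_of_ne (hB.mono p q hpq.le hq) h
  · intro hpq
    by_contra hle
    exact absurd (hB.mono q p (by omega) hp) (by omega)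

theorem eq_of_between {p q s : ℕ} (h1 : s ≤ p) (h2 : p ≤ q) (hq : q < M) (hs : blk q = s) :
    blk p = s := by
  have h3 := hB.idem q hq
  rw [hs] at h3
  have h4 := hB.mono s p h1 (by omega)
  have h5 := hB.mono p q h2 hq
  omega

/-- The members of `F` lie between `s` and their maximum, which is thus at least `s + F.card - 1`,
and the whole interval up to it belongs to the block. Knowing enough members of a block thus yields
its first positions. -/
theorem fill {F : Finset ℕ} {s r : ℕ} (hF : ∀ p ∈ F, p < M ∧ blk p = s) (hr : r < F.card) :
    s + r < M ∧ blk (s + r) = s := by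
  have hne : F.Nonempty := Finset.card_pos.1 (by omega)
  have hmax := F.max'_mem hne
  have h1 : F ⊆ Finset.Icc s (F.max' hne) := fun p hp => by
    have h2 := hF p hp
    have h3 := hB.le p h2.1
    exact Finset.mem_Icc.2 ⟨by omega, F.le_max' p hp⟩
  have h2 := Finset.card_le_card h1
  rw [Nat.card_Icc] at h2
  have h3 := hF _ hmax
  exact ⟨by omega, hB.eq_of_between (by omega) (by omega) h3.1 h3.2⟩

end Blocks

variable {n m : ℕ}

/-! ## Half-edges of paths -/

/-- Numbers below `M` for the pairs of an edge of a path and an end of this edge: `lab` is the path,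
`nd` the node at this end, `nb` the other end; `opp` is the half-edge at the other end, and `tw` the
other half-edge of the path at the same node. -/
structure HalfEdges where
  M : ℕ
  lab : ℕ → ℕ
  nd : ℕ → ℕ
  nb : ℕ → ℕ
  opp : ℕ → ℕ
  tw : ℕ → ℕ

namespace HalfEdges

/-- `h` is the half-edge of the path `i` at `x` towards `w`. -/
def IsHalf (H : HalfEdges) (h : ℕ) (i : Fin m) (x w : Fin n) : Prop :=
  h < H.M ∧ H.lab h = i ∧ H.nd h = x ∧ H.nb h = w

/-- `h` is the half-edge of the path `i` with which the node list `d` starts. -/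
def Starts (H : HalfEdges) (h : ℕ) (i : Fin m) (d : List (Fin n)) : Prop :=
  ∃ x w l, d = x :: w :: l ∧ H.IsHalf h i x w

/-- The half-edges are those of the paths of `I`. -/
structure Valid (H : HalfEdges) (I : RoutedGraph n m) : Prop where
  exists_path : ∀ h < H.M, ∃ i x w, H.IsHalf (n := n) (m := m) h i x w ∧ I.Traverses i [x, w]
  exists_half : ∀ {i x w}, I.Traverses i [x, w] → ∃ h, H.IsHalf h i x w
  unique : ∀ {h h'} {i : Fin m} {x w : Fin n}, H.IsHalf h i x w → H.IsHalf h' i x w → h = h'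
  opp : ∀ {h} {i : Fin m} {x w : Fin n}, H.IsHalf h i x w → H.IsHalf (H.opp h) i w x
  tw : ∀ {h h'} {i : Fin m} {x w w' : Fin n}, H.IsHalf h i x w → H.IsHalf h' i x w' → w ≠ w' →
    H.tw h = h'

variable {H : HalfEdges} {I : RoutedGraph n m}

theorem IsHalf.congr {h : ℕ} {i i' : Fin m} {x x' w w' : Fin n} (h1 : H.IsHalf h i x w)
    (h2 : H.IsHalf h i' x' w') : i = i' ∧ x = x' ∧ w = w' := by
  obtain ⟨-, h1, h3, h5⟩ := h1
  obtain ⟨-, h2, h4, h6⟩ := h2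
  exact ⟨Fin.ext (by omega), Fin.ext (by omega), Fin.ext (by omega)⟩

theorem Starts.lt {h : ℕ} {i : Fin m} {d : List (Fin n)} (hd : H.Starts h i d) : h < H.M := by
  obtain ⟨x, w, l, -, h1⟩ := hd
  exact h1.1

theorem Starts.lab {h : ℕ} {i : Fin m} {d : List (Fin n)} (hd : H.Starts h i d) :
    H.lab h = i := by
  obtain ⟨x, w, l, -, h1⟩ := hd
  exact h1.2.1

theorem Starts.nd {h : ℕ} {i : Fin m} {d : List (Fin n)} (hd : H.Starts h i d) {x : Fin n}
    (hx : d.head? = some x) : H.nd h = x := by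
  obtain ⟨y, w, l, rfl, h1⟩ := hd
  obtain rfl : y = x := by simpa using hx
  exact h1.2.2.1

theorem Starts.append {h : ℕ} {i : Fin m} {d e : List (Fin n)} (hd : H.Starts h i d) :
    H.Starts h i (d ++ e) := by
  obtain ⟨x, w, l, rfl, h1⟩ := hd
  exact ⟨x, w, l ++ e, by simp, h1⟩

theorem Starts.of_append {τ : List (Fin n)} {h : ℕ} {i : Fin m} {d e : List (Fin n)}
    (hl : IsLink τ d) (hd : H.Starts h i (d ++ e)) : H.Starts h i d := by
  obtain ⟨x, w, l, rfl⟩ := hl.exists_cons_cons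
  obtain ⟨x', w', l', heq, h1⟩ := hd
  simp only [List.cons_append, List.cons.injEq] at heq
  obtain ⟨rfl, rfl, -⟩ := heq
  exact ⟨_, _, _, rfl, h1⟩

variable (hH : H.Valid I)

include hH

theorem Valid.starts_unique {h h' : ℕ} {i : Fin m} {d : List (Fin n)} (h1 : H.Starts h i d)
    (h2 : H.Starts h' i d) : h = h' := by
  obtain ⟨x, w, l, rfl, h1⟩ := h1
  obtain ⟨x', w', l', heq, h2⟩ := h2
  simp only [List.cons.injEq] at heq
  obtain ⟨rfl, rfl, -⟩ := heq
  exact hH.unique h1 h2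

theorem Valid.exists_starts {τ : List (Fin n)} {i : Fin m} {d : List (Fin n)} (hd : IsLink τ d)
    (hi : I.Traverses i d) : ∃ h, H.Starts h i d := by
  obtain ⟨x, w, l, rfl⟩ := hd.exists_cons_cons
  obtain ⟨h, hh⟩ := hH.exists_half (hi.of_infix (e := [x, w]) ⟨[], l, by simp⟩)
  exact ⟨h, x, w, l, rfl, hh⟩

/-- From `x`, follow the path over the half-edge to the first node outside `τ`; the end of the path
is such a node. -/
theorem Valid.exists_link {τ : List (Fin n)} (hτ : ∀ u ∈ τ, ∀ i, ¬ I.TerminalOf i u) {h : ℕ}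
    (hh : h < H.M) {x : Fin n} (hx : H.nd h = x) (hxτ : x ∉ τ) :
    ∃ i d, IsLink τ d ∧ d.head? = some x ∧ I.Traverses i d ∧ H.Starts h i d := by
  obtain ⟨i, x', w, h1, hi⟩ := hH.exists_path h hh
  obtain rfl : x' = x := Fin.ext (by rw [← hx, h1.2.2.1])
  obtain ⟨p, hp, s, t, hst⟩ := traverses_iff.1 hi
  obtain ⟨z, hz, hzp⟩ : ∃ z, I.TerminalOf i z ∧ p.getLast? = some z := by
    obtain ⟨q, hq⟩ := head_support (I := I) i
    obtain ⟨q', hq'⟩ := last_support (I := I) i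
    rcases hp with rfl | rfl
    · exact ⟨_, .inr rfl, by rw [hq']; simp⟩
    · exact ⟨_, .inl rfl, by rw [hq]; simp⟩
  have hzm : z ∈ w :: t := by
    have : p.getLast? = (w :: t).getLast? := by
      rw [← hst]
      simp only [List.append_assoc, List.cons_append, List.nil_append]
      rw [List.getLast?_append_of_ne_nil _ (by simp), List.getLast?_cons_cons]
    rw [this] at hzp
    exact List.mem_of_getLast? hzp
  obtain ⟨l, y, C, hC, hl⟩ := exists_link_prefix hxτ (fun h => hτ z h i hz) hzm
  refine ⟨i, _, hl, rfl, traverses_iff.2 ⟨p, hp, s, C, ?_⟩, ?_⟩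
  · rw [← hst]
    simp only [List.append_assoc, List.cons_append, List.nil_append, hC]
  · cases l with
    | nil =>
      simp at hC
      exact ⟨x', y, [], rfl, hC.1 ▸ h1⟩
    | cons a l =>
      simp at hC
      exact ⟨x', a, l ++ [y], rfl, hC.1 ▸ h1⟩

theorem Valid.tw_starts {τ : List (Fin n)} {h h' : ℕ} {i : Fin m} {d e : List (Fin n)} {v : Fin n}
    (hd : IsLink τ d) (he : IsLink τ e) (hdv : d.head? = some v) (hev : e.head? = some v)
    (hi : I.Traverses i d) (hi' : I.Traverses i e) (hne : e ≠ d) (h1 : H.Starts h i d)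
    (h2 : H.Starts h' i e) : H.tw h = h' := by
  have hg := (traverses_glue hd he hdv hev).2 ⟨hi, hi', hne⟩
  obtain ⟨x, w, l, rfl, h1⟩ := h1
  obtain ⟨x', w', l', rfl, h2⟩ := h2
  obtain rfl : x = v := by simpa using hdv
  obtain rfl : x' = x := by simpa using hev
  refine hH.tw h1 h2 ?_
  rintro rfl
  have := hg.nodup
  simp [List.nodup_append] at this

end HalfEdges

theorem isLink_split {I : RoutedGraph n m} {τ D : List (Fin n)} {v : Fin n} {i : Fin m}
    (hvτ : v ∉ τ) (hD : IsLink (τ ++ [v]) D) (hi : I.Traverses i D) :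
    IsLink τ D ∧ v ∉ D ∨ ∃ d e, IsLink τ d ∧ IsLink τ e ∧ d.head? = some v ∧ e.head? = some v ∧
      D = d.reverse ++ e.tail := by
  have hnd := hi.nodup
  obtain ⟨x, l, y, rfl, hx, hy, hl⟩ := hD
  simp only [List.mem_append, List.mem_cons, List.not_mem_nil, or_false, not_or] at hx hy hl
  by_cases hv : v ∈ l
  · right
    obtain ⟨A, B, rfl⟩ := List.append_of_mem hv
    have h2 : ∀ u, u ∈ A ∨ u ∈ B → u ∈ τ := by
      intro u hu
      rcases hl u (by simp; tauto) with h | rfl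
      · exact h
      · exfalso
        have h3 : (A ++ u :: (B ++ [y])).Nodup := by simpa using hnd.of_cons
        have h4 := (List.nodup_cons.1 (List.nodup_middle.1 h3)).1
        simp at h4
        tauto
    refine ⟨v :: (A.reverse ++ [x]), v :: (B ++ [y]), ⟨v, _, x, rfl, hvτ, hx.1, ?_⟩,
      ⟨v, B, y, rfl, hvτ, hy.1, fun u hu => h2 u (.inr hu)⟩, rfl, rfl, by simp⟩
    intro u hu
    exact h2 u (.inl (by simpa using hu))
  · left
    refine ⟨⟨x, l, y, rfl, hx.1, hy.1, fun u hu => ?_⟩, ?_⟩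
    · rcases hl u hu with h | rfl
      · exact h
      · exact absurd hu hv
    · simp only [List.mem_cons, List.mem_append, List.not_mem_nil, or_false, not_or]
      exact ⟨Ne.symm hx.2, hv, Ne.symm hy.2⟩

/-! ## Layouts -/

/-- An arrangement of the half-edges: `obj` gives the half-edge at a position and `pos` the position
of a half-edge; `mate` is the half-edge at the other end of the current link, and `blk` the start of
the block of half-edges with the same link. -/
structure Layout where
  obj : ℕ → ℕ
  pos : ℕ → ℕ
  mate : ℕ → ℕ
  blk : ℕ → ℕ

/-- The layout `S` describes the links after the deletion of the nodes in `τ`; `pn` is the node of a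
position. -/
structure Layout.Valid (S : Layout) (I : RoutedGraph n m) (H : HalfEdges) (pn : ℕ → ℕ)
    (τ : List (Fin n)) : Prop where
  pos_lt : ∀ h < H.M, S.pos h < H.M
  obj_pos : ∀ h < H.M, S.obj (S.pos h) = h
  obj_lt : ∀ q < H.M, S.obj q < H.M
  pos_obj : ∀ q < H.M, S.pos (S.obj q) = q
  node : ∀ q < H.M, H.nd (S.obj q) = pn q
  blocks : Blocks H.M S.blk
  blk_node : ∀ p < H.M, ∀ q < H.M, S.blk p = S.blk q → pn p = pn q
  mate_starts : ∀ {i d h}, IsLink τ d → I.Traverses i d → H.Starts h i d →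
    H.Starts (S.mate h) i d.reverse
  blk_iff : ∀ {i j d e h h'}, IsLink τ d → IsLink τ e → I.Traverses i d → I.Traverses j e →
    H.Starts h i d → H.Starts h' j e → (S.blk (S.pos h) = S.blk (S.pos h') ↔ d = e)

namespace Layout

variable (S : Layout) (H : HalfEdges) (pn : ℕ → ℕ) (v : Fin n)

/-- The positions at `v`. -/
def posAt : Finset ℕ := (Finset.range H.M).filter (fun q => pn q = v)

/-- The half-edge that is moved when position `q` of the deleted node is visited. -/
def moved (q : ℕ) : ℕ := S.mate (H.tw (S.obj q))

/-- The start of the block in which it is moved. -/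
def target (q : ℕ) : ℕ := S.blk (S.pos (S.moved H q))

/-- The rank of `q` in the order in which the positions are visited. -/
def rank (q : ℕ) : ℕ := if S.pos (H.tw (S.obj q)) < q then q else q + H.M

/-- The new position of the half-edge that is moved. -/
def slot (q : ℕ) : ℕ := S.target H q +
  ((posAt H pn v).filter (fun p => S.target H p = S.target H q ∧ S.rank H p < S.rank H q)).card

/-- The start of its new block. -/
def newBlk (q : ℕ) : ℕ := S.target H q +
  ((posAt H pn v).filter (fun p => S.target H p = S.target H q ∧ S.rank H p < S.rank H q ∧
    S.blk p ≠ S.blk q)).card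

/-- `S'` results from `S` by deletion of the node `v`. -/
structure Deleted (S' : Layout) : Prop where
  moved : ∀ q ∈ posAt H pn v, S'.obj (S.slot H pn v q) = S.moved H q ∧
    S'.pos (S.moved H q) = S.slot H pn v q ∧ S'.mate (S.moved H q) = S.mate (S.obj q) ∧
    S'.blk (S.slot H pn v q) = S.newBlk H pn v q
  obj_eq : ∀ p < H.M, (∀ q ∈ posAt H pn v, p ≠ S.slot H pn v q) →
    S'.obj p = S.obj p ∧ S'.blk p = S.blk p
  pos_eq : ∀ h < H.M, (∀ q ∈ posAt H pn v, h ≠ S.moved H q) →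
    S'.pos h = S.pos h ∧ S'.mate h = S.mate h

variable {S H pn v} {I : RoutedGraph n m} {τ : List (Fin n)} (hH : H.Valid I)
  (hτ : I.IsPartialDeletion (τ ++ [v])) (hS : S.Valid I H pn τ)

theorem mem_posAt {q : ℕ} : q ∈ posAt H pn v ↔ q < H.M ∧ pn q = v := by
  simp [posAt]

/-- The path of the half-edge at position `q` enters `v` on `d` and leaves on `e`. -/
structure Turn (S : Layout) (I : RoutedGraph n m) (H : HalfEdges) (τ : List (Fin n)) (v : Fin n)
    (q : ℕ) (i : Fin m) (d e : List (Fin n)) : Prop where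
  link : IsLink τ d
  link' : IsLink τ e
  head : d.head? = some v
  head' : e.head? = some v
  ne : e ≠ d
  trav : I.Traverses i d
  trav' : I.Traverses i e
  starts : H.Starts (H.tw (S.obj q)) i d
  starts' : H.Starts (S.obj q) i e
  moved : H.Starts (S.moved H q) i d.reverse

include hH hτ hS

theorem exists_turn {q : ℕ} (hq : q ∈ posAt H pn v) : ∃ i d e, Turn S I H τ v q i d e := by
  rw [mem_posAt] at hq
  obtain ⟨i, e, he, hev, hie, hse⟩ := hH.exists_link hτ.of_append.2 (hS.obj_lt q hq.1)
    ((hS.node q hq.1).trans hq.2) hτ.notMem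
  obtain ⟨d, hd, hdv, hne, hid⟩ := link_other (fun u hu => hτ.of_append.2 u hu i) he hev
    (hτ.nonterminal i) hie
  obtain ⟨t, ht⟩ := hH.exists_starts hd hid
  have := hH.tw_starts he hd hev hdv hie hid hne hse ht
  refine ⟨i, d, e, hd, he, hdv, hev, hne.symm, hid, hie, this ▸ ht, hse, ?_⟩
  unfold Layout.moved
  rw [this]
  exact hS.mate_starts hd hid ht

omit hτ in
/-- A path that uses two links at `v` has a half-edge at `v` with this turn. -/
theorem exists_position {i : Fin m} {d e : List (Fin n)} (hd : IsLink τ d) (he : IsLink τ e)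
    (hdv : d.head? = some v) (hev : e.head? = some v) (hne : e ≠ d) (hid : I.Traverses i d)
    (hie : I.Traverses i e) {h : ℕ} (hh : H.Starts h i d.reverse) :
    ∃ q ∈ posAt H pn v, Turn S I H τ v q i d e ∧ S.moved H q = h := by
  obtain ⟨t, ht⟩ := hH.exists_starts he hie
  obtain ⟨u, hu⟩ := hH.exists_starts hd hid
  have htw := hH.tw_starts he hd hev hdv hie hid hne.symm ht hu
  have ho := hS.obj_pos t ht.lt
  have hm : S.moved H (S.pos t) = h := by
    unfold Layout.moved
    rw [ho, htw]
    exact hH.starts_unique (hS.mate_starts hd hid hu) hh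
  refine ⟨S.pos t, ?_, ⟨hd, he, hdv, hev, hne, hid, hie, by rw [ho, htw]; exact hu,
    by rw [ho]; exact ht, by rw [hm]; exact hh⟩, hm⟩
  rw [mem_posAt]
  have := hS.pos_lt t ht.lt
  exact ⟨this, by rw [← hS.node _ this, ho]; exact ht.nd hev⟩

omit hH hτ in
theorem Turn.target_eq_iff {q q' : ℕ} {i i' : Fin m} {d e d' e' : List (Fin n)}
    (h : Turn S I H τ v q i d e) (h' : Turn S I H τ v q' i' d' e') :
    S.target H q = S.target H q' ↔ d = d' := by
  unfold target
  rw [hS.blk_iff h.link.reverse h'.link.reverse (traverses_reverse.2 h.trav)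
    (traverses_reverse.2 h'.trav) h.moved h'.moved, List.reverse_inj]

omit hH hτ in
theorem Turn.blk_eq_iff {q q' : ℕ} {i i' : Fin m} {d e d' e' : List (Fin n)}
    (h : Turn S I H τ v q i d e) (h' : Turn S I H τ v q' i' d' e') (hq : q < H.M)
    (hq' : q' < H.M) : S.blk q = S.blk q' ↔ e = e' := by
  rw [← hS.blk_iff h.link' h'.link' h.trav' h'.trav' h.starts' h'.starts', hS.pos_obj q hq,
    hS.pos_obj q' hq']

omit hH hτ in
theorem Turn.blk_tw {q q' : ℕ} {i i' : Fin m} {d e d' e' : List (Fin n)}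
    (h : Turn S I H τ v q i d e) (h' : Turn S I H τ v q' i' d' e')
    (heq : S.target H q = S.target H q') :
    S.blk (S.pos (H.tw (S.obj q))) = S.blk (S.pos (H.tw (S.obj q'))) :=
  (hS.blk_iff h.link h'.link h.trav h'.trav h.starts h'.starts).2 ((h.target_eq_iff hS h').1 heq)

omit hH hτ in
theorem Turn.blk_ne {q : ℕ} {i : Fin m} {d e : List (Fin n)} (h : Turn S I H τ v q i d e)
    (hq : q < H.M) : S.blk (S.pos (H.tw (S.obj q))) ≠ S.blk q := by
  have := (hS.blk_iff h.link h.link' h.trav h.trav' h.starts h.starts').not.2 h.ne.symm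
  rwa [hS.pos_obj q hq] at this

theorem moved_lt {q : ℕ} (hq : q ∈ posAt H pn v) : S.moved H q < H.M := by
  obtain ⟨i, d, e, ht⟩ := exists_turn hH hτ hS hq
  exact ht.moved.lt

theorem moved_injOn : Set.InjOn (S.moved H) (posAt H pn v) := by
  intro q hq q' hq' heq
  obtain ⟨i, d, e, ht⟩ := exists_turn hH hτ hS hq
  obtain ⟨i', d', e', ht'⟩ := exists_turn hH hτ hS hq'
  have h1 : i = i' := Fin.ext (by rw [← ht.moved.lab, heq, ht'.moved.lab])
  subst h1
  have h2 : d = d' := (ht.target_eq_iff hS ht').1 (by unfold target; rw [heq])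
  subst h2
  have h3 := link_third ht.link ht.link' ht'.link' ht.head ht.head' ht'.head' ht.trav ht.trav'
    ht'.trav' ht.ne ht'.ne
  subst h3
  have h4 := hH.starts_unique ht.starts' ht'.starts'
  rw [← hS.pos_obj q (mem_posAt.1 hq).1, h4, hS.pos_obj q' (mem_posAt.1 hq').1]

omit hH hτ hS in
-- For the half-edges that come from one link `d` at `v`, the rank is the clockwise order after `d`:
-- positions behind the block of `d` keep their number, those before it are shifted by `M`. The
-- unshifted and the shifted values lie in disjoint ranges.
theorem rank_injOn : Set.InjOn (S.rank H) (posAt H pn v) := by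
  intro q hq q' hq' heq
  have h1 := (mem_posAt.1 hq).1
  have h2 := (mem_posAt.1 hq').1
  unfold rank at heq
  split_ifs at heq <;> omega

/-- Slots are counted from the start of the target block. The half-edges moved within it are
different members of this block, so it has room for all of them. -/
theorem blk_slot {q : ℕ} (hq : q ∈ posAt H pn v) :
    S.slot H pn v q < H.M ∧ S.blk (S.slot H pn v q) = S.target H q := by
  set W := (posAt H pn v).filter (fun p => S.target H p = S.target H q)
  have hinj : Set.InjOn (fun p => S.pos (S.moved H p)) W := by
    intro p hp p' hp' heq
    have hp1 := (Finset.mem_filter.1 hp).1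
    have hp1' := (Finset.mem_filter.1 hp').1
    refine moved_injOn hH hτ hS hp1 hp1' ?_
    rw [← hS.obj_pos _ (moved_lt hH hτ hS hp1), ← hS.obj_pos _ (moved_lt hH hτ hS hp1')]
    exact congrArg S.obj heq
  refine hS.blocks.fill (F := W.image (fun p => S.pos (S.moved H p))) ?_ ?_
  · intro p hp
    obtain ⟨r, hr, rfl⟩ := Finset.mem_image.1 hp
    have hr' := Finset.mem_filter.1 hr
    exact ⟨hS.pos_lt _ (moved_lt hH hτ hS hr'.1), hr'.2⟩
  · rw [Finset.card_image_of_injOn hinj]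
    refine Finset.card_lt_card ⟨fun p hp => ?_, fun h => ?_⟩
    · have := Finset.mem_filter.1 hp
      exact Finset.mem_filter.2 ⟨this.1, this.2.1⟩
    · have := Finset.mem_filter.1 (h (Finset.mem_filter.2 ⟨hq, rfl⟩))
      exact absurd this.2.2 (lt_irrefl _)

omit hH hτ hS in
theorem slot_lt_slot {q q' : ℕ} (hq : q ∈ posAt H pn v) (ht : S.target H q = S.target H q')
    (hr : S.rank H q < S.rank H q') : S.slot H pn v q < S.slot H pn v q' := by
  unfold slot
  rw [ht]
  refine Nat.add_lt_add_left (Finset.card_lt_card ⟨fun p hp => ?_, fun h => ?_⟩) _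
  · have := Finset.mem_filter.1 hp
    exact Finset.mem_filter.2 ⟨this.1, this.2.1, this.2.2.trans hr⟩
  · have := Finset.mem_filter.1 (h (Finset.mem_filter.2 ⟨hq, ht, hr⟩))
    exact absurd this.2.2 (lt_irrefl _)

theorem slot_injOn : Set.InjOn (S.slot H pn v) (posAt H pn v) := by
  intro q hq q' hq' heq
  have ht : S.target H q = S.target H q' := by
    rw [← (blk_slot hH hτ hS hq).2, heq, (blk_slot hH hτ hS hq').2]
  rcases lt_trichotomy (S.rank H q) (S.rank H q') with h | h | h
  · exact absurd heq (slot_lt_slot hq ht h).ne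
  · exact rank_injOn hq hq' h
  · exact absurd heq (slot_lt_slot hq' ht.symm h).ne'

/-- The positions of one block that are visited for the same target are visited in a row. -/
theorem blk_between {q₁ q₂ q₃ : ℕ} (h₁ : q₁ ∈ posAt H pn v) (h₂ : q₂ ∈ posAt H pn v)
    (h₃ : q₃ ∈ posAt H pn v) (ht' : S.target H q₁ = S.target H q₃) (hr : S.rank H q₁ ≤ S.rank H q₂)
    (hr' : S.rank H q₂ ≤ S.rank H q₃) (hb : S.blk q₁ = S.blk q₃) : S.blk q₂ = S.blk q₁ := by
  obtain ⟨i₁, d₁, e₁, t₁⟩ := exists_turn hH hτ hS h₁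
  obtain ⟨i₂, d₂, e₂, t₂⟩ := exists_turn hH hτ hS h₂
  obtain ⟨i₃, d₃, e₃, t₃⟩ := exists_turn hH hτ hS h₃
  have l₁ := (mem_posAt.1 h₁).1
  have l₂ := (mem_posAt.1 h₂).1
  have l₃ := (mem_posAt.1 h₃).1
  have a₁ := t₁.blk_ne hS l₁
  have a₃ := t₃.blk_ne hS l₃
  have e₁₃ := t₁.blk_tw hS t₃ ht'
  have c₁ := hS.blocks.lt_iff (hS.pos_lt _ t₁.starts.lt) l₁ a₁
  have c₃ := hS.blocks.lt_iff (hS.pos_lt _ t₃.starts.lt) l₃ a₃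
  rw [e₁₃, hb] at c₁
  unfold rank at hr hr'
  have m1 := hS.blocks.mono q₁ q₂
  have m2 := hS.blocks.mono q₂ q₃
  -- The twins of `q₁` and `q₃` are in one block, and `q₁`, `q₃` lie both behind it or both before
  -- it. Ranks between theirs force `q₂` between them in position, hence into the same block.
  by_cases hc : S.blk (S.pos (H.tw (S.obj q₃))) < S.blk q₃
  · rw [if_pos (c₁.2 hc)] at hr
    rw [if_pos (c₃.2 hc)] at hr'
    split_ifs at hr hr' with h
    · have := m1 hr l₂
      have := m2 hr' l₃
      omega
    · omega
  · rw [if_neg (fun h => hc (c₁.1 h))] at hr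
    rw [if_neg (fun h => hc (c₃.1 h))] at hr'
    split_ifs at hr hr' with h
    · omega
    · have := m1 (by omega) l₂
      have := m2 (by omega) l₃
      omega

omit hH hτ hS in
theorem newBlk_le (q : ℕ) : S.newBlk H pn v q ≤ S.slot H pn v q := by
  unfold newBlk slot
  refine Nat.add_le_add_left (Finset.card_le_card fun p hp => ?_) _
  have := Finset.mem_filter.1 hp
  exact Finset.mem_filter.2 ⟨this.1, this.2.1, this.2.2.1⟩

theorem newBlk_eq {q q' : ℕ} (hq : q ∈ posAt H pn v) (hq' : q' ∈ posAt H pn v)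
    (ht : S.target H q = S.target H q') (hb : S.blk q = S.blk q') :
    S.newBlk H pn v q = S.newBlk H pn v q' := by
  wlog hr : S.rank H q ≤ S.rank H q' generalizing q q'
  · exact (this hq' hq ht.symm hb.symm (by omega)).symm
  unfold newBlk
  rw [ht, hb]
  congr 2
  refine Finset.filter_congr fun p hp => ?_
  constructor
  · rintro ⟨h1, h2, h3⟩
    exact ⟨h1, by omega, h3⟩
  · rintro ⟨h1, h2, h3⟩
    refine ⟨h1, ?_, h3⟩
    by_contra hle
    exact h3 ((blk_between hH hτ hS hq hp hq' ht (by omega) (by omega) hb).trans hb)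

/-- When `q'` is visited, the positions from the block of `q` that have the same target form a
completed run. All of them, and everything placed before them, precede the new block of `q'`. -/
theorem slot_lt_newBlk {q q' : ℕ} (hq : q ∈ posAt H pn v) (hq' : q' ∈ posAt H pn v)
    (ht : S.target H q = S.target H q') (hb : S.blk q ≠ S.blk q')
    (hr : S.rank H q < S.rank H q') : S.slot H pn v q < S.newBlk H pn v q' := by
  unfold slot newBlk
  rw [ht]
  refine Nat.add_lt_add_left (Finset.card_lt_card ⟨fun p hp => ?_, fun h => ?_⟩) _
  · obtain ⟨hp, h1, h2⟩ := Finset.mem_filter.1 hp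
    refine Finset.mem_filter.2 ⟨hp, h1, h2.trans hr, fun h => hb ?_⟩
    exact (blk_between hH hτ hS hp hq hq' h1 h2.le hr.le h).trans h
  · have := Finset.mem_filter.1 (h (Finset.mem_filter.2 ⟨hq, ht, hr, hb⟩))
    exact absurd this.2.2 (lt_irrefl _)

theorem exists_first {q : ℕ} (hq : q ∈ posAt H pn v) : ∃ q₀ ∈ posAt H pn v,
    S.target H q₀ = S.target H q ∧ S.blk q₀ = S.blk q ∧
      S.slot H pn v q₀ = S.newBlk H pn v q := by
  obtain ⟨q₀, hq₀, hmin⟩ := Finset.exists_min_image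
    ((posAt H pn v).filter (fun p => S.target H p = S.target H q ∧ S.blk p = S.blk q)) (S.rank H)
    ⟨q, Finset.mem_filter.2 ⟨hq, rfl, rfl⟩⟩
  obtain ⟨h0, ht, hb⟩ := Finset.mem_filter.1 hq₀
  refine ⟨q₀, h0, ht, hb, ?_⟩
  rw [← newBlk_eq hH hτ hS h0 hq ht hb]
  unfold slot newBlk
  congr 2
  refine Finset.filter_congr fun p hp => ?_
  constructor
  · rintro ⟨h1, h2⟩
    refine ⟨h1, h2, fun h3 => ?_⟩
    exact absurd (hmin p (Finset.mem_filter.2 ⟨hp, h1.trans ht, h3.trans hb⟩)) (by omega)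
  · rintro ⟨h1, h2, -⟩
    exact ⟨h1, h2⟩

omit hH hτ hS in
/-- The half-edge that was placed last in the same block. -/
theorem exists_pred {q : ℕ} (h : S.target H q < S.slot H pn v q) :
    ∃ p ∈ posAt H pn v, S.target H p = S.target H q ∧ S.rank H p < S.rank H q ∧
      S.slot H pn v q = S.slot H pn v p + 1 ∧ ∀ r ∈ posAt H pn v, S.target H r = S.target H q →
        S.rank H r < S.rank H q → S.rank H r ≤ S.rank H p := by
  have hne : ((posAt H pn v).filter (fun p => S.target H p = S.target H q ∧
      S.rank H p < S.rank H q)).Nonempty := by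
    rw [← Finset.card_pos]; unfold slot at h; omega
  obtain ⟨p, hp, hmax⟩ := Finset.exists_max_image _ (S.rank H) hne
  obtain ⟨hp', ht, hr⟩ := Finset.mem_filter.1 hp
  have hmax' : ∀ r ∈ posAt H pn v, S.target H r = S.target H q →
      S.rank H r < S.rank H q → S.rank H r ≤ S.rank H p :=
    fun r hr ht hlt => hmax r (Finset.mem_filter.2 ⟨hr, ht, hlt⟩)
  refine ⟨p, hp', ht, hr, ?_, hmax'⟩
  unfold slot
  rw [ht, add_assoc]
  congr 1
  rw [← Finset.card_insert_of_notMem (a := p) (by simp)]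
  congr 1
  ext r
  simp only [Finset.mem_insert, Finset.mem_filter]
  constructor
  · rintro ⟨h1, h2, h3⟩
    rcases (hmax' r h1 h2 h3).lt_or_eq with h | h
    · exact .inr ⟨h1, h2, h⟩
    · exact .inl (rank_injOn h1 hp' h)
  · rintro (rfl | ⟨h1, h2, h3⟩)
    · exact ⟨hp', ht, hr⟩
    · exact ⟨h1, h2, by omega⟩

/-- A target block belongs to a link that ends at the nonterminal node `v`, so every path on it
turns at `v`. Thus all half-edges of a touched block are moved, and the moves permute the block. -/
theorem exists_moved {q h : ℕ} (hq : q ∈ posAt H pn v) (hh : h < H.M)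
    (hb : S.blk (S.pos h) = S.target H q) :
    ∃ q' ∈ posAt H pn v, S.target H q' = S.target H q ∧ h = S.moved H q' := by
  obtain ⟨i, d, e, ht⟩ := exists_turn hH hτ hS hq
  obtain ⟨x, l, y, hd⟩ := ht.link
  have hy : d.reverse.head? = some y := by rw [hd.1]; simp
  have h1 : H.nd h = y := by
    rw [← ht.moved.nd hy, ← hS.obj_pos h hh, hS.node _ (hS.pos_lt h hh),
      hS.blk_node _ (hS.pos_lt h hh) _ (hS.pos_lt _ ht.moved.lt) hb,
      ← hS.node _ (hS.pos_lt _ ht.moved.lt), hS.obj_pos _ ht.moved.lt]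
  obtain ⟨j, D, hD, hDy, hjD, hsD⟩ := hH.exists_link hτ.of_append.2 hh h1 hd.2.2.1
  have h2 : D = d.reverse := (hS.blk_iff hD ht.link.reverse hjD (traverses_reverse.2 ht.trav) hsD
    ht.moved).1 hb
  subst h2
  have hjd := traverses_reverse.1 hjD
  obtain ⟨e', he', hev, hne, hje⟩ := link_other (fun u hu => hτ.of_append.2 u hu j) ht.link ht.head
    (hτ.nonterminal j) hjd
  obtain ⟨q', hq', ht', hm⟩ := exists_position hH hS ht.link he' ht.head hev hne hjd hje hsD
  exact ⟨q', hq', by unfold target; rw [hm]; exact hb, hm.symm⟩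

omit hH hτ hS in
theorem glue_inj {i : Fin m} {d e d' e' : List (Fin n)} (hd : d.head? = some v)
    (he : e.head? = some v) (hd' : d'.head? = some v) (he' : e'.head? = some v)
    (hi : I.Traverses i (d.reverse ++ e.tail)) :
    d.reverse ++ e.tail = d'.reverse ++ e'.tail ↔ d = d' ∧ e = e' := by
  refine ⟨fun h => ?_, fun h => by rw [h.1, h.2]⟩
  obtain ⟨a, rfl⟩ : ∃ a, d = v :: a := ⟨_, List.eq_cons_of_mem_head? hd⟩
  obtain ⟨b, rfl⟩ : ∃ a, e = v :: a := ⟨_, List.eq_cons_of_mem_head? he⟩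
  obtain ⟨a', rfl⟩ : ∃ a, d' = v :: a := ⟨_, List.eq_cons_of_mem_head? hd'⟩
  obtain ⟨b', rfl⟩ : ∃ a, e' = v :: a := ⟨_, List.eq_cons_of_mem_head? he'⟩
  have hn := hi.nodup
  simp only [List.reverse_cons, List.tail_cons, List.append_assoc, List.cons_append,
    List.nil_append] at h hn
  have := List.append_cons_inj_of_nodup h hn
  rw [this.2, List.reverse_injective this.1]
  exact ⟨rfl, rfl⟩

/-! ### Deletion of a node preserves the validity of a layout -/

namespace Deleted

variable {S' : Layout} (hD : Deleted S H pn v S')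

include hD

theorem pos_lt {h : ℕ} (hh : h < H.M) : S'.pos h < H.M := by
  by_cases hq : ∃ q ∈ posAt H pn v, h = S.moved H q
  · obtain ⟨q, hq, rfl⟩ := hq
    rw [(hD.moved q hq).2.1]
    exact (blk_slot hH hτ hS hq).1
  · push Not at hq
    rw [(hD.pos_eq h hh hq).1]
    exact hS.pos_lt h hh

theorem blk_pos {h : ℕ} (hh : h < H.M) : S.blk (S'.pos h) = S.blk (S.pos h) := by
  by_cases hq : ∃ q ∈ posAt H pn v, h = S.moved H q
  · obtain ⟨q, hq, rfl⟩ := hq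
    rw [(hD.moved q hq).2.1]
    exact (blk_slot hH hτ hS hq).2
  · push Not at hq
    rw [(hD.pos_eq h hh hq).1]

theorem obj_pos {h : ℕ} (hh : h < H.M) : S'.obj (S'.pos h) = h := by
  by_cases hq : ∃ q ∈ posAt H pn v, h = S.moved H q
  · obtain ⟨q, hq, rfl⟩ := hq
    rw [(hD.moved q hq).2.1, (hD.moved q hq).1]
  · push Not at hq
    have h1 := hS.pos_lt h hh
    rw [(hD.pos_eq h hh hq).1, (hD.obj_eq _ h1 fun q hq' heq => ?_).1, hS.obj_pos h hh]
    have h2 := (blk_slot hH hτ hS hq').2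
    rw [← heq] at h2
    obtain ⟨q', h3, -, h4⟩ := exists_moved hH hτ hS hq' hh h2
    exact hq q' h3 h4

/-- `S'.pos` has a left inverse on the finite set of half-edges, so it is a permutation of the
positions. -/
theorem exists_pos {p : ℕ} (hp : p < H.M) : ∃ h < H.M, S'.pos h = p := by
  have h1 : Set.InjOn S'.pos (Finset.range H.M) := fun a ha b hb heq => by
    rw [← hD.obj_pos hH hτ hS (Finset.mem_range.1 ha), heq,
      hD.obj_pos hH hτ hS (Finset.mem_range.1 hb)]
  have h2 : Set.MapsTo S'.pos (Finset.range H.M) (Finset.range H.M) := fun a ha =>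
    Finset.mem_coe.2 (Finset.mem_range.2 (hD.pos_lt hH hτ hS (Finset.mem_range.1 ha)))
  obtain ⟨h, h3, h4⟩ := Finset.surjOn_of_injOn_of_card_le _ h2 h1 le_rfl
    (Finset.mem_coe.2 (Finset.mem_range.2 hp))
  exact ⟨h, Finset.mem_range.1 h3, h4⟩

theorem exists_slot {p q : ℕ} (hp : p < H.M) (hq : q ∈ posAt H pn v)
    (h : S.blk p = S.target H q) :
    ∃ q' ∈ posAt H pn v, S.target H q' = S.target H q ∧ p = S.slot H pn v q' := by
  obtain ⟨g, hg, rfl⟩ := hD.exists_pos hH hτ hS hp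
  rw [hD.blk_pos hH hτ hS hg] at h
  obtain ⟨q', h1, h2, rfl⟩ := exists_moved hH hτ hS hq hg h
  exact ⟨q', h1, h2, (hD.moved q' h1).2.1⟩

theorem blk_blk {p : ℕ} (hp : p < H.M) : S.blk (S'.blk p) = S.blk p := by
  by_cases hq : ∃ q ∈ posAt H pn v, p = S.slot H pn v q
  · obtain ⟨q, hq, rfl⟩ := hq
    obtain ⟨q₀, h0, h1, -, h2⟩ := exists_first hH hτ hS hq
    rw [(hD.moved q hq).2.2.2, ← h2, (blk_slot hH hτ hS h0).2, (blk_slot hH hτ hS hq).2, h1]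
  · push Not at hq
    rw [(hD.obj_eq p hp hq).2, hS.blocks.idem p hp]

omit hD in
theorem blk_slot_le {q q' : ℕ} (hq : q ∈ posAt H pn v) (hq' : q' ∈ posAt H pn v)
    (ht : S.target H q = S.target H q') (hle : S.slot H pn v q ≤ S.slot H pn v q') :
    S.newBlk H pn v q ≤ S.newBlk H pn v q' := by
  by_cases hb : S.blk q = S.blk q'
  · exact (newBlk_eq hH hτ hS hq hq' ht hb).le
  · refine (newBlk_le q).trans (slot_lt_newBlk hH hτ hS hq hq' ht hb ?_).le
    by_contra hr
    rcases (not_lt.1 hr).lt_or_eq with h | h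
    · exact absurd (slot_lt_slot hq' ht.symm h) (by omega)
    · exact hb (by rw [rank_injOn hq' hq h])

theorem blocks : Blocks H.M S'.blk := by
  refine ⟨fun p hp => ?_, fun p hp => ?_, fun p p' hpp hp' => ?_⟩
  · by_cases hq : ∃ q ∈ posAt H pn v, p = S.slot H pn v q
    · obtain ⟨q, hq, rfl⟩ := hq
      rw [(hD.moved q hq).2.2.2]
      exact newBlk_le q
    · push Not at hq
      rw [(hD.obj_eq p hp hq).2]
      exact hS.blocks.le p hp
  · by_cases hq : ∃ q ∈ posAt H pn v, p = S.slot H pn v q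
    · obtain ⟨q, hq, rfl⟩ := hq
      obtain ⟨q₀, h0, h1, h2, h3⟩ := exists_first hH hτ hS hq
      rw [(hD.moved q hq).2.2.2, ← h3, (hD.moved q₀ h0).2.2.2, h3,
        newBlk_eq hH hτ hS h0 hq h1 h2]
    · push Not at hq
      have h1 := hS.blocks.le p hp
      rw [(hD.obj_eq p hp hq).2, (hD.obj_eq (S.blk p) (by omega) fun q hq' heq => ?_).2,
        hS.blocks.idem p hp]
      have h2 := (blk_slot hH hτ hS hq').2
      rw [← heq, hS.blocks.idem p hp] at h2
      obtain ⟨q', h3, -, h4⟩ := hD.exists_slot hH hτ hS hp hq' h2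
      exact hq q' h3 h4
  · have hp : p < H.M := by omega
    have hle : ∀ p < H.M, S'.blk p < H.M := fun p hp => by
      by_cases hq : ∃ q ∈ posAt H pn v, p = S.slot H pn v q
      · obtain ⟨q, hq, rfl⟩ := hq
        rw [(hD.moved q hq).2.2.2]
        exact (newBlk_le q).trans_lt hp
      · push Not at hq
        rw [(hD.obj_eq p hp hq).2]
        exact (hS.blocks.le p hp).trans_lt hp
    by_cases hb : S.blk p = S.blk p'
    · by_cases hq : ∃ q ∈ posAt H pn v, p = S.slot H pn v q
      · obtain ⟨q, hq, rfl⟩ := hq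
        rw [(blk_slot hH hτ hS hq).2] at hb
        obtain ⟨q', h1, h2, rfl⟩ := hD.exists_slot hH hτ hS hp' hq hb.symm
        rw [(hD.moved q hq).2.2.2, (hD.moved q' h1).2.2.2]
        exact blk_slot_le hH hτ hS hq h1 h2.symm hpp
      · push Not at hq
        rw [(hD.obj_eq p hp hq).2, (hD.obj_eq p' hp' fun q hq' heq => ?_).2, hb]
        have h2 := (blk_slot hH hτ hS hq').2
        rw [← heq, ← hb] at h2
        obtain ⟨q', h3, -, h4⟩ := hD.exists_slot hH hτ hS hp hq' h2
        exact hq q' h3 h4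
    · have h1 := hS.blocks.mono p p' hpp hp'
      rw [← hD.blk_blk hH hτ hS hp, ← hD.blk_blk hH hτ hS hp'] at h1 hb
      exact ((hS.blocks.lt_iff (hle p hp) (hle p' hp') hb).2 (by omega)).le

theorem blk_eq_of_blk_eq {p p' : ℕ} (hp : p < H.M) (hp' : p' < H.M) (h : S'.blk p = S'.blk p') :
    S.blk p = S.blk p' := by
  rw [← hD.blk_blk hH hτ hS hp, h, hD.blk_blk hH hτ hS hp']

/-- The half-edges whose links do not contain `v` are not touched. -/
theorem blk_pos_of_notMem {i : Fin m} {d : List (Fin n)} {h : ℕ} (hd : IsLink τ d)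
    (hi : I.Traverses i d) (hh : H.Starts h i d) (hv : v ∉ d) :
    S'.pos h = S.pos h ∧ S'.mate h = S.mate h ∧ S'.blk (S'.pos h) = S.blk (S.pos h) := by
  have h1 : ∀ q ∈ posAt H pn v, S.blk (S.pos h) ≠ S.target H q := by
    intro q hq heq
    obtain ⟨j, d', e', ht⟩ := exists_turn hH hτ hS hq
    have := (hS.blk_iff hd ht.link.reverse hi (traverses_reverse.2 ht.trav) hh ht.moved).1 heq
    refine hv (this ▸ List.mem_reverse.2 (List.mem_of_mem_head? ht.head))
  have h2 := hD.pos_eq h hh.lt fun q hq heq => h1 q hq (by unfold target; rw [heq])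
  refine ⟨h2.1, h2.2, ?_⟩
  rw [h2.1, (hD.obj_eq _ (hS.pos_lt h hh.lt) fun q hq heq => h1 q hq ?_).2]
  rw [heq, (blk_slot hH hτ hS hq).2]

theorem newBlk_eq_iff {q q' : ℕ} (hq : q ∈ posAt H pn v) (hq' : q' ∈ posAt H pn v) :
    S.newBlk H pn v q = S.newBlk H pn v q' ↔
      S.target H q = S.target H q' ∧ S.blk q = S.blk q' := by
  refine ⟨fun h => ?_, fun h => newBlk_eq hH hτ hS hq hq' h.1 h.2⟩
  have h1 := hD.blk_eq_of_blk_eq hH hτ hS (blk_slot hH hτ hS hq).1 (blk_slot hH hτ hS hq').1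
    (by rw [(hD.moved q hq).2.2.2, (hD.moved q' hq').2.2.2, h])
  rw [(blk_slot hH hτ hS hq).2, (blk_slot hH hτ hS hq').2] at h1
  refine ⟨h1, by_contra fun hb => ?_⟩
  rcases lt_trichotomy (S.rank H q) (S.rank H q') with hr | hr | hr
  · have h2 := slot_lt_newBlk hH hτ hS hq hq' h1 hb hr
    have h3 := newBlk_le (S := S) (H := H) (pn := pn) (v := v) q
    omega
  · exact hb (by rw [rank_injOn hq hq' hr])
  · have h2 := slot_lt_newBlk hH hτ hS hq' hq h1.symm (Ne.symm hb) hr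
    have h3 := newBlk_le (S := S) (H := H) (pn := pn) (v := v) q'
    omega

/-- A join through `v` is determined by its two links at `v`: the far end of the first fixes the old
block, and the second fixes the new block inside it. All other links keep their blocks, so the
blocks again correspond to links. -/
theorem valid : S'.Valid I H pn (τ ++ [v]) where
  pos_lt h hh := hD.pos_lt hH hτ hS hh
  obj_pos h hh := hD.obj_pos hH hτ hS hh
  obj_lt p hp := by
    obtain ⟨h, hh, rfl⟩ := hD.exists_pos hH hτ hS hp
    rwa [hD.obj_pos hH hτ hS hh]
  pos_obj p hp := by
    obtain ⟨h, hh, rfl⟩ := hD.exists_pos hH hτ hS hp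
    rw [hD.obj_pos hH hτ hS hh]
  node p hp := by
    obtain ⟨h, hh, rfl⟩ := hD.exists_pos hH hτ hS hp
    have h1 := hS.pos_lt h hh
    rw [hD.obj_pos hH hτ hS hh, hS.blk_node _ hp _ h1 (hD.blk_pos hH hτ hS hh), ← hS.node _ h1,
      hS.obj_pos h hh]
  blocks := hD.blocks hH hτ hS
  blk_node p hp p' hp' h := hS.blk_node p hp p' hp' (hD.blk_eq_of_blk_eq hH hτ hS hp hp' h)
  mate_starts := by
    intro i D h hl hi hs
    rcases isLink_split hτ.notMem hl hi with ⟨h1, h2⟩ | ⟨d, e, hd, he, hdv, hev, rfl⟩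
    · rw [(hD.blk_pos_of_notMem hH hτ hS h1 hi hs h2).2.1]
      exact hS.mate_starts h1 hi hs
    · obtain ⟨hid, hie, hne⟩ := (traverses_glue hd he hdv hev).1 hi
      obtain ⟨q, hq, ht, rfl⟩ := exists_position hH hS hd he hdv hev hne hid hie
        (hs.of_append hd.reverse)
      rw [(hD.moved q hq).2.2.1]
      have h3 := (hS.mate_starts he hie ht.starts').append (e := d.tail)
      obtain ⟨a, rfl⟩ : ∃ a, d = v :: a := ⟨_, List.eq_cons_of_mem_head? hdv⟩
      obtain ⟨b, rfl⟩ : ∃ a, e = v :: a := ⟨_, List.eq_cons_of_mem_head? hev⟩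
      simpa using h3
  blk_iff := by
    intro i j D E h h' hl hl' hi hj hs hs'
    -- A link that avoids `v` and a join through `v` already belonged to different blocks before the
    -- deletion, and blocks are only refined.
    have key : ∀ {i j : Fin m} {D : List (Fin n)} {h h' : ℕ} {d e : List (Fin n)}, IsLink τ D →
        v ∉ D → IsLink τ d → d.head? = some v → I.Traverses i D → I.Traverses j d →
        H.Starts h i D → H.Starts h' j d.reverse →
        (S'.blk (S'.pos h) = S'.blk (S'.pos h') ↔ D = d.reverse ++ e.tail) := by
      intro i j D h h' d e h1 h2 hd hdv hi hj hs hs'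
      have hvd : v ∈ d := List.mem_of_mem_head? hdv
      constructor
      · intro h3
        have h4 := hD.blk_eq_of_blk_eq hH hτ hS (hD.pos_lt hH hτ hS hs.lt)
          (hD.pos_lt hH hτ hS hs'.lt) h3
        rw [hD.blk_pos hH hτ hS hs.lt, hD.blk_pos hH hτ hS hs'.lt,
          hS.blk_iff h1 hd.reverse hi (traverses_reverse.2 hj) hs hs'] at h4
        exact absurd (h4 ▸ List.mem_reverse.2 hvd) h2
      · rintro rfl
        exact absurd (List.mem_append_left _ (List.mem_reverse.2 hvd)) h2
    rcases isLink_split hτ.notMem hl hi with ⟨h1, h2⟩ | ⟨d, e, hd, he, hdv, hev, rfl⟩ <;>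
    rcases isLink_split hτ.notMem hl' hj with ⟨h1', h2'⟩ | ⟨d', e', hd', he', hdv', hev', rfl⟩
    · rw [(hD.blk_pos_of_notMem hH hτ hS h1 hi hs h2).2.2,
        (hD.blk_pos_of_notMem hH hτ hS h1' hj hs' h2').2.2]
      exact hS.blk_iff h1 h1' hi hj hs hs'
    · exact key h1 h2 hd' hdv' hi ((traverses_glue hd' he' hdv' hev').1 hj).1 hs
        (hs'.of_append hd'.reverse)
    · rw [eq_comm, key h1' h2' hd hdv hj ((traverses_glue hd he hdv hev).1 hi).1 hs'
        (hs.of_append hd.reverse), eq_comm]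
    · obtain ⟨hid, hie, hne⟩ := (traverses_glue hd he hdv hev).1 hi
      obtain ⟨q, hq, ht, rfl⟩ := exists_position hH hS hd he hdv hev hne hid hie
        (hs.of_append hd.reverse)
      obtain ⟨hid', hie', hne'⟩ := (traverses_glue hd' he' hdv' hev').1 hj
      obtain ⟨q', hq', ht', rfl⟩ := exists_position hH hS hd' he' hdv' hev' hne' hid' hie'
        (hs'.of_append hd'.reverse)
      rw [(hD.moved q hq).2.1, (hD.moved q' hq').2.1, (hD.moved q hq).2.2.2,
        (hD.moved q' hq').2.2.2, hD.newBlk_eq_iff hH hτ hS hq hq', ht.target_eq_iff hS ht',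
        ht.blk_eq_iff hS ht' (mem_posAt.1 hq).1 (mem_posAt.1 hq').1,
        glue_inj hdv hev hdv' hev' hi]

end Deleted

end Layout

end RoutedGraph

namespace RoutedGraph

variable {n m : ℕ}

/-! ## Final positions -/

/-- The number of positions in the block with start `s`. -/
def blockSize (M : ℕ) (blk : ℕ → ℕ) (s : ℕ) : ℕ :=
  ((Finset.range M).filter (fun p => blk p = s)).card

theorem Blocks.eq_iff {M : ℕ} {blk : ℕ → ℕ} (hB : Blocks M blk) {q s : ℕ} :
    q < M ∧ blk q = s ↔ s ≤ q ∧ q < s + blockSize M blk s := by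
  constructor
  · rintro ⟨hq, rfl⟩
    have h1 := hB.le q hq
    have h2 : Finset.Icc (blk q) q ⊆ (Finset.range M).filter (fun p => blk p = blk q) := by
      intro p hp
      have hp := Finset.mem_Icc.1 hp
      exact Finset.mem_filter.2 ⟨Finset.mem_range.2 (by omega), hB.eq_of_between hp.1 hp.2 hq rfl⟩
    have h3 := Finset.card_le_card h2
    rw [Nat.card_Icc] at h3
    unfold blockSize
    omega
  · rintro ⟨h1, h2⟩
    obtain ⟨r, rfl⟩ := Nat.exists_eq_add_of_le h1
    refine hB.fill (F := (Finset.range M).filter (fun p => blk p = s)) (fun p hp => ?_)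
      (by unfold blockSize at h2; omega)
    simpa using hp

/-- The number of later positions in a block. -/
theorem Blocks.card_later {M : ℕ} {blk : ℕ → ℕ} (hB : Blocks M blk) {q : ℕ} (hq : q < M) :
    ((Finset.range M).filter (fun p => q < p ∧ blk p = blk q)).card =
      blk q + blockSize M blk (blk q) - 1 - q := by
  have : (Finset.range M).filter (fun p => q < p ∧ blk p = blk q) =
      Finset.Ioo q (blk q + blockSize M blk (blk q)) := by
    ext p
    have h1 := hB.eq_iff (q := p) (s := blk q)
    have h2 := hB.le q hq
    simp only [Finset.mem_filter, Finset.mem_range, Finset.mem_Ioo]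
    constructor
    · rintro ⟨h3, h4, h5⟩
      exact ⟨h4, (h1.1 ⟨h3, h5⟩).2⟩
    · rintro ⟨h3, h4⟩
      have h5 := h1.2 ⟨by omega, h4⟩
      exact ⟨h5.1, h3, h5.2⟩
  rw [this, Nat.card_Ioo]
  omega

/-- The half-edge `h` is at a node that is not in `τ`. -/
def HalfEdges.Live (H : HalfEdges) (τ : List (Fin n)) (h : ℕ) : Prop :=
  h < H.M ∧ ∀ u ∈ τ, H.nd h ≠ u

namespace Layout

section Mate

variable {S : Layout} {H : HalfEdges} {pn : ℕ → ℕ} {I : RoutedGraph n m} {τ : List (Fin n)}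
  (hH : H.Valid I) (hτ : I.IsPartialDeletion τ) (hS : S.Valid I H pn τ)

include hH hτ hS

theorem exists_mate {h : ℕ} (hh : H.Live τ h) : ∃ i x l y, IsLink τ (x :: (l ++ [y])) ∧
    I.Traverses i (x :: (l ++ [y])) ∧ H.Starts h i (x :: (l ++ [y])) ∧ H.nd h = x ∧
      H.Starts (S.mate h) i (y :: (l.reverse ++ [x])) ∧ H.nd (S.mate h) = y ∧ y ∉ τ ∧ x ≠ y := by
  obtain ⟨_, x, _, hx, -⟩ := hH.exists_path h hh.1
  obtain ⟨i, d, hd, hdx, hi, hs⟩ := hH.exists_link hτ.2 hh.1 hx.2.2.1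
    fun hx' => hh.2 x hx' hx.2.2.1
  have hm := hS.mate_starts hd hi hs
  obtain ⟨x', l, y, rfl, h1, h2, h3⟩ := hd
  obtain rfl : x' = x := by simpa using hdx
  have hn := hi.nodup
  refine ⟨i, x', l, y, ⟨x', l, y, rfl, h1, h2, h3⟩, hi, hs, hx.2.2.1, by simpa using hm,
    hm.nd (by simp), h2, ?_⟩
  rintro rfl
  simp at hn

theorem live_mate {h : ℕ} (hh : H.Live τ h) : H.Live τ (S.mate h) := by
  obtain ⟨i, x, l, y, -, -, -, -, h1, h2, h3, -⟩ := exists_mate hH hτ hS hh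
  refine ⟨h1.lt, fun u hu heq => h3 ?_⟩
  rwa [← Fin.ext (heq.symm.trans h2)]

theorem lab_mate {h : ℕ} (hh : H.Live τ h) : H.lab (S.mate h) = H.lab h := by
  obtain ⟨i, x, l, y, -, -, h0, -, h1, -⟩ := exists_mate hH hτ hS hh
  rw [h0.lab, h1.lab]

theorem nd_mate_ne {h : ℕ} (hh : H.Live τ h) : H.nd (S.mate h) ≠ H.nd h := by
  obtain ⟨i, x, l, y, -, -, -, h1, -, h2, -, h3⟩ := exists_mate hH hτ hS hh
  rw [h1, h2]
  exact fun h => h3 (Fin.ext h.symm)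

theorem mate_mate {h : ℕ} (hh : H.Live τ h) : S.mate (S.mate h) = h := by
  obtain ⟨i, x, l, y, h1, h2, h3, -, h4, -⟩ := exists_mate hH hτ hS hh
  have h5 : (x :: (l ++ [y])).reverse = y :: (l.reverse ++ [x]) := by simp
  have := hS.mate_starts h1.reverse (traverses_reverse.2 h2) (h5 ▸ h4)
  rw [List.reverse_reverse] at this
  exact hH.starts_unique this h3

omit hH hτ in
theorem nd_eq_of_blk {h h' : ℕ} (hh : h < H.M) (hh' : h' < H.M)
    (hb : S.blk (S.pos h) = S.blk (S.pos h')) : H.nd h = H.nd h' := by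
  have h1 := hS.pos_lt h hh
  have h2 := hS.pos_lt h' hh'
  rw [← hS.obj_pos h hh, ← hS.obj_pos h' hh', hS.node _ h1, hS.node _ h2]
  exact hS.blk_node _ h1 _ h2 hb

omit hH hτ in
theorem live_of_blk {h h' : ℕ} (hh : H.Live τ h) (hh' : h' < H.M)
    (hb : S.blk (S.pos h) = S.blk (S.pos h')) : H.Live τ h' :=
  ⟨hh', fun u hu => (nd_eq_of_blk hS hh.1 hh' hb) ▸ hh.2 u hu⟩

theorem blk_mate {h h' : ℕ} (hh : H.Live τ h) (hh' : h' < H.M)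
    (hb : S.blk (S.pos h) = S.blk (S.pos h')) :
    S.blk (S.pos (S.mate h)) = S.blk (S.pos (S.mate h')) := by
  obtain ⟨i, x, l, y, h1, h2, h3, -, h4, -⟩ := exists_mate hH hτ hS hh
  obtain ⟨i', x', l', y', h1', h2', h3', -, h4', -⟩ :=
    exists_mate hH hτ hS (live_of_blk hS hh hh' hb)
  have h5 := (hS.blk_iff h1 h1' h2 h2' h3 h3').1 hb
  have e1 : y :: (l.reverse ++ [x]) = (x :: (l ++ [y])).reverse := by simp
  have e2 : y' :: (l'.reverse ++ [x']) = (x' :: (l' ++ [y'])).reverse := by simp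
  rw [e1] at h4
  rw [e2] at h4'
  exact (hS.blk_iff h1.reverse h1'.reverse (traverses_reverse.2 h2) (traverses_reverse.2 h2') h4
    h4').2 (by rw [h5])

/-- `mate` is an involution on live half-edges and maps the block of a link to the block of the
reversed link. -/
theorem blockSize_mate {h : ℕ} (hh : H.Live τ h) :
    blockSize H.M S.blk (S.blk (S.pos h)) = blockSize H.M S.blk (S.blk (S.pos (S.mate h))) := by
  have key : ∀ h, H.Live τ h → blockSize H.M S.blk (S.blk (S.pos h)) ≤
      blockSize H.M S.blk (S.blk (S.pos (S.mate h))) := by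
    intro h hh
    have hp : ∀ p ∈ (Finset.range H.M).filter (fun p => S.blk p = S.blk (S.pos h)),
        p < H.M ∧ S.obj p < H.M ∧ S.blk (S.pos h) = S.blk (S.pos (S.obj p)) := by
      intro p hp
      obtain ⟨h1, h2⟩ := Finset.mem_filter.1 hp
      rw [Finset.mem_range] at h1
      exact ⟨h1, hS.obj_lt p h1, by rw [hS.pos_obj p h1, h2]⟩
    refine Finset.card_le_card_of_injOn (fun p => S.pos (S.mate (S.obj p))) ?_ ?_
    · intro p hp'
      obtain ⟨h1, h2, h3⟩ := hp p hp'
      have h4 := live_mate hH hτ hS (live_of_blk hS hh h2 h3)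
      exact Finset.mem_coe.2 (Finset.mem_filter.2 ⟨Finset.mem_range.2 (hS.pos_lt _ h4.1),
        (blk_mate hH hτ hS hh h2 h3).symm⟩)
    · intro p hp1 q hq1 heq
      obtain ⟨h1, h2, h3⟩ := hp p hp1
      obtain ⟨h1', h2', h3'⟩ := hp q hq1
      have l1 := live_of_blk hS hh h2 h3
      have l2 := live_of_blk hS hh h2' h3'
      have h4 := congrArg S.obj heq
      dsimp only at h4
      rw [hS.obj_pos _ (live_mate hH hτ hS l1).1, hS.obj_pos _ (live_mate hH hτ hS l2).1] at h4
      have h5 := congrArg S.mate h4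
      rw [mate_mate hH hτ hS l1, mate_mate hH hτ hS l2] at h5
      rw [← hS.pos_obj p h1, h5, hS.pos_obj q h1']
  refine le_antisymm (key h hh) ?_
  have := key _ (live_mate hH hτ hS hh)
  rwa [mate_mate hH hτ hS hh] at this

end Mate

/-- An arrangement of the half-edges that keeps them at their nodes. -/
structure Placement (H : HalfEdges) (pn : ℕ → ℕ) (fp : ℕ → ℕ) : Prop where
  lt : ∀ h < H.M, fp h < H.M
  inj : ∀ h < H.M, ∀ h' < H.M, fp h = fp h' → h = h'
  node : ∀ h < H.M, pn (fp h) = H.nd h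

/-- The arrangement keeps the half-edges in their blocks. -/
def Agrees (S : Layout) (H : HalfEdges) (τ : List (Fin n)) (fp : ℕ → ℕ) : Prop :=
  ∀ h, H.Live τ h → S.blk (fp h) = S.blk (S.pos h)

/-- The block of `h` is arranged in reverse order at the other end. -/
def Mirrored (S : Layout) (H : HalfEdges) (fp : ℕ → ℕ) (h : ℕ) : Prop :=
  ∀ h' < H.M, S.blk (S.pos h) = S.blk (S.pos h') →
    (fp h < fp h' ↔ fp (S.mate h') < fp (S.mate h))

/-- Rearrange the blocks at `v` according to their other ends. -/
def mirror (S : Layout) (H : HalfEdges) (v : Fin n) (fp : ℕ → ℕ) (h : ℕ) : ℕ :=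
  if H.nd h = v then S.blk (S.pos h) + blockSize H.M S.blk (S.blk (S.pos h)) - 1 -
    (fp (S.mate h) - S.blk (S.pos (S.mate h))) else fp h

section Mirror

variable {S : Layout} {H : HalfEdges} {pn : ℕ → ℕ} {I : RoutedGraph n m} {τ : List (Fin n)}
  {v : Fin n} {fp : ℕ → ℕ} (hH : H.Valid I) (hτ : I.IsPartialDeletion τ) (hS : S.Valid I H pn τ)
  (hv : v ∉ τ) (hp : Placement H pn fp)
  (ha : ∀ h, H.Live τ h → H.nd h ≠ v → S.blk (fp h) = S.blk (S.pos h))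

omit hH hτ hS in
theorem mirror_of_ne {h : ℕ} (h1 : H.nd h ≠ v) : S.mirror H v fp h = fp h := if_neg h1

include hH hτ hS hv hp ha

/-- The mirrored position reflects the position of the mate, inside a block of the same size. The
additive form of the equation removes the truncated subtractions from all later arguments. -/
theorem mirror_spec {h : ℕ} (hh : h < H.M) (h1 : H.nd h = v) : H.Live τ h ∧
    S.mirror H v fp h + 1 + fp (S.mate h) =
      S.blk (S.pos h) + blockSize H.M S.blk (S.blk (S.pos h)) + S.blk (S.pos (S.mate h)) ∧
    S.blk (S.pos h) ≤ S.mirror H v fp h ∧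
    S.mirror H v fp h < S.blk (S.pos h) + blockSize H.M S.blk (S.blk (S.pos h)) ∧
    H.nd (S.mate h) ≠ v := by
  have hl : H.Live τ h := ⟨hh, fun u hu heq => hv (by rwa [Fin.ext (h1.symm.trans heq)])⟩
  have hm := live_mate hH hτ hS hl
  have h3 := nd_mate_ne hH hτ hS hl
  have h2 := hS.blocks.eq_iff.1 ⟨hp.lt _ hm.1, ha _ hm (by rwa [h1] at h3)⟩
  rw [← blockSize_mate hH hτ hS hl] at h2
  unfold mirror
  rw [if_pos h1]
  refine ⟨hl, ?_, ?_, ?_, by rwa [h1] at h3⟩ <;> omega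

theorem agrees_mirror : S.Agrees H τ (S.mirror H v fp) := by
  intro h hh
  by_cases h1 : H.nd h = v
  · have := mirror_spec hH hτ hS hv hp ha hh.1 h1
    exact (hS.blocks.eq_iff.2 ⟨this.2.2.1, this.2.2.2.1⟩).2
  · rw [mirror_of_ne h1]
    exact ha h hh h1

theorem placement_mirror : Placement H pn (S.mirror H v fp) := by
  have hlt : ∀ h < H.M, S.mirror H v fp h < H.M := by
    intro h hh
    by_cases h1 : H.nd h = v
    · have := mirror_spec hH hτ hS hv hp ha hh h1
      exact (hS.blocks.eq_iff.2 ⟨this.2.2.1, this.2.2.2.1⟩).1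
    · rw [mirror_of_ne h1]
      exact hp.lt h hh
  have hnode : ∀ h < H.M, pn (S.mirror H v fp h) = H.nd h := by
    intro h hh
    by_cases h1 : H.nd h = v
    · have := mirror_spec hH hτ hS hv hp ha hh h1
      have h2 := hS.pos_lt h hh
      rw [hS.blk_node _ (hlt h hh) _ h2 (agrees_mirror hH hτ hS hv hp ha h this.1),
        ← hS.node _ h2, hS.obj_pos h hh]
    · rw [mirror_of_ne h1]
      exact hp.node h hh
  refine ⟨hlt, fun h hh h' hh' heq => ?_, hnode⟩
  have h0 : H.nd h = H.nd h' := by rw [← hnode h hh, heq, hnode h' hh']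
  by_cases h1 : H.nd h = v
  · have a1 := mirror_spec hH hτ hS hv hp ha hh h1
    have a2 := mirror_spec hH hτ hS hv hp ha hh' (h0 ▸ h1)
    have hb := agrees_mirror hH hτ hS hv hp ha h a1.1
    rw [heq, agrees_mirror hH hτ hS hv hp ha h' a2.1] at hb
    have e1 := blk_mate hH hτ hS a1.1 hh' hb.symm
    rw [hb] at a2
    have := hp.inj _ (live_mate hH hτ hS a1.1).1 _ (live_mate hH hτ hS a2.1).1 (by omega)
    rw [← mate_mate hH hτ hS a1.1, this, mate_mate hH hτ hS a2.1]
  · rw [mirror_of_ne h1, mirror_of_ne (h0 ▸ h1)] at heq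
    exact hp.inj h hh h' hh' heq

theorem mirrored_mirror {h : ℕ} (hh : H.Live τ h) (h1 : H.nd h = v ∨ H.nd (S.mate h) = v) :
    S.Mirrored H (S.mirror H v fp) h := by
  have key : ∀ h h', H.Live τ h → H.nd h = v → h' < H.M → S.blk (S.pos h) = S.blk (S.pos h') →
      (S.mirror H v fp h < S.mirror H v fp h' ↔
        S.mirror H v fp (S.mate h') < S.mirror H v fp (S.mate h)) := by
    intro h h' hh h1 hh' hb
    have a1 := mirror_spec hH hτ hS hv hp ha hh.1 h1
    have a2 := mirror_spec hH hτ hS hv hp ha hh' (nd_eq_of_blk hS hh.1 hh' hb ▸ h1)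
    rw [← blk_mate hH hτ hS a1.1 hh' hb, ← hb] at a2
    rw [mirror_of_ne a1.2.2.2.2, mirror_of_ne a2.2.2.2.2]
    omega
  intro h' hh' hb
  rcases h1 with h1 | h1
  · exact key h h' hh h1 hh' hb
  · have hl' := live_of_blk hS hh hh' hb
    have hm := blk_mate hH hτ hS hh hh' hb
    have lm := live_mate hH hτ hS hh
    have lm' := live_mate hH hτ hS hl'
    have := key _ _ lm' (by rwa [← nd_eq_of_blk hS lm.1 lm'.1 hm]) lm.1 hm.symm
    rw [mate_mate hH hτ hS hh, mate_mate hH hτ hS hl'] at this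
    exact this.symm

omit ha hv hp in
theorem Mirrored.mirror {h : ℕ} (hm : S.Mirrored H fp h) (hh : H.Live τ h) (h1 : H.nd h ≠ v)
    (h2 : H.nd (S.mate h) ≠ v) : S.Mirrored H (S.mirror H v fp) h := by
  intro h' hh' hb
  have hl' := live_of_blk hS hh hh' hb
  have h3 := nd_eq_of_blk hS hh.1 hh' hb
  have h4 := nd_eq_of_blk hS (live_mate hH hτ hS hh).1 (live_mate hH hτ hS hl').1
    (blk_mate hH hτ hS hh hh' hb)
  rw [mirror_of_ne h1, mirror_of_ne h2, mirror_of_ne (h3 ▸ h1), mirror_of_ne (h4 ▸ h2)]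
  exact hm h' hh' hb

/-- Copying the blocks at `v` from their other ends, in reverse order. -/
theorem copy_spec {out out' : ℕ → ℕ} (ho : ∀ h < H.M, out (fp h) = H.lab h)
    (h1 : ∀ q ∈ posAt H pn v, out' q = out (S.blk (S.pos (S.mate (S.obj q))) +
      ((posAt H pn v).filter (fun p => q < p ∧ S.blk p = S.blk q)).card))
    (h2 : ∀ q < H.M, q ∉ posAt H pn v → out' q = out q) :
    ∀ h < H.M, out' (S.mirror H v fp h) = H.lab h := by
  intro h hh
  have hp' := placement_mirror hH hτ hS hv hp ha
  have hlt := hp'.lt h hh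
  have hnode := hp'.node h hh
  by_cases h3 : H.nd h = v
  · have a1 := mirror_spec hH hτ hS hv hp ha hh h3
    have hb := agrees_mirror hH hτ hS hv hp ha h a1.1
    have hb' : S.blk (S.pos h) = S.blk (S.pos (S.obj (S.mirror H v fp h))) := by
      rw [hS.pos_obj _ hlt, hb]
    rw [h1 _ (mem_posAt.2 ⟨hlt, by rw [hnode, h3]⟩),
      ← blk_mate hH hτ hS a1.1 (hS.obj_lt _ hlt) hb']
    have hc : (posAt H pn v).filter (fun p => S.mirror H v fp h < p ∧
        S.blk p = S.blk (S.mirror H v fp h)) = (Finset.range H.M).filter (fun p =>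
        S.mirror H v fp h < p ∧ S.blk p = S.blk (S.mirror H v fp h)) := by
      ext p
      simp only [Finset.mem_filter, mem_posAt, Finset.mem_range]
      constructor
      · rintro ⟨h4, h5⟩
        exact ⟨h4.1, h5⟩
      · rintro ⟨h4, h5⟩
        exact ⟨⟨h4, by rw [hS.blk_node _ h4 _ hlt h5.2, hnode, h3]⟩, h5⟩
    rw [hc, hS.blocks.card_later hlt, hb]
    have hm := live_mate hH hτ hS a1.1
    -- The number of positions of the block behind the mirrored one equals the offset of the mate in
    -- its own block, so the word read is the one at the mate's position.
    have e : S.blk (S.pos (S.mate h)) + (S.blk (S.pos h) +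
        blockSize H.M S.blk (S.blk (S.pos h)) - 1 - S.mirror H v fp h) = fp (S.mate h) := by
      have := hS.blocks.eq_iff.1 ⟨hp.lt _ hm.1, ha _ hm a1.2.2.2.2⟩
      omega
    rw [e, ho _ hm.1, lab_mate hH hτ hS a1.1]
  · rw [h2 _ hlt fun h4 => h3 (hnode ▸ (mem_posAt.1 h4).2), mirror_of_ne h3]
    exact ho h hh

end Mirror

end Layout

end RoutedGraph

namespace RoutedGraph

variable {n m : ℕ}

/-! ## Deletion of the nonterminal nodes in increasing order -/

open Classical in
/-- The nonterminal nodes below `k`, in increasing order. -/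
noncomputable def dead (I : RoutedGraph n m) : ℕ → List (Fin n)
  | 0 => []
  | k + 1 => if h : ∃ hk : k < n, ¬ ∃ i, I.TerminalOf i ⟨k, hk⟩ then dead I k ++ [⟨k, h.1⟩]
      else dead I k

section Dead

variable {I : RoutedGraph n m}

theorem dead_succ {v : Fin n} (hv : ¬ ∃ i, I.TerminalOf i v) :
    I.dead (v + 1) = I.dead v ++ [v] := by
  rw [dead, dif_pos ⟨v.2, hv⟩]

theorem dead_succ_of_terminal {v : Fin n} (hv : ∃ i, I.TerminalOf i v) :
    I.dead (v + 1) = I.dead v := by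
  rw [dead, dif_neg]
  rintro ⟨_, h⟩
  exact h hv

theorem mem_dead {k : ℕ} {u : Fin n} : u ∈ I.dead k ↔ u < k ∧ ¬ ∃ i, I.TerminalOf i u := by
  induction k with
  | zero => simp [dead]
  | succ k ih =>
    rw [dead]
    split_ifs with h
    · rw [List.mem_append, ih, List.mem_singleton]
      constructor
      · rintro (h1 | rfl)
        · exact ⟨by omega, h1.2⟩
        · exact ⟨Nat.lt_succ_self k, h.2⟩
      · rintro ⟨h1, h2⟩
        rcases Nat.lt_succ_iff_lt_or_eq.1 h1 with h3 | h3
        · exact .inl ⟨h3, h2⟩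
        · exact .inr (Fin.ext h3)
    · rw [ih]
      refine ⟨fun h1 => ⟨by omega, h1.2⟩, fun h1 => ⟨?_, h1.2⟩⟩
      by_contra h2
      obtain rfl : k = u := by omega
      exact h ⟨u.2, h1.2⟩

theorem nodup_dead (k : ℕ) : (I.dead k).Nodup := by
  induction k with
  | zero => simp [dead]
  | succ k ih =>
    rw [dead]
    split_ifs with h
    · refine List.nodup_append.2 ⟨ih, by simp, ?_⟩
      rintro a ha b hb rfl
      rw [List.mem_singleton.1 hb] at ha
      exact lt_irrefl _ (mem_dead.1 ha).1
    · exact ih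

theorem isDeletionOrder_dead : I.IsDeletionOrder (I.dead n) :=
  ⟨nodup_dead n, fun v => by simp [mem_dead]⟩

theorem isPartialDeletion_dead (k : ℕ) : I.IsPartialDeletion (I.dead k) :=
  ⟨nodup_dead k, fun _ hu i hi => (mem_dead.1 hu).2 ⟨i, hi⟩⟩

theorem dead_prefix {k l : ℕ} (h : k ≤ l) : I.dead k <+: I.dead l := by
  induction l, h using Nat.le_induction with
  | base => exact List.prefix_rfl
  | succ l _ ih =>
    rw [dead]
    split_ifs
    · exact ih.trans (List.prefix_append _ _)
    · exact ih

theorem eq_dead {τ ρ : List (Fin n)} {v : Fin n} (h : I.dead n = τ ++ v :: ρ) : τ = I.dead v := by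
  have hv : v ∈ I.dead n := by rw [h]; simp
  have h1 := (mem_dead.1 hv).2
  obtain ⟨ρ', h2⟩ := dead_prefix (I := I) (show (v : ℕ) + 1 ≤ n from v.2)
  rw [dead_succ h1, h, List.append_assoc, List.singleton_append] at h2
  exact (List.append_cons_inj_of_nodup h2.symm (by rw [← h]; exact nodup_dead n)).1

end Dead

namespace Layout

/-- A sequence of layouts that describe the deletion of the nonterminal nodes below `k`. -/
structure Chain (I : RoutedGraph n m) (H : HalfEdges) (pn : ℕ → ℕ) (S : ℕ → Layout) (k : ℕ) :
    Prop where
  init : (S 0).Valid I H pn []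
  deleted : ∀ v : Fin n, v < k → (¬ ∃ i, I.TerminalOf i v) → Deleted (S v) H pn v (S (v + 1))
  kept : ∀ v : Fin n, v < k → (∃ i, I.TerminalOf i v) → S (v + 1) = S v

section Chain

variable {I : RoutedGraph n m} {H : HalfEdges} {pn : ℕ → ℕ} {S : ℕ → Layout} {k : ℕ}
  (hH : H.Valid I) (hC : Chain I H pn S k)

include hC

omit hC in
theorem isPartialDeletion_dead_append {v : Fin n} (hv : ¬ ∃ i, I.TerminalOf i v) :
    I.IsPartialDeletion (I.dead v ++ [v]) := by
  rw [← dead_succ hv]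
  exact isPartialDeletion_dead _

include hH in
theorem Chain.valid (hk : k ≤ n) {j : ℕ} (hj : j ≤ k) : (S j).Valid I H pn (I.dead j) := by
  induction j with
  | zero => exact hC.init
  | succ j ih =>
    have ih := ih (by omega)
    by_cases ht : ∃ i, I.TerminalOf i ⟨j, by omega⟩
    · have h1 := hC.kept ⟨j, by omega⟩ hj ht
      have h2 := dead_succ_of_terminal ht
      dsimp only at h1 h2
      rw [h1, h2]
      exact ih
    · have h1 := hC.deleted ⟨j, by omega⟩ hj ht
      have h2 := dead_succ ht
      have h3 := isPartialDeletion_dead (I := I) (j + 1)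
      dsimp only at h1 h2
      rw [h2] at h3 ⊢
      exact h1.valid hH h3 ih

theorem Chain.succ {S' : Layout} {v : Fin n} (hv : (v : ℕ) = k)
    (h : (¬ ∃ i, I.TerminalOf i v) → Deleted (S k) H pn v S')
    (h' : (∃ i, I.TerminalOf i v) → S' = S k) :
    Chain I H pn (Function.update S (k + 1) S') (k + 1) := by
  have h0 : ∀ j ≤ k, Function.update S (k + 1) S' j = S j := fun j hj =>
    Function.update_of_ne (by omega) _ _
  refine ⟨by rw [h0 0 (by omega)]; exact hC.init, fun u hu ht => ?_, fun u hu ht => ?_⟩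
  · rcases Nat.lt_succ_iff_lt_or_eq.1 hu with h1 | h1
    · rw [h0 _ (by omega), h0 _ (by omega)]
      exact hC.deleted u h1 ht
    · obtain rfl : u = v := Fin.ext (by omega)
      rw [h0 _ (by omega), ← hv, Function.update_self, hv]
      exact h ht
  · rcases Nat.lt_succ_iff_lt_or_eq.1 hu with h1 | h1
    · rw [h0 _ (by omega), h0 _ (by omega)]
      exact hC.kept u h1 ht
    · obtain rfl : u = v := Fin.ext (by omega)
      rw [h0 u (by omega), hv, Function.update_self]
      exact h' ht

end Chain

section Deleted

variable {S S' : Layout} {H : HalfEdges} {pn : ℕ → ℕ} {I : RoutedGraph n m} {τ : List (Fin n)}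
  {v : Fin n} {fp : ℕ → ℕ} (hH : H.Valid I) (hτ : I.IsPartialDeletion (τ ++ [v]))
  (hS : S.Valid I H pn τ) (hD : Deleted S H pn v S')

include hH hτ hS hD

/-- The blocks at deleted nodes do not change any more. -/
theorem Deleted.blk_eq {q : ℕ} (hq : q < H.M) {u : Fin n} (hu : u ∈ τ ++ [v]) (hqu : pn q = u) :
    S'.blk q = S.blk q := by
  refine (hD.obj_eq q hq ?_).2
  rintro p hp rfl
  obtain ⟨i, d, e, ht⟩ := exists_turn hH hτ hS hp
  have h1 := blk_slot hH hτ hS hp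
  obtain ⟨x, l, y, rfl, h3, h4, -⟩ := ht.link
  obtain rfl : x = v := by simpa using ht.head
  have h5 := ht.moved.nd (x := y) (by simp)
  have h6 := hS.pos_lt _ ht.moved.lt
  have h7 := hS.node _ h6
  rw [hS.obj_pos _ ht.moved.lt, h5, ← hS.blk_node _ h1.1 _ h6 h1.2, hqu] at h7
  obtain rfl : y = u := Fin.ext h7
  have hn := ht.trav.nodup
  rcases List.mem_append.1 hu with h | h
  · exact h4 h
  · rw [List.mem_singleton] at h
    simp [h] at hn

/-- Blocks are only refined by deletions, so an arrangement that keeps the new blocks keeps the old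
ones, except at `v`, where the new layout says nothing. -/
theorem Deleted.agrees (ha : S'.Agrees H (τ ++ [v]) fp) (hp : Placement H pn fp) {h : ℕ}
    (hh : H.Live τ h) (hv : H.nd h ≠ v) : S.blk (fp h) = S.blk (S.pos h) := by
  rw [hD.blk_eq_of_blk_eq hH hτ hS (hp.lt h hh.1) (hD.pos_lt hH hτ hS hh.1) (ha h ⟨hh.1, ?_⟩),
    hD.blk_pos hH hτ hS hh.1]
  intro u hu
  rcases List.mem_append.1 hu with h | h
  · exact hh.2 u h
  · rwa [List.mem_singleton.1 h]

/-- A link of `S` has its inner nodes in `τ`. If no end is `v`, it avoids `v`, and its mates and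
blocks are the same in both layouts. -/
theorem Deleted.mirrored {h : ℕ} (hm : S'.Mirrored H fp h) (hh : H.Live τ h) (h1 : H.nd h ≠ v)
    (h2 : H.nd (S.mate h) ≠ v) : S.Mirrored H fp h := by
  have hτ' := hτ.of_append
  have key : ∀ h, H.Live τ h → H.nd h ≠ v → H.nd (S.mate h) ≠ v →
      S'.mate h = S.mate h ∧ S'.blk (S'.pos h) = S.blk (S.pos h) := by
    intro h hh h1 h2
    obtain ⟨i, x, l, y, hl, hi, hs, hx, -, hy, -⟩ := exists_mate hH hτ' hS hh
    refine (hD.blk_pos_of_notMem hH hτ hS hl hi hs fun hv => ?_).2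
    rcases List.mem_cons.1 hv with rfl | hv
    · exact h1 hx
    · rcases List.mem_append.1 hv with hv | hv
      · obtain ⟨x', l', y', heq, -, -, h5⟩ := hl
        simp only [List.cons.injEq] at heq
        have := List.append_inj_left' heq.2 rfl
        exact hτ.notMem (h5 v (this ▸ hv))
      · rw [List.mem_singleton.1 hv] at h2
        exact h2 hy
  intro h' hh' hb
  have hl' := live_of_blk hS hh hh' hb
  have h3 := nd_eq_of_blk hS hh.1 hh' hb
  have h4 := nd_eq_of_blk hS (live_mate hH hτ' hS hh).1 (live_mate hH hτ' hS hl').1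
    (blk_mate hH hτ' hS hh hh' hb)
  obtain ⟨k1, k2⟩ := key h hh h1 h2
  obtain ⟨k3, k4⟩ := key h' hl' (h3 ▸ h1) (h4 ▸ h2)
  rw [← k1, ← k3]
  exact hm h' hh' (by rw [k2, k4, hb])

end Deleted

/-- The arrangement `fp` resolves all blocks of the layouts from number `k` on. -/
structure Resolved (I : RoutedGraph n m) (H : HalfEdges) (pn : ℕ → ℕ) (S : ℕ → Layout) (k : ℕ)
    (fp : ℕ → ℕ) : Prop where
  placement : Placement H pn fp
  agrees : ∀ j, k ≤ j → j ≤ n → (S j).Agrees H (I.dead j) fp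
  mirrored : ∀ j, k ≤ j → j ≤ n → ∀ h, H.Live (I.dead j) h → (S j).Mirrored H fp h

/-! ### Resolved arrangements have no crossings of paths that share a link -/

section Resolved

variable {I : RoutedGraph n m} {H : HalfEdges} {pn : ℕ → ℕ} {S : ℕ → Layout} {fp : ℕ → ℕ}
  (hH : H.Valid I) (hC : Chain I H pn S n)

omit hH in
include hC in
theorem Resolved.of_terminal {v : Fin n} (hR : Resolved I H pn S (v + 1) fp)
    (hv : ∃ i, I.TerminalOf i v) : Resolved I H pn S v fp := by
  have h1 := hC.kept v v.2 hv
  have h2 := dead_succ_of_terminal hv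
  refine ⟨hR.placement, fun j hj hjn => ?_, fun j hj hjn => ?_⟩
  · rcases hj.eq_or_lt with rfl | hj
    · rw [← h1, ← h2]
      exact hR.agrees _ le_rfl v.2
    · exact hR.agrees j hj hjn
  · rcases hj.eq_or_lt with rfl | hj
    · rw [← h1, ← h2]
      exact hR.mirrored _ le_rfl v.2
    · exact hR.mirrored j hj hjn

include hH hC

/-- Only half-edges at `v` are rearranged, and they are not live in the layouts after number `v`, so
those remain resolved. In layout `v` itself, the links with an end at `v` become mirrored by
construction, and the others were already links of the next layout. -/
theorem Resolved.mirror {v : Fin n} (hR : Resolved I H pn S (v + 1) fp)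
    (hv : ¬ ∃ i, I.TerminalOf i v) : Resolved I H pn S v ((S v).mirror H v fp) ∧
      ∀ out out' : ℕ → ℕ, (∀ h < H.M, out (fp h) = H.lab h) →
      (∀ q ∈ posAt H pn v, out' q = out ((S v).blk ((S v).pos ((S v).mate ((S v).obj q))) +
        ((posAt H pn v).filter (fun p => q < p ∧ (S v).blk p = (S v).blk q)).card)) →
      (∀ q < H.M, q ∉ posAt H pn v → out' q = out q) →
      ∀ h < H.M, out' ((S v).mirror H v fp h) = H.lab h := by
  have hτ := isPartialDeletion_dead_append hv
  have hS := hC.valid hH le_rfl v.2.le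
  have hD := hC.deleted v v.2 hv
  have hds := dead_succ hv
  have ha : ∀ h, H.Live (I.dead v) h → H.nd h ≠ v → (S v).blk (fp h) = (S v).blk ((S v).pos h) :=
    fun h hh hv' => hD.agrees hH hτ hS (hds ▸ hR.agrees _ le_rfl v.2) hR.placement hh hv'
  have hlive : ∀ j, (v : ℕ) < j → ∀ h, H.Live (I.dead j) h → H.nd h ≠ v := fun j hj h hh =>
    hh.2 v (mem_dead.2 ⟨hj, hv⟩)
  refine ⟨⟨placement_mirror hH hτ.of_append hS hτ.notMem hR.placement ha, fun j hj hjn => ?_,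
    fun j hj hjn h hh => ?_⟩, fun out out' ho h1 h2 => copy_spec hH hτ.of_append hS hτ.notMem
      hR.placement ha ho h1 h2⟩
  · rcases hj.eq_or_lt with rfl | hj
    · exact agrees_mirror hH hτ.of_append hS hτ.notMem hR.placement ha
    · intro h hh
      rw [mirror_of_ne (hlive j hj h hh)]
      exact hR.agrees j hj hjn h hh
  · rcases hj.eq_or_lt with rfl | hj
    · by_cases h1 : H.nd h = v ∨ H.nd ((S v).mate h) = v
      · exact mirrored_mirror hH hτ.of_append hS hτ.notMem hR.placement ha hh h1
      · rw [not_or] at h1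
        refine Mirrored.mirror hH hτ.of_append hS ?_ hh h1.1 h1.2
        refine hD.mirrored hH hτ hS (hR.mirrored _ le_rfl v.2 h ⟨hh.1, fun u hu => ?_⟩) hh h1.1 h1.2
        rw [hds] at hu
        rcases List.mem_append.1 hu with h | h
        · exact hh.2 u h
        · rw [List.mem_singleton.1 h]
          exact h1.1
    · have hSj := hC.valid hH le_rfl hjn
      have hj' := isPartialDeletion_dead (I := I) j
      intro h' hh' hb
      have hl' := live_of_blk hSj hh hh' hb
      rw [mirror_of_ne (hlive j hj h hh), mirror_of_ne (hlive j hj h' hl'),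
        mirror_of_ne (hlive j hj _ (live_mate hH hj' hSj hh)),
        mirror_of_ne (hlive j hj _ (live_mate hH hj' hSj hl'))]
      exact hR.mirrored j hj hjn h hh h' hh' hb

/-- If two paths share the link `d` at `v`, the order in which their half-edges are arranged. -/
theorem Resolved.arrangement (hR : Resolved I H pn S 0 fp) {v : Fin n}
    (hv : ¬ ∃ i, I.TerminalOf i v) {i j : Fin m} {d e f : List (Fin n)} {a b a' b' : ℕ}
    (hd : IsLink (I.dead v) d) (he : IsLink (I.dead v) e) (hf : IsLink (I.dead v) f)
    (hdv : d.head? = some v) (hev : e.head? = some v) (hfv : f.head? = some v)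
    (hed : e ≠ d) (hfd : f ≠ d) (hid : I.Traverses i d) (hie : I.Traverses i e)
    (hjd : I.Traverses j d) (hjf : I.Traverses j f) (ha : H.Starts a i d) (hb : H.Starts b i e)
    (ha' : H.Starts a' j d) (hb' : H.Starts b' j f) (hlt : fp a < fp a') :
    fp b' < fp b ∧ (fp a' < fp b' ∨ fp b < fp a) ∨ fp b < fp a ∧ fp a' < fp b' := by
  have hτ := isPartialDeletion_dead_append hv
  have hτ' := hτ.of_append
  have hS := hC.valid hH le_rfl v.2.le
  have hS' := hC.valid hH le_rfl (j := v + 1) v.2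
  have hD := hC.deleted v v.2 hv
  have hp := hR.placement
  have live : ∀ {k : Fin m} {c : List (Fin n)} {g : ℕ}, IsLink (I.dead v) c → H.Starts g k c →
      H.Live (I.dead v) g := by
    intro k c g hc hg
    obtain ⟨x, l, y, rfl, hx, -⟩ := hc
    refine ⟨hg.lt, fun u hu h => hx ?_⟩
    rw [hg.nd rfl] at h
    rwa [Fin.ext h]
  have order : ∀ {k k' : Fin m} {c c' : List (Fin n)} {g g' : ℕ}, IsLink (I.dead v) c →
      IsLink (I.dead v) c' → I.Traverses k c → I.Traverses k' c' → H.Starts g k c →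
      H.Starts g' k' c' → c ≠ c' →
      (fp g < fp g' ↔ (S v).blk ((S v).pos g) < (S v).blk ((S v).pos g')) := by
    intro k k' c c' g g' hc hc' hk hk' hg hg' hne
    have h1 := (hS.blk_iff hc hc' hk hk' hg hg').not.2 hne
    have h2 := hR.agrees v (Nat.zero_le _) v.2.le g (live hc hg)
    have h3 := hR.agrees v (Nat.zero_le _) v.2.le g' (live hc' hg')
    rw [← h2, ← h3] at h1 ⊢
    exact hS.blocks.lt_iff (hp.lt g hg.lt) (hp.lt g' hg'.lt) h1
  have hblk := (hS.blk_iff hd hd hid hjd ha ha').2 rfl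
  have o1 := order hd he hid hie ha hb hed.symm
  have o1' := order he hd hie hid hb ha hed
  have o2 := order hd hf hjd hjf ha' hb' hfd.symm
  have o2' := order hf hd hjf hjd hb' ha' hfd
  have o3 := order hd he hjd hie ha' hb hed.symm
  have o3' := order he hd hie hjd hb ha' hed
  have o4 := order hd hf hid hjf ha hb' hfd.symm
  have o4' := order hf hd hjf hid hb' ha hfd
  have hm := hS.mate_starts hd hid ha
  have hm' := hS.mate_starts hd hjd ha'
  obtain ⟨q, hq, ht, hqm⟩ := exists_position hH hS hd he hdv hev hed hid hie hm
  obtain ⟨q', hq', ht', hqm'⟩ := exists_position hH hS hd hf hdv hfv hfd hjd hjf hm'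
  have hqb : (S v).obj q = b := hH.starts_unique ht.starts' hb
  have hqb' : (S v).obj q' = b' := hH.starts_unique ht'.starts' hb'
  have hqa := hH.starts_unique ht.starts ha
  have hqa' := hH.starts_unique ht'.starts ha'
  have hM := mem_posAt.1 hq
  have hM' := mem_posAt.1 hq'
  have hpb : (S v).pos b = q := by rw [← hqb, hS.pos_obj q hM.1]
  have hpb' : (S v).pos b' = q' := by rw [← hqb', hS.pos_obj q' hM'.1]
  have mir := hR.mirrored v (Nat.zero_le _) v.2.le
  have live' : ∀ {q : ℕ} {k : Fin m} {c c' : List (Fin n)},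
      Turn (S v) I H (I.dead v) v q k c c' → H.Live (I.dead (v + 1)) ((S v).moved H q) := by
    intro q k c c' ht
    have h1 := live ht.link.reverse ht.moved
    refine ⟨h1.1, fun u hu => ?_⟩
    rw [dead_succ hv] at hu
    rcases List.mem_append.1 hu with h | h
    · exact h1.2 u h
    · rw [List.mem_singleton.1 h]
      have := nd_mate_ne hH hτ' hS (live ht.link ht.starts)
      rwa [hH.starts_unique (hS.mate_starts ht.link ht.trav ht.starts) ht.moved,
        ht.starts.nd ht.head] at this
  have hT : (S v).target H q = (S v).target H q' := (ht.target_eq_iff hS ht').2 rfl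
  have m1 := mir a (live hd ha) a' ha'.lt hblk
  rw [← hqm, ← hqm'] at m1
  have agree : ∀ {q : ℕ} {k : Fin m} {c c' : List (Fin n)}, q ∈ posAt H pn v →
      Turn (S v) I H (I.dead v) v q k c c' →
      (S (v + 1)).blk (fp ((S v).moved H q)) = (S v).newBlk H pn v q := by
    intro q k c c' hq ht
    rw [hR.agrees (v + 1) (Nat.zero_le _) v.2 _ (live' ht), (hD.moved q hq).2.1,
      (hD.moved q hq).2.2.2]
  -- If both paths turn from `d` to the same link, three mirrored blocks lie between `a` and `b`:
  -- those of `d`, of the joined link, and of `e`. Three reversals make the order on `e` opposite to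
  -- that on `d`.
  by_cases hef : e = f
  · subst hef
    have hb2 : (S v).blk q = (S v).blk q' := (ht.blk_eq_iff hS ht' hM.1 hM'.1).2 rfl
    have m2 := hR.mirrored (v + 1) (Nat.zero_le _) v.2 _ (live' ht') _ (live' ht).1 (by
      rw [(hD.moved q hq).2.1, (hD.moved q' hq').2.1, (hD.moved q hq).2.2.2,
        (hD.moved q' hq').2.2.2]
      exact newBlk_eq hH hτ hS hq' hq hT.symm hb2.symm)
    rw [(hD.moved q hq).2.2.1, (hD.moved q' hq').2.2.1, hqb, hqb'] at m2
    have m3 := mir b' (live hf hb') b hb.lt (by rw [hpb, hpb', hb2])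
    have : fp b' < fp b := m3.2 (m2.1 (m1.1 hlt))
    have hne := (hS.blk_iff hd he hid hie ha hb).not.2 hed.symm
    have k1 := congrArg (S v).blk hpb
    have k2 := congrArg (S v).blk hpb'
    left
    refine ⟨this, ?_⟩
    omega
  -- If the paths leave on different links, the far end of `d` has them in different new blocks,
  -- which are arranged by rank. The order at the far end thus shows which of `e` and `f` comes
  -- first clockwise after `d`.
  · have hb2 := (ht.blk_eq_iff hS ht' hM.1 hM'.1).not.2 hef
    have o5 := order he hf hie hjf hb hb' hef
    have o5' := order hf he hjf hie hb' hb (Ne.symm hef)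
    have hnb : (S v).newBlk H pn v q ≠ (S v).newBlk H pn v q' := fun h =>
      hb2 ((hD.newBlk_eq_iff hH hτ hS hq hq').1 h).2
    have o6 := hS'.blocks.lt_iff (hp.lt _ ht'.moved.lt) (hp.lt _ ht.moved.lt) (by
      rw [agree hq ht, agree hq' ht']
      exact hnb.symm)
    rw [agree hq ht, agree hq' ht'] at o6
    have hr : (S v).rank H q' < (S v).rank H q := by
      by_contra hr
      rcases (not_lt.1 hr).lt_or_eq with h | h
      · have h1 := slot_lt_newBlk hH hτ hS hq hq' hT hb2 h
        have h2 := newBlk_le (S := S v) (H := H) (pn := pn) (v := v) q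
        have := o6.1 (m1.1 hlt)
        omega
      · exact hb2 (by rw [rank_injOn hq hq' h])
    have c1 := hS.blocks.lt_iff (hS.pos_lt _ ha.lt) hM.1
      (by rw [← hpb]; exact (hS.blk_iff hd he hid hie ha hb).not.2 hed.symm)
    have c2 := hS.blocks.lt_iff (hS.pos_lt _ ha'.lt) hM'.1
      (by rw [← hpb']; exact (hS.blk_iff hd hf hjd hjf ha' hb').not.2 hfd.symm)
    have c3 := hS.blocks.lt_iff hM'.1 hM.1 (Ne.symm hb2)
    have n1 := (hS.blk_iff hd he hid hie ha hb).not.2 hed.symm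
    have n2 := (hS.blk_iff hd hf hjd hjf ha' hb').not.2 hfd.symm
    unfold rank at hr
    rw [hqa, hqa'] at hr
    have k1 := congrArg (S v).blk hpb
    have k2 := congrArg (S v).blk hpb'
    split_ifs at hr <;> omega

/-- No two paths cross at `v` after they have shared a link at `v`. -/
theorem Resolved.not_alternating (hR : Resolved I H pn S 0 fp) {v : Fin n}
    (hv : ¬ ∃ i, I.TerminalOf i v) {i j : Fin m} {d : List (Fin n)} (hd : IsLink (I.dead v) d)
    (hdv : d.head? = some v) (hid : I.Traverses i d) (hjd : I.Traverses j d) {h₁ h₂ h₃ h₄ : ℕ}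
    (hM₁ : h₁ < H.M) (hM₂ : h₂ < H.M) (hM₃ : h₃ < H.M) (hM₄ : h₄ < H.M)
    (hv₁ : H.nd h₁ = v) (hv₂ : H.nd h₂ = v) (hv₃ : H.nd h₃ = v) (hv₄ : H.nd h₄ = v)
    (hl₁ : H.lab h₁ = i) (hl₂ : H.lab h₂ = j) (hl₃ : H.lab h₃ = i) (hl₄ : H.lab h₄ = j)
    (h₁₂ : fp h₁ < fp h₂) (h₂₃ : fp h₂ < fp h₃) (h₃₄ : fp h₃ < fp h₄) : False := by
  have hτ := isPartialDeletion_dead_append hv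
  have key : ∀ {h h' : ℕ} {k : Fin m}, h < H.M → h' < H.M → H.nd h = v → H.nd h' = v →
      H.lab h = k → H.lab h' = k → h ≠ h' → I.Traverses k d → ∃ e, IsLink (I.dead v) e ∧
      e.head? = some v ∧ e ≠ d ∧ I.Traverses k e ∧ (H.Starts h k d ∧ H.Starts h' k e ∨
        H.Starts h' k d ∧ H.Starts h k e) := by
    intro h h' k hM hM' hvh hvh' hl hl' hne hk
    obtain ⟨k1, c, hc, hcv, hkc, hs⟩ := hH.exists_link hτ.of_append.2 hM hvh hτ.notMem
    obtain rfl : k1 = k := Fin.ext (by rw [← hs.lab, hl])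
    obtain ⟨k2, c', hc', hcv', hkc', hs'⟩ := hH.exists_link hτ.of_append.2 hM' hvh' hτ.notMem
    obtain rfl : k1 = k2 := Fin.ext (by rw [← hs'.lab, hl'])
    by_cases h1 : c = d
    · subst h1
      refine ⟨c', hc', hcv', ?_, hkc', .inl ⟨hs, hs'⟩⟩
      rintro rfl
      exact hne (hH.starts_unique hs hs')
    · by_cases h2 : c' = d
      · subst h2
        exact ⟨c, hc, hcv, h1, hkc, .inr ⟨hs', hs⟩⟩
      · exfalso
        have := link_third hd hc hc' hdv hcv hcv' hk hkc hkc' h1 h2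
        subst this
        exact hne (hH.starts_unique hs hs')
  obtain ⟨e, he, hev, hed, hie, hst⟩ := key hM₁ hM₃ hv₁ hv₃ hl₁ hl₃ (by rintro rfl; omega) hid
  obtain ⟨f, hf, hfv, hfd, hjf, hst'⟩ := key hM₂ hM₄ hv₂ hv₄ hl₂ hl₄ (by rintro rfl; omega) hjd
  -- For each path, one of its two half-edges at `v` lies on `d`. Whichever it is, and whichever
  -- path comes first on `d`, the arrangement excludes the alternating order.
  have fin : ∀ {a b a' b' : ℕ}, H.Starts a i d → H.Starts b i e → H.Starts a' j d →
      H.Starts b' j f → (fp a < fp a' → fp b' < fp b ∧ (fp a' < fp b' ∨ fp b < fp a) ∨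
        fp b < fp a ∧ fp a' < fp b') ∧ (fp a' < fp a → fp b < fp b' ∧
        (fp a < fp b ∨ fp b' < fp a') ∨ fp b' < fp a' ∧ fp a < fp b) := fun ha hb ha' hb' =>
    ⟨hR.arrangement hH hC hv hd he hf hdv hev hfv hed hfd hid hie hjd hjf ha hb ha' hb',
      hR.arrangement hH hC hv hd hf he hdv hfv hev hfd hed hjd hjf hid hie ha' hb' ha hb⟩
  rcases hst with ⟨s1, s3⟩ | ⟨s3, s1⟩ <;> rcases hst' with ⟨s2, s4⟩ | ⟨s4, s2⟩
  · have := fin s1 s3 s2 s4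
    omega
  · have := fin s1 s3 s4 s2
    omega
  · have := fin s3 s1 s2 s4
    omega
  · have := fin s3 s1 s4 s2
    omega

end Resolved

end Layout

end RoutedGraph

namespace RAM

/-! ## Loops -/

/-- The time bound is a Boolean test, so that `rfl` settles it for a concrete program. -/
theorem runs_of_effect {p : Prog} {s : State} {T : ℕ} {Q : State → Prop} (hp : p.loopFree = true)
    (hT : p.time.ble T = true) (h : Q (p.effect s)) : Runs p s T Q :=
  (runs_of_loopFree hp h).mono (Nat.le_of_ble_eq_true hT) fun _ => id

theorem runs_for {e f : Expr} {p : Prog} {s : State} (Inv : ℕ → State → Prop) (N T : ℕ)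
    (h0 : Inv 0 s) (hstep : ∀ k < N, ∀ s', Inv k s' → Frame p s s' →
      e.eval s' < f.eval s' ∧ Runs p s' T (Inv (k + 1)))
    (hend : ∀ s', Inv N s' → Frame p s s' → ¬ e.eval s' < f.eval s') :
    Runs (.loop e f p) s ((T + (e.cost + f.cost + 1)) * N + (e.cost + f.cost + 1)) (Inv N) := by
  refine (runs_loop Inv N (fun _ => T) h0 hstep hend).mono (le_of_eq ?_) fun _ => id
  simp [mul_comm]

/-- A loop whose running time is bounded by the increase of `b`. -/
theorem runs_loop_potential {e f : Expr} {p : Prog} {s : State} (Inv : ℕ → State → Prop) (N T : ℕ)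
    (b : ℕ → ℕ) (hb : ∀ k < N, b k ≤ b (k + 1)) (h0 : Inv 0 s)
    (hstep : ∀ k < N, ∀ s', Inv k s' → Frame p s s' →
      e.eval s' < f.eval s' ∧ Runs p s' (T * (b (k + 1) - b k + 1)) (Inv (k + 1)))
    (hend : ∀ s', Inv N s' → Frame p s s' → ¬ e.eval s' < f.eval s') :
    Runs (.loop e f p) s ((T + (e.cost + f.cost + 1)) * (b N + N + 1)) (Inv N) := by
  refine (runs_loop Inv N (fun k => T * (b (k + 1) - b k + 1)) h0 hstep hend).mono ?_ fun _ => id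
  have key : ∀ k ≤ N, ∑ j ∈ Finset.range k, (T * (b (j + 1) - b j + 1) + (e.cost + f.cost + 1)) ≤
      (T + (e.cost + f.cost + 1)) * (b k + k) := by
    intro k
    induction k with
    | zero => simp
    | succ k ih =>
      intro hk
      rw [Finset.sum_range_succ]
      have h1 := ih (by omega)
      obtain ⟨d, hd⟩ := Nat.exists_eq_add_of_le (hb k (by omega))
      rw [hd, Nat.add_sub_cancel_left]
      nlinarith
  have := key N le_rfl
  nlinarith

/-! ## Buckets -/

/-- The numbers below the last argument with key `y`, in decreasing order. -/
def bucket (key : ℕ → ℕ) (y : ℕ) : ℕ → List ℕ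
  | 0 => []
  | c + 1 => if key c = y then c :: bucket key y c else bucket key y c

/-- The head of a list, as a pointer. -/
def headPtr : List ℕ → ℕ
  | [] => 0
  | a :: _ => a + 1

theorem mem_bucket {key : ℕ → ℕ} {y c h : ℕ} : h ∈ bucket key y c ↔ h < c ∧ key h = y := by
  induction c with
  | zero => simp [bucket]
  | succ c ih =>
    rw [bucket]
    split_ifs with hc
    · rw [List.mem_cons, ih]
      constructor
      · rintro (rfl | h)
        · exact ⟨by omega, hc⟩
        · exact ⟨by omega, h.2⟩
      · rintro ⟨h1, h2⟩
        rcases Nat.lt_succ_iff_lt_or_eq.1 h1 with h | h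
        · exact .inr ⟨h, h2⟩
        · exact .inl h
    · rw [ih]
      refine ⟨fun h => ⟨by omega, h.2⟩, fun h => ⟨?_, h.2⟩⟩
      rcases Nat.lt_succ_iff_lt_or_eq.1 h.1 with h1 | h1
      · exact h1
      · exact absurd (h1 ▸ h.2) hc

theorem nodup_bucket (key : ℕ → ℕ) (y c : ℕ) : (bucket key y c).Nodup := by
  induction c with
  | zero => simp [bucket]
  | succ c ih =>
    rw [bucket]
    split_ifs
    · refine List.nodup_cons.2 ⟨fun h => lt_irrefl _ (mem_bucket.1 h).1, ih⟩
    · exact ih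

/-- In a list in decreasing order, what follows `h` consists of the numbers below `h` with the same
key. The link written when `h` is inserted therefore stays correct. -/
theorem bucket_drop {key : ℕ → ℕ} {y N t h : ℕ} {l : List ℕ}
    (hl : (bucket key y N).drop t = h :: l) : l = bucket key y h := by
  induction N generalizing t with
  | zero => simp [bucket] at hl
  | succ N ih =>
    rw [bucket] at hl
    split_ifs at hl
    · cases t with
      | zero =>
        simp only [List.drop_zero, List.cons.injEq] at hl
        rw [← hl.1, hl.2]
      | succ t => exact ih (by simpa using hl)
    · exact ih hl

theorem sum_length_bucket {key : ℕ → ℕ} (K N : ℕ) :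
    ∑ y ∈ Finset.range K, (bucket key y N).length =
      ((Finset.range N).filter (fun h => key h < K)).card := by
  rw [Finset.card_eq_sum_card_fiberwise (f := key) (t := Finset.range K)
    (fun h hh => by simpa using (Finset.mem_filter.1 hh).2)]
  refine Finset.sum_congr rfl fun y hy => ?_
  rw [← List.toFinset_card_of_nodup (nodup_bucket key y N)]
  congr 1
  ext h
  simp only [List.mem_toFinset, mem_bucket, Finset.mem_filter, Finset.mem_range]
  rw [Finset.mem_range] at hy
  constructor
  · rintro ⟨h1, rfl⟩
    exact ⟨⟨h1, hy⟩, rfl⟩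
  · rintro ⟨⟨h1, -⟩, h2⟩
    exact ⟨h1, h2⟩

/-- Execute programs one after the other. -/
def Prog.block : List Prog → Prog
  | [] => .skip
  | [p] => p
  | p :: q :: l => .seq p (block (q :: l))

/-- Increase a register. -/
def Prog.incr (r : ℕ) : Prog := .assign r (.add (.reg r) (.const 1))

/-- Collect the indices `h` below register `3` in linked lists, one for each value of the array
`key`; the list for `y` starts at `hd[y] - 1` and continues after `h` at `nxt[h] - 1`. -/
def Prog.collect (ctr key hd nxt : ℕ) : Prog :=
  .loop (.reg ctr) (.reg 3) (.block [
    .store nxt (.reg ctr) (.arr hd (.arr key (.reg ctr))),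
    .store hd (.arr key (.reg ctr)) (.add (.reg ctr) (.const 1)),
    .incr ctr])

/-- Pointers are indices plus one, so zero-initialised memory already represents empty lists and no
time is spent on clearing the heads. -/
theorem runs_collect {ctr key hd nxt : ℕ} (h1 : ctr ≠ 3) (h2 : key ≠ hd) (h3 : key ≠ nxt)
    (h4 : hd ≠ nxt) {s : State} (h5 : s.reg ctr = 0) (h6 : ∀ y, s.arr hd y = 0) :
    Runs (.collect ctr key hd nxt) s (19 * s.reg 3 + 3) (fun s' =>
      (∀ y, s'.arr hd y = headPtr (bucket (s.arr key) y (s.reg 3))) ∧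
      ∀ h < s.reg 3, s'.arr nxt h = headPtr (bucket (s.arr key) (s.arr key h) h)) := by
  refine (runs_for (fun c s' => s'.reg ctr = c ∧
    (∀ y, s'.arr hd y = headPtr (bucket (s.arr key) y c)) ∧
    ∀ h < c, s'.arr nxt h = headPtr (bucket (s.arr key) (s.arr key h) h)) (s.reg 3) 16
    ⟨h5, by simpa [bucket, headPtr] using h6, by simp⟩ ?_ ?_).mono (by simp [Expr.cost])
    fun s' hs => hs.2
  · rintro c hc s' ⟨i1, i2, i3⟩ hf
    have f1 : s'.reg 3 = s.reg 3 := hf.1 3 (by simp [Prog.block, Prog.incr, Prog.regs, h1.symm])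
    have f2 : s'.arr key = s.arr key := hf.2 key (by simp [Prog.block, Prog.incr, Prog.arrs, h2, h3])
    refine ⟨by simp [Expr.eval, i1, f1, hc], runs_of_effect rfl rfl ?_⟩
    simp only [Prog.block, Prog.effect, Expr.eval, Prog.incr, Function.update_self, i1,
      Function.update_of_ne h3, Function.update_of_ne h4,
      Function.update_of_ne h4.symm, f2, true_and]
    refine ⟨fun y => ?_, fun h hh => ?_⟩
    · rw [bucket]
      split_ifs with hy
      · subst hy
        rw [Function.update_self]
        rfl
      · rw [Function.update_of_ne (Ne.symm hy)]
        exact i2 y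
    · by_cases hc' : h = c
      · subst hc'
        rw [Function.update_self]
        exact i2 _
      · rw [Function.update_of_ne hc']
        exact i3 h (by omega)
  · rintro s' ⟨i1, -, -⟩ hf
    have f1 : s'.reg 3 = s.reg 3 := hf.1 3 (by simp [Prog.block, Prog.incr, Prog.regs, h1.symm])
    simp [Expr.eval, i1, f1]

/-- Run through a linked list; register `ptr` holds the index plus one. -/
def Prog.walk (ptr nxt : ℕ) (p : Prog) : Prog :=
  .loop (.const 0) (.reg ptr) (.seq p (.assign ptr (.arr nxt (.sub (.reg ptr) (.const 1)))))

theorem runs_walk {ptr nxt y N : ℕ} {key : ℕ → ℕ} {p : Prog} {s : State} (Inv : ℕ → State → Prop)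
    (hr : ptr ∉ p.regs) (ha : nxt ∉ p.arrs) (hp : p.loopFree = true)
    (h1 : s.reg ptr = headPtr (bucket key y N))
    (h2 : ∀ h < N, s.arr nxt h = headPtr (bucket key (key h) h)) (h0 : Inv 0 s)
    (hstep : ∀ t h, (bucket key y N)[t]? = some h → ∀ s', Inv t s' → s'.reg ptr = h + 1 →
      Frame (.seq p (.assign ptr (.arr nxt (.sub (.reg ptr) (.const 1))))) s s' →
      Inv (t + 1) (p.effect s'))
    (hupd : ∀ t s' x, Inv t s' → Inv t { s' with reg := Function.update s'.reg ptr x }) :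
    Runs (.walk ptr nxt p) s ((p.time + 8) * (bucket key y N).length + 3)
      (Inv (bucket key y N).length) := by
  refine (runs_for (fun t s' => s'.reg ptr = headPtr ((bucket key y N).drop t) ∧ Inv t s')
    (bucket key y N).length (p.time + 5) ⟨h1, h0⟩ ?_ ?_).mono (by simp [Expr.cost]) fun s' hs => hs.2
  · rintro t ht s' ⟨i1, i2⟩ hf
    have hd := List.drop_eq_getElem_cons ht
    set h := (bucket key y N)[t]
    have hh := mem_bucket.1 (List.getElem_mem ht)
    have hb := bucket_drop hd
    rw [hd, headPtr] at i1
    refine ⟨by simp [Expr.eval, i1], Runs.seq (runs_of_loopFree hp (Q := fun s'' =>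
      s'' = p.effect s') rfl) fun s'' hs'' hf' => ?_⟩
    refine runs_of_effect rfl rfl ?_
    subst hs''
    have i3 := hstep t h (List.getElem?_eq_getElem ht) s' i2 i1 hf
    have f1 := hf'.1 ptr hr
    have f2 := hf'.2 nxt ha
    have f3 : s'.arr nxt = s.arr nxt := hf.2 nxt (by simpa [Prog.arrs] using ha)
    refine ⟨?_, hupd _ _ _ i3⟩
    simp only [Prog.effect, Expr.eval, Function.update_self, f1, f2, f3, i1, Nat.add_sub_cancel]
    rw [h2 h hh.1, hh.2, hb]
  · rintro s' ⟨i1, -⟩ -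
    rw [List.drop_length] at i1
    simp [Expr.eval, i1, headPtr]

end RAM

namespace RAM

/-! ## The input -/

theorem flatten_getD {α : Type*} {ls : List (List α)} (x : α) {k j : ℕ} {l : List α}
    (hl : ls[k]? = some l) (hj : j < l.length) :
    ls.flatten.getD ((ls.take k).flatten.length + j) x = l[j] := by
  obtain ⟨hk, rfl⟩ := List.getElem?_eq_some_iff.1 hl
  have h1 : ls.flatten = (ls.take k).flatten ++ (ls[k] ++ (ls.drop (k + 1)).flatten) := by
    rw [← List.flatten_cons, ← List.drop_eq_getElem_cons, ← List.flatten_append,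
      List.take_append_drop]
  rw [h1, List.getD_append_right _ _ _ _ (Nat.le_add_right _ _), Nat.add_sub_cancel_left,
    List.getD_append _ _ _ _ hj, List.getD_eq_getElem _ _ hj]

theorem offsets_getD {α : Type*} (ls : List (List α)) {k : ℕ} (hk : k ≤ ls.length) :
    (offsets ls).getD k 0 = (ls.take k).flatten.length := by
  unfold offsets
  rw [List.getD_eq_getElem _ _ (by simpa using Nat.lt_succ_iff.2 hk)]
  simp

theorem length_take_succ {α : Type*} {ls : List (List α)} {k : ℕ} {l : List α}
    (hl : ls[k]? = some l) :
    (ls.take (k + 1)).flatten.length = (ls.take k).flatten.length + l.length := by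
  obtain ⟨hk, rfl⟩ := List.getElem?_eq_some_iff.1 hl
  rw [List.take_succ_eq_append_getElem hk, List.flatten_append, List.length_append]
  simp

theorem contents_getD {c : ℕ} {ls : List (List (Fin c))} {k j : ℕ} {l : List (Fin c)}
    (hl : ls[k]? = some l) (hj : j < l.length) :
    (contents ls).getD ((ls.take k).flatten.length + j) 0 = (l[j] : Fin c) := by
  have hlt : (ls.take k).flatten.length + j < ls.flatten.length := by
    have h1 := length_take_succ hl
    have h2 := ((List.take_sublist (k + 1) ls).flatten).length_le
    omega
  unfold contents
  rw [List.getD_eq_getElem _ _ (by rwa [List.length_map]), List.getElem_map,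
    ← flatten_getD l[j] hl hj, List.getD_eq_getElem _ _ hlt]

theorem offsets_le {α : Type*} (ls : List (List α)) (k : ℕ) :
    (offsets ls).getD k 0 ≤ ls.flatten.length := by
  by_cases hk : k ≤ ls.length
  · rw [offsets_getD ls hk]
    exact ((List.take_sublist k ls).flatten).length_le
  · rw [List.getD_eq_default _ _ (by simp [offsets]; omega)]
    exact Nat.zero_le _

theorem contents_lt {c : ℕ} (ls : List (List (Fin c))) (k : ℕ) : (contents ls).getD k 0 ≤ c := by
  by_cases hk : k < (contents ls).length
  · rw [List.getD_eq_getElem _ _ hk]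
    simp only [contents, List.getElem_map]
    exact Fin.is_le'
  · rw [List.getD_eq_default _ _ (by omega)]
    exact Nat.zero_le _

end RAM

namespace RoutedGraph

variable {n m : ℕ} (I : RoutedGraph n m)

/-- The length of path number `i`. -/
def pathLength (i : ℕ) : ℕ := if h : i < m then (I.path ⟨i, h⟩).length else 0

/-- Node number `j` of path number `i`. -/
def pathNode (i j : ℕ) : ℕ := if h : i < m then (I.path ⟨i, h⟩).getVert j else 0

/-- The total length of the first `i` paths. -/
def pathOffset (i : ℕ) : ℕ := ∑ k ∈ Finset.range i, I.pathLength k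

variable {I}

theorem pathOffset_eq : I.pathOffset m = I.totalLength := by
  unfold pathOffset totalLength
  rw [Finset.sum_range]
  exact Finset.sum_congr rfl fun i _ => by simp [pathLength]

theorem pathOffset_succ (i : ℕ) : I.pathOffset (i + 1) = I.pathOffset i + I.pathLength i :=
  Finset.sum_range_succ _ _

theorem pathOffset_mono {i j : ℕ} (h : i ≤ j) : I.pathOffset i ≤ I.pathOffset j :=
  Finset.sum_le_sum_of_subset (Finset.range_mono h)

theorem pathOffset_inj {i i' j j' : ℕ} (hj : j < I.pathLength i) (hj' : j' < I.pathLength i')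
    (h : I.pathOffset i + j = I.pathOffset i' + j') : i = i' ∧ j = j' := by
  have h1 := I.pathOffset_succ i
  have h2 := I.pathOffset_succ i'
  rcases lt_trichotomy i i' with hlt | rfl | hlt
  · have := I.pathOffset_mono (show i + 1 ≤ i' from hlt)
    omega
  · exact ⟨rfl, by omega⟩
  · have := I.pathOffset_mono (show i' + 1 ≤ i from hlt)
    omega

theorem exists_pathOffset {c i : ℕ} (hc : c < I.pathOffset i) :
    ∃ k < i, ∃ j < I.pathLength k, c = I.pathOffset k + j := by
  induction i with
  | zero => simp [pathOffset] at hc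
  | succ i ih =>
    by_cases h : c < I.pathOffset i
    · obtain ⟨k, hk, j, h1, h2⟩ := ih h
      exact ⟨k, by omega, j, h1, h2⟩
    · rw [pathOffset_succ] at hc
      exact ⟨i, by omega, c - I.pathOffset i, by omega, by omega⟩

theorem finRange_map_getElem? {α : Type*} {c : ℕ} (f : Fin c → α) (i : Fin c) :
    ((List.finRange c).map f)[(i : ℕ)]? = some (f i) := by
  rw [List.getElem?_map, List.getElem?_eq_getElem (by simp)]
  simp

/-- A path has one node more than edges, which accounts for the summand `i` after `i` paths. -/
theorem offset_supports {i : ℕ} (hi : i ≤ m) :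
    ((((List.finRange m).map fun i => (I.path i).support).take i).flatten).length =
      I.pathOffset i + i := by
  induction i with
  | zero => simp [pathOffset]
  | succ i ih =>
    rw [RAM.length_take_succ (finRange_map_getElem? _ ⟨i, hi⟩), ih (by omega), pathOffset_succ,
      SimpleGraph.Walk.length_support, pathLength, dif_pos (show i < m from hi)]
    omega

theorem input_pathOffset {i : ℕ} (hi : i ≤ m) : I.input.arr 2 i = I.pathOffset i + i := by
  have := RAM.offsets_getD ((List.finRange m).map fun i => (I.path i).support) (k := i)
    (by simpa using hi)
  rw [offset_supports hi] at this
  exact this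

theorem input_pathNode {i j : ℕ} (hi : i < m) (hj : j ≤ I.pathLength i) :
    I.input.arr 3 (I.pathOffset i + i + j) = I.pathNode i j := by
  rw [pathLength, dif_pos hi] at hj
  have := RAM.contents_getD (finRange_map_getElem? (fun i => (I.path i).support) ⟨i, hi⟩) (j := j)
    (by simpa using Nat.lt_succ_iff.2 hj)
  rw [offset_supports hi.le] at this
  refine this.trans ?_
  rw [pathNode, dif_pos hi, SimpleGraph.Walk.getVert_eq_support_getElem _ hj]

theorem pathLength_of_fin (i : Fin m) : I.pathLength i = (I.path i).length := by simp [pathLength]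

theorem pathNode_of_fin (i : Fin m) (j : ℕ) : I.pathNode i j = (I.path i).getVert j := by
  simp [pathNode]

theorem getVert_inj {i : Fin m} {j j' : ℕ} (hj : j ≤ (I.path i).length)
    (hj' : j' ≤ (I.path i).length) (h : (I.path i).getVert j = (I.path i).getVert j') : j = j' :=
  (I.isPath i).getVert_injOn hj hj' h

theorem traverses_pair_iff_getVert {i : Fin m} {x w : Fin n} : I.Traverses i [x, w] ↔
    ∃ j < (I.path i).length, (x = (I.path i).getVert j ∧ w = (I.path i).getVert (j + 1)) ∨
      (x = (I.path i).getVert (j + 1) ∧ w = (I.path i).getVert j) := by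
  rw [traverses_pair_iff, SimpleGraph.Walk.mk_mem_edges_iff_exists]
  refine exists_congr fun j => and_congr_right fun _ => ?_
  rw [Sym2.eq_iff]
  constructor <;> rintro (⟨h1, h2⟩ | ⟨h1, h2⟩) <;> simp [h1, h2]

/-! ## Tables of half-edges -/

/-- The half-edges of the edge number `j` of path `i` have the numbers `c` and `c + L`, where `c` is
the position of this edge among the edges of all paths. -/
structure HalfEdges.Record (H : HalfEdges) (I : RoutedGraph n m) (L i j c : ℕ) : Prop where
  nd : H.nd c = I.pathNode i j
  nb : H.nb c = I.pathNode i (j + 1)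
  lab : H.lab c = i
  opp : H.opp c = c + L
  tw : H.tw c = c + L - 1
  nd' : H.nd (c + L) = I.pathNode i (j + 1)
  nb' : H.nb (c + L) = I.pathNode i j
  lab' : H.lab (c + L) = i
  opp' : H.opp (c + L) = c
  tw' : H.tw (c + L) = c + 1

/-- The half-edges of all edges of paths that precede number `c`. -/
def HalfEdges.IsTable (H : HalfEdges) (I : RoutedGraph n m) (L c : ℕ) : Prop :=
  ∀ i < m, ∀ j < I.pathLength i, I.pathOffset i + j < c → H.Record I L i j (I.pathOffset i + j)

/-- The two half-edges at an inner node belong to consecutive edges, hence the twins `c + L - 1` and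
`c + 1`. At the ends of a path these entries are meaningless; validity asks for the twin only where
two half-edges of the path exist at the node. -/
theorem HalfEdges.IsTable.valid {H : HalfEdges} (hM : H.M = 2 * I.totalLength)
    (hT : H.IsTable I I.totalLength I.totalLength) : H.Valid I := by
  have hlt : ∀ (i : Fin m) j, j < (I.path i).length → I.pathOffset i + j < I.totalLength := by
    intro i j hj
    rw [← pathOffset_eq]
    have := I.pathOffset_mono (show (i : ℕ) + 1 ≤ m from i.2)
    rw [pathOffset_succ, pathLength_of_fin] at this
    omega
  have hrec : ∀ (i : Fin m) j, j < (I.path i).length →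
      H.Record I I.totalLength i j (I.pathOffset i + j) := fun i j hj =>
    hT i i.2 j (by rwa [pathLength_of_fin]) (hlt i j hj)
  have hfwd : ∀ (i : Fin m) j, j < (I.path i).length → H.IsHalf (I.pathOffset i + j) i
      ((I.path i).getVert j) ((I.path i).getVert (j + 1)) := fun i j hj => by
    have h1 := hrec i j hj
    have h2 := hlt i j hj
    exact ⟨by omega, h1.lab, by rw [h1.nd, pathNode_of_fin], by rw [h1.nb, pathNode_of_fin]⟩
  have hbwd : ∀ (i : Fin m) j, j < (I.path i).length →
      H.IsHalf (I.pathOffset i + j + I.totalLength) i ((I.path i).getVert (j + 1))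
        ((I.path i).getVert j) := fun i j hj => by
    have h1 := hrec i j hj
    have h2 := hlt i j hj
    exact ⟨by omega, h1.lab', by rw [h1.nd', pathNode_of_fin], by rw [h1.nb', pathNode_of_fin]⟩
  have hcases : ∀ h < H.M, ∃ (i : Fin m) (j : ℕ), j < (I.path i).length ∧
      (h = I.pathOffset i + j ∨ h = I.pathOffset i + j + I.totalLength) := by
    intro h hh
    have h1 : ∀ c < I.totalLength, ∃ (i : Fin m) (j : ℕ), j < (I.path i).length ∧
        c = I.pathOffset i + j := by
      intro c hc
      rw [← pathOffset_eq] at hc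
      obtain ⟨k, hk, j, h1, h2⟩ := exists_pathOffset hc
      exact ⟨⟨k, hk⟩, j, by rw [← pathLength_of_fin]; exact h1, h2⟩
    by_cases hl : h < I.totalLength
    · obtain ⟨i, j, h2, h3⟩ := h1 h hl
      exact ⟨i, j, h2, .inl h3⟩
    · obtain ⟨i, j, h2, h3⟩ := h1 (h - I.totalLength) (by omega)
      exact ⟨i, j, h2, .inr (by omega)⟩
  have hhalf : ∀ {h} {i : Fin m} {x w : Fin n}, H.IsHalf h i x w → ∃ j < (I.path i).length,
      (h = I.pathOffset i + j ∧ x = (I.path i).getVert j ∧ w = (I.path i).getVert (j + 1)) ∨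
      (h = I.pathOffset i + j + I.totalLength ∧ x = (I.path i).getVert (j + 1) ∧
        w = (I.path i).getVert j) := by
    intro h i x w hh
    obtain ⟨i', j, hj, rfl | rfl⟩ := hcases h hh.1
    · obtain ⟨rfl, rfl, rfl⟩ := hh.congr (hfwd i' j hj)
      exact ⟨j, hj, .inl ⟨rfl, rfl, rfl⟩⟩
    · obtain ⟨rfl, rfl, rfl⟩ := hh.congr (hbwd i' j hj)
      exact ⟨j, hj, .inr ⟨rfl, rfl, rfl⟩⟩
  constructor
  · intro h hh
    obtain ⟨i, j, hj, rfl | rfl⟩ := hcases h hh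
    · exact ⟨i, _, _, hfwd i j hj, traverses_pair_iff_getVert.2 ⟨j, hj, .inl ⟨rfl, rfl⟩⟩⟩
    · exact ⟨i, _, _, hbwd i j hj, traverses_pair_iff_getVert.2 ⟨j, hj, .inr ⟨rfl, rfl⟩⟩⟩
  · intro i x w hi
    obtain ⟨j, hj, ⟨rfl, rfl⟩ | ⟨rfl, rfl⟩⟩ := traverses_pair_iff_getVert.1 hi
    · exact ⟨_, hfwd i j hj⟩
    · exact ⟨_, hbwd i j hj⟩
  · intro h h' i x w h1 h2
    obtain ⟨j, hj, ⟨rfl, hx, hw⟩ | ⟨rfl, hx, hw⟩⟩ := hhalf h1 <;>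
      obtain ⟨j', hj', ⟨rfl, hx', hw'⟩ | ⟨rfl, hx', hw'⟩⟩ := hhalf h2 <;>
      rw [hx] at hx' <;> rw [hw] at hw' <;>
      have e1 := getVert_inj (by omega) (by omega) hx' <;>
      have e2 := getVert_inj (by omega) (by omega) hw' <;> omega
  · intro h i x w hh
    obtain ⟨j, hj, ⟨rfl, rfl, rfl⟩ | ⟨rfl, rfl, rfl⟩⟩ := hhalf hh
    · rw [(hrec i j hj).opp]
      exact hbwd i j hj
    · rw [(hrec i j hj).opp']
      exact hfwd i j hj
  · intro h h' i x w w' h1 h2 hne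
    obtain ⟨j, hj, ⟨rfl, hx, rfl⟩ | ⟨rfl, hx, rfl⟩⟩ := hhalf h1 <;>
      obtain ⟨j', hj', ⟨rfl, hx', rfl⟩ | ⟨rfl, hx', rfl⟩⟩ := hhalf h2 <;>
      rw [hx] at hx' <;>
      have e1 := getVert_inj (by omega) (by omega) hx'
    · exact absurd (by rw [e1]) hne
    · rw [(hrec i j hj).tw]
      omega
    · rw [(hrec i j hj).tw']
      omega
    · exact absurd (by rw [show j = j' by omega]) hne

end RoutedGraph

/-! ### Reading the half-edges and the terminal nodes -/

namespace RAM

/-- Enumerate the half-edges of the path in register `4`. -/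
def Prog.readEdges : Prog :=
  .loop (.add (.reg 5) (.const 1)) (.arr 2 (.add (.reg 4) (.const 1))) (.block [
    .store 6 (.reg 2) (.arr 3 (.reg 5)),
    .store 7 (.reg 2) (.arr 3 (.add (.reg 5) (.const 1))),
    .store 8 (.reg 2) (.reg 4),
    .store 9 (.reg 2) (.reg 3),
    .store 10 (.reg 2) (.sub (.reg 3) (.const 1)),
    .store 6 (.reg 3) (.arr 3 (.add (.reg 5) (.const 1))),
    .store 7 (.reg 3) (.arr 3 (.reg 5)),
    .store 8 (.reg 3) (.reg 4),
    .store 9 (.reg 3) (.reg 2),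
    .store 10 (.reg 3) (.add (.reg 2) (.const 1)),
    .incr 2, .incr 3, .incr 5])

/-- Enumerate the half-edges of one path, and mark its ends as terminal nodes. -/
def Prog.readPath : Prog := .block [
  .assign 5 (.arr 2 (.reg 4)),
  .store 11 (.arr 3 (.reg 5)) (.const 1),
  .readEdges,
  .store 11 (.arr 3 (.reg 5)) (.const 1),
  .incr 4]

/-- Enumerate the half-edges of all paths, and mark the terminal nodes. -/
def Prog.readPaths : Prog := .block [
  .assign 3 (.sub (.arr 2 (.reg 1)) (.reg 1)),
  .loop (.reg 4) (.reg 1) .readPath]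

end RAM

namespace RoutedGraph

open RAM

variable {n m : ℕ} {I : RoutedGraph n m}

/-- The half-edges stored in the memory. -/
def halfEdges (M : ℕ) (s : State) : HalfEdges where
  M := M
  lab := s.arr 8
  nd := s.arr 6
  nb := s.arr 7
  opp := s.arr 9
  tw := s.arr 10

/-- The state after `t` edges of path `i` have been read. -/
structure IsRead (I : RoutedGraph n m) (i t : ℕ) (s : State) : Prop where
  r2 : s.reg 2 = I.pathOffset i + t
  r3 : s.reg 3 = I.totalLength + (I.pathOffset i + t)
  r4 : s.reg 4 = i
  table : (halfEdges (2 * I.totalLength) s).IsTable I I.totalLength (I.pathOffset i + t)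

theorem runs_readEdges {i : ℕ} (hi : i < m) {s : State} (h : IsRead I i 0 s)
    (h5 : s.reg 5 = I.pathOffset i + i) (ha2 : s.arr 2 = I.input.arr 2)
    (ha3 : s.arr 3 = I.input.arr 3) :
    Runs .readEdges s (80 * (I.pathLength i + 1)) (fun s' => IsRead I i (I.pathLength i) s' ∧
      s'.reg 5 = I.pathOffset i + i + I.pathLength i) := by
  refine (runs_for (fun t s' => IsRead I i t s' ∧ s'.reg 5 = I.pathOffset i + i + t)
    (I.pathLength i) 68 ⟨h, h5⟩ ?_ ?_).mono (by simp [Expr.cost]; omega) fun _ => id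
  · rintro t ht s' ⟨⟨r2, r3, r4, tab⟩, r5⟩ hf
    have f2 : s'.arr 2 = I.input.arr 2 := (hf.2 2 (by decide)).trans ha2
    have f3 : s'.arr 3 = I.input.arr 3 := (hf.2 3 (by decide)).trans ha3
    have g2 : I.input.arr 2 (i + 1) = I.pathOffset i + I.pathLength i + (i + 1) := by
      rw [input_pathOffset hi, pathOffset_succ]
    refine ⟨?_, runs_of_effect rfl rfl ⟨⟨?_, ?_, ?_, ?_⟩, ?_⟩⟩
    · simp only [Expr.eval, r5, r4, f2, g2]
      omega
    · simp [Prog.block, Prog.incr, Prog.effect, Expr.eval, r2]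
      omega
    · simp [Prog.block, Prog.incr, Prog.effect, Expr.eval, r3]
      omega
    · simp [Prog.block, Prog.incr, Prog.effect, r4]
    · have hL : I.pathOffset i + I.pathLength i ≤ I.totalLength := by
        rw [← pathOffset_succ, ← pathOffset_eq]
        exact pathOffset_mono hi
      have v1 := input_pathNode (I := I) hi (j := t) ht.le
      have v2 := input_pathNode (I := I) hi (j := t + 1) ht
      intro i' hi' j hj hlt
      by_cases heq : I.pathOffset i' + j = I.pathOffset i + t
      · obtain ⟨rfl, rfl⟩ := pathOffset_inj hj ht heq
        have n1 : I.pathOffset i' + j ≠ I.totalLength + (I.pathOffset i' + j) := by omega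
        have n2 : I.pathOffset i' + j + I.totalLength = I.totalLength + (I.pathOffset i' + j) := by
          omega
        rw [← add_assoc] at v2
        generalize I.totalLength + (I.pathOffset i' + j) = D at *
        generalize I.pathOffset i' + i' + j = A at *
        generalize I.pathOffset i' + j = B at *
        constructor <;>
          simp [halfEdges, Prog.block, Prog.incr, Prog.effect, Expr.eval, *]
      · have hold := tab i' hi' j hj (by omega)
        have n1 : I.pathOffset i' + j ≠ I.totalLength + (I.pathOffset i + t) := by omega
        have n2 : I.pathOffset i' + j + I.totalLength ≠ I.totalLength + (I.pathOffset i + t) := by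
          omega
        have n3 : I.pathOffset i' + j + I.totalLength ≠ I.pathOffset i + t := by omega
        obtain ⟨h1, h2, h3, h4, h5, h6, h7, h8, h9, h10⟩ := hold
        simp only [halfEdges] at h1 h2 h3 h4 h5 h6 h7 h8 h9 h10
        constructor <;>
          simp [halfEdges, Prog.block, Prog.incr, Prog.effect, Expr.eval, *]
    · simp [Prog.block, Prog.incr, Prog.effect, Expr.eval, r5]
      omega
  · rintro s' ⟨h', r5⟩ hf
    have f2 : s'.arr 2 = I.input.arr 2 := (hf.2 2 (by decide)).trans ha2
    have g2 : I.input.arr 2 (i + 1) = I.pathOffset i + I.pathLength i + (i + 1) := by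
      rw [input_pathOffset hi, pathOffset_succ]
    simp only [Expr.eval, r5, h'.r4, f2, g2]
    omega

theorem isTerminal_iff {v : Fin n} : (∃ i, I.TerminalOf i v) ↔
    ∃ k < m, (v : ℕ) = I.pathNode k 0 ∨ (v : ℕ) = I.pathNode k (I.pathLength k) := by
  constructor
  · rintro ⟨i, hi⟩
    refine ⟨i, i.2, hi.imp ?_ ?_⟩ <;> rintro rfl <;> simp [pathNode_of_fin, pathLength_of_fin]
  · rintro ⟨k, hk, h⟩
    refine ⟨⟨k, hk⟩, h.imp ?_ ?_⟩ <;> intro h <;> ext <;>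
      simpa [pathNode, pathLength, hk] using h

/-- The state after the first `i` paths have been read. -/
structure AreRead (I : RoutedGraph n m) (i : ℕ) (s : State) : Prop where
  read : IsRead I i 0 s
  marked : ∀ x, 0 < s.arr 11 x ↔ ∃ k < i, x = I.pathNode k 0 ∨ x = I.pathNode k (I.pathLength k)
  r1 : s.reg 1 = m
  a2 : s.arr 2 = I.input.arr 2
  a3 : s.arr 3 = I.input.arr 3

theorem runs_readPath {i : ℕ} (hi : i < m) {s : State} (h : AreRead I i s) :
    Runs Prog.readPath s (120 * (I.pathLength i + 1)) (AreRead I (i + 1)) := by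
  have v1 := input_pathNode (I := I) hi (j := 0) (Nat.zero_le _)
  have v2 := input_pathNode (I := I) hi (j := I.pathLength i) le_rfl
  rw [add_zero] at v1
  have g2 := input_pathOffset (I := I) hi.le
  obtain ⟨⟨r2, r3, r4, tab⟩, hm, r1, a2, a3⟩ := h
  refine Runs.mono (T := 5 + (6 + (80 * (I.pathLength i + 1) + (6 + 4)))) ?_ (by omega)
    fun _ => id
  refine Runs.seq (runs_of_effect rfl rfl rfl : Runs _ _ _ (fun s' => s' = _)) fun s₁ hs₁ _ => ?_
  refine Runs.seq (runs_of_effect rfl rfl rfl : Runs _ _ _ (fun s' => s' = _)) fun s₂ hs₂ _ => ?_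
  have e1 : s₁.reg = Function.update s.reg 5 (I.pathOffset i + i) := by
    rw [hs₁]
    simp [Prog.effect, Expr.eval, r4, a2, g2]
  have e2 : s₂.reg = s₁.reg := by rw [hs₂]; rfl
  have e3 : s₂.arr = Function.update s.arr 11 (Function.update (s.arr 11) (I.pathNode i 0) 1) := by
    rw [hs₂, hs₁]
    simp [Prog.effect, Expr.eval, r4, a2, a3, g2, v1]
  refine Runs.seq (runs_readEdges hi (s := s₂) ⟨?_, ?_, ?_, ?_⟩ ?_ ?_ ?_)
    fun s₃ hs₃ hf₃ => ?_
  · simp [e2, e1, r2]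
  · simp [e2, e1, r3]
  · simp [e2, e1, r4]
  · simpa [halfEdges, e3] using tab
  · simp [e2, e1]
  · simp [e3, a2]
  · simp [e3, a3]
  obtain ⟨⟨q2, q3, q4, tab'⟩, q5⟩ := hs₃
  have b1 : s₃.reg 1 = m := by rw [hf₃.1 1 (by decide), e2, e1]; simpa using r1
  have b2 : s₃.arr 2 = I.input.arr 2 := by rw [hf₃.2 2 (by decide), e3]; simpa using a2
  have b3 : s₃.arr 3 = I.input.arr 3 := by rw [hf₃.2 3 (by decide), e3]; simpa using a3
  have b11 : s₃.arr 11 = Function.update (s.arr 11) (I.pathNode i 0) 1 := by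
    rw [hf₃.2 11 (by decide), e3]; simp
  refine runs_of_effect rfl rfl ⟨⟨?_, ?_, ?_, ?_⟩, fun x => ?_, ?_, ?_, ?_⟩
  · simp [Prog.block, Prog.incr, Prog.effect, q2, pathOffset_succ]
  · simp [Prog.block, Prog.incr, Prog.effect, q3, pathOffset_succ]
  · simp [Prog.block, Prog.incr, Prog.effect, Expr.eval, q4]
  · simpa [Prog.block, Prog.incr, Prog.effect, halfEdges, pathOffset_succ] using tab'
  · simp only [Prog.block, Prog.incr, Prog.effect, Expr.eval, q5, b3, v2, b11, Function.update_self]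
    by_cases x1 : x = I.pathNode i 0
    · simp only [x1, Function.update_apply, if_true]
      exact iff_of_true (by split_ifs <;> simp) ⟨i, by omega, .inl rfl⟩
    · by_cases x2 : x = I.pathNode i (I.pathLength i)
      · rw [x2, Function.update_self]
        exact iff_of_true (by simp) ⟨i, by omega, .inr rfl⟩
      · rw [Function.update_of_ne x2, Function.update_of_ne x1, hm]
        constructor
        · rintro ⟨k, hk, h⟩
          exact ⟨k, by omega, h⟩
        · rintro ⟨k, hk, h⟩
          rcases Nat.lt_succ_iff_lt_or_eq.1 hk with h' | rfl
          · exact ⟨k, h', h⟩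
          · tauto
  · simp [Prog.block, Prog.incr, Prog.effect, b1]
  · simp [Prog.block, Prog.incr, Prog.effect, b2]
  · simp [Prog.block, Prog.incr, Prog.effect, b3]

theorem runs_readPaths : Runs .readPaths I.input (200 * (I.totalLength + m + 1)) (fun s =>
    s.reg 3 = 2 * I.totalLength ∧ (halfEdges (2 * I.totalLength) s).Valid I ∧
      ∀ v : Fin n, 0 < s.arr 11 v ↔ ∃ i, I.TerminalOf i v) := by
  refine Runs.mono (T := 5 + (120 + 3) * (I.pathOffset m + m + 1)) ?_
    (by rw [pathOffset_eq]; omega) fun _ => id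
  refine Runs.seq (runs_of_effect rfl rfl rfl : Runs _ _ _ (fun s' => s' = _)) fun s₁ hs₁ _ => ?_
  have g2 := input_pathOffset (I := I) (i := m) le_rfl
  have r1 : I.input.reg 1 = m := rfl
  have r2 : I.input.reg 2 = 0 := rfl
  have r4 : I.input.reg 4 = 0 := rfl
  have a11 : I.input.arr 11 = fun _ => 0 := rfl
  have e1 : s₁.reg = Function.update I.input.reg 3 I.totalLength := by
    rw [hs₁]
    simp [Prog.effect, Expr.eval, r1, g2, pathOffset_eq]
  have e2 : s₁.arr = I.input.arr := by rw [hs₁]; rfl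
  have p0 : I.pathOffset 0 = 0 := rfl
  refine (runs_loop_potential (AreRead I) m 120 I.pathOffset (fun k _ => pathOffset_mono (by omega))
    ⟨⟨?_, ?_, ?_, ?_⟩, ?_, ?_, ?_, ?_⟩ (fun k hk s hs _ => ⟨?_, ?_⟩) (fun s hs _ => ?_)).mono
      le_rfl fun s hs => ⟨?_, ?_, fun v => ?_⟩
  · simp [e1, r2, p0]
  · simp [e1, p0]
  · simp [e1, r4]
  · intro i _ j _ h
    simp [p0] at h
  · simp [e2, a11]
  · simp [e1, r1]
  · rw [e2]
  · rw [e2]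
  · simp [Expr.eval, hs.r1, hs.read.r4, hk]
  · rw [pathOffset_succ, Nat.add_sub_cancel_left]
    exact runs_readPath hk hs
  · simp [Expr.eval, hs.r1, hs.read.r4]
  · rw [hs.read.r3, add_zero, pathOffset_eq]
    omega
  · have := hs.read.table
    rw [add_zero, pathOffset_eq] at this
    exact this.valid rfl
  · rw [hs.marked, isTerminal_iff]

end RoutedGraph

/-! ### Sorting the half-edges by their darts -/

namespace RAM

/-- Find the number of the dart at `nd h` towards `nb h`, for each half-edge `h`. -/
def Prog.findDarts : Prog := .loop (.reg 7) (.reg 0) (.block [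
  .assign 8 (.arr 0 (.reg 7)),
  .loop (.reg 8) (.arr 0 (.add (.reg 7) (.const 1))) (.block [
    .store 14 (.arr 1 (.reg 8)) (.reg 8),
    .incr 8]),
  .assign 9 (.arr 12 (.reg 7)),
  .walk 9 13 (.store 15 (.sub (.reg 9) (.const 1)) (.arr 14 (.arr 7 (.sub (.reg 9) (.const 1))))),
  .incr 7])

/-- Sort the half-edges by the numbers of their darts. -/
def Prog.placeHalves : Prog := .block [
  .loop (.reg 10) (.arr 0 (.reg 0)) (.block [
    .store 4 (.reg 10) (.reg 11),
    .assign 9 (.arr 16 (.reg 10)),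
    .walk 9 17 (.block [
      .store 18 (.reg 11) (.sub (.reg 9) (.const 1)),
      .store 19 (.sub (.reg 9) (.const 1)) (.reg 11),
      .store 20 (.reg 11) (.arr 4 (.reg 10)),
      .incr 11]),
    .incr 10]),
  .store 4 (.reg 10) (.reg 11)]

end RAM

namespace RoutedGraph

open RAM

variable {n m : ℕ}

/-! ## Darts -/

/-- The position in the input at which the list of the neighbours of `v` starts. -/
def rotOffset (I : RoutedGraph n m) (v : ℕ) : ℕ :=
  ((((List.finRange n).map I.rot).take v).flatten).length

/-- The neighbour `w` of `v` is at position `k` of the input. -/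
def IsDart (I : RoutedGraph n m) (k : ℕ) (v w : Fin n) : Prop :=
  ∃ j, (I.rot v)[j]? = some w ∧ k = I.rotOffset v + j

variable {I : RoutedGraph n m}

theorem rotOffset_succ (v : Fin n) : I.rotOffset (v + 1) = I.rotOffset v + (I.rot v).length :=
  RAM.length_take_succ (finRange_map_getElem? I.rot v)

theorem rotOffset_mono {v w : ℕ} (h : v ≤ w) : I.rotOffset v ≤ I.rotOffset w :=
  ((List.take_prefix_take_left h).sublist.flatten).length_le

theorem input_rotOffset {v : ℕ} (hv : v ≤ n) : I.input.arr 0 v = I.rotOffset v :=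
  RAM.offsets_getD _ (by simpa using hv)

theorem IsDart.bounds {k : ℕ} {v w : Fin n} (h : I.IsDart k v w) :
    I.rotOffset v ≤ k ∧ k < I.rotOffset (v + 1) ∧ k < I.rotOffset n := by
  obtain ⟨j, hj, rfl⟩ := h
  have h1 := (List.getElem?_eq_some_iff.1 hj).1
  have h2 := I.rotOffset_mono (show (v : ℕ) + 1 ≤ n from v.2)
  rw [rotOffset_succ] at h2 ⊢
  omega

theorem IsDart.input {k : ℕ} {v w : Fin n} (h : I.IsDart k v w) : I.input.arr 1 k = w := by
  obtain ⟨j, hj, rfl⟩ := h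
  obtain ⟨h1, h2⟩ := List.getElem?_eq_some_iff.1 hj
  refine (RAM.contents_getD (finRange_map_getElem? I.rot v) h1).trans ?_
  rw [h2]

theorem eq_of_rotOffset_le {k : ℕ} {v v' : Fin n} (h1 : I.rotOffset v ≤ k)
    (h2 : k < I.rotOffset (v + 1)) (h3 : I.rotOffset v' ≤ k) (h4 : k < I.rotOffset (v' + 1)) :
    v = v' := by
  ext
  by_contra hne
  rcases lt_or_gt_of_ne hne with h | h
  · have := I.rotOffset_mono (show (v : ℕ) + 1 ≤ v' from h)
    omega
  · have := I.rotOffset_mono (show (v' : ℕ) + 1 ≤ v from h)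
    omega

theorem IsDart.unique {k : ℕ} {v w v' w' : Fin n} (h : I.IsDart k v w) (h' : I.IsDart k v' w') :
    v = v' ∧ w = w' := by
  have b := h.bounds
  have b' := h'.bounds
  obtain rfl := eq_of_rotOffset_le b.1 b.2.1 b'.1 b'.2.1
  obtain ⟨j, hj, rfl⟩ := h
  obtain ⟨j', hj', heq⟩ := h'
  obtain rfl : j = j' := by omega
  exact ⟨rfl, Option.some_injective _ (hj.symm.trans hj')⟩

theorem IsDart.eq {k k' : ℕ} {v w : Fin n} (h : I.IsDart k v w) (h' : I.IsDart k' v w) :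
    k = k' := by
  obtain ⟨j, hj, rfl⟩ := h
  obtain ⟨j', hj', rfl⟩ := h'
  obtain ⟨h1, h2⟩ := List.getElem?_eq_some_iff.1 hj
  obtain ⟨h1', h2'⟩ := List.getElem?_eq_some_iff.1 hj'
  rw [(I.rot_nodup v).getElem_inj_iff.1 (h2.trans h2'.symm)]

theorem exists_isDart {v w : Fin n} (h : I.graph.Adj v w) : ∃ k, I.IsDart k v w := by
  obtain ⟨j, hj, h1⟩ := List.getElem_of_mem ((I.mem_rot v w).2 h)
  exact ⟨_, j, by rw [List.getElem?_eq_getElem hj, h1], rfl⟩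

/-- The numbers of the darts of the half-edges. -/
def IsKey (I : RoutedGraph n m) (H : HalfEdges) (key : ℕ → ℕ) (h : ℕ) : Prop :=
  ∀ v w : Fin n, H.nd h = v → H.nb h = w → I.IsDart (key h) v w

/-- For each node `x`, its neighbour list is scanned once, and array 14 receives the place of each
neighbour in it; then the half-edges at `x` look up their darts. Array 14 is never cleared: a
half-edge at `x` reads only the entry of a neighbour of `x`, which was just overwritten. -/
theorem runs_findDarts {H : HalfEdges} (hH : H.Valid I) {s : State} (h0 : s.reg 0 = n)
    (h7 : s.reg 7 = 0) (ha0 : s.arr 0 = I.input.arr 0) (ha1 : s.arr 1 = I.input.arr 1)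
    (ha7 : s.arr 7 = H.nb) (ha12 : ∀ y, s.arr 12 y = headPtr (bucket H.nd y H.M))
    (ha13 : ∀ h < H.M, s.arr 13 h = headPtr (bucket H.nd (H.nd h) h)) :
    Runs .findDarts s (100 * (I.rotOffset n + H.M + n + 1))
      (fun s' => ∀ h < H.M, IsKey I H (s'.arr 15) h) := by
  have hsum : ∑ y ∈ Finset.range n, (bucket H.nd y H.M).length ≤ H.M := by
    rw [sum_length_bucket]
    exact (Finset.card_filter_le _ _).trans (by simp)
  -- The potential counts the darts and the half-edges at the nodes below `x`; each is handled once.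
  refine (runs_loop_potential (fun x s' => s'.reg 7 = x ∧
    ∀ h < H.M, H.nd h < x → IsKey I H (s'.arr 15) h) n 60
    (fun x => I.rotOffset x + ∑ y ∈ Finset.range x, (bucket H.nd y H.M).length) (fun k _ => by
      have := I.rotOffset_mono (Nat.le_succ k)
      rw [Finset.sum_range_succ]
      dsimp only [Nat.succ_eq_add_one] at this ⊢
      omega) ⟨h7, by simp⟩ ?_ ?_).mono (by simp only [Expr.cost]; omega) ?_
  · rintro x hx s' ⟨r7, hkey⟩ hf
    have f0 : s'.reg 0 = n := (hf.1 0 (by decide)).trans h0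
    have fa0 : s'.arr 0 = I.input.arr 0 := (hf.2 0 (by decide)).trans ha0
    have fa1 : s'.arr 1 = I.input.arr 1 := (hf.2 1 (by decide)).trans ha1
    have fa7 : s'.arr 7 = H.nb := (hf.2 7 (by decide)).trans ha7
    have fa12 : s'.arr 12 = s.arr 12 := hf.2 12 (by decide)
    have fa13 : s'.arr 13 = s.arr 13 := hf.2 13 (by decide)
    obtain ⟨v, rfl⟩ : ∃ v : Fin n, (v : ℕ) = x := ⟨⟨x, hx⟩, rfl⟩
    have g0 := input_rotOffset (I := I) (v := v) v.2.le
    have g1 := input_rotOffset (I := I) (v := v + 1) v.2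
    rw [rotOffset_succ] at g1
    refine ⟨by simp [Expr.eval, r7, f0, hx], ?_⟩
    refine Runs.mono (T := 3 + ((9 + 6) * (I.rot v).length + 6 + (3 +
      ((9 + 8) * (bucket H.nd v H.M).length + 3 + 4)))) ?_ ?_ fun _ => id
    · refine Runs.seq (runs_of_effect rfl rfl rfl : Runs _ _ _ (fun s' => s' = _))
        fun s₁ hs₁ _ => ?_
      have q7 : s₁.reg 7 = v := by rw [hs₁]; simpa [Prog.effect] using r7
      have q8 : s₁.reg 8 = I.rotOffset v := by
        rw [hs₁]; simpa [Prog.effect, Expr.eval, r7, fa0] using g0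
      have qa : s₁.arr = s'.arr := by rw [hs₁]; rfl
      refine Runs.seq (runs_for (fun t s₂ => s₂.reg 8 = I.rotOffset v + t ∧
        ∀ j w, j < t → (I.rot v)[j]? = some w → s₂.arr 14 w = I.rotOffset v + j) (I.rot v).length 9
        ⟨q8, by simp⟩ ?_ ?_) fun s₂ hs₂ hf₂ => ?_
      · rintro t ht s₂ ⟨r8, hm⟩ hf₂
        have c7 : s₂.reg 7 = v := (hf₂.1 7 (by decide)).trans q7
        have c0 : s₂.arr 0 = I.input.arr 0 := by rw [hf₂.2 0 (by decide), qa, fa0]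
        have c1 : s₂.arr 1 = I.input.arr 1 := by rw [hf₂.2 1 (by decide), qa, fa1]
        have hd : I.IsDart (I.rotOffset v + t) v (I.rot v)[t] :=
          ⟨t, List.getElem?_eq_getElem ht, rfl⟩
        refine ⟨by simp [Expr.eval, r8, c7, c0, g1, ht], runs_of_effect rfl rfl ⟨?_, ?_⟩⟩
        · simp [Prog.block, Prog.incr, Prog.effect, Expr.eval, r8, add_assoc]
        · intro j w hj hw
          simp only [Prog.block, Prog.incr, Prog.effect, Expr.eval, r8, c1, hd.input,
            Function.update_self]
          by_cases hjt : j = t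
          · subst hjt
            rw [List.getElem?_eq_getElem ht, Option.some.injEq] at hw
            rw [hw, Function.update_self]
          · rw [Function.update_of_ne]
            · exact hm j w (by omega) hw
            · intro heq
              obtain ⟨h1, h2⟩ := List.getElem?_eq_some_iff.1 hw
              exact hjt ((I.rot_nodup v).getElem_inj_iff.1 (h2.trans (Fin.ext heq)))
      · rintro s₂ ⟨r8, -⟩ hf₂
        have c7 : s₂.reg 7 = v := (hf₂.1 7 (by decide)).trans q7
        have c0 : s₂.arr 0 = I.input.arr 0 := by rw [hf₂.2 0 (by decide), qa, fa0]
        simp [Expr.eval, r8, c7, c0, g1]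
      have c7 : s₂.reg 7 = v := (hf₂.1 7 (by decide)).trans q7
      have ca7 : s₂.arr 7 = H.nb := by rw [hf₂.2 7 (by decide), qa, fa7]
      have ca12 : s₂.arr 12 = s.arr 12 := by rw [hf₂.2 12 (by decide), qa, fa12]
      have ca13 : s₂.arr 13 = s.arr 13 := by rw [hf₂.2 13 (by decide), qa, fa13]
      have ca15 : s₂.arr 15 = s'.arr 15 := by rw [hf₂.2 15 (by decide), qa]
      refine Runs.seq (runs_of_effect rfl rfl rfl : Runs _ _ _ (fun s' => s' = _))
        fun s₃ hs₃ _ => ?_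
      have d7 : s₃.reg 7 = v := by rw [hs₃]; simpa [Prog.effect] using c7
      have d9 : s₃.reg 9 = headPtr (bucket H.nd v H.M) := by
        rw [hs₃]; simpa [Prog.effect, Expr.eval, c7, ca12] using ha12 v
      have da : s₃.arr = s₂.arr := by rw [hs₃]; rfl
      refine Runs.seq (runs_walk (key := H.nd) (y := v) (N := H.M) (fun t s₄ =>
        ∀ h < H.M, H.nd h < v ∨ h ∈ (bucket H.nd v H.M).take t → IsKey I H (s₄.arr 15) h)
        (by decide) (by decide) rfl d9 (by rw [da, ca13]; exact ha13) ?_ ?_ ?_)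
        fun s₄ hs₄ hf₄ => ?_
      · intro h hh hor
        rw [da, ca15]
        exact hkey h hh (by simpa using hor)
      · intro t h ht s₄ hi hr hf₄ g hg hor
        have e7 : s₄.arr 7 = H.nb := by rw [hf₄.2 7 (by decide), da, ca7]
        have e14 : s₄.arr 14 = s₂.arr 14 := by rw [hf₄.2 14 (by decide), da]
        have hb := mem_bucket.1 (List.mem_of_getElem? ht)
        simp only [Prog.effect, Expr.eval, hr, e7, e14, Function.update_self, Nat.add_sub_cancel]
        intro x w hgx hw
        by_cases hgh : g = h
        · subst hgh
          obtain rfl : x = v := Fin.ext (hgx.symm.trans hb.2)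
          obtain ⟨i, x', w', hhalf, htr⟩ := hH.exists_path g hg
          obtain rfl : x' = x := Fin.ext (hhalf.2.2.1.symm.trans hgx)
          obtain rfl : w' = w := Fin.ext (hhalf.2.2.2.symm.trans hw)
          obtain ⟨j, hj, h1⟩ := List.getElem_of_mem ((I.mem_rot _ _).2 htr.adj)
          have hj' : (I.rot x')[j]? = some w' := by rw [List.getElem?_eq_getElem hj, h1]
          rw [Function.update_self, hw, hs₂.2 j w' hj hj']
          exact ⟨j, hj', rfl⟩
        · rw [Function.update_of_ne hgh]
          refine hi g hg (hor.imp_right fun hmem => ?_) x w hgx hw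
          rw [List.take_add_one, ht] at hmem
          rcases List.mem_append.1 hmem with h1 | h1
          · exact h1
          · exact absurd (by simpa using h1) hgh
      · exact fun _ _ _ h => h
      have d7' : s₄.reg 7 = v := (hf₄.1 7 (by decide)).trans d7
      rw [List.take_length] at hs₄
      refine runs_of_effect rfl rfl ⟨?_, fun h hh hlt => ?_⟩
      · simp [Prog.block, Prog.incr, Prog.effect, Expr.eval, d7']
      · refine hs₄ h hh ?_
        rcases Nat.lt_succ_iff_lt_or_eq.1 hlt with h1 | h1
        · exact .inl h1
        · exact .inr (mem_bucket.2 ⟨hh, h1⟩)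
    · simp only [Finset.sum_range_succ, rotOffset_succ]
      omega
  · rintro s' ⟨r7, -⟩ hf
    have f0 : s'.reg 0 = n := (hf.1 0 (by decide)).trans h0
    simp [Expr.eval, r7, f0]
  · rintro s' ⟨-, hkey⟩ h hh
    obtain ⟨_, x, _, hx, -⟩ := hH.exists_path h hh
    exact hkey h hh (by rw [hx.2.2.1]; exact x.2)

end RoutedGraph

namespace RoutedGraph

open RAM

variable {n m : ℕ} {I : RoutedGraph n m}

/-- The number of half-edges below `M` with key below `k`. -/
def cumulative (key : ℕ → ℕ) (M k : ℕ) : ℕ := ∑ y ∈ Finset.range k, (bucket key y M).length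

theorem cumulative_succ (key : ℕ → ℕ) (M k : ℕ) :
    cumulative key M (k + 1) = cumulative key M k + (bucket key k M).length :=
  Finset.sum_range_succ _ _

theorem cumulative_mono {key : ℕ → ℕ} {M k l : ℕ} (h : k ≤ l) :
    cumulative key M k ≤ cumulative key M l :=
  Finset.sum_le_sum_of_subset (Finset.range_mono h)

theorem cumulative_eq {key : ℕ → ℕ} {M k : ℕ} (h : ∀ h < M, key h < k) :
    cumulative key M k = M := by
  unfold cumulative
  rw [sum_length_bucket, Finset.filter_true_of_mem (fun x hx => h x (Finset.mem_range.1 hx)),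
    Finset.card_range]

theorem key_eq_of_cumulative {key : ℕ → ℕ} {M k l p : ℕ} (h1 : cumulative key M k ≤ p)
    (h2 : p < cumulative key M (k + 1)) (h3 : cumulative key M l ≤ p)
    (h4 : p < cumulative key M (l + 1)) : k = l := by
  by_contra hne
  rcases lt_or_gt_of_ne hne with h | h
  · have := cumulative_mono (key := key) (M := M) (show k + 1 ≤ l from h)
    omega
  · have := cumulative_mono (key := key) (M := M) (show l + 1 ≤ k from h)
    omega

/-- The layout stored in the memory. -/
def layout (s : State) : Layout where
  obj := s.arr 18
  pos := s.arr 19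
  mate := s.arr 9
  blk := s.arr 20

/-- The half-edges with keys below `k`, and the first `t` of those with key `k`, are at their
positions. -/
structure IsPlaced (key : ℕ → ℕ) (M k t : ℕ) (S : Layout) : Prop where
  obj : ∀ p < cumulative key M k + t, S.obj p < M ∧ S.pos (S.obj p) = p ∧
    (key (S.obj p) < k ∨ S.obj p ∈ (bucket key k M).take t) ∧
    cumulative key M (key (S.obj p)) ≤ p ∧ p < cumulative key M (key (S.obj p) + 1) ∧
    S.blk p = cumulative key M (key (S.obj p))
  pos : ∀ h < M, key h < k ∨ h ∈ (bucket key k M).take t →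
    S.pos h < cumulative key M k + t ∧ S.obj (S.pos h) = h

theorem IsPlaced.place {key : ℕ → ℕ} {M k t h : ℕ} {S : Layout} (hS : IsPlaced key M k t S)
    (ht : (bucket key k M)[t]? = some h) {mate : ℕ → ℕ} :
    IsPlaced key M k (t + 1)
      { obj := Function.update S.obj (cumulative key M k + t) h
        pos := Function.update S.pos h (cumulative key M k + t)
        mate := mate
        blk := Function.update S.blk (cumulative key M k + t) (cumulative key M k) } := by
  have hb := mem_bucket.1 (List.mem_of_getElem? ht)
  obtain ⟨htl, hth⟩ := List.getElem?_eq_some_iff.1 ht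
  have htake : ∀ g, g ∈ (bucket key k M).take (t + 1) ↔ g ∈ (bucket key k M).take t ∨ g = h := by
    intro g
    rw [List.take_add_one, ht]
    simp
  have hne : ∀ g, (key g < k ∨ g ∈ (bucket key k M).take t) → g ≠ h := by
    rintro g hg rfl
    rcases hg with hg | hg
    · omega
    · obtain ⟨j, hj, hj'⟩ := List.getElem_of_mem hg
      rw [List.getElem_take] at hj'
      have := (nodup_bucket key k M).getElem_inj_iff.1 (hj'.trans hth.symm)
      rw [List.length_take] at hj
      omega
  constructor
  · intro p hp
    dsimp only
    by_cases hpt : p = cumulative key M k + t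
    · subst hpt
      rw [Function.update_self, Function.update_self, Function.update_self, hb.2]
      refine ⟨hb.1, rfl, .inr ((htake h).2 (.inr rfl)), by omega, ?_, rfl⟩
      rw [cumulative_succ]
      omega
    · obtain ⟨h1, h2, h3, h4⟩ := hS.obj p (by omega)
      rw [Function.update_of_ne hpt, Function.update_of_ne hpt, Function.update_of_ne (hne _ h3)]
      exact ⟨h1, h2, h3.imp_right fun h => (htake _).2 (.inl h), h4⟩
  · intro g hg hor
    dsimp only
    by_cases hgh : g = h
    · subst hgh
      rw [Function.update_self, Function.update_self]
      exact ⟨by omega, rfl⟩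
    · have h1 := hS.pos g hg (hor.imp_right fun h => ((htake g).1 h).resolve_right hgh)
      rw [Function.update_of_ne hgh, Function.update_of_ne (by omega)]
      exact ⟨by omega, h1.2⟩

theorem IsPlaced.succ {key : ℕ → ℕ} {M k : ℕ} {S : Layout}
    (hS : IsPlaced key M k (bucket key k M).length S) : IsPlaced key M (k + 1) 0 S := by
  have hor : ∀ h < M, key h < k + 1 ↔
      (key h < k ∨ h ∈ (bucket key k M).take (bucket key k M).length) := by
    intro h hh
    rw [List.take_length, mem_bucket]
    omega
  refine ⟨fun p hp => ?_, fun h hh h1 => ?_⟩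
  · rw [cumulative_succ, add_zero] at hp
    obtain ⟨h1, h2, h3, h4⟩ := hS.obj p hp
    exact ⟨h1, h2, .inl ((hor _ h1).2 h3), h4⟩
  · have := hS.pos h hh ((hor h hh).1 (h1.resolve_right (by simp)))
    rwa [cumulative_succ, add_zero]

/-- A bucket sort. Since half-edges later stay within the interval of their dart, the start
positions stored in array 4 already are the offsets of the output. -/
theorem runs_placeHalves {key : ℕ → ℕ} {M : ℕ} {s : State} (hkey : ∀ h < M, key h < I.rotOffset n)
    (h0 : s.reg 0 = n) (h10 : s.reg 10 = 0) (h11 : s.reg 11 = 0) (ha0 : s.arr 0 = I.input.arr 0)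
    (ha16 : ∀ y, s.arr 16 y = headPtr (bucket key y M))
    (ha17 : ∀ h < M, s.arr 17 h = headPtr (bucket key (key h) h)) :
    Runs .placeHalves s (100 * (I.rotOffset n + M + 1)) (fun s' =>
      (∀ k ≤ I.rotOffset n, s'.arr 4 k = cumulative key M k) ∧
      IsPlaced key M (I.rotOffset n) 0 (layout s')) := by
  have hM := cumulative_eq hkey
  have hD : I.input.arr 0 n = I.rotOffset n := input_rotOffset le_rfl
  have hz : cumulative key M 0 = 0 := rfl
  refine Runs.mono (T := (50 + (1 + 2 + 1)) * (cumulative key M (I.rotOffset n) +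
    I.rotOffset n + 1) + 3) ?_ (by omega) fun _ => id
  refine Runs.seq ((runs_loop_potential (fun k s' => s'.reg 10 = k ∧
    s'.reg 11 = cumulative key M k ∧ (∀ j < k, s'.arr 4 j = cumulative key M j) ∧
    IsPlaced key M k 0 (layout s')) (I.rotOffset n) 50 (cumulative key M)
    (fun k _ => cumulative_mono (Nat.le_succ k)) ⟨h10, h11, by simp, ⟨?_, by simp⟩⟩ ?_ ?_).mono
    (by simp [Expr.cost]) fun _ => id) fun s' hs' hf => ?_
  · intro p hp
    simp [hz] at hp
  · rintro k hk s' ⟨r10, r11, ha4, hP⟩ hf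
    have f0 : s'.reg 0 = n := (hf.1 0 (by decide)).trans h0
    have fa0 : s'.arr 0 = I.input.arr 0 := (hf.2 0 (by decide)).trans ha0
    have fa16 : s'.arr 16 = s.arr 16 := hf.2 16 (by decide)
    have fa17 : s'.arr 17 = s.arr 17 := hf.2 17 (by decide)
    refine ⟨by simp [Expr.eval, r10, fa0, f0, hD, hk], ?_⟩
    refine Runs.mono (T := 3 + (3 + ((18 + 8) * (bucket key k M).length + 3 + 4))) ?_
      (by rw [cumulative_succ]; omega) fun _ => id
    refine Runs.seq (runs_of_effect rfl rfl rfl : Runs _ _ _ (fun s' => s' = _)) fun s₁ hs₁ _ => ?_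
    refine Runs.seq (runs_of_effect rfl rfl rfl : Runs _ _ _ (fun s' => s' = _)) fun s₂ hs₂ _ => ?_
    have q10 : s₂.reg 10 = k := by rw [hs₂, hs₁]; simpa [Prog.effect] using r10
    have q11 : s₂.reg 11 = cumulative key M k := by rw [hs₂, hs₁]; simpa [Prog.effect] using r11
    have q9 : s₂.reg 9 = headPtr (bucket key k M) := by
      rw [hs₂, hs₁]
      simpa [Prog.effect, Expr.eval, r10, fa16] using ha16 k
    have qa4 : s₂.arr 4 = Function.update (s'.arr 4) k (cumulative key M k) := by
      rw [hs₂, hs₁]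
      simp [Prog.effect, Expr.eval, r10, r11]
    have qa : ∀ A ≠ 4, s₂.arr A = s'.arr A := by
      intro A hA
      rw [hs₂, hs₁]
      simp [Prog.effect, hA]
    have ql : layout s₂ = layout s' := by
      simp [layout, qa]
    refine Runs.seq ((runs_walk (key := key) (y := k) (N := M) (fun t s₃ => s₃.reg 10 = k ∧
      s₃.reg 11 = cumulative key M k + t ∧ (∀ j < k + 1, s₃.arr 4 j = cumulative key M j) ∧
      IsPlaced key M k t (layout s₃)) (by decide) (by decide) rfl q9
      (by rw [qa 17 (by decide), fa17]; exact ha17) ⟨q10, q11, ?_, by rwa [ql]⟩ ?_ ?_).mono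
      le_rfl fun _ => id) fun s₃ hs₃ hf₃ => ?_
    · intro j hj
      rw [qa4]
      by_cases hjk : j = k
      · rw [hjk, Function.update_self]
      · rw [Function.update_of_ne hjk]
        exact ha4 j (by omega)
    · rintro t h ht s₃ ⟨i10, i11, i4, iP⟩ hr -
      refine ⟨?_, ?_, ?_, ?_⟩
      · simpa [Prog.block, Prog.incr, Prog.effect] using i10
      · simp [Prog.block, Prog.incr, Prog.effect, Expr.eval, i11, add_assoc]
      · simpa [Prog.block, Prog.incr, Prog.effect] using i4
      · have := iP.place ht (mate := s₃.arr 9)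
        simpa [Prog.block, Prog.incr, Prog.effect, Expr.eval, layout, i10, i11, hr,
          i4 k (Nat.lt_succ_self k)] using this
    · rintro t s₃ x ⟨i10, i11, i4, iP⟩
      exact ⟨by simpa using i10, by simpa using i11, i4, iP⟩
    · obtain ⟨i10, i11, i4, iP⟩ := hs₃
      refine runs_of_effect rfl rfl ⟨?_, ?_, ?_, ?_⟩
      · simp [Prog.block, Prog.incr, Prog.effect, Expr.eval, i10]
      · simpa [Prog.block, Prog.incr, Prog.effect, Expr.eval, cumulative_succ] using i11
      · simpa [Prog.block, Prog.incr, Prog.effect] using i4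
      · simpa [Prog.block, Prog.incr, Prog.effect, layout] using iP.succ
  · rintro s' ⟨r10, -⟩ hf
    have f0 : s'.reg 0 = n := (hf.1 0 (by decide)).trans h0
    have fa0 : s'.arr 0 = I.input.arr 0 := (hf.2 0 (by decide)).trans ha0
    simp [Expr.eval, r10, fa0, f0, hD]
  · obtain ⟨r10, r11, ha4, hP⟩ := hs'
    refine runs_of_effect rfl rfl ⟨fun k hk => ?_, ?_⟩
    · simp only [Prog.block, Prog.effect, Expr.eval, r10, r11, Function.update_self]
      by_cases hkD : k = I.rotOffset n
      · rw [hkD, Function.update_self]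
      · rw [Function.update_of_ne hkD]
        exact ha4 k (by omega)
    · simpa [Prog.block, Prog.effect, layout] using hP

/-! ## The initial layout -/

/-- The positions are sorted by darts, and the positions of dart `k` start at `start k`. -/
structure Layout.Sorted (S : Layout) (I : RoutedGraph n m) (H : HalfEdges) (start : ℕ → ℕ) :
    Prop where
  valid : S.Valid I H (fun q => H.nd (S.obj q)) []
  zero : start 0 = 0
  last : start (I.rotOffset n) = H.M
  mono : ∀ k l, k ≤ l → l ≤ I.rotOffset n → start k ≤ start l
  dart : ∀ {k v w}, I.IsDart k v w → ∀ q < H.M, start k ≤ q ∧ q < start (k + 1) ↔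
    H.nd (S.obj q) = v ∧ H.nb (S.obj q) = w
  node : ∀ (v : Fin n), ∀ q < H.M, start (I.rotOffset v) ≤ q ∧ q < start (I.rotOffset (v + 1)) ↔
    H.nd (S.obj q) = v

/-- Before any deletion the links are the darts: the mate of a half-edge is the opposite one, and
the blocks are the classes of equal keys. -/
theorem IsPlaced.sorted {H : HalfEdges} (hH : H.Valid I) {key start : ℕ → ℕ} {S : Layout}
    (hkey : ∀ h < H.M, IsKey I H key h) (hP : IsPlaced key H.M (I.rotOffset n) 0 S)
    (hstart : ∀ k ≤ I.rotOffset n, start k = cumulative key H.M k) (hm : S.mate = H.opp) :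
    S.Sorted I H start := by
  have hdart : ∀ h < H.M, ∃ i v w, H.IsHalf (n := n) (m := m) h i v w ∧ I.IsDart (key h) v w := by
    intro h hh
    obtain ⟨i, v, w, h1, -⟩ := hH.exists_path h hh
    exact ⟨i, v, w, h1, hkey h hh v w h1.2.2.1 h1.2.2.2⟩
  have hlt : ∀ h < H.M, key h < I.rotOffset n := fun h hh => by
    obtain ⟨_, _, _, -, h1⟩ := hdart h hh
    exact h1.bounds.2.2
  have hM := cumulative_eq hlt
  have hobj : ∀ p < H.M, S.obj p < H.M ∧ S.pos (S.obj p) = p ∧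
      cumulative key H.M (key (S.obj p)) ≤ p ∧ p < cumulative key H.M (key (S.obj p) + 1) ∧
      S.blk p = cumulative key H.M (key (S.obj p)) := fun p hp => by
    obtain ⟨h1, h2, -, h3⟩ := hP.obj p (by rw [hM]; exact hp)
    exact ⟨h1, h2, h3⟩
  have hpos : ∀ h < H.M, S.pos h < H.M ∧ S.obj (S.pos h) = h := fun h hh => by
    have := hP.pos h hh (.inl (hlt h hh))
    rwa [hM] at this
  have hbk : ∀ p < H.M, ∀ q < H.M, S.blk p = S.blk q → key (S.obj p) = key (S.obj q) := by
    intro p hp q hq heq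
    obtain ⟨-, -, h1, h2, h3⟩ := hobj p hp
    obtain ⟨-, -, h1', h2', h3'⟩ := hobj q hq
    exact key_eq_of_cumulative (key := key) (M := H.M) (p := S.blk p) (by omega) (by omega) (by omega) (by omega)
  have hkd : ∀ {h k : ℕ} {v w : Fin n}, h < H.M → I.IsDart k v w →
      (key h = k ↔ H.nd h = v ∧ H.nb h = w) := by
    intro h k v w hh hd
    obtain ⟨i, v', w', h1, h2⟩ := hdart h hh
    rw [h1.2.2.1, h1.2.2.2]
    constructor
    · rintro rfl
      obtain ⟨rfl, rfl⟩ := h2.unique hd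
      exact ⟨rfl, rfl⟩
    · rintro ⟨hv, hw⟩
      obtain rfl := Fin.ext hv
      obtain rfl := Fin.ext hw
      exact h2.eq hd
  have hblocks : Blocks H.M S.blk := by
    refine ⟨fun q hq => ?_, fun q hq => ?_, fun p q hpq hq => ?_⟩
    · obtain ⟨-, -, h1, -, h2⟩ := hobj q hq
      omega
    · obtain ⟨-, -, h1, h2, h3⟩ := hobj q hq
      obtain ⟨-, -, h1', h2', h3'⟩ := hobj (S.blk q) (by omega)
      rw [h3', key_eq_of_cumulative (p := S.blk q) h1' h2' h3.ge (by omega), h3]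
    · obtain ⟨-, -, h1, h2, h3⟩ := hobj p (by omega)
      obtain ⟨-, -, h1', h2', h3'⟩ := hobj q hq
      rw [h3, h3']
      refine cumulative_mono ?_
      by_contra hlt
      have := cumulative_mono (key := key) (M := H.M)
        (show key (S.obj q) + 1 ≤ key (S.obj p) by omega)
      omega
  have hlink : ∀ {d : List (Fin n)}, IsLink [] d → ∃ x y, d = [x, y] := by
    rintro d ⟨x, l, y, rfl, -, -, hl⟩
    obtain rfl := List.eq_nil_iff_forall_not_mem.2 fun u hu => List.not_mem_nil (hl u hu)
    exact ⟨x, y, rfl⟩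
  have hhalf : ∀ {h : ℕ} {i : Fin m} {x y : Fin n}, H.Starts h i [x, y] → H.IsHalf h i x y := by
    rintro h i x y ⟨x', y', l, heq, hh⟩
    simp only [List.cons.injEq] at heq
    rwa [heq.1, heq.2.1]
  refine ⟨⟨fun h hh => (hpos h hh).1, fun h hh => (hpos h hh).2, fun q hq => (hobj q hq).1,
    fun q hq => (hobj q hq).2.1, fun _ _ => rfl, hblocks, fun p hp q hq heq => ?_, ?_, ?_⟩,
    ?_, ?_, fun k l hkl hl => ?_, fun {k v w} hd q hq => ?_, fun v q hq => ?_⟩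
  · obtain ⟨_, v, w, h1, h2⟩ := hdart _ (hobj p hp).1
    obtain ⟨_, v', w', h1', h2'⟩ := hdart _ (hobj q hq).1
    rw [h1.2.2.1, h1'.2.2.1]
    rw [hbk p hp q hq heq] at h2
    rw [(h2.unique h2').1]
  · intro i d h hd hi hs
    obtain ⟨x, y, rfl⟩ := hlink hd
    rw [hm]
    exact ⟨y, x, [], rfl, hH.opp (hhalf hs)⟩
  · intro i j d e h h' hd he hi hj hs hs'
    obtain ⟨x, y, rfl⟩ := hlink hd
    obtain ⟨x', y', rfl⟩ := hlink he
    have h1 := hhalf hs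
    have h2 := hhalf hs'
    have k1 := hkey h h1.1 x y h1.2.2.1 h1.2.2.2
    have k2 := hkey h' h2.1 x' y' h2.2.2.1 h2.2.2.2
    have p1 := hpos h h1.1
    have p2 := hpos h' h2.1
    constructor
    · intro heq
      have := hbk _ p1.1 _ p2.1 heq
      rw [p1.2, p2.2] at this
      rw [this] at k1
      obtain ⟨rfl, rfl⟩ := k1.unique k2
      rfl
    · intro heq
      simp only [List.cons.injEq, and_true] at heq
      obtain ⟨rfl, rfl⟩ := heq
      rw [(hobj _ p1.1).2.2.2.2, (hobj _ p2.1).2.2.2.2, p1.2, p2.2, k1.eq k2]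
  · rw [hstart 0 (Nat.zero_le _)]
    rfl
  · rw [hstart _ le_rfl, hM]
  · rw [hstart k (hkl.trans hl), hstart l hl]
    exact cumulative_mono hkl
  · obtain ⟨h1, -, h2, h3, -⟩ := hobj q hq
    have hb := hd.bounds.2.2
    rw [← hkd h1 hd, hstart k hb.le, hstart (k + 1) hb]
    constructor
    · rintro ⟨h4, h5⟩
      exact key_eq_of_cumulative h2 h3 h4 h5
    · rintro rfl
      exact ⟨h2, h3⟩
  · obtain ⟨h1, -, h2, h3, -⟩ := hobj q hq
    obtain ⟨_, v', w', h4, h5⟩ := hdart _ h1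
    have b := h5.bounds
    rw [hstart _ (rotOffset_mono v.2.le),
      hstart _ (rotOffset_mono (show (v : ℕ) + 1 ≤ n from v.2)), h4.2.2.1]
    constructor
    · rintro ⟨h6, h7⟩
      refine congrArg _ (eq_of_rotOffset_le b.1 b.2.1 (v' := v) ?_ ?_)
      · by_contra hlt
        have := cumulative_mono (key := key) (M := H.M)
          (show key (S.obj q) + 1 ≤ I.rotOffset v by omega)
        omega
      · by_contra hlt
        have := cumulative_mono (key := key) (M := H.M)
          (show I.rotOffset (v + 1) ≤ key (S.obj q) by omega)
        omega
    · intro hv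
      obtain rfl := Fin.ext hv
      exact ⟨(cumulative_mono b.1).trans h2, h3.trans_le (cumulative_mono b.2.1)⟩

end RoutedGraph

/-! ### Deletion of one node by the program -/

namespace RAM

/-- The positions at the node in register `12`. -/
def Prog.bounds : Prog := .block [
  .assign 13 (.arr 4 (.arr 0 (.reg 12))),
  .assign 14 (.arr 4 (.arr 0 (.add (.reg 12) (.const 1))))]

/-- For each block between the bounds, find the block at the other ends of its half-edges. -/
def Prog.findTargets : Prog := .block [
  .assign 15 (.reg 13),
  .loop (.reg 15) (.reg 14) (.block [
    .store 21 (.arr 20 (.reg 15)) (.arr 20 (.arr 19 (.arr 9 (.arr 18 (.reg 15))))),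
    .store 22 (.arr 21 (.arr 20 (.reg 15))) (.arr 21 (.arr 20 (.reg 15))),
    .incr 15])]

/-- The position of the twin of the half-edge at the current position. -/
def Expr.twin : Expr := .arr 19 (.arr 10 (.arr 18 (.reg 15)))

/-- Start a new block at the position in register `18`. -/
def Prog.newBlock : Prog := .store 20 (.reg 18) (.reg 18)

/-- Move the half-edge at the other end of the twin of the half-edge at the current position to
the first free position of its new block. -/
def Prog.relocate : Prog := .block [
  .assign 16 (.arr 9 (.arr 10 (.arr 18 (.reg 15)))),
  .assign 17 (.arr 21 (.arr 20 .twin)),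
  .assign 18 (.arr 22 (.reg 17)),
  .store 22 (.reg 17) (.add (.reg 18) (.const 1)),
  .store 19 (.reg 16) (.reg 18),
  .store 9 (.reg 16) (.arr 9 (.arr 18 (.reg 15))),
  .store 18 (.reg 18) (.reg 16),
  .store 23 (.reg 18) (.arr 20 (.reg 15))]

/-- Extend the block before the position in register `18`, or start a new one. -/
def Prog.extendBlock : Prog :=
  .ite (.reg 17) (.reg 18)
    (.ite (.arr 23 (.sub (.reg 18) (.const 1))) (.arr 20 (.reg 15)) .newBlock
      (.ite (.arr 20 (.reg 15)) (.arr 23 (.sub (.reg 18) (.const 1))) .newBlock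
        (.store 20 (.reg 18) (.arr 20 (.sub (.reg 18) (.const 1))))))
    .newBlock

/-- Merge the current half-edge and its twin. -/
def Prog.move : Prog := .seq .relocate .extendBlock

/-- Move the half-edges at the positions between the bounds that pass a test. -/
def Prog.pass (e f : Expr) : Prog := .seq (.assign 15 (.reg 13))
  (.loop (.reg 15) (.reg 14) (.seq (.ite e f .move .skip) (.incr 15)))

/-- Delete the node in register `12`. -/
def Prog.delete : Prog := .block [
  .bounds,
  .findTargets,
  .pass .twin (.reg 15),
  .pass (.reg 15) .twin]

end RAM

namespace RoutedGraph

open RAM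

variable {n m : ℕ}

namespace Layout

variable {S : Layout} {H : HalfEdges} {pn : ℕ → ℕ} {I : RoutedGraph n m} {τ : List (Fin n)}
  {v : Fin n}

/-- The block at the other end. -/
def otherBlk (S : Layout) (q : ℕ) : ℕ := S.blk (S.pos (S.mate (S.obj q)))

section

variable (hH : H.Valid I) (hτ : I.IsPartialDeletion τ) (hS : S.Valid I H pn τ) (hv : v ∉ τ)

include hS

theorem nd_obj {q : ℕ} (hq : q ∈ posAt H pn v) : H.nd (S.obj q) = v := by
  rw [mem_posAt] at hq
  rw [hS.node q hq.1, hq.2]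

theorem pos_mem {h : ℕ} (hh : h < H.M) (hv : H.nd h = v) : S.pos h ∈ posAt H pn v := by
  have h1 := hS.pos_lt h hh
  exact mem_posAt.2 ⟨h1, by rw [← hS.node _ h1, hS.obj_pos h hh, hv]⟩

theorem blk_mem {q : ℕ} (hq : q ∈ posAt H pn v) : S.blk q ∈ posAt H pn v := by
  rw [mem_posAt] at hq ⊢
  have h1 := (hS.blocks.le q hq.1).trans_lt hq.1
  exact ⟨h1, by rw [hS.blk_node _ h1 _ hq.1 (hS.blocks.idem q hq.1), hq.2]⟩

include hv

theorem live_obj {q : ℕ} (hq : q ∈ posAt H pn v) : H.Live τ (S.obj q) :=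
  ⟨hS.obj_lt q (mem_posAt.1 hq).1, fun u hu heq =>
    hv (by rwa [Fin.ext ((nd_obj hS hq).symm.trans heq)])⟩

include hH hτ

theorem otherBlk_eq {q q' : ℕ} (hq : q ∈ posAt H pn v) (hq' : q' ∈ posAt H pn v)
    (hb : S.blk q = S.blk q') : S.otherBlk q = S.otherBlk q' := by
  refine blk_mate hH hτ hS (live_obj hS hv hq) (live_obj hS hv hq').1 ?_
  rwa [hS.pos_obj q (mem_posAt.1 hq).1, hS.pos_obj q' (mem_posAt.1 hq').1]

end

variable (hH : H.Valid I) (hτ : I.IsPartialDeletion (τ ++ [v])) (hS : S.Valid I H pn τ)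

include hH hτ hS

theorem nd_moved_ne {q : ℕ} (hq : q ∈ posAt H pn v) : H.nd (S.moved H q) ≠ v := by
  obtain ⟨i, d, e, ht⟩ := exists_turn hH hτ hS hq
  obtain ⟨x, l, y, rfl, -⟩ := ht.link
  obtain rfl : x = v := by simpa using ht.head
  rw [ht.moved.nd (x := y) (by simp)]
  intro heq
  have hn := ht.trav.nodup
  simp [Fin.ext heq] at hn

/-- The far ends of the links at `v` are other nodes. So deletion writes nothing at the positions of
`v`, and what the program reads there is still the old layout. -/
theorem slot_notMem {q : ℕ} (hq : q ∈ posAt H pn v) : S.slot H pn v q ∉ posAt H pn v := by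
  intro h
  have h1 := blk_slot hH hτ hS hq
  have h2 := moved_lt hH hτ hS hq
  have h3 := hS.pos_lt _ h2
  refine nd_moved_ne hH hτ hS hq ?_
  rw [← hS.obj_pos _ h2, hS.node _ h3, ← hS.blk_node _ h1.1 _ h3 h1.2, (mem_posAt.1 h).2]

theorem nd_tw {q : ℕ} (hq : q ∈ posAt H pn v) :
    H.tw (S.obj q) < H.M ∧ H.nd (H.tw (S.obj q)) = v := by
  obtain ⟨i, d, e, ht⟩ := exists_turn hH hτ hS hq
  exact ⟨ht.starts.lt, ht.starts.nd ht.head⟩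

theorem otherBlk_pos_tw {q : ℕ} (hq : q ∈ posAt H pn v) :
    S.otherBlk (S.pos (H.tw (S.obj q))) = S.target H q := by
  unfold otherBlk
  rw [hS.obj_pos _ (nd_tw hH hτ hS hq).1]
  rfl

omit hH hτ hS in
theorem newBlk_of_le {q : ℕ} (h : S.slot H pn v q ≤ S.target H q) :
    S.newBlk H pn v q = S.slot H pn v q :=
  le_antisymm (newBlk_le q) (h.trans (Nat.le_add_right _ _))

/-- By `blk_between`, positions from one block reach a target in a row. Comparing with the half-edge
placed just before is thus enough to decide whether a block is continued or a new one begins. -/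
theorem newBlk_of_lt {q : ℕ} (hq : q ∈ posAt H pn v) (h : S.target H q < S.slot H pn v q) :
    ∃ p ∈ posAt H pn v, S.rank H p < S.rank H q ∧ S.slot H pn v q = S.slot H pn v p + 1 ∧
      (S.blk p = S.blk q → S.newBlk H pn v q = S.newBlk H pn v p) ∧
      (S.blk p ≠ S.blk q → S.newBlk H pn v q = S.slot H pn v q) := by
  obtain ⟨p, hp, ht, hr, hs, hmax⟩ := exists_pred h
  refine ⟨p, hp, hr, hs, fun hb => (newBlk_eq hH hτ hS hp hq ht hb).symm, fun hb => ?_⟩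
  unfold newBlk slot
  congr 2
  refine Finset.filter_congr fun r hr' => ?_
  constructor
  · rintro ⟨h1, h2, -⟩
    exact ⟨h1, h2⟩
  · rintro ⟨h1, h2⟩
    refine ⟨h1, h2, fun h3 => hb ?_⟩
    exact (blk_between hH hτ hS hr' hp hq h1 (hmax r hr' h1 h2) hr.le h3).trans h3

end Layout

open Layout

/-- During the deletion of `v`, the positions with rank below `θ` have been visited. -/
structure IsMoved (S : Layout) (H : HalfEdges) (pn : ℕ → ℕ) (v : Fin n) (θ : ℕ) (s : State) :
    Prop where
  done : ∀ q ∈ posAt H pn v, S.rank H q < θ → s.arr 18 (S.slot H pn v q) = S.moved H q ∧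
    s.arr 19 (S.moved H q) = S.slot H pn v q ∧ s.arr 9 (S.moved H q) = S.mate (S.obj q) ∧
    s.arr 20 (S.slot H pn v q) = S.newBlk H pn v q ∧ s.arr 23 (S.slot H pn v q) = S.blk q
  obj_eq : ∀ p < H.M, (∀ q ∈ posAt H pn v, S.rank H q < θ → p ≠ S.slot H pn v q) →
    s.arr 18 p = S.obj p ∧ s.arr 20 p = S.blk p
  pos_eq : ∀ h < H.M, (∀ q ∈ posAt H pn v, S.rank H q < θ → h ≠ S.moved H q) →
    s.arr 19 h = S.pos h ∧ s.arr 9 h = S.mate h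
  next : ∀ q ∈ posAt H pn v, s.arr 22 (S.target H q) = S.target H q + ((posAt H pn v).filter
    (fun p => S.target H p = S.target H q ∧ S.rank H p < θ)).card
  other : ∀ q ∈ posAt H pn v, s.arr 21 (S.blk q) = S.otherBlk q

namespace IsMoved

variable {S : Layout} {H : HalfEdges} {pn : ℕ → ℕ} {I : RoutedGraph n m} {τ : List (Fin n)}
  {v : Fin n} {θ : ℕ} {s : State}

theorem congr (h : IsMoved S H pn v θ s) {θ' : ℕ}
    (hθ : ∀ q ∈ posAt H pn v, S.rank H q < θ' ↔ S.rank H q < θ) : IsMoved S H pn v θ' s := by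
  refine ⟨fun q hq hr => h.done q hq ((hθ q hq).1 hr),
    fun p hp hne => h.obj_eq p hp fun q hq hr => hne q hq ((hθ q hq).2 hr),
    fun g hg hne => h.pos_eq g hg fun q hq hr => hne q hq ((hθ q hq).2 hr), fun q hq => ?_, h.other⟩
  rw [h.next q hq]
  congr 2
  refine Finset.filter_congr fun p hp => ?_
  rw [hθ p hp]

theorem deleted (h : IsMoved S H pn v θ s) (hθ : ∀ q ∈ posAt H pn v, S.rank H q < θ) :
    Deleted S H pn v (layout s) where
  moved q hq := by
    obtain ⟨h1, h2, h3, h4, -⟩ := h.done q hq (hθ q hq)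
    exact ⟨h1, h2, h3, h4⟩
  obj_eq p hp hne := h.obj_eq p hp fun q hq _ => hne q hq
  pos_eq g hg hne := h.pos_eq g hg fun q hq _ => hne q hq

variable (hH : H.Valid I) (hτ : I.IsPartialDeletion (τ ++ [v])) (hS : S.Valid I H pn τ)

include hH hτ hS

theorem step (h : IsMoved S H pn v θ s) {q : ℕ} (hq : q ∈ posAt H pn v)
    (hr : ∀ p ∈ posAt H pn v, S.rank H p < θ ↔ S.rank H p < S.rank H q) {s' : State}
    (h18 : s'.arr 18 = Function.update (s.arr 18) (S.slot H pn v q) (S.moved H q))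
    (h19 : s'.arr 19 = Function.update (s.arr 19) (S.moved H q) (S.slot H pn v q))
    (h9 : s'.arr 9 = Function.update (s.arr 9) (S.moved H q) (S.mate (S.obj q)))
    (h20 : s'.arr 20 = Function.update (s.arr 20) (S.slot H pn v q) (S.newBlk H pn v q))
    (h23 : s'.arr 23 = Function.update (s.arr 23) (S.slot H pn v q) (S.blk q))
    (h22 : s'.arr 22 = Function.update (s.arr 22) (S.target H q) (S.slot H pn v q + 1))
    (h21 : s'.arr 21 = s.arr 21) : IsMoved S H pn v (S.rank H q + 1) s' := by
  have h' := h.congr (θ' := S.rank H q) fun p hp => (hr p hp).symm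
  have key : ∀ p ∈ posAt H pn v, S.rank H p < S.rank H q + 1 → S.rank H p < S.rank H q ∨ p = q :=
    fun p hp hlt => (Nat.lt_succ_iff_lt_or_eq.1 hlt).imp_right fun h => rank_injOn hp hq h
  constructor
  · intro p hp hlt
    rw [h18, h19, h9, h20, h23]
    by_cases hpq : p = q
    · subst hpq
      simp
    · have n1 : S.slot H pn v p ≠ S.slot H pn v q := fun heq =>
        hpq (slot_injOn hH hτ hS hp hq heq)
      have n2 : S.moved H p ≠ S.moved H q := fun heq => hpq (moved_injOn hH hτ hS hp hq heq)
      simp only [Function.update_of_ne n1, Function.update_of_ne n2]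
      exact h'.done p hp ((key p hp hlt).resolve_right hpq)
  · intro p hp hne
    rw [h18, h20, Function.update_of_ne (hne q hq (by omega)),
      Function.update_of_ne (hne q hq (by omega))]
    exact h'.obj_eq p hp fun r hr hlt => hne r hr (by omega)
  · intro g hg hne
    rw [h19, h9, Function.update_of_ne (hne q hq (by omega)),
      Function.update_of_ne (hne q hq (by omega))]
    exact h'.pos_eq g hg fun r hr hlt => hne r hr (by omega)
  · intro p hp
    rw [h22]
    by_cases ht : S.target H p = S.target H q
    · rw [ht, Function.update_self]
      unfold slot
      rw [add_assoc, ← Finset.card_insert_of_notMem (a := q) (by simp)]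
      congr 2
      ext r
      simp only [Finset.mem_insert, Finset.mem_filter]
      constructor
      · rintro (rfl | ⟨h1, h2, h3⟩)
        · exact ⟨hq, rfl, by omega⟩
        · exact ⟨h1, h2, by omega⟩
      · rintro ⟨h1, h2, h3⟩
        rcases key r h1 h3 with h4 | h4
        · exact .inr ⟨h1, h2, h4⟩
        · exact .inl h4
    · rw [Function.update_of_ne ht, h'.next p hp]
      congr 2
      refine Finset.filter_congr fun r hr => ?_
      refine and_congr_right fun h1 => ⟨fun h2 => by omega, fun h2 => ?_⟩
      refine (key r hr h2).resolve_right ?_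
      rintro rfl
      exact ht h1.symm
  · rw [h21]
    exact h'.other

/-- The half-edges at `v` are not moved. -/
theorem read (h : IsMoved S H pn v θ s) {q : ℕ} (hq : q ∈ posAt H pn v) :
    s.arr 18 q = S.obj q ∧ s.arr 20 q = S.blk q ∧ s.arr 9 (S.obj q) = S.mate (S.obj q) ∧
      s.arr 19 (H.tw (S.obj q)) = S.pos (H.tw (S.obj q)) ∧
      s.arr 9 (H.tw (S.obj q)) = S.moved H q := by
  have h1 := h.obj_eq q (mem_posAt.1 hq).1 fun p hp _ heq => slot_notMem hH hτ hS hp (heq ▸ hq)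
  have h2 : ∀ g < H.M, H.nd g = v → s.arr 19 g = S.pos g ∧ s.arr 9 g = S.mate g :=
    fun g hg hgv => h.pos_eq g hg fun p hp _ heq => nd_moved_ne hH hτ hS hp (heq ▸ hgv)
  have h3 := nd_tw hH hτ hS hq
  have h4 := h2 _ h3.1 h3.2
  exact ⟨h1.1, h1.2, (h2 _ (hS.obj_lt q (mem_posAt.1 hq).1) (nd_obj hS hq)).2, h4.1, h4.2⟩

theorem runs_move (h : IsMoved S H pn v θ s) {q : ℕ} (hq : q ∈ posAt H pn v)
    (hr : ∀ p ∈ posAt H pn v, S.rank H p < θ ↔ S.rank H p < S.rank H q) (h15 : s.reg 15 = q)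
    (h10 : s.arr 10 = H.tw) :
    Runs .move s 100 (IsMoved S H pn v (S.rank H q + 1)) := by
  obtain ⟨e18, e20, e9, e19, e9'⟩ := h.read hH hτ hS hq
  have htw := nd_tw hH hτ hS hq
  have hp := pos_mem hS htw.1 htw.2
  have e20' := (h.read hH hτ hS hp).2.1
  have e21 : s.arr 21 (S.blk (S.pos (H.tw (S.obj q)))) = S.target H q := by
    rw [h.other _ hp, otherBlk_pos_tw hH hτ hS hq]
  have e22 : s.arr 22 (S.target H q) = S.slot H pn v q := by
    rw [h.next q hq]
    unfold slot
    congr 2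
    refine Finset.filter_congr fun p hp => ?_
    rw [hr p hp]
  have hne : q ≠ S.slot H pn v q := fun heq => slot_notMem hH hτ hS hq (heq ▸ hq)
  refine (Runs.seq (T₁ := 60) (T₂ := 40) (Q := fun s' => s'.reg 17 = S.target H q ∧
    s'.reg 18 = S.slot H pn v q ∧
    s'.arr 18 = Function.update (s.arr 18) (S.slot H pn v q) (S.moved H q) ∧
    s'.arr 19 = Function.update (s.arr 19) (S.moved H q) (S.slot H pn v q) ∧
    s'.arr 9 = Function.update (s.arr 9) (S.moved H q) (S.mate (S.obj q)) ∧
    s'.arr 23 = Function.update (s.arr 23) (S.slot H pn v q) (S.blk q) ∧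
    s'.arr 22 = Function.update (s.arr 22) (S.target H q) (S.slot H pn v q + 1))
    (runs_of_effect rfl rfl ?_) ?_).mono le_rfl fun _ => id
  · simp [Prog.relocate, Prog.block, Prog.effect, Expr.eval, Expr.twin, h15, e18, h10, e19, e20',
      e21, e22, e9', e9, e20]
  rintro s' ⟨g17, g18, a18, a19, a9, a23, a22⟩ hf
  have g15 : s'.reg 15 = q := (hf.1 15 (by decide)).trans h15
  have a20 : s'.arr 20 = s.arr 20 := hf.2 20 (by decide)
  have a21 : s'.arr 21 = s.arr 21 := hf.2 21 (by decide)
  have hnew : S.newBlk H pn v q = S.slot H pn v q →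
      IsMoved S H pn v (S.rank H q + 1) (Prog.newBlock.effect s') := fun hb =>
    h.step hH hτ hS hq hr a18 a19 a9 (by simp [Prog.newBlock, Prog.effect, Expr.eval, a20, g18, hb])
      a23 a22 a21
  by_cases hlt : S.target H q < S.slot H pn v q
  · obtain ⟨p, hp', hpr, hs, hb, hb'⟩ := newBlk_of_lt hH hτ hS hq hlt
    obtain ⟨-, -, -, d20, d23⟩ := h.done p hp' ((hr p hp').2 hpr)
    have v23 : s'.arr 23 (S.slot H pn v q - 1) = S.blk p := by
      rw [a23, Function.update_of_ne (by omega), hs, Nat.add_sub_cancel, d23]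
    have v20 : s'.arr 20 (S.slot H pn v q - 1) = S.newBlk H pn v p := by
      rw [a20, hs, Nat.add_sub_cancel, d20]
    have w20 : s'.arr 20 q = S.blk q := by rw [a20, e20]
    refine runs_of_effect rfl rfl ?_
    simp only [Prog.extendBlock, Prog.effect, Expr.eval, g17, g18, g15, v23, v20, w20, if_pos hlt]
    split_ifs with c1 c2
    · exact hnew (hb' c1.ne)
    · exact hnew (hb' c2.ne')
    · exact h.step hH hτ hS hq hr a18 a19 a9 (by
        simp [a20, hb (by omega)]) a23 a22 a21
  · refine runs_of_effect rfl rfl ?_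
    simp only [Prog.extendBlock, Prog.effect, Expr.eval, g17, g18, if_neg hlt]
    exact hnew (newBlk_of_le (not_lt.1 hlt))

end IsMoved

end RoutedGraph

namespace RoutedGraph

open RAM Layout

variable {n m : ℕ} {I : RoutedGraph n m} {H : HalfEdges} {pn : ℕ → ℕ} {S : Layout}
  {τ : List (Fin n)} {v : Fin n}

/-- The positions at `v` are those between the registers `13` and `14`. -/
structure HasBounds (H : HalfEdges) (pn : ℕ → ℕ) (v : Fin n) (s : State) : Prop where
  le : s.reg 13 ≤ s.reg 14
  mem : ∀ q, q ∈ posAt H pn v ↔ s.reg 13 ≤ q ∧ q < s.reg 14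

theorem HasBounds.congr {s s' : State} (h : HasBounds H pn v s) (h1 : s'.reg 13 = s.reg 13)
    (h2 : s'.reg 14 = s.reg 14) : HasBounds H pn v s' := by
  refine ⟨by rw [h1, h2]; exact h.le, ?_⟩
  rw [h1, h2]
  exact h.mem

theorem runs_bounds {start : ℕ → ℕ} (hS : S.Sorted I H start) {s : State}
    (h4 : ∀ k ≤ I.rotOffset n, s.arr 4 k = start k) (h0 : s.arr 0 = I.input.arr 0)
    (h12 : s.reg 12 = v) : Runs .bounds s 30 (fun s' =>
      HasBounds H (fun q => H.nd (S.obj q)) v s' ∧ s'.reg 13 = start (I.rotOffset v) ∧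
      s'.reg 14 = start (I.rotOffset (v + 1))) := by
  have e0 : s.arr 4 (s.arr 0 v) = start (I.rotOffset v) := by
    rw [h0, input_rotOffset v.2.le, h4 _ (rotOffset_mono v.2.le)]
  have e1 : s.arr 4 (s.arr 0 (v + 1)) = start (I.rotOffset (v + 1)) := by
    rw [h0, input_rotOffset v.2, h4 _ (rotOffset_mono v.2)]
  refine runs_of_effect rfl rfl ?_
  have h13 : (Prog.bounds.effect s).reg 13 = start (I.rotOffset v) := by
    simp [Prog.bounds, Prog.block, Prog.effect, Expr.eval, h12, e0]
  have h14 : (Prog.bounds.effect s).reg 14 = start (I.rotOffset (v + 1)) := by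
    simp [Prog.bounds, Prog.block, Prog.effect, Expr.eval, h12, e1]
  refine ⟨⟨?_, fun q => ?_⟩, h13, h14⟩
  · rw [h13, h14]
    exact hS.mono _ _ (rotOffset_mono (Nat.le_succ _)) (rotOffset_mono v.2)
  · rw [h13, h14, mem_posAt]
    constructor
    · rintro ⟨h1, h2⟩
      exact (hS.node v q h1).2 h2
    · intro h
      have h1 : q < H.M := by
        rw [← hS.last]
        exact h.2.trans_le (hS.mono _ _ (rotOffset_mono v.2) le_rfl)
      exact ⟨h1, (hS.node v q h1).1 h⟩

/-- Array 21 keeps, under the start of each block at `v`, the block at the other end. The second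
phase reuses this record, because later deletions change the layout at that end. Array 22 is set to
the first free position of each target. -/
theorem runs_findTargets (hH : H.Valid I) (hτ : I.IsPartialDeletion τ) (hS : S.Valid I H pn τ)
    (hv : v ∉ τ) {s : State} (hs : layout s = S) (hB : HasBounds H pn v s) :
    Runs .findTargets s (60 * (s.reg 14 - s.reg 13 + 1)) (fun s' =>
      (∀ q ∈ posAt H pn v, s'.arr 21 (S.blk q) = S.otherBlk q ∧
        s'.arr 22 (S.otherBlk q) = S.otherBlk q) ∧
      ∀ y ∉ posAt H pn v, s'.arr 21 y = s.arr 21 y) := by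
  subst hs
  obtain ⟨d, hd⟩ := Nat.exists_eq_add_of_le hB.le
  rw [hd, Nat.add_sub_cancel_left]
  refine Runs.mono (T := 4 + ((50 + 3) * d + 3)) ?_ (by omega) fun _ => id
  refine Runs.seq (Q := fun s' => s'.reg 15 = s.reg 13) (runs_of_effect rfl rfl ?_)
    fun s' h15 hf => ?_
  · simp [Prog.effect, Expr.eval]
  have f13 := hf.1 13 (by decide)
  have f14 := hf.1 14 (by decide)
  have fa : ∀ A, s'.arr A = s.arr A := fun A => hf.2 A (by simp [Prog.arrs])
  refine (runs_for (fun t s₁ => s₁.reg 15 = s.reg 13 + t ∧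
    (∀ q ∈ posAt H pn v, q < s.reg 13 + t → s₁.arr 21 ((layout s).blk q) = (layout s).otherBlk q ∧
        s₁.arr 22 ((layout s).otherBlk q) = (layout s).otherBlk q) ∧
      ∀ y ∉ posAt H pn v, s₁.arr 21 y = s.arr 21 y) d 50 ⟨h15, fun q hq hlt => ?_, ?_⟩ ?_ ?_).mono
      (by simp [Expr.cost]) ?_
  · have := (hB.mem q).1 hq
    omega
  · rw [fa]
    exact fun _ _ => rfl
  · rintro t ht s₁ ⟨i1, i2, i3⟩ hf₁
    have g : ∀ A, A ≠ 21 → A ≠ 22 → s₁.arr A = s.arr A := fun A h h' =>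
      (hf₁.2 A (by simp [Prog.block, Prog.incr, Prog.arrs, h, h'])).trans (fa A)
    have g14 := (hf₁.1 14 (by decide)).trans f14
    refine ⟨by simp [Expr.eval, i1, g14]; omega, runs_of_effect rfl rfl ?_⟩
    have hq : s.reg 13 + t ∈ posAt H pn v := (hB.mem _).2 (by omega)
    have e1 : s.arr 20 (s.arr 19 (s.arr 9 (s.arr 18 (s.reg 13 + t)))) =
      (layout s).otherBlk (s.reg 13 + t) := rfl
    have e2 : s.arr 20 = (layout s).blk := rfl
    simp only [Prog.block, Prog.effect, Expr.eval, Prog.incr, Function.update_self, i1,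
      Function.update_of_ne (show (20 : ℕ) ≠ 21 by decide),
      Function.update_of_ne (show (21 : ℕ) ≠ 22 by decide),
      Function.update_of_ne (show (22 : ℕ) ≠ 21 by decide), g 20 (by decide) (by decide),
      g 19 (by decide) (by decide), g 18 (by decide) (by decide), g 9 (by decide) (by decide)]
    rw [e1, e2]
    refine ⟨by omega, fun q hq' hlt => ⟨?_, ?_⟩, fun y hy => ?_⟩
    · by_cases hb : (layout s).blk q = (layout s).blk (s.reg 13 + t)
      · rw [hb, Function.update_self]
        exact (otherBlk_eq hH hτ hS hv hq' hq hb).symm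
      · rw [Function.update_of_ne hb]
        refine (i2 q hq' ?_).1
        by_contra hge
        exact hb (by rw [show q = s.reg 13 + t by omega])
    · by_cases hb : (layout s).otherBlk q = (layout s).otherBlk (s.reg 13 + t)
      · rw [hb, Function.update_self]
      · rw [Function.update_of_ne hb]
        refine (i2 q hq' ?_).2
        by_contra hge
        exact hb (by rw [show q = s.reg 13 + t by omega])
    · rw [Function.update_of_ne]
      · exact i3 y hy
      · rintro rfl
        exact hy (blk_mem hS hq)
  · rintro s₁ ⟨i1, -, -⟩ hf₁
    have g14 := (hf₁.1 14 (by decide)).trans f14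
    simp [Expr.eval, i1, g14, hd]
  · rintro s₁ ⟨-, i2, i3⟩
    exact ⟨fun q hq => i2 q hq (by have := (hB.mem q).1 hq; omega), i3⟩

/-- One pass over the positions at `v`. -/
theorem runs_pass (hH : H.Valid I) (hτ : I.IsPartialDeletion (τ ++ [v])) (hS : S.Valid I H pn τ)
    {s : State} (hB : HasBounds H pn v s) (h10 : s.arr 10 = H.tw) {e f : Expr} {c : ℕ}
    (hc : e.cost + f.cost + 1 ≤ 20)
    (h0 : IsMoved S H pn v (s.reg 13 + c) s)
    (htest : ∀ s₁ : State, ∀ q ∈ posAt H pn v, s₁.reg 15 = q → s₁.arr 10 = H.tw →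
      s₁.arr 18 q = S.obj q → s₁.arr 19 (H.tw (S.obj q)) = S.pos (H.tw (S.obj q)) →
      (e.eval s₁ < f.eval s₁ ↔ S.rank H q = q + c))
    (hrank : ∀ p ∈ posAt H pn v, ∀ q ∈ posAt H pn v, S.rank H p = q + c → p = q) :
    Runs (.pass e f) s
      (140 * (s.reg 14 - s.reg 13 + 1)) (IsMoved S H pn v (s.reg 14 + c)) := by
  obtain ⟨d, hd⟩ := Nat.exists_eq_add_of_le hB.le
  rw [hd, Nat.add_sub_cancel_left]
  refine Runs.mono (T := 4 + ((130 + 3) * d + 3)) ?_ (by omega) fun _ => id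
  refine Runs.seq (Q := fun s' => s'.reg 15 = s.reg 13 ∧ IsMoved S H pn v (s.reg 13 + c) s')
    (runs_of_effect rfl rfl ⟨?_, ?_⟩) fun s' ⟨h15, h1⟩ hf => ?_
  · simp [Prog.effect, Expr.eval]
  · exact ⟨h0.done, h0.obj_eq, h0.pos_eq, h0.next, h0.other⟩
  have f14 := hf.1 14 (by decide)
  have f10 := hf.2 10 (by simp [Prog.arrs])
  refine (runs_for (fun t s₁ => s₁.reg 15 = s.reg 13 + t ∧ IsMoved S H pn v (s.reg 13 + t + c) s₁)
    d 130 ⟨h15, h1⟩ ?_ ?_).mono (by simp [Expr.cost]) ?_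
  · rintro t ht s₁ ⟨i1, i2⟩ hf₁
    have g14 := (hf₁.1 14 (by simp [Prog.incr, Prog.regs]; decide)).trans f14
    have g10 := ((hf₁.2 10 (by simp [Prog.incr, Prog.arrs]; decide)).trans f10).trans h10
    refine ⟨by simp [Expr.eval, i1, g14]; omega, ?_⟩
    have hq : s.reg 13 + t ∈ posAt H pn v := (hB.mem _).2 (by omega)
    obtain ⟨r18, -, -, r19, -⟩ := i2.read hH hτ hS hq
    have ht := htest s₁ _ hq i1 g10 r18 r19
    refine Runs.mono (T := 120 + 4) ?_ (by omega) fun _ => id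
    refine Runs.seq (Q := fun s₂ => IsMoved S H pn v (s.reg 13 + (t + 1) + c) s₂)
      ((Runs.ite (T := 100) (fun hlt => ?_) fun hlt => ?_).mono (by omega) fun _ => id)
      fun s₂ h2 hf₂ => runs_of_effect rfl rfl ⟨?_, ?_⟩
    · have hr := ht.1 hlt
      have := i2.runs_move hH hτ hS hq (fun p hp => by rw [hr]) i1 g10
      rw [hr] at this
      refine this.mono le_rfl fun s₃ h3 => ?_
      rwa [show s.reg 13 + (t + 1) + c = s.reg 13 + t + c + 1 by omega]
    · refine runs_of_effect rfl rfl (i2.congr fun p hp => ?_)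
      have : S.rank H p ≠ s.reg 13 + t + c := fun heq => by
        obtain rfl := hrank p hp _ hq heq
        exact hlt (ht.2 heq)
      omega
    · have := hf₂.1 15 (by simp [Prog.regs]; decide)
      simp only [Prog.incr, Prog.effect, Expr.eval, Function.update_self, this, i1]
      omega
    · exact ⟨h2.done, h2.obj_eq, h2.pos_eq, h2.next, h2.other⟩
  · rintro s₁ ⟨i1, -⟩ hf₁
    have g14 := (hf₁.1 14 (by simp [Prog.incr, Prog.regs]; decide)).trans f14
    simp [Expr.eval, i1, g14, hd]
  · rintro s₁ ⟨-, i2⟩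
    exact i2

/-- The first pass handles the positions behind their twins, the second those before them. Together
they visit the positions in the order of rank, without sorting, in time proportional to their
number. -/
theorem runs_delete (hH : H.Valid I) (hτ : I.IsPartialDeletion (τ ++ [v])) {S₀ : Layout}
    {start : ℕ → ℕ} (hS₀ : S₀.Sorted I H start)
    (hS : S.Valid I H (fun q => H.nd (S₀.obj q)) τ) {s : State} (hs : layout s = S)
    (h4 : ∀ k ≤ I.rotOffset n, s.arr 4 k = start k) (h0 : s.arr 0 = I.input.arr 0)
    (h10 : s.arr 10 = H.tw) (h12 : s.reg 12 = v) :
    Runs .delete s (400 * (start (I.rotOffset (v + 1)) - start (I.rotOffset v) + 1)) (fun s' =>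
      Deleted S H (fun q => H.nd (S₀.obj q)) v (layout s') ∧
      (∀ q ∈ posAt H (fun q => H.nd (S₀.obj q)) v, s'.arr 21 (S.blk q) = S.otherBlk q) ∧
      ∀ y ∉ posAt H (fun q => H.nd (S₀.obj q)) v, s'.arr 21 y = s.arr 21 y) := by
  set pn := fun q => H.nd (S₀.obj q)
  set ℓ := start (I.rotOffset (v + 1)) - start (I.rotOffset v)
  refine Runs.mono (T := 30 + (60 * (ℓ + 1) + (140 * (ℓ + 1) + 140 * (ℓ + 1)))) ?_ (by omega)
    fun _ => id
  refine (runs_bounds hS₀ h4 h0 h12).seq fun s₁ ⟨b1, b13, b14⟩ hf₁ => ?_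
  have hs₁ : layout s₁ = S := by
    rw [← hs]
    simp only [layout, hf₁.2 18 (by decide), hf₁.2 19 (by decide), hf₁.2 9 (by decide),
      hf₁.2 20 (by decide)]
  have hℓ : s₁.reg 14 - s₁.reg 13 = ℓ := by rw [b13, b14]
  have hft := runs_findTargets hH hτ.of_append hS hτ.notMem hs₁ b1
  rw [hℓ] at hft
  refine hft.seq fun s₂ ⟨t1, t2⟩ hf₂ => ?_
  have c13 := hf₂.1 13 (by decide)
  have c14 := hf₂.1 14 (by decide)
  have b2 := b1.congr c13 c14
  have g2 : ∀ A, A ∉ Prog.findTargets.arrs → s₂.arr A = s.arr A := fun A h =>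
    (hf₂.2 A h).trans (hf₁.2 A (by simp [Prog.bounds, Prog.block, Prog.arrs]))
  have hrank : ∀ q, S.rank H q = q ∨ S.rank H q = q + H.M := fun q => by
    unfold rank
    split_ifs <;> simp
  have hlt : ∀ q ∈ posAt H pn v, q < H.M := fun q hq => (mem_posAt.1 hq).1
  have hle := fun q => (b2.mem q).1
  -- No rank lies below the first position at `v`, so nothing has been visited yet.
  have m0 : IsMoved S H pn v (s₂.reg 13 + 0) s₂ := by
    have hno : ∀ q ∈ posAt H pn v, ¬ S.rank H q < s₂.reg 13 + 0 := fun q hq => by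
      have := hle q hq
      have := hrank q
      omega
    have e : ∀ A, A ∉ Prog.findTargets.arrs → s₂.arr A = s.arr A := g2
    refine ⟨fun q hq hr => absurd hr (hno q hq), fun p _ _ => ?_, fun p _ _ => ?_, fun q hq => ?_,
      fun q hq => (t1 q hq).1⟩
    · rw [e 18 (by decide), e 20 (by decide), ← hs]
      exact ⟨rfl, rfl⟩
    · rw [e 19 (by decide), e 9 (by decide), ← hs]
      exact ⟨rfl, rfl⟩
    · rw [Finset.filter_false_of_mem, Finset.card_empty, add_zero]
      · have hp := nd_tw hH hτ hS hq
        rw [← otherBlk_pos_tw hH hτ hS hq]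
        exact (t1 _ (pos_mem hS hp.1 hp.2)).2
      · exact fun p hp h => hno p hp h.2
  have hp1 := runs_pass (e := .twin) (f := .reg 15) (c := 0) hH hτ hS b2
    ((g2 10 (by decide)).trans h10) (by simp [Expr.twin, Expr.cost]) m0 (by
      intro s' q hq h15 h10' h18 h19
      simp only [Expr.twin, Expr.eval, h15, h10', h18, h19, rank]
      have := hlt q hq
      split_ifs <;> omega) (by
      intro p hp q hq h
      have := hrank p
      have := hlt q hq
      omega)
  rw [c13, c14, hℓ] at hp1
  refine hp1.seq fun s₃ m1 hf₃ => ?_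
  have d13 := hf₃.1 13 (by decide)
  have d14 := hf₃.1 14 (by decide)
  have b3 := b2.congr d13 d14
  -- No rank lies from the upper bound of the first pass to the lower bound of the second: ranks are
  -- positions at `v`, or such positions shifted by `M`.
  have m1' : IsMoved S H pn v (s₃.reg 13 + H.M) s₃ := m1.congr fun q hq => by
    have h1 := hle q hq
    have h2 := hlt q hq
    have h3 := hlt _ ((b2.mem (s₂.reg 14 - 1)).2 (by omega))
    have := hrank q
    rw [d13, ← c14]
    omega
  have hp2 := runs_pass (e := .reg 15) (f := .twin) (c := H.M) hH hτ hS b3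
    ((hf₃.2 10 (by decide)).trans ((g2 10 (by decide)).trans h10)) (by simp [Expr.twin, Expr.cost])
    m1' (by
      intro s' q hq h15 h10' h18 h19
      simp only [Expr.twin, Expr.eval, h15, h10', h18, h19, rank]
      have h1 := hlt q hq
      have h2 : S.pos (H.tw (S.obj q)) ≠ q := fun heq => by
        obtain ⟨i, d, e, ht⟩ := exists_turn hH hτ hS hq
        exact ht.blk_ne hS h1 (by rw [heq])
      split_ifs <;> omega) (by
      intro p hp q hq h
      have := hrank p
      have := hlt p hp
      omega)
  rw [d13, d14, c13, c14, hℓ] at hp2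
  refine hp2.frame.mono le_rfl fun s₄ ⟨m2, hf₄⟩ => ⟨m2.deleted fun q hq => ?_, m2.other, fun y hy => ?_⟩
  · have h1 := hle q hq
    have := hrank q
    rw [c14] at h1
    omega
  · rw [hf₄.2 21 (by decide), hf₃.2 21 (by decide), t2 y hy, hf₁.2 21 (by decide)]

end RoutedGraph

/-! ### The first phase of the program -/

namespace RAM

/-- Delete the nonterminal nodes in increasing order. -/
def Prog.deleteAll : Prog := .loop (.reg 12) (.reg 0)
  (.seq (.ite (.arr 11 (.reg 12)) (.const 1) .delete .skip) (.incr 12))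

end RAM

namespace RoutedGraph

open RAM Layout

variable {n m : ℕ} {I : RoutedGraph n m} {H : HalfEdges} {S : ℕ → Layout} {start : ℕ → ℕ}

/-- The node of a position. -/
def Layout.nodeAt (S : Layout) (H : HalfEdges) (q : ℕ) : ℕ := H.nd (S.obj q)

/-- The blocks at the nodes that satisfy `P`, and the blocks at the other ends of their
half-edges, before the deletion of the node. -/
def Records (H : HalfEdges) (S : ℕ → Layout) (P : Fin n → Prop) (s : State) : Prop :=
  ∀ v, P v → ∀ q ∈ posAt H ((S 0).nodeAt H) v,
    s.arr 20 q = (S v).blk q ∧ s.arr 21 ((S v).blk q) = (S v).otherBlk q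

/-- The potential is the number of positions at the nodes already treated. The positions of a node
never change in number, so all deletions together take time linear in the number of nodes and
half-edges. -/
theorem runs_deleteAll (hH : H.Valid I) {S₀ : Layout} (hS₀ : S₀.Sorted I H start) {s : State}
    (hs : layout s = S₀) (h0 : s.reg 0 = n) (h12 : s.reg 12 = 0)
    (h4 : ∀ k ≤ I.rotOffset n, s.arr 4 k = start k) (ha0 : s.arr 0 = I.input.arr 0)
    (h10 : s.arr 10 = H.tw) (h11 : ∀ v : Fin n, 0 < s.arr 11 v ↔ ∃ i, I.TerminalOf i v) :
    Runs .deleteAll s (500 * (H.M + n + 1)) (fun s' => ∃ S : ℕ → Layout, S 0 = S₀ ∧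
      S n = layout s' ∧ Chain I H (S₀.nodeAt H) S n ∧
      Records H S (fun v => ¬ ∃ i, I.TerminalOf i v) s') := by
  refine (runs_loop_potential (fun k s' => s'.reg 12 = k ∧ ∃ S : ℕ → Layout, S 0 = S₀ ∧
    S k = layout s' ∧ Chain I H (S₀.nodeAt H) S k ∧
    Records H S (fun v : Fin n => v < k ∧ ¬ ∃ i, I.TerminalOf i v) s') n 450
    (fun k => start (I.rotOffset k)) (fun k hk => ?_) ⟨h12, fun _ => S₀, rfl, hs.symm,
      ⟨hS₀.valid, fun v hv => by omega, fun v hv => by omega⟩, fun v hv => by omega⟩ ?_ ?_).mono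
      ?_ ?_
  · exact hS₀.mono _ _ (rotOffset_mono (Nat.le_succ _)) (rotOffset_mono hk)
  · rintro k hk s₁ ⟨i12, S, i0, iS, hC, hR⟩ hf
    have g : ∀ A, A ∉ Prog.delete.arrs → s₁.arr A = s.arr A := fun A h =>
      hf.2 A (by simpa [Prog.arrs, Prog.incr] using h)
    have g0 : s₁.reg 0 = n := (hf.1 0 (by decide)).trans h0
    refine ⟨by simpa [Expr.eval, i12, g0] using hk, ?_⟩
    set ℓ := start (I.rotOffset (k + 1)) - start (I.rotOffset k)
    refine Runs.mono (T := 20 + 400 * (ℓ + 1) + 4) ?_ (by omega) fun _ => id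
    have hS := hC.valid hH hk.le le_rfl
    have ht : s₁.arr 11 k < 1 ↔ ¬ ∃ i, I.TerminalOf i ⟨k, hk⟩ := by
      rw [← h11, g 11 (by decide)]
      dsimp only
      omega
    refine Runs.seq (Q := fun s₂ => ∃ S : ℕ → Layout, S 0 = S₀ ∧
      S (k + 1) = layout s₂ ∧ Chain I H (S₀.nodeAt H) S (k + 1) ∧
      Records H S (fun v : Fin n => v < k + 1 ∧ ¬ ∃ i, I.TerminalOf i v) s₂)
      ((Runs.ite (T := 400 * (ℓ + 1)) (fun hlt => ?_) fun hlt => ?_).mono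
        (by simp [Expr.cost]) fun _ => id)
      fun s₂ hs₂ hf₂ => runs_of_effect rfl rfl ⟨?_, hs₂⟩
    · simp only [Expr.eval, i12] at hlt
      have hnt := ht.1 hlt
      have hτ := isPartialDeletion_dead_append hnt
      refine (runs_delete (v := ⟨k, hk⟩) hH hτ hS₀ hS iS.symm
        (by rwa [g 4 (by decide)]) ((g 0 (by decide)).trans ha0) ((g 10 (by decide)).trans h10)
        i12).mono le_rfl ?_
      rintro s₂ ⟨hD, d1, d2⟩
      refine ⟨Function.update S (k + 1) (layout s₂), by simp [i0], by simp,
        hC.succ (v := ⟨k, hk⟩) rfl (fun _ => hD) (fun h => absurd h hnt), ?_⟩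
      rintro u ⟨hu, hut⟩ q hq
      rw [Function.update_of_ne (by omega)] at hq ⊢
      rw [i0] at hq
      have hq' := mem_posAt.1 hq
      -- The blocks at a deleted node are final (`Deleted.blk_eq`), so array 20 still holds them
      -- when the node is re-inserted.
      rw [show s₂.arr 20 q = (layout s₂).blk q from rfl, hD.blk_eq hH hτ hS hq'.1 (u := u) (by
        rcases Nat.lt_succ_iff_lt_or_eq.1 hu with h | h
        · exact List.mem_append_left _ (mem_dead.2 ⟨h, hut⟩)
        · exact List.mem_append_right _ (by simp [Fin.ext_iff, h])) hq'.2]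
      rcases Nat.lt_succ_iff_lt_or_eq.1 hu with h | h
      · obtain ⟨h1, h2⟩ := hR u ⟨h, hut⟩ q (by rwa [i0])
        refine ⟨by rw [iS]; exact h1, ?_⟩
        rw [d2, h2]
        intro h3
        have h4 := blk_mem (hC.valid hH hk.le h.le) hq
        have h5 := (mem_posAt.1 h3).2.symm.trans (mem_posAt.1 h4).2
        simp only at h5
        omega
      · obtain rfl : u = ⟨k, hk⟩ := Fin.ext h
        exact ⟨rfl, d1 q hq⟩
    · simp only [Expr.eval, i12] at hlt
      have hnt := not_not.1 (ht.not.1 hlt)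
      refine runs_of_effect rfl (Nat.ble_eq_true_of_le (by simp [Prog.time]; omega))
        ⟨Function.update S (k + 1) (layout s₁), by simp [i0], by simp [Prog.effect],
        hC.succ (v := ⟨k, hk⟩) rfl (fun h => absurd hnt h) (fun _ => iS.symm), ?_⟩
      rintro u ⟨hu, hut⟩ q hq
      rw [Function.update_of_ne (by omega)] at hq ⊢
      refine hR u ⟨?_, hut⟩ q hq
      rcases Nat.lt_succ_iff_lt_or_eq.1 hu with h | h
      · exact h
      · exact absurd (by rwa [show u = ⟨k, hk⟩ from Fin.ext h]) hut
    · have := hf₂.1 12 (by decide)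
      simp only [Prog.incr, Prog.effect, Expr.eval, Function.update_self, this, i12]
  · rintro s₁ ⟨i12, -⟩ hf
    have g0 : s₁.reg 0 = n := (hf.1 0 (by decide)).trans h0
    simp [Expr.eval, i12, g0]
  · have := hS₀.last
    simp only [Expr.cost, this]
    omega
  · rintro s₁ ⟨-, S, h1, h2, h3, h4⟩
    exact ⟨S, h1, h2, h3, fun v hv => h4 v ⟨v.2, hv⟩⟩

end RoutedGraph

/-! ### Copying blocks from their other ends -/

namespace RAM

/-- Copy the paths between the bounds from the other ends of their half-edges, in reverse order. -/
def Prog.copy : Prog := .seq (.assign 15 (.reg 14))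
  (.loop (.reg 13) (.reg 15) (.block [
    .assign 15 (.sub (.reg 15) (.const 1)),
    .assign 16 (.arr 21 (.arr 20 (.reg 15))),
    .store 5 (.reg 15) (.arr 5 (.reg 16)),
    .store 21 (.arr 20 (.reg 15)) (.add (.reg 16) (.const 1))]))

end RAM

namespace RoutedGraph

open RAM Layout

variable {n m : ℕ} {I : RoutedGraph n m} {H : HalfEdges} {pn : ℕ → ℕ} {S : Layout}
  {τ : List (Fin n)} {v : Fin n}

theorem Layout.otherBlk_add_notMem (hH : H.Valid I) (hτ : I.IsPartialDeletion τ)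
    (hS : S.Valid I H pn τ) (hv : v ∉ τ) {q c : ℕ} (hq : q ∈ posAt H pn v)
    (hc : c < blockSize H.M S.blk (S.blk q)) : S.otherBlk q + c ∉ posAt H pn v := by
  intro hmem
  have hl := live_obj hS hv hq
  have hm := live_mate hH hτ hS hl
  have h1 := blockSize_mate hH hτ hS hl
  rw [hS.pos_obj q (mem_posAt.1 hq).1] at h1
  change _ = blockSize H.M S.blk (S.otherBlk q) at h1
  obtain ⟨h2, h3⟩ := (hS.blocks.eq_iff (q := S.otherBlk q + c) (s := S.otherBlk q)).2
    ⟨Nat.le_add_right _ _, by omega⟩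
  have h4 := hS.pos_lt _ hm.1
  refine nd_mate_ne hH hτ hS hl ?_
  rw [nd_obj hS hq, ← (mem_posAt.1 hmem).2, hS.blk_node _ h2 _ h4 h3, ← hS.node _ h4,
    hS.obj_pos _ hm.1]

/-- The positions at `v` are visited downwards while the pointer of each block in array 21 moves
upwards at the other end, which produces the reverse order. The pointers destroy the record for `v`
only; the source positions are not at `v` (`otherBlk_add_notMem`), so they are not overwritten. -/
theorem runs_copy (hH : H.Valid I) (hτ : I.IsPartialDeletion τ) (hS : S.Valid I H pn τ)
    (hv : v ∉ τ) {s : State} (hB : HasBounds H pn v s)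
    (hr : ∀ q ∈ posAt H pn v, s.arr 20 q = S.blk q ∧ s.arr 21 (S.blk q) = S.otherBlk q) :
    Runs .copy s (60 * (s.reg 14 - s.reg 13 + 1)) (fun s' =>
      (∀ q ∈ posAt H pn v, s'.arr 5 q = s.arr 5 (S.otherBlk q +
        ((posAt H pn v).filter (fun p => q < p ∧ S.blk p = S.blk q)).card)) ∧
      (∀ q, q ∉ posAt H pn v → s'.arr 5 q = s.arr 5 q) ∧
      ∀ y, y ∉ posAt H pn v → s'.arr 21 y = s.arr 21 y) := by
  obtain ⟨d, hd⟩ := Nat.exists_eq_add_of_le hB.le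
  rw [hd, Nat.add_sub_cancel_left]
  refine Runs.mono (T := 4 + ((50 + 3) * d + 3)) ?_ (by omega) fun _ => id
  refine Runs.seq (Q := fun s' => s'.reg 15 = s.reg 14) (runs_of_effect rfl rfl ?_)
    fun s' h15 hf => ?_
  · simp [Prog.effect, Expr.eval]
  have f13 := hf.1 13 (by decide)
  have fa : ∀ A, s'.arr A = s.arr A := fun A => hf.2 A (by simp [Prog.arrs])
  have hlt : ∀ q, q ∈ posAt H pn v ↔ s.reg 13 ≤ q ∧ q < s.reg 13 + d := by
    rw [← hd]
    exact hB.mem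
  refine (runs_for (fun t s₁ => s₁.reg 15 = s.reg 13 + (d - t) ∧
    (∀ q ∈ posAt H pn v, s.reg 13 + (d - t) ≤ q → s₁.arr 5 q = s.arr 5 (S.otherBlk q +
        ((posAt H pn v).filter (fun p => q < p ∧ S.blk p = S.blk q)).card)) ∧
    (∀ q, q ∉ posAt H pn v → s₁.arr 5 q = s.arr 5 q) ∧
    (∀ q ∈ posAt H pn v, s₁.arr 21 (S.blk q) = S.otherBlk q +
      ((posAt H pn v).filter (fun p => s.reg 13 + (d - t) ≤ p ∧ S.blk p = S.blk q)).card) ∧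
    ∀ y, y ∉ posAt H pn v → s₁.arr 21 y = s.arr 21 y) d 50 ⟨?_, fun q hq hle => ?_, ?_,
      fun q hq => ?_, ?_⟩ ?_ ?_).mono (by simp [Expr.cost]) ?_
  · rw [h15, hd, Nat.sub_zero]
  · have := (hlt q).1 hq
    omega
  · rw [fa]
    exact fun _ _ => rfl
  · rw [fa, (hr q hq).2, Finset.filter_false_of_mem, Finset.card_empty, add_zero]
    intro p hp h
    have := (hlt p).1 hp
    omega
  · rw [fa]
    exact fun _ _ => rfl
  · rintro t ht s₁ ⟨i1, i2, i3, i4, i5⟩ hf₁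
    have g20 := (hf₁.2 20 (by decide)).trans (fa 20)
    have g13 := (hf₁.1 13 (by decide)).trans f13
    refine ⟨by simp only [Expr.eval, i1, g13]; omega, ?_⟩
    obtain ⟨x, hx⟩ : ∃ x, s.reg 13 + (d - t) = x + 1 := ⟨s.reg 13 + (d - t) - 1, by omega⟩
    have hx' : s.reg 13 + (d - (t + 1)) = x := by omega
    have hxV : x ∈ posAt H pn v := (hlt x).2 (by omega)
    rw [hx] at i1 i2 i4
    rw [hx']
    simp only [Nat.succ_le_iff] at i2 i4
    have e20 : s₁.arr 20 x = S.blk x := by rw [g20, (hr x hxV).1]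
    have e21 := i4 x hxV
    have hsrc : S.otherBlk x + ((posAt H pn v).filter (fun p => x < p ∧ S.blk p = S.blk x)).card ∉
        posAt H pn v := by
      refine otherBlk_add_notMem hH hτ hS hv hxV ?_
      have h1 := hS.blocks.card_later (mem_posAt.1 hxV).1
      have h2 := (hS.blocks.eq_iff (q := x) (s := S.blk x)).1 ⟨(mem_posAt.1 hxV).1, rfl⟩
      have h3 : ((posAt H pn v).filter (fun p => x < p ∧ S.blk p = S.blk x)).card ≤
          ((Finset.range H.M).filter (fun p => x < p ∧ S.blk p = S.blk x)).card :=
        Finset.card_le_card (Finset.filter_subset_filter _ (Finset.filter_subset _ _))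
      omega
    refine runs_of_effect rfl rfl ?_
    simp only [Prog.block, Prog.effect, Expr.eval, Function.update_self, i1,
      Function.update_of_ne (show (15 : ℕ) ≠ 16 by decide),
      Function.update_of_ne (show (20 : ℕ) ≠ 5 by decide),
      Function.update_of_ne (show (21 : ℕ) ≠ 5 by decide),
      Function.update_of_ne (show (5 : ℕ) ≠ 21 by decide),
      Nat.add_sub_cancel, e20, e21, true_and]
    refine ⟨fun q hq hle => ?_, fun q hq => ?_, fun q hq => ?_, fun y hy => ?_⟩
    · by_cases hqx : q = x
      · rw [hqx, Function.update_self]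
        exact i3 _ hsrc
      · rw [Function.update_of_ne hqx]
        exact i2 q hq (by omega)
    · rw [Function.update_of_ne]
      · exact i3 q hq
      · rintro rfl
        exact hq hxV
    · by_cases hb : S.blk q = S.blk x
      · rw [hb, Function.update_self, otherBlk_eq hH hτ hS hv hq hxV hb, add_assoc,
          ← Finset.card_insert_of_notMem (a := x) (by simp)]
        congr 2
        ext p
        simp only [Finset.mem_insert, Finset.mem_filter]
        constructor
        · rintro (rfl | ⟨h1, h2, h3⟩)
          · exact ⟨hxV, le_rfl, rfl⟩
          · exact ⟨h1, h2.le, h3⟩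
        · rintro ⟨h1, h2, h3⟩
          rcases h2.eq_or_lt with h | h
          · exact .inl h.symm
          · exact .inr ⟨h1, h, h3⟩
      · rw [Function.update_of_ne hb, i4 q hq]
        congr 2
        refine Finset.filter_congr fun p hp => ⟨fun h => ⟨h.1.le, h.2⟩, fun h => ⟨?_, h.2⟩⟩
        refine lt_of_le_of_ne h.1 ?_
        rintro rfl
        exact hb h.2.symm
    · rw [Function.update_of_ne]
      · exact i5 y hy
      · rintro rfl
        exact hy (blk_mem hS hxV)
  · rintro s₁ ⟨i1, -⟩ hf₁
    have g13 := (hf₁.1 13 (by decide)).trans f13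
    simp [Expr.eval, i1, g13]
  · rintro s₁ ⟨-, i2, i3, -, i5⟩
    refine ⟨fun q hq => i2 q hq ?_, i3, i5⟩
    have := (hlt q).1 hq
    omega

end RoutedGraph

/-! ### The second phase of the program -/

namespace RAM

/-- Write the paths of all half-edges. -/
def Prog.writePaths : Prog := .seq (.assign 15 (.const 0))
  (.loop (.reg 15) (.reg 3) (.seq (.store 5 (.reg 15) (.arr 8 (.arr 18 (.reg 15)))) (.incr 15)))

/-- Make the orders at the two ends of each remaining edge agree. -/
def Prog.orderTerminals : Prog := .seq (.assign 12 (.const 0))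
  (.loop (.reg 12) (.reg 0) (.seq
    (.ite (.const 0) (.arr 11 (.reg 12)) (.block [.bounds, .findTargets, .copy]) .skip)
    (.incr 12)))

/-- Insert the deleted nodes in decreasing order. -/
def Prog.reinsert : Prog := .loop (.const 0) (.reg 12) (.seq
  (.assign 12 (.sub (.reg 12) (.const 1)))
  (.ite (.arr 11 (.reg 12)) (.const 1) (.seq .bounds .copy) .skip))

end RAM

namespace RoutedGraph

open RAM Layout

variable {n m : ℕ} {I : RoutedGraph n m} {H : HalfEdges} {S : ℕ → Layout} {start : ℕ → ℕ}

/-- The program writes the paths at the final positions `fp`. -/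
def Writes (H : HalfEdges) (fp : ℕ → ℕ) (s : State) : Prop := ∀ h < H.M, s.arr 5 (fp h) = H.lab h

/-- What remains unchanged in the second phase. -/
structure IsFixed (I : RoutedGraph n m) (H : HalfEdges) (S : Layout) (start : ℕ → ℕ) (s : State) :
    Prop where
  layout_eq : layout s = S
  r0 : s.reg 0 = n
  a0 : s.arr 0 = I.input.arr 0
  a4 : ∀ k ≤ I.rotOffset n, s.arr 4 k = start k
  a11 : ∀ v : Fin n, 0 < s.arr 11 v ↔ ∃ i, I.TerminalOf i v

theorem IsFixed.frame {S : Layout} {s s' : State} {p : Prog} (h : IsFixed I H S start s)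
    (hf : Frame p s s') (hr : 0 ∉ p.regs) (ha : ∀ A ∈ [0, 4, 9, 11, 18, 19, 20], A ∉ p.arrs) :
    IsFixed I H S start s' := by
  refine ⟨?_, (hf.1 0 hr).trans h.r0, (hf.2 0 (ha 0 (by simp))).trans h.a0, ?_, ?_⟩
  · rw [← h.layout_eq]
    simp only [layout, hf.2 18 (ha 18 (by simp)), hf.2 19 (ha 19 (by simp)),
      hf.2 9 (ha 9 (by simp)), hf.2 20 (ha 20 (by simp))]
  · rw [hf.2 4 (ha 4 (by simp))]
    exact h.a4
  · rw [hf.2 11 (ha 11 (by simp))]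
    exact h.a11

theorem runs_writePaths {S : Layout} {s : State} (hs : layout s = S) (h3 : s.reg 3 = H.M)
    (h8 : s.arr 8 = H.lab) :
    Runs .writePaths s (30 * (H.M + 1)) (fun s' => ∀ q < H.M, s'.arr 5 q = H.lab (S.obj q)) := by
  refine Runs.mono (T := 2 + ((13 + 3) * H.M + 3)) ?_ (by omega) fun _ => id
  refine Runs.seq (Q := fun s' => s'.reg 15 = 0) (runs_of_effect rfl rfl ?_) fun s' h15 hf => ?_
  · simp [Prog.effect, Expr.eval]
  refine (runs_for (fun t s₁ => s₁.reg 15 = t ∧ ∀ q < t, s₁.arr 5 q = H.lab (S.obj q)) H.M 13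
    ⟨h15, by simp⟩ ?_ ?_).mono (by simp [Expr.cost]) fun _ h => h.2
  · rintro t ht s₁ ⟨i1, i2⟩ hf₁
    have g3 := (hf₁.1 3 (by decide)).trans ((hf.1 3 (by decide)).trans h3)
    have g8 := (hf₁.2 8 (by decide)).trans ((hf.2 8 (by decide)).trans h8)
    have g18 : s₁.arr 18 = S.obj := by
      rw [hf₁.2 18 (by decide), hf.2 18 (by decide), ← hs]
      rfl
    refine ⟨by simpa [Expr.eval, i1, g3], runs_of_effect rfl rfl ?_⟩
    simp only [Prog.effect, Expr.eval, Prog.incr, i1, g8, g18, Function.update_self, true_and]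
    intro q hq
    by_cases h : q = t
    · rw [h, Function.update_self]
    · rw [Function.update_of_ne h]
      exact i2 q (by omega)
  · rintro s₁ ⟨i1, -⟩ hf₁
    have g3 := (hf₁.1 3 (by decide)).trans ((hf.1 3 (by decide)).trans h3)
    simp [Expr.eval, i1, g3]

theorem HalfEdges.Valid.nd_lt (hH : H.Valid I) {h : ℕ} (hh : h < H.M) : H.nd h < n := by
  obtain ⟨i, v, w, h1, -⟩ := hH.exists_path h hh
  rw [h1.2.2.1]
  exact v.2

theorem Records.congr (hH : H.Valid I) (hC : Chain I H ((S 0).nodeAt H) S n) {s s' : State}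
    {P P' : Fin n → Prop} (h : Records H S P s) {v : Fin n} (hP : ∀ u, P' u → P u ∧ u ≠ v)
    (h20 : s'.arr 20 = s.arr 20)
    (h21 : ∀ y ∉ posAt H ((S 0).nodeAt H) v, s'.arr 21 y = s.arr 21 y) : Records H S P' s' := by
  intro u hu q hq
  obtain ⟨h1, h2⟩ := h u (hP u hu).1 q hq
  refine ⟨by rw [h20, h1], ?_⟩
  rw [h21, h2]
  intro hmem
  have h3 := blk_mem (hC.valid hH le_rfl u.2.le) hq
  exact (hP u hu).2 (Fin.ext ((mem_posAt.1 h3).2.symm.trans (mem_posAt.1 hmem).2))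

/-- After the first phase, the two ends of a remaining link carry the same paths in unrelated
orders. A link becomes mirrored when its first end is visited, and copying again at the second end
keeps it so. This fixes the orders on the remaining edges. -/
theorem runs_orderTerminals (hH : H.Valid I) (hS₀ : (S 0).Sorted I H start)
    (hC : Chain I H ((S 0).nodeAt H) S n) {s : State} (hs : IsFixed I H (S n) start s)
    (h5 : ∀ q < H.M, s.arr 5 q = H.lab ((S n).obj q))
    (hR : Records H S (fun v => ¬ ∃ i, I.TerminalOf i v) s) :
    Runs .orderTerminals s (300 * (H.M + n + 1)) (fun s' => s'.reg 12 = n ∧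
      Records H S (fun v => ¬ ∃ i, I.TerminalOf i v) s' ∧
      ∃ fp, Resolved I H ((S 0).nodeAt H) S n fp ∧ Writes H fp s') := by
  have hSn := hC.valid hH le_rfl le_rfl
  have hτ := isPartialDeletion_dead (I := I) n
  refine Runs.mono (T := 2 + (250 + (1 + 1 + 1)) * (start (I.rotOffset n) + n + 1)) ?_
    (by rw [hS₀.last]; omega) fun _ => id
  refine Runs.seq (Q := fun s' => s'.reg 12 = 0) (runs_of_effect rfl rfl ?_) fun s' h12 hf => ?_
  · simp [Prog.effect, Expr.eval]
  have hs' := hs.frame hf (by decide) (by simp [Prog.arrs])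
  have fa : ∀ A, s'.arr A = s.arr A := fun A => hf.2 A (by simp [Prog.arrs])
  refine (runs_loop_potential (fun t s₁ => s₁.reg 12 = t ∧
    Records H S (fun v => ¬ ∃ i, I.TerminalOf i v) s₁ ∧
    ∃ fp, Placement H ((S 0).nodeAt H) fp ∧ (S n).Agrees H (I.dead n) fp ∧
      (∀ h, H.Live (I.dead n) h → H.nd h < t ∨ H.nd ((S n).mate h) < t →
        (S n).Mirrored H fp h) ∧ Writes H fp s₁) n 250
    (fun k => start (I.rotOffset k)) (fun k hk => ?_) ⟨h12, ?_, (S n).pos, ?_⟩ ?_ ?_).mono le_rfl ?_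
  · exact hS₀.mono _ _ (rotOffset_mono (Nat.le_succ _)) (rotOffset_mono hk)
  · intro v hv q hq
    rw [fa, fa]
    exact hR v hv q hq
  · refine ⟨⟨hSn.pos_lt, ?_, fun h hh => ?_⟩, fun h hh => rfl, fun h _ hh => by omega,
      fun h hh => ?_⟩
    · intro h hh h' hh' heq
      rw [← hSn.obj_pos h hh, heq, hSn.obj_pos h' hh']
    · rw [← hSn.node _ (hSn.pos_lt h hh), hSn.obj_pos h hh]
    · rw [fa, h5 _ (hSn.pos_lt h hh), hSn.obj_pos h hh]
  · rintro k hk s₁ ⟨i12, iR, fp, i1, i2, i3, i4⟩ hf₁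
    have hs₁ := hs'.frame hf₁ (by decide) (by decide)
    refine ⟨by simpa [Expr.eval, i12, hs₁.r0] using hk, ?_⟩
    set ℓ := start (I.rotOffset (k + 1)) - start (I.rotOffset k)
    refine Runs.mono (T := 5 + 200 * (ℓ + 1) + 4) ?_ (by omega) fun _ => id
    have ht := hs₁.a11 ⟨k, hk⟩
    refine Runs.seq (Q := fun s₂ => Records H S (fun v => ¬ ∃ i, I.TerminalOf i v) s₂ ∧
      ∃ fp, Placement H ((S 0).nodeAt H) fp ∧ (S n).Agrees H (I.dead n) fp ∧
      (∀ h, H.Live (I.dead n) h → H.nd h < k + 1 ∨ H.nd ((S n).mate h) < k + 1 →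
        (S n).Mirrored H fp h) ∧ Writes H fp s₂)
      ((Runs.ite (T := 200 * (ℓ + 1)) (fun hlt => ?_) fun hlt => ?_).mono
        (by simp [Expr.cost]) fun _ => id)
      fun s₂ hs₂ hf₂ => runs_of_effect rfl rfl ⟨?_, hs₂⟩
    · simp only [Expr.eval, i12] at hlt
      have hvt := ht.1 hlt
      have hv : (⟨k, hk⟩ : Fin n) ∉ I.dead n := fun h => (mem_dead.1 h).2 hvt
      refine Runs.mono (T := 30 + (60 * (ℓ + 1) + 60 * (ℓ + 1))) ?_ (by omega) fun _ => id
      refine (runs_bounds (v := ⟨k, hk⟩) hS₀ hs₁.a4 hs₁.a0 i12).seq fun s₂ ⟨b1, b13, b14⟩ hf₂ => ?_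
      have hs₂ := hs₁.frame hf₂ (by decide) (by decide)
      have hℓ : s₂.reg 14 - s₂.reg 13 = ℓ := by rw [b13, b14]
      have hft := runs_findTargets hH hτ hSn hv hs₂.layout_eq b1
      rw [hℓ] at hft
      refine hft.seq fun s₃ ⟨t1, t2⟩ hf₃ => ?_
      have hs₃ := hs₂.frame hf₃ (by decide) (by decide)
      have c13 := hf₃.1 13 (by decide)
      have c14 := hf₃.1 14 (by decide)
      have hcp := runs_copy hH hτ hSn hv (b1.congr c13 c14) (fun q hq => ⟨by
        rw [← hs₃.layout_eq]; rfl, (t1 q hq).1⟩)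
      rw [c13, c14, hℓ] at hcp
      refine hcp.frame.mono le_rfl fun s₄ ⟨⟨p1, p2, p3⟩, hf₄⟩ => ?_
      have e5 : s₃.arr 5 = s₁.arr 5 := (hf₃.2 5 (by decide)).trans (hf₂.2 5 (by decide))
      have ha : ∀ h, H.Live (I.dead n) h → H.nd h ≠ (⟨k, hk⟩ : Fin n) →
        (S n).blk (fp h) = (S n).blk ((S n).pos h) := fun h hh _ => i2 h hh
      refine ⟨iR.congr hH hC (v := ⟨k, hk⟩) (fun u hu => ⟨hu, ?_⟩) ?_ fun y hy => ?_,
        (S n).mirror H ⟨k, hk⟩ fp, placement_mirror hH hτ hSn hv i1 ha,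
        agrees_mirror hH hτ hSn hv i1 ha, fun h hh hlt => ?_, ?_⟩
      · rintro rfl
        exact hu hvt
      · rw [hf₄.2 20 (by decide), hf₃.2 20 (by decide), hf₂.2 20 (by decide)]
      · exact (p3 y hy).trans ((t2 y hy).trans (by rw [hf₂.2 21 (by decide)]))
      · by_cases h1 : H.nd h = (⟨k, hk⟩ : Fin n) ∨ H.nd ((S n).mate h) = (⟨k, hk⟩ : Fin n)
        · exact mirrored_mirror hH hτ hSn hv i1 ha hh h1
        · rw [not_or] at h1
          refine Mirrored.mirror hH hτ hSn (i3 h hh ?_) hh h1.1 h1.2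
          have h2 : H.nd h ≠ k := h1.1
          have h3 : H.nd ((S n).mate h) ≠ k := h1.2
          omega
      · refine copy_spec hH hτ hSn hv i1 ha (out := s₁.arr 5) i4 (fun q hq => ?_) fun q _ hq => ?_
        · rw [← e5]
          exact p1 q hq
        · rw [← e5]
          exact p2 q hq
    · simp only [Expr.eval, i12] at hlt
      have hvt := ht.not.1 hlt
      refine runs_of_effect rfl (Nat.ble_eq_true_of_le (by simp [Prog.time]; omega))
        ⟨iR, fp, i1, i2, fun h hh hlt => i3 h hh ?_, i4⟩
      have hv : (⟨k, hk⟩ : Fin n) ∈ I.dead n := mem_dead.2 ⟨hk, hvt⟩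
      have h1 : H.nd h ≠ k := hh.2 _ hv
      have h2 : H.nd ((S n).mate h) ≠ k := (live_mate hH hτ hSn hh).2 _ hv
      omega
    · have := hf₂.1 12 (by decide)
      simp only [Prog.incr, Prog.effect, Expr.eval, Function.update_self, this, i12]
  · rintro s₁ ⟨i12, -⟩ hf₁
    simp [Expr.eval, i12, (hs'.frame hf₁ (by decide) (by decide)).r0]
  · rintro s₁ ⟨i12, iR, fp, i1, i2, i3, i4⟩
    refine ⟨i12, iR, fp, ⟨i1, fun j hj hjn => ?_, fun j hj hjn h hh => ?_⟩, i4⟩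
    · obtain rfl : j = n := by omega
      exact i2
    · obtain rfl : j = n := by omega
      exact i3 h hh (.inl (hH.nd_lt hh.1))

theorem runs_reinsert (hH : H.Valid I) (hS₀ : (S 0).Sorted I H start)
    (hC : Chain I H ((S 0).nodeAt H) S n) {s : State} (hs : IsFixed I H (S n) start s)
    (h12 : s.reg 12 = n) (hR : Records H S (fun v => ¬ ∃ i, I.TerminalOf i v) s) {fp : ℕ → ℕ}
    (hfp : Resolved I H ((S 0).nodeAt H) S n fp) (hw : Writes H fp s) :
    Runs .reinsert s (300 * (H.M + n + 1)) (fun s' =>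
      ∃ fp, Resolved I H ((S 0).nodeAt H) S 0 fp ∧ Writes H fp s') := by
  -- The nodes are visited downwards, so the potential counts the positions at the nodes with number
  -- at least `n - t`.
  refine Runs.mono (T := (250 + (1 + 1 + 1)) * ((H.M - start (I.rotOffset (n - n))) + n + 1)) ?_
    (by
      have : H.M - start (I.rotOffset (n - n)) ≤ H.M := Nat.sub_le _ _
      omega) fun _ => id
  refine (runs_loop_potential (fun t s₁ => s₁.reg 12 = n - t ∧
    Records H S (fun v : Fin n => v < n - t ∧ ¬ ∃ i, I.TerminalOf i v) s₁ ∧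
    ∃ fp, Resolved I H ((S 0).nodeAt H) S (n - t) fp ∧ Writes H fp s₁) n 250
    (fun t => H.M - start (I.rotOffset (n - t))) (fun t ht => ?_)
    ⟨h12, fun v hv => hR v hv.2, fp, hfp, hw⟩ ?_ ?_).mono le_rfl ?_
  · have := hS₀.mono _ _ (I.rotOffset_mono (show n - (t + 1) ≤ n - t by omega))
      (rotOffset_mono (Nat.sub_le _ _))
    omega
  · rintro t ht s₁ ⟨i12, iR, fp, i1, i2⟩ hf₁
    have hs₁ := hs.frame hf₁ (by decide) (by decide)
    refine ⟨by simp [Expr.eval, i12]; omega, ?_⟩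
    obtain ⟨k, hk⟩ : ∃ k, n - t = k + 1 := ⟨n - t - 1, by omega⟩
    have hk' : n - (t + 1) = k := by omega
    have hkn : k < n := by omega
    rw [hk] at i12 iR i1 ⊢
    rw [hk']
    have hmono := hS₀.mono _ _ (I.rotOffset_mono (Nat.le_succ k)) (rotOffset_mono hkn)
    have hmono' := hS₀.mono _ _ (I.rotOffset_mono (show k + 1 ≤ n from hkn)) le_rfl
    rw [hS₀.last] at hmono'
    have hℓ' : (H.M - start (I.rotOffset k)) - (H.M - start (I.rotOffset (k + 1))) =
      start (I.rotOffset (k + 1)) - start (I.rotOffset k) := by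
      dsimp only [Nat.succ_eq_add_one] at hmono
      omega
    rw [hℓ']
    set ℓ := start (I.rotOffset (k + 1)) - start (I.rotOffset k)
    refine Runs.mono (T := 5 + (5 + 90 * (ℓ + 1))) ?_ (by omega) fun _ => id
    refine Runs.seq (Q := fun s₂ => s₂.reg 12 = k) (runs_of_effect rfl rfl ?_)
      fun s₂ j12 hf₂ => ?_
    · simp [Prog.effect, Expr.eval, i12]
    have hs₂ := hs₁.frame hf₂ (by decide) (by decide)
    have fa : ∀ A, s₂.arr A = s₁.arr A := fun A => hf₂.2 A (by simp [Prog.arrs])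
    have ht' := hs₂.a11 ⟨k, hkn⟩
    have hS := hC.valid hH le_rfl hkn.le
    have hτ := isPartialDeletion_dead (I := I) k
    refine (Runs.ite (T := 90 * (ℓ + 1)) (fun hlt => ?_) fun hlt => ?_).mono
      (by simp [Expr.cost]) fun _ => id
    · simp only [Expr.eval, j12] at hlt
      have hvt : ¬ ∃ i, I.TerminalOf i ⟨k, hkn⟩ := by
        rw [← ht']
        dsimp only
        omega
      have hv : (⟨k, hkn⟩ : Fin n) ∉ I.dead k := fun h => lt_irrefl _ (mem_dead.1 h).1
      refine Runs.mono (T := 30 + 60 * (ℓ + 1)) ?_ (by omega) fun _ => id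
      refine (runs_bounds (v := ⟨k, hkn⟩) hS₀ hs₂.a4 hs₂.a0 j12).frame.seq ?_
      rintro s₃ ⟨⟨b1, b13, b14⟩, -⟩ hf₃
      have hℓ : s₃.reg 14 - s₃.reg 13 = ℓ := by rw [b13, b14]
      have fa' : ∀ A, s₃.arr A = s₁.arr A := fun A =>
        (hf₃.2 A (by simp [Prog.bounds, Prog.block, Prog.arrs])).trans (fa A)
      have hcp := runs_copy (S := S k) hH hτ hS hv b1 (fun q hq => by
        rw [fa', fa']
        exact iR ⟨k, hkn⟩ ⟨Nat.lt_succ_self k, hvt⟩ q hq)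
      rw [hℓ] at hcp
      refine hcp.frame.mono le_rfl fun s₄ ⟨⟨p1, p2, p3⟩, hf₄⟩ => ?_
      rw [fa'] at p1 p2 p3
      obtain ⟨r1, r2⟩ := i1.mirror (v := ⟨k, hkn⟩) hH hC hvt
      refine ⟨?_, iR.congr hH hC (v := ⟨k, hkn⟩) (fun u hu => ⟨⟨hu.1.trans (Nat.lt_succ_self k),
        hu.2⟩, ?_⟩) ?_ p3, _, r1, r2 _ _ i2 p1 fun q _ hq => p2 q hq⟩
      · rw [hf₄.1 12 (by decide), hf₃.1 12 (by decide), j12]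
      · rintro rfl
        exact lt_irrefl _ hu.1
      · rw [hf₄.2 20 (by decide), fa']
    · simp only [Expr.eval, j12] at hlt
      have hvt : ∃ i, I.TerminalOf i ⟨k, hkn⟩ := by
        rw [← ht']
        dsimp only
        omega
      refine runs_of_effect rfl (Nat.ble_eq_true_of_le (by simp [Prog.time]; omega))
        ⟨j12, fun u hu q hq => ?_, fp, i1.of_terminal (v := ⟨k, hkn⟩) hC hvt, fun h hh => ?_⟩
      · simp only [Prog.effect, fa]
        exact iR u ⟨hu.1.trans (Nat.lt_succ_self k), hu.2⟩ q hq
      · simp only [Prog.effect, fa]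
        exact i2 h hh
  · rintro s₁ ⟨i12, -⟩ -
    simp [Expr.eval, i12]
  · rintro s₁ ⟨-, -, fp, i1, i2⟩
    rw [Nat.sub_self] at i1
    exact ⟨fp, i1, i2⟩

end RoutedGraph

namespace RoutedGraph

open RAM Layout

variable {n m : ℕ} {I : RoutedGraph n m} {H : HalfEdges} {S : Layout} {start fp out : ℕ → ℕ}

/-! ## The ordering that the program computes -/

/-- The words at the positions from `a` to `b`, as paths. -/
def segment (m : ℕ) (out : ℕ → ℕ) (a b : ℕ) : List (Fin m) :=
  (List.Ico a b).filterMap (fun q => if h : out q < m then some ⟨out q, h⟩ else none)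

open Classical in
/-- The ordering of paths that is stored in `out`. -/
noncomputable def stored (I : RoutedGraph n m) (start out : ℕ → ℕ) (v w : Fin n) : List (Fin m) :=
  if h : ∃ k, I.IsDart k v w then segment m out (start h.choose) (start (h.choose + 1)) else []

theorem segment_append {a b c : ℕ} (h : a ≤ b) (h' : b ≤ c) :
    segment m out a b ++ segment m out b c = segment m out a c := by
  unfold segment
  rw [← List.filterMap_append, List.Ico.append_consecutive h h']

theorem flatMap_segment {a b : ℕ} (hab : a ≤ b)
    (hs : ∀ k l, a ≤ k → k ≤ l → l ≤ b → start k ≤ start l) :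
    (List.Ico a b).flatMap (fun k => segment m out (start k) (start (k + 1))) =
      segment m out (start a) (start b) := by
  induction b, hab using Nat.le_induction with
  | base => simp [segment]
  | succ b hb ih =>
    rw [List.Ico.succ_top hb, List.flatMap_append, ih fun k l h1 h2 h3 => hs k l h1 h2 (by omega),
      List.flatMap_singleton, segment_append (hs _ _ le_rfl hb (by omega))
        (hs _ _ hb (by omega) le_rfl)]

theorem stored_eq {k : ℕ} {v w : Fin n} (h : I.IsDart k v w) :
    I.stored start out v w = segment m out (start k) (start (k + 1)) := by
  have h' : ∃ k, I.IsDart k v w := ⟨k, h⟩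
  rw [stored, dif_pos h', h'.choose_spec.eq h]

theorem map_stored (v : Fin n) : (I.rot v).map (I.stored start out v) =
    (List.Ico (I.rotOffset v) (I.rotOffset (v + 1))).map
      (fun k => segment m out (start k) (start (k + 1))) := by
  rw [rotOffset_succ]
  refine List.ext_getElem (by simp) fun j hj hj' => ?_
  rw [List.length_map] at hj
  have hd : I.IsDart (I.rotOffset v + j) v (I.rot v)[j] := ⟨j, List.getElem?_eq_getElem hj, rfl⟩
  simp [List.Ico, stored_eq hd]

theorem outputLists_stored : I.outputLists (I.stored start out) =
    (List.range (I.rotOffset n)).map (fun k => segment m out (start k) (start (k + 1))) := by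
  have key : ∀ c ≤ n, ((List.finRange n).take c).flatMap
      (fun v => (I.rot v).map (I.stored start out v)) =
      (List.range (I.rotOffset c)).map (fun k => segment m out (start k) (start (k + 1))) := by
    intro c
    induction c with
    | zero => simp [rotOffset]
    | succ c ih =>
      intro hc
      have hm := I.rotOffset_mono (Nat.le_succ c)
      rw [List.take_succ_eq_append_getElem (by simpa using hc), List.flatMap_append,
        ih (by omega), List.flatMap_singleton, List.getElem_finRange, map_stored,
        ← List.Ico.zero_bot, ← List.Ico.zero_bot, ← List.map_append]
      exact congrArg _ (List.Ico.append_consecutive (Nat.zero_le _) hm)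
  have := key n le_rfl
  rwa [List.take_of_length_le (by simp)] at this

/-- The positions `fp` describe an ordering of paths. -/
structure Arranged (I : RoutedGraph n m) (H : HalfEdges) (S : Layout) (start fp out : ℕ → ℕ) :
    Prop where
  valid : H.Valid I
  sorted : S.Sorted I H start
  placement : Placement H (S.nodeAt H) fp
  agrees : ∀ h < H.M, S.blk (fp h) = S.blk (S.pos h)
  mirrored : ∀ h < H.M, S.Mirrored H fp h
  writes : ∀ h < H.M, out (fp h) = H.lab h

namespace Arranged

variable (hA : Arranged I H S start fp out)

include hA

theorem exists_half {q : ℕ} (hq : q < H.M) : ∃ h i x w, fp h = q ∧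
    H.IsHalf (n := n) (m := m) h i x w ∧ I.Traverses i [x, w] ∧ out q = i := by
  have hsurj := Finset.surjOn_of_injOn_of_card_le (s := Finset.range H.M) (t := Finset.range H.M)
    fp (fun h hh => by simpa using hA.placement.lt h (by simpa using hh))
    (fun h hh h' hh' => hA.placement.inj h (by simpa using hh) h' (by simpa using hh')) le_rfl
  obtain ⟨h, hh, rfl⟩ := hsurj (by simpa using hq : q ∈ (Finset.range H.M : Set ℕ))
  have hh : h < H.M := by simpa using hh
  obtain ⟨i, x, w, h1, h2⟩ := hA.valid.exists_path h hh
  exact ⟨h, i, x, w, rfl, h1, h2, (hA.writes h hh).trans h1.2.1⟩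

/-- In the first layout the blocks are the darts, and the final arrangement keeps every half-edge in
its block. -/
theorem mem_dart_iff {h k : ℕ} {i : Fin m} {x w x' w' : Fin n} (hh : H.IsHalf h i x w)
    (hi : I.Traverses i [x, w]) (hk : I.IsDart k x' w') :
    start k ≤ fp h ∧ fp h < start (k + 1) ↔ x = x' ∧ w = w' := by
  have hS := hA.sorted.valid
  have hlt := hA.placement.lt h hh.1
  obtain ⟨j, y, z, h1, h2⟩ := hA.valid.exists_path _ (hS.obj_lt _ hlt)
  have h3 := (hS.blk_iff isLink_pair isLink_pair hi h2 ⟨x, w, [], rfl, hh⟩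
    ⟨y, z, [], rfl, h1⟩).1 (by rw [hS.pos_obj _ hlt, hA.agrees h hh.1])
  simp only [List.cons.injEq, and_true] at h3
  rw [hA.sorted.dart hk _ hlt, h1.2.2.1, h1.2.2.2, h3.1, h3.2, Fin.val_inj, Fin.val_inj]

theorem start_le {k l : ℕ} (h : k ≤ l) (hl : l ≤ I.rotOffset n) : start l ≤ H.M ∧ start k ≤ start l :=
  ⟨by rw [← hA.sorted.last]; exact hA.sorted.mono _ _ hl le_rfl, hA.sorted.mono _ _ h hl⟩

theorem pairwise_segment {k : ℕ} {v w : Fin n} (hk : I.IsDart k v w) :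
    (segment m out (start k) (start (k + 1))).Pairwise (fun i j => ∃ h h',
      H.IsHalf h i v w ∧ H.IsHalf h' j v w ∧ fp h < fp h') := by
  have hM := (hA.start_le (Nat.le_succ k) hk.bounds.2.2).1
  unfold segment
  rw [List.pairwise_filterMap]
  refine (List.Ico.pairwise_lt _ _).imp_of_mem fun {q q'} hq hq' hlt => ?_
  rw [List.Ico.mem] at hq hq'
  obtain ⟨h, i, x, y, rfl, h1, h2, h3⟩ := hA.exists_half (hq.2.trans_le hM)
  obtain ⟨h', i', x', y', rfl, h1', h2', h3'⟩ := hA.exists_half (hq'.2.trans_le hM)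
  obtain ⟨rfl, rfl⟩ := (hA.mem_dart_iff h1 h2 hk).1 hq
  obtain ⟨rfl, rfl⟩ := (hA.mem_dart_iff h1' h2' hk).1 hq'
  intro j hj j' hj'
  simp only [h3, h3', Fin.is_lt, dite_true, Option.some.injEq, Fin.eta] at hj hj'
  exact ⟨h, h', hj ▸ h1, hj' ▸ h1', hlt⟩

theorem mem_segment {k : ℕ} {v w : Fin n} (hk : I.IsDart k v w) {i : Fin m} :
    i ∈ segment m out (start k) (start (k + 1)) ↔ I.Traverses i [v, w] := by
  have hM := (hA.start_le (Nat.le_succ k) hk.bounds.2.2).1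
  unfold segment
  rw [List.mem_filterMap]
  constructor
  · rintro ⟨q, hq, hi⟩
    rw [List.Ico.mem] at hq
    obtain ⟨h, j, x, y, rfl, h1, h2, h3⟩ := hA.exists_half (hq.2.trans_le hM)
    obtain ⟨rfl, rfl⟩ := (hA.mem_dart_iff h1 h2 hk).1 hq
    simp only [h3, Fin.is_lt, dite_true, Option.some.injEq, Fin.eta] at hi
    exact hi ▸ h2
  · intro hi
    obtain ⟨h, hh⟩ := hA.valid.exists_half hi
    have h1 : out (fp h) = i := (hA.writes h hh.1).trans hh.2.1
    exact ⟨fp h, List.Ico.mem.2 ((hA.mem_dart_iff hh hi hk).2 ⟨rfl, rfl⟩), by simp [h1]⟩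

theorem isOrdering : I.IsOrdering (I.stored start out) := by
  have hmem : ∀ v w i, i ∈ I.stored start out v w ↔ I.Traverses i [v, w] := by
    intro v w i
    by_cases h : ∃ k, I.IsDart k v w
    · obtain ⟨k, hk⟩ := h
      rw [stored_eq hk, hA.mem_segment hk]
    · rw [stored, dif_neg h]
      refine iff_of_false (by simp) fun h' => h (exists_isDart h'.adj)
  have hpw : ∀ v w, (I.stored start out v w).Pairwise (fun i j => ∃ h h',
      H.IsHalf h i v w ∧ H.IsHalf h' j v w ∧ fp h < fp h') := by
    intro v w
    by_cases h : ∃ k, I.IsDart k v w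
    · obtain ⟨k, hk⟩ := h
      rw [stored_eq hk]
      exact hA.pairwise_segment hk
    · rw [stored, dif_neg h]
      exact List.Pairwise.nil
  have hnd : ∀ v w, (I.stored start out v w).Nodup := fun v w =>
    (hpw v w).imp fun {i j} ⟨h, h', h1, h2, h3⟩ hij => by
      subst hij
      rw [hA.valid.unique h1 h2] at h3
      exact lt_irrefl _ h3
  intro v w
  refine ⟨hnd v w, fun i => by rw [hmem, traverses_pair_iff], ?_⟩
  -- Both lists have the same members and increase along the final positions of their half-edges.
  -- Mirroring reverses one order into the other, so they agree as lists.
  have hperm : (I.stored start out w v).Perm (I.stored start out v w).reverse := by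
    rw [List.perm_ext_iff_of_nodup (hnd _ _) (List.nodup_reverse.2 (hnd _ _))]
    intro i
    rw [List.mem_reverse, hmem, hmem, ← traverses_reverse]
    rfl
  refine hperm.eq_of_pairwise (le := fun i j => ∃ h h', H.IsHalf h i w v ∧ H.IsHalf h' j w v ∧
    fp h < fp h') ?_ (hpw w v) ?_
  · rintro i j - - ⟨h₁, h₂, a1, a2, a3⟩ ⟨h₃, h₄, b1, b2, b3⟩
    rw [hA.valid.unique b1 a2, hA.valid.unique b2 a1] at b3
    omega
  · rw [List.pairwise_reverse]
    refine (hpw v w).imp_of_mem ?_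
    rintro i j hi hj ⟨h, h', h1, h2, h3⟩
    have hS := hA.sorted.valid
    rw [hmem] at hi hj
    have s1 : H.Starts h i [v, w] := ⟨v, w, [], rfl, h1⟩
    have s2 : H.Starts h' j [v, w] := ⟨v, w, [], rfl, h2⟩
    have hb := (hS.blk_iff isLink_pair isLink_pair hi hj s1 s2).2 rfl
    have h4 := (hA.mirrored h h1.1 h' h2.1 hb).1 h3
    have key : ∀ {h : ℕ} {i : Fin m}, H.Starts h i [w, v] → H.IsHalf h i w v := by
      rintro h i ⟨x, y, l, h5, h6⟩
      simp only [List.cons.injEq] at h5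
      obtain ⟨rfl, rfl, -⟩ := h5
      exact h6
    exact ⟨_, _, key (hS.mate_starts isLink_pair hj s2), key (hS.mate_starts isLink_pair hi s1), h4⟩

theorem around_stored (v : Fin n) : I.around (I.stored start out) v =
    segment m out (start (I.rotOffset v)) (start (I.rotOffset (v + 1))) := by
  rw [around, List.flatMap_def, map_stored, ← List.flatMap_def]
  refine flatMap_segment (rotOffset_mono (Nat.le_succ _)) fun k l _ h1 h2 => ?_
  exact hA.sorted.mono _ _ h1 (h2.trans (rotOffset_mono v.2))

/-- A crossing around `v` gives four half-edges at `v` in increasing positions that belong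
alternately to the two paths. A further present node of a common subpath gives a shared link at `v`,
and `Resolved.not_alternating` applies. -/
theorem crossesLast {S' : ℕ → Layout} (hC : Chain I H (S.nodeAt H) S' n)
    (hR : Resolved I H (S.nodeAt H) S' 0 fp) : I.CrossesLast (I.stored start out) (I.dead n) := by
  have key : ∀ (i j : Fin m) (v : Fin n), (¬ ∃ i, I.TerminalOf i v) →
      (I.around (I.stored start out) v).filter (fun k => k = i ∨ k = j) = [i, j, i, j] →
      ∀ d, IsLink (I.dead v) d → d.head? = some v → I.Traverses i d → I.Traverses j d → False := by
    intro i j v hv hf d hd hdv hid hjd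
    have h1 : List.Sublist [i, j, i, j] (I.around (I.stored start out) v) :=
      hf ▸ List.filter_sublist
    rw [hA.around_stored] at h1
    have hM := (hA.start_le (I.rotOffset_mono (Nat.le_succ v)) (rotOffset_mono v.2)).1
    -- The default `i` is never used: every position below `M` holds the number of a path.
    have hlist : segment m out (start (I.rotOffset v)) (start (I.rotOffset (v + 1))) =
        (List.Ico (start (I.rotOffset v)) (start (I.rotOffset (v + 1)))).map
          (fun q => if h : out q < m then ⟨out q, h⟩ else i) := by
      unfold segment
      rw [← List.filterMap_eq_map]
      refine List.filterMap_congr fun q hq => ?_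
      obtain ⟨h, k, x, y, -, -, -, h3⟩ := hA.exists_half ((List.Ico.mem.1 hq).2.trans_le hM)
      simp [h3]
    rw [hlist, List.sublist_map_iff] at h1
    obtain ⟨l, h2, h3⟩ := h1
    have h4 := (List.Ico.pairwise_lt _ _).sublist h2
    have hpos : ∀ q ∈ l, ∀ k : Fin m, k = (if h : out q < m then ⟨out q, h⟩ else i) →
        ∃ h < H.M, H.nd h = v ∧ H.lab h = k ∧ fp h = q := by
      intro q hq k hk
      have hq' := List.Ico.mem.1 (h2.subset hq)
      have hlt := hq'.2.trans_le hM
      obtain ⟨h, k', x, y, rfl, a1, a2, a3⟩ := hA.exists_half hlt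
      refine ⟨h, a1.1, ?_, ?_, rfl⟩
      · rw [← hA.placement.node h a1.1]
        exact (hA.sorted.node v _ hlt).1 hq'
      · rw [hk, a1.2.1]
        simp [a3]
    obtain ⟨q₁, l, rfl, k₁, h3⟩ := List.map_eq_cons_iff.1 h3.symm
    obtain ⟨q₂, l, rfl, k₂, h3⟩ := List.map_eq_cons_iff.1 h3
    obtain ⟨q₃, l, rfl, k₃, h3⟩ := List.map_eq_cons_iff.1 h3
    obtain ⟨q₄, l, rfl, k₄, h3⟩ := List.map_eq_cons_iff.1 h3
    obtain ⟨h₁, m₁, v₁, l₁, rfl⟩ := hpos q₁ (by simp) _ k₁.symm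
    obtain ⟨h₂, m₂, v₂, l₂, rfl⟩ := hpos q₂ (by simp) _ k₂.symm
    obtain ⟨h₃, m₃, v₃, l₃, rfl⟩ := hpos q₃ (by simp) _ k₃.symm
    obtain ⟨h₄, m₄, v₄, l₄, rfl⟩ := hpos q₄ (by simp) _ k₄.symm
    simp only [List.pairwise_cons, List.mem_cons, forall_eq_or_imp] at h4
    exact hR.not_alternating hA.valid hC hv hd hdv hid hjd m₁ m₂ m₃ m₄ v₁ v₂ v₃ v₄ l₁ l₂ l₃ l₄
      h4.1.1 h4.2.1.1 h4.2.2.1.1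
  intro i j _ τ v ρ hσ hc d hid hjd hvd u hud huv
  by_contra hu
  obtain rfl := eq_dead hσ
  have hv : ¬ ∃ i, I.TerminalOf i v := (mem_dead.1 (by rw [hσ]; simp : v ∈ I.dead n)).2
  obtain ⟨e, h1, h2, h3, h4⟩ := exists_common_link hid hjd hud hvd huv hu
    (fun h => lt_irrefl _ (mem_dead.1 h).1)
  rcases hc with h | h
  · exact key i j v hv h e h1 h2 h3 h4
  · refine key j i v hv ?_ e h1 h2 h4 h3
    rw [← h]
    congr 1
    ext k
    simp [or_comm]

theorem isOutput {s : State} (h4 : ∀ k ≤ I.rotOffset n, s.arr 4 k = start k)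
    (h5 : s.arr 5 = out) : I.IsOutput s (I.stored start out) := by
  have hflat : ∀ k ≤ I.rotOffset n, (((List.range (I.rotOffset n)).map
      (fun k => segment m out (start k) (start (k + 1)))).take k).flatten =
      segment m out 0 (start k) := by
    intro k hk
    rw [← List.map_take, List.take_range, min_eq_left hk, ← List.Ico.zero_bot,
      ← List.flatMap_def, flatMap_segment (Nat.zero_le _)
        fun a b _ h1 h2 => hA.sorted.mono a b h1 (h2.trans hk), hA.sorted.zero]
  have hmap : ∀ k ≤ H.M, (segment m out 0 k).map Fin.val = (List.range k).map out := by
    intro k hk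
    unfold segment
    rw [List.map_filterMap, List.Ico.zero_bot, ← List.filterMap_eq_map]
    refine List.filterMap_congr fun q hq => ?_
    obtain ⟨h, k, x, y, -, -, -, h3⟩ := hA.exists_half ((List.mem_range.1 hq).trans_le hk)
    simp [h3]
  constructor
  · intro k hk
    rw [outputLists_stored] at hk ⊢
    have hk : k ≤ I.rotOffset n := by
      simp only [offsets, List.length_map, List.length_range] at hk
      omega
    have hM := (hA.start_le hk le_rfl)
    rw [offsets_getD _ (by simpa using hk), hflat k hk, h4 k hk,
      ← List.length_map (f := Fin.val), hmap _ (hM.2.trans hM.1)]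
    simp
  · intro k hk
    have hc : contents (I.outputLists (I.stored start out)) = (List.range H.M).map out := by
      have := hflat _ le_rfl
      rw [List.take_of_length_le (by simp), hA.sorted.last] at this
      rw [outputLists_stored, contents, this, hmap _ le_rfl]
    rw [hc] at hk ⊢
    rw [List.getD_eq_getElem _ _ hk]
    simp [h5]

end Arranged

end RoutedGraph

/-! ### The complete program -/

namespace RAM

/-- The program that computes a consistent ordering of paths. -/
def Prog.orderPaths : Prog := .block [
  .readPaths,
  .collect 6 6 12 13,
  .findDarts,
  .collect 17 15 16 17,
  .placeHalves,
  .deleteAll,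
  .writePaths,
  .orderTerminals,
  .reinsert]

theorem Prog.incremental_orderPaths : Prog.orderPaths.Incremental := by
  simp [Prog.orderPaths, Prog.readPaths, Prog.readPath, Prog.readEdges, Prog.collect,
    Prog.findDarts, Prog.placeHalves, Prog.deleteAll, Prog.writePaths, Prog.orderTerminals,
    Prog.reinsert, Prog.delete, Prog.pass, Prog.move, Prog.relocate, Prog.extendBlock,
    Prog.newBlock, Prog.bounds, Prog.findTargets, Prog.copy, Prog.walk, Prog.block, Prog.incr,
    Expr.twin, Prog.Incremental, Expr.Incremental]

end RAM

namespace RoutedGraph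

open RAM Layout

variable {n m : ℕ} {I : RoutedGraph n m}

theorem length_pos (i : Fin m) : 0 < (I.path i).length := by
  rw [Nat.pos_iff_ne_zero]
  exact fun h => I.src_ne_tgt i (SimpleGraph.Walk.eq_of_length_eq_zero h)

/-- Every path has at least one edge, so time spent once per path is covered by the total length. -/
theorem card_paths_le : m ≤ I.totalLength := by
  have : ∑ _i : Fin m, 1 ≤ I.totalLength := Finset.sum_le_sum fun i _ => length_pos i
  simpa using this

theorem rotOffset_eq : I.rotOffset n = 2 * I.numEdges := by
  classical
  have h1 : I.rotOffset n = ∑ v, (I.rot v).length := by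
    rw [rotOffset, List.take_of_length_le (by simp), List.length_flatten, List.map_map,
      Fin.sum_univ_def]
    rfl
  have h2 : ∀ v, (I.rot v).length = I.graph.degree v := by
    intro v
    rw [← List.toFinset_card_of_nodup (I.rot_nodup v), ← SimpleGraph.card_neighborFinset_eq_degree]
    congr 1
    ext w
    simp [I.mem_rot]
  rw [h1, Finset.sum_congr rfl fun v _ => h2 v, I.graph.sum_degrees_eq_twice_card_edges, numEdges,
    Set.ncard_eq_toFinset_card', SimpleGraph.edgeFinset]

theorem input_boundedBy : I.input.BoundedBy (3 * I.size) := by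
  have hm := I.card_paths_le
  have hD := I.rotOffset_eq
  have h2 : ((List.finRange m).map (fun i => (I.path i).support)).flatten.length =
      I.totalLength + m := by
    have := (input_pathOffset (I := I) le_rfl)
    rw [pathOffset_eq] at this
    rw [← this]
    symm
    refine (offsets_getD _ (k := m) (by simp)).trans ?_
    rw [List.take_of_length_le (by simp)]
  have h0 : ((List.finRange n).map I.rot).flatten.length = 2 * I.numEdges := by
    rw [← hD, rotOffset, List.take_of_length_le (by simp)]
  constructor
  · intro r
    match r with
    | 0 => simp [input, size]; omega
    | 1 => simp [input, size]; omega
    | r + 2 => simp [input]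
  · intro A k
    match A with
    | 0 =>
      refine (offsets_le ((List.finRange n).map I.rot) k).trans ?_
      rw [h0, size]
      omega
    | 1 =>
      refine (contents_lt ((List.finRange n).map I.rot) k).trans ?_
      rw [size]
      omega
    | 2 =>
      refine (offsets_le ((List.finRange m).map (fun i => (I.path i).support)) k).trans ?_
      rw [h2, size]
      omega
    | 3 =>
      refine (contents_lt ((List.finRange m).map (fun i => (I.path i).support)) k).trans ?_
      rw [size]
      omega
    | A + 4 => simp [input]

/-- The bounds of the phases are linear in `n`, `m`, the number of darts and the total length;
`card_paths_le` and `rotOffset_eq` turn their sum into a multiple of the size. -/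
theorem runs_orderPaths (I : RoutedGraph n m) : Runs .orderPaths I.input (10000 * I.size)
    (fun s => ∃ o, I.IsOrdering o ∧ I.CrossesLast o (I.dead n) ∧ I.IsOutput s o) := by
  have hm := I.card_paths_le
  have hD := I.rotOffset_eq
  have hz : ∀ A, 4 ≤ A → ∀ k, I.input.arr A k = 0 := fun A hA k => by
    obtain ⟨A, rfl⟩ := Nat.exists_eq_add_of_le' hA
    simp [input]
  have hr : ∀ r, 2 ≤ r → I.input.reg r = 0 := fun r hr => by
    obtain ⟨r, rfl⟩ := Nat.exists_eq_add_of_le' hr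
    simp [input]
  set L := I.totalLength
  set D := I.rotOffset n
  refine Runs.mono (T := 200 * (L + m + 1) + ((19 * (2 * L) + 3) + (100 * (D + 2 * L + n + 1) +
    ((19 * (2 * L) + 3) + (100 * (D + 2 * L + 1) + (500 * (2 * L + n + 1) + (30 * (2 * L + 1) +
    (300 * (2 * L + n + 1) + 300 * (2 * L + n + 1))))))))) ?_ (by rw [size]; omega) fun _ => id
  refine runs_readPaths.seq fun s₁ ⟨r3, hH, h11⟩ f₁ => ?_
  set H := halfEdges (2 * L) s₁ with hHdef
  have hM : H.M = 2 * L := rfl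
  have c2 := runs_collect (ctr := 6) (key := 6) (hd := 12) (nxt := 13) (s := s₁) (by decide)
    (by decide) (by decide) (by decide) ((f₁.1 6 (by decide)).trans (hr 6 (by decide)))
    (fun y => by rw [f₁.2 12 (by decide)]; exact hz 12 (by decide) y)
  rw [r3] at c2
  refine c2.seq fun s₂ ⟨a12, a13⟩ f₂ => ?_
  have g0 : s₂.reg 0 = n := (f₂.1 0 (by decide)).trans (f₁.1 0 (by decide))
  refine (runs_findDarts hH (s := s₂) g0
    ((f₂.1 7 (by decide)).trans ((f₁.1 7 (by decide)).trans (hr 7 (by decide))))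
    ((f₂.2 0 (by decide)).trans (f₁.2 0 (by decide)))
    ((f₂.2 1 (by decide)).trans (f₁.2 1 (by decide))) (f₂.2 7 (by decide)) a12 a13).seq
    fun s₃ hkey f₃ => ?_
  have g3 : s₃.reg 3 = 2 * L := (f₃.1 3 (by decide)).trans ((f₂.1 3 (by decide)).trans r3)
  have c4 := runs_collect (ctr := 17) (key := 15) (hd := 16) (nxt := 17) (s := s₃) (by decide)
    (by decide) (by decide) (by decide) ((f₃.1 17 (by decide)).trans ((f₂.1 17 (by decide)).trans
    ((f₁.1 17 (by decide)).trans (hr 17 (by decide)))))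
    (fun y => by
      rw [f₃.2 16 (by decide), f₂.2 16 (by decide), f₁.2 16 (by decide)]
      exact hz 16 (by decide) y)
  rw [g3] at c4
  refine c4.seq fun s₄ ⟨a16, a17⟩ f₄ => ?_
  have hlt : ∀ h < 2 * L, s₃.arr 15 h < D := fun h hh => by
    obtain ⟨i, v, w, h1, -⟩ := hH.exists_path h hh
    exact (hkey h hh v w h1.2.2.1 h1.2.2.2).bounds.2.2
  have hreg : ∀ r, 2 ≤ r → r ∉ Prog.readPaths.regs → r ∉ (Prog.collect 6 6 12 13).regs →
      r ∉ Prog.findDarts.regs → r ∉ (Prog.collect 17 15 16 17).regs → s₄.reg r = 0 :=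
    fun r h h1 h2 h3 h4 => (f₄.1 r h4).trans ((f₃.1 r h3).trans ((f₂.1 r h2).trans
      ((f₁.1 r h1).trans (hr r h))))
  refine (runs_placeHalves (s := s₄) hlt ((f₄.1 0 (by decide)).trans ((f₃.1 0 (by decide)).trans g0))
    (hreg 10 (by decide) (by decide) (by decide) (by decide) (by decide))
    (hreg 11 (by decide) (by decide) (by decide) (by decide) (by decide))
    ((f₄.2 0 (by decide)).trans ((f₃.2 0 (by decide)).trans ((f₂.2 0 (by decide)).trans
      (f₁.2 0 (by decide))))) a16 a17).seq fun s₅ ⟨a4, hP⟩ f₅ => ?_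
  have harr : ∀ A, A ∉ (Prog.collect 6 6 12 13).arrs → A ∉ Prog.findDarts.arrs →
      A ∉ (Prog.collect 17 15 16 17).arrs → A ∉ Prog.placeHalves.arrs → s₅.arr A = s₁.arr A :=
    fun A h2 h3 h4 h5 => (f₅.2 A h5).trans ((f₄.2 A h4).trans ((f₃.2 A h3).trans (f₂.2 A h2)))
  have hS₀ : (layout s₅).Sorted I H (s₅.arr 4) := hP.sorted hH hkey a4
    (harr 9 (by decide) (by decide) (by decide) (by decide))
  have e0 : s₅.reg 0 = n := (f₅.1 0 (by decide)).trans ((f₄.1 0 (by decide)).trans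
    ((f₃.1 0 (by decide)).trans g0))
  have ea0 : s₅.arr 0 = I.input.arr 0 :=
    (harr 0 (by decide) (by decide) (by decide) (by decide)).trans (f₁.2 0 (by decide))
  have e11 : s₅.arr 11 = s₁.arr 11 := harr 11 (by decide) (by decide) (by decide) (by decide)
  refine (runs_deleteAll hH hS₀ rfl e0
    ((f₅.1 12 (by decide)).trans (hreg 12 (by decide) (by decide) (by decide) (by decide)
      (by decide))) (fun k _ => rfl) ea0 (harr 10 (by decide) (by decide) (by decide) (by decide))
    (by rwa [e11])).seq fun s₆ ⟨S, hS0, hSn, hC, hR⟩ f₆ => ?_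
  rw [← hS0] at hS₀ hC
  have hF₆ : IsFixed I H (S n) (s₅.arr 4) s₆ := by
    refine ⟨hSn.symm, (f₆.1 0 (by decide)).trans e0, (f₆.2 0 (by decide)).trans ea0, fun k _ => ?_,
      ?_⟩
    · rw [f₆.2 4 (by decide)]
    · rwa [f₆.2 11 (by decide), e11]
  refine (runs_writePaths (H := H) hSn.symm ((f₆.1 3 (by decide)).trans ((f₅.1 3 (by decide)).trans
    ((f₄.1 3 (by decide)).trans g3))) ((f₆.2 8 (by decide)).trans
    (harr 8 (by decide) (by decide) (by decide) (by decide)))).seq fun s₇ h7 f₇ => ?_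
  have hF₇ := hF₆.frame f₇ (by decide) (by decide)
  refine (runs_orderTerminals hH hS₀ hC hF₇ h7 (fun v hv q hq => ?_)).seq
    fun s₈ ⟨h12, hR₈, fp, hfp, hw⟩ f₈ => ?_
  · rw [f₇.2 20 (by decide), f₇.2 21 (by decide)]
    exact hR v hv q hq
  have hF₈ := hF₇.frame f₈ (by decide) (by decide)
  refine (runs_reinsert hH hS₀ hC hF₈ h12 hR₈ hfp hw).frame.mono le_rfl ?_
  rintro s₉ ⟨⟨fp', hfp', hw'⟩, f₉⟩
  have hF₉ := hF₈.frame f₉ (by decide) (by decide)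
  have hA : Arranged I H (S 0) (s₅.arr 4) fp' (s₉.arr 5) :=
    ⟨hH, hS₀, hfp'.placement, fun h hh => hfp'.agrees 0 le_rfl (Nat.zero_le _) h
      ⟨hh, by simp [dead]⟩, fun h hh => hfp'.mirrored 0 le_rfl (Nat.zero_le _) h
      ⟨hh, by simp [dead]⟩, hw'⟩
  exact ⟨_, hA.isOrdering, hA.crossesLast hC hfp', hA.isOutput hF₉.a4 rfl⟩

end RoutedGraph

/-- The algorithm computes a consistent ordering of paths, it runs in linear time, and consistent
orderings have the minimum number of crossings. -/
theorem mainTheorem1 :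
    -- the algorithm computes a consistent ordering, whatever choices it makes
    (∀ (n m : ℕ) (I : RoutedGraph n m), I.PathTerminalProperty →
      ∀ (σ : List (Fin n)) (base : HDart n → List (Fin m)), I.IsRun σ base →
        I.IsConsistent (I.algorithm σ base)) ∧
    -- it runs in linear time on a random access machine with words of logarithmic length
    (∃ (prog : RAM.Prog) (C : ℕ), ∀ (n m : ℕ) (I : RoutedGraph n m), I.PathTerminalProperty →
      ∃ (σ : List (Fin n)) (base : HDart n → List (Fin m)), I.IsRun σ base ∧
        ∃ (t : ℕ) (s : RAM.State), RAM.Exec (C * I.size) prog I.input t s ∧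
          t ≤ C * I.size ∧ I.IsOutput s (I.algorithm σ base)) ∧
    -- a consistent ordering exists, and consistent orderings minimize the number of crossings
    (∀ (n m : ℕ) (I : RoutedGraph n m), I.PathTerminalProperty →
      (∃ o, I.IsConsistent o) ∧
        ∀ o, I.IsConsistent o → ∀ o', I.IsOrdering o' → I.crossings o ≤ I.crossings o') := by
  have h1 : ∀ (n m : ℕ) (I : RoutedGraph n m), I.PathTerminalProperty →
      ∀ (σ : List (Fin n)) (base : HDart n → List (Fin m)), I.IsRun σ base →
        I.IsConsistent (I.algorithm σ base) := fun n m I hP σ base h =>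
    RoutedGraph.isConsistent_of_crossesLast hP h.1 h.isOrdering h.crossesLast
  have h2 : ∀ (n m : ℕ) (I : RoutedGraph n m),
      ∃ (σ : List (Fin n)) (base : HDart n → List (Fin m)), I.IsRun σ base ∧
        ∃ (t : ℕ) (s : RAM.State), RAM.Exec (10003 * I.size) .orderPaths I.input t s ∧
          t ≤ 10003 * I.size ∧ I.IsOutput s (I.algorithm σ base) := by
    intro n m I
    obtain ⟨t, s, hrun, ht, o, ho, hc, hout⟩ := I.runs_orderPaths
    obtain ⟨base, hb, rfl⟩ := RoutedGraph.exists_run ho RoutedGraph.isDeletionOrder_dead hc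
    -- The factor 10003 consists of 10000 for the running time and 3 for the bound on the input
    -- words.
    exact ⟨_, base, hb, t, s, (hrun.exec RAM.Prog.incremental_orderPaths I.input_boundedBy).2 _
      (by omega), by omega, hout⟩
  refine ⟨h1, ⟨.orderPaths, 10003, fun n m I _ => h2 n m I⟩, fun n m I hP => ⟨?_, fun o ho o' ho' =>
    RoutedGraph.crossings_le_of_isConsistent ho ho'⟩⟩
  -- A run exists because the machine produces one; its result is a consistent ordering by the first
  -- part.
  obtain ⟨σ, base, h, -⟩ := h2 n m I
  exact ⟨_, h1 n m I hP σ base h⟩
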